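/- **Gauss and arrow diagrams.** A based Gauss diagram $G$ of a diagram of an oriented $m$-component classical link $L$ consists of $m$ oriented circles parametrizing the link diagram, one of them with a base point, and for each crossing an arrow from its overpassing to its underpassing preimage, with the sign (writhe) of the crossing. A based arrow diagram $A$ is the same kind of object (circles, arrows with distinct endpoints, a base point away from the endpoints) without signs and without realizability by a link diagram, up to orientation-preserving diffeomorphisms of the circles. It is connected if it is connected as a graph, and a connected $A$ is *irreducible* if it stays connected after the removal of any one arrow, otherwise *reducible*. Let $\Sigma(A)$ be the oriented surface obtained from disks bounded by the circles by gluing a ribbon along each arrow. If $\partial\Sigma(A)$ is connected, $A$ is *ascending* (resp. *descending*) if, when one follows $\partial\Sigma(A)$ from the base point along the orientation, each ribbon is passed the first time in the direction opposite to its arrow (resp. in the direction of its arrow). Let $\mathcal A_{n,m}$ (resp. $\mathcal D_{n,m}$) be the set of connected ascending (resp. descending) based arrow diagrams with $n$ arrows, $m$ circles and one boundary component. A homomorphism $\phi:A\to G$ consists of orientation-preserving homeomorphisms (up to isotopy) from the circles of $A$ onto the circles of $G$, mapping base point to base point and inducing an injection of arrows to arrows. Put $\langle A,G\rangle=\sum_{\phi:A\to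 G}\ \prod_{\alpha}\operatorname{sign}(\phi(\alpha))$, where $\alpha$ runs over the arrows of $A$, and $$AIr_{n,m}(G)=\sum_{A\in\mathcal A_{n,m}\text{ irreducible}}\langle A,G\rangle,\qquad DIr_{n,m}(G)=\sum_{A\in\mathcal D_{n,m}\text{ irreducible}}\langle A,G\rangle .$$ **Theorem.** Let $n\ge 0$ and $m\geq 1$, and let $G$ be a based Gauss diagram of an $m$-component oriented classical link $L$. 1. $AIr_{n,m}(G)$ and $DIr_{n,m}(G)$ are invariants of $L$: they do not change when $G$ is replaced by any based Gauss diagram (with any position of the base point, on any circle) of a link isotopic to $L$. 2. $AIr_{n,m}(G)=DIr_{n,m}(G)$. 3. There is a $\mathbb Z[z]$-valued isotopy invariant $\nabla=\sum_k c_k z^k$ of oriented classical links, the Conway polynomial, with $\nabla(\text{unknot})=1$ and $\nabla(L_+)-\nabla(L_-)=z\nabla(L_0)$ for every Conway triple, such that for every $n\ge 0$ and every based Gauss diagram $G$ of a two-component classical link $L=L_1\cup L_2$ (so $m=2$) $$\sum_{A\in\mathcal A_{n,2}\text{ reducible}}\langle A,G\rangle=\operatorname{lk}(L_1,L_2)\sum_{k=0}^{n-1}c_k(L_1)\,c_{n-1-k}(L_2)=\sum_{A\in\mathcal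 D_{n,2}\text{ reducible}}\langle A,G\rangle .$$ Here classical links are given combinatorially: by Gauss diagrams that are realizable by a diagram on the sphere, and two such diagrams represent isotopic links iff they are related by Reidemeister moves through realizable Gauss diagrams. -/

import Mathlib

open Polynomial

noncomputable section

/-! ### Arrow diagrams -/

/-- A based arrow diagram with `m` oriented circles and `n` arrows.
The endpoint `(a, true)` is the tail of the arrow `a`, and `(a, false)` is its head.
`word i` lists the endpoints on the `i`-th circle in the order in which they are met when the
circle is traversed once along its orientation. On the circle `base` the traversal starts at the
base point; on the other circles the starting point is immaterial (see `ArrowDiagram.IsHom`). -/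
structure ArrowDiagram (m n : ℕ) where
  word : Fin m → List (Fin n × Bool)
  base : Fin m
  /-- every endpoint of every arrow occurs exactly once -/
  complete : ∀ e : Fin n × Bool, ∑ i, (word i).count e = 1

namespace ArrowDiagram

variable {m n N : ℕ}

/-- The other endpoint of the same arrow. -/
def opp {α : Type} (e : α × Bool) : α × Bool := (e.1, !e.2)

/-- A map of arrows, applied to endpoints (tails go to tails and heads go to heads). -/
def mapEnd {α β : Type} (f : α → β) (e : α × Bool) : β × Bool := (f e.1, e.2)

open Classical in
/-- The word of endpoints that remains when only the arrows in `S` are kept. -/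
def keep {α : Type} (S : Set α) (l : List (α × Bool)) : List (α × Bool) :=
  l.filter (fun e => e.1 ∈ S)

/-- `IsHom A B σ τ`: the bijection `σ` of circles and the injection `τ` of arrows are induced by
orientation preserving homeomorphisms from the circles of `A` to those of `B` that map the base
point to the base point. Such homeomorphisms exist iff the image arrows are met in the same
order, counted from the base point on the based circle, and in the same cyclic order on the other
circles (`~r` is equality of words up to cyclic rotation). -/
structure IsHom (A : ArrowDiagram m n) (B : ArrowDiagram m N)
    (σ : Fin m ≃ Fin m) (τ : Fin n ↪ Fin N) : Prop where
  base : σ A.base = B.base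
  word_base : keep (Set.range τ) (B.word B.base) = (A.word A.base).map (mapEnd τ)
  word : ∀ i, keep (Set.range τ) (B.word (σ i)) ~r (A.word i).map (mapEnd τ)

/-- Two arrow diagrams are the same up to orientation preserving diffeomorphisms of the circles
(and names of arrows and circles). -/
def Iso (A B : ArrowDiagram m n) : Prop := ∃ σ τ, IsHom A B σ τ

/-- The arrow `a` has one endpoint on the circle `i` and the other one on the circle `j`. -/
def Joins (A : ArrowDiagram m n) (a : Fin n) (i j : Fin m) : Prop :=
  ((a, true) ∈ A.word i ∧ (a, false) ∈ A.word j) ∨ ((a, true) ∈ A.word j ∧ (a, false) ∈ A.word i)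

/-- `A` with only the arrows in `S`, as a graph in which each circle is contracted to a vertex. -/
def graph (A : ArrowDiagram m n) (S : Set (Fin n)) : SimpleGraph (Fin m) :=
  SimpleGraph.fromRel fun i j => ∃ a ∈ S, A.Joins a i j

/-- An arrow diagram is connected if it is connected as a graph. -/
def IsConnected (A : ArrowDiagram m n) : Prop := (A.graph Set.univ).Connected

/-- Irreducible: the removal of any one arrow leaves a connected graph. -/
def IsIrreducible (A : ArrowDiagram m n) : Prop := ∀ a, (A.graph {a}ᶜ).Connected

/-! ### The surface of an arrow diagram

On every circle `i` put one marker `Sum.inl i`, at the point where `word i` starts (so that the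
marker of the based circle is the base point). Markers and endpoints of arrows cut the circles
into arcs; the arc that starts at the point `p` is named `p`, and it ends at `succ p`. -/

/-- The points that cut the circles into arcs. -/
abbrev Pt (m n : ℕ) : Type := Fin m ⊕ (Fin n × Bool)

/-- The next point along the orientation of the circle. -/
def succ (A : ArrowDiagram m n) : Equiv.Perm (Pt m n) :=
  (List.ofFn fun i : Fin m => (Sum.inl i :: (A.word i).map Sum.inr).formPerm).prod

/-- Crossing to the other end of an arrow. Nothing happens at a marker. -/
def jump : Equiv.Perm (Pt m n) :=
  Equiv.sumCongr (Equiv.refl _) (Equiv.prodCongr (Equiv.refl _) Equiv.boolNot)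

/-- The boundary of the surface obtained from disks bounded by the circles by gluing a ribbon
along each arrow, as an oriented passage from arc to arc: follow an arc to its end; if this is an
endpoint of an arrow, run along the edge of the ribbon to the other endpoint of that arrow; go on
along the orientation of the circle. -/
def boundary (A : ArrowDiagram m n) : Equiv.Perm (Pt m n) := A.succ.trans jump

/-- The number of boundary components of the surface. -/
def numBoundary (A : ArrowDiagram m n) : ℕ :=
  Nat.card (Quotient (Equiv.Perm.SameCycle.setoid A.boundary))

/-- The arc on which one is after `k` steps along the boundary, from the base point. -/
def tour (A : ArrowDiagram m n) (k : ℕ) : Pt m n := (A.boundary ^ k) (Sum.inl A.base)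

/-- Ascending (for one boundary component): along the boundary, from the base point, each ribbon
is passed the first time from the head of its arrow to the tail, that is, one leaves it at the
tail before one leaves it at the head. -/
def IsAscending (A : ArrowDiagram m n) : Prop :=
  ∀ a k, A.tour k = Sum.inr (a, false) → ∃ j < k, A.tour j = Sum.inr (a, true)

/-- Descending (for one boundary component): each ribbon is passed the first time from the tail
of its arrow to the head. -/
def IsDescending (A : ArrowDiagram m n) : Prop :=
  ∀ a k, A.tour k = Sum.inr (a, true) → ∃ j < k, A.tour j = Sum.inr (a, false)

/-- Connected ascending diagrams with one boundary component. -/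
def InA (A : ArrowDiagram m n) : Prop := A.IsConnected ∧ A.numBoundary = 1 ∧ A.IsAscending

/-- Connected descending diagrams with one boundary component. -/
def InD (A : ArrowDiagram m n) : Prop := A.IsConnected ∧ A.numBoundary = 1 ∧ A.IsDescending

/-! ### Isomorphism classes -/

theorem keep_range_equiv (τ : Fin n ↪ Fin n) (l : List (Fin n × Bool)) :
    keep (Set.range τ) l = l := by
  have h : Set.range τ = Set.univ := Set.range_eq_univ.2 (Finite.injective_iff_surjective.1 τ.2)
  simp [keep, h]

theorem Iso.refl (A : ArrowDiagram m n) : Iso A A :=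
  ⟨Equiv.refl _, Function.Embedding.refl _, rfl, by
    rw [keep_range_equiv]; exact (List.map_id _).symm, fun i => by
    rw [keep_range_equiv]; exact (List.map_id (A.word i)).symm ▸ List.IsRotated.refl _⟩

theorem Iso.trans {A B C : ArrowDiagram m n} (h : Iso A B) (h' : Iso B C) : Iso A C := by
  obtain ⟨σ, τ, h⟩ := h
  obtain ⟨σ', τ', h'⟩ := h'
  refine ⟨σ.trans σ', τ.trans τ', ?_, ?_, ?_⟩
  · simp [h.base, h'.base]
  · have h1 := h.word_base
    have h2 := h'.word_base
    rw [keep_range_equiv] at h1 h2 ⊢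
    rw [h2, h1, List.map_map]; rfl
  · intro i
    have h1 := h.word i
    have h2 := h'.word (σ i)
    rw [keep_range_equiv] at h1 h2 ⊢
    have h3 := h2.trans (h1.map (mapEnd τ'))
    rw [List.map_map] at h3
    exact h3

theorem Iso.symm {A B : ArrowDiagram m n} (h : Iso A B) : Iso B A := by
  obtain ⟨σ, τ, h⟩ := h
  let ρ : Fin n ≃ Fin n := Equiv.ofBijective τ ((Finite.injective_iff_bijective).1 τ.2)
  have hc : (mapEnd ρ.symm : Fin n × Bool → Fin n × Bool) ∘ mapEnd τ = id := by
    funext e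
    exact Prod.ext (ρ.symm_apply_apply e.1) rfl
  refine ⟨σ.symm, ρ.symm.toEmbedding, ?_, ?_, ?_⟩
  · rw [← h.base]; simp
  · have h1 := h.word_base
    rw [keep_range_equiv] at h1 ⊢
    rw [h1, List.map_map, Equiv.coe_toEmbedding, hc, List.map_id]
  · intro i
    have h1 := (h.word (σ.symm i)).map (mapEnd ρ.symm)
    rw [keep_range_equiv] at h1 ⊢
    rw [List.map_map, hc, List.map_id, Equiv.apply_symm_apply] at h1
    exact h1.symm

instance isoSetoid (m n : ℕ) : Setoid (ArrowDiagram m n) :=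
  ⟨Iso, Iso.refl, Iso.symm, Iso.trans⟩

theorem word_nodup (A : ArrowDiagram m n) (i : Fin m) : (A.word i).Nodup := by
  rw [List.nodup_iff_count_le_one]
  intro e
  rw [← A.complete e]
  exact Finset.single_le_sum (f := fun i => (A.word i).count e) (fun _ _ => Nat.zero_le _)
    (Finset.mem_univ i)

instance : Finite (ArrowDiagram m n) := by
  refine Finite.of_injective (β := (Fin m → {l : List (Fin n × Bool) // l.Nodup}) × Fin m)
    (fun A => (fun i => ⟨A.word i, A.word_nodup i⟩, A.base)) ?_
  rintro ⟨w, b, h⟩ ⟨w', b', h'⟩ hh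
  simp only [Prod.mk.injEq, funext_iff, Subtype.mk.injEq] at hh
  obtain ⟨h1, rfl⟩ := hh
  obtain rfl : w = w' := funext h1
  rfl

instance : Fintype (Quotient (isoSetoid m n)) := Fintype.ofFinite _

end ArrowDiagram

open ArrowDiagram

/-! ### Gauss diagrams and pairings -/

/-- A based Gauss diagram with `m` circles: an arrow diagram with signs. Arrows point from the
overpassing preimage of a crossing to the underpassing one. -/
structure GaussDiagram (m : ℕ) where
  n : ℕ
  toArrow : ArrowDiagram m n
  sign : Fin n → ℤˣ

namespace GaussDiagram

variable {m m₀ : ℕ}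

/-- The endpoints of arrows on the `i`-th circle, in order. -/
def word (G : GaussDiagram m) (i : Fin m) : List (Fin G.n × Bool) := G.toArrow.word i

open Classical in
/-- `⟨A, G⟩`: the sum over all homomorphisms from `A` to `G` of the product of the signs of the
image arrows. -/
def pairing {n : ℕ} (A : ArrowDiagram m n) (G : GaussDiagram m) : ℤ :=
  ∑ φ : (Fin m ≃ Fin m) × (Fin n ↪ Fin G.n) with IsHom A G.toArrow φ.1 φ.2,
    ∏ a, (G.sign (φ.2 a) : ℤ)

open Classical in
/-- The sum of `⟨A, G⟩` over all arrow diagrams `A` (up to isomorphism) that have `m` circles,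
`n` arrows and the property `P`. -/
def pairingSum {n : ℕ} (P : ArrowDiagram m n → Prop) (G : GaussDiagram m) : ℤ :=
  ∑ q : Quotient (isoSetoid m n) with P q.out, pairing q.out G

/-- The sum over the irreducible ascending diagrams with one boundary component. -/
def AIr (n : ℕ) (G : GaussDiagram m) : ℤ :=
  pairingSum (fun A : ArrowDiagram m n => A.InA ∧ A.IsIrreducible) G

/-- The sum over the irreducible descending diagrams with one boundary component. -/
def DIr (n : ℕ) (G : GaussDiagram m) : ℤ :=
  pairingSum (fun A : ArrowDiagram m n => A.InD ∧ A.IsIrreducible) G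

/-- The sum over the reducible ascending diagrams with one boundary component. -/
def ARed (n : ℕ) (G : GaussDiagram m) : ℤ :=
  pairingSum (fun A : ArrowDiagram m n => A.InA ∧ ¬ A.IsIrreducible) G

/-- The sum over the reducible descending diagrams with one boundary component. -/
def DRed (n : ℕ) (G : GaussDiagram m) : ℤ :=
  pairingSum (fun A : ArrowDiagram m n => A.InD ∧ ¬ A.IsIrreducible) G

/-! ### Diagrams of classical links

A Gauss diagram determines a link diagram on a closed oriented surface: the crossings and markers
are the vertices, the arcs are the edges, and the sign of a crossing prescribes the cyclic order
of the four edge ends there (in a positive crossing the under-strand passes the over-strand from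
right to left, in a negative one from left to right). The faces are found by walking along edges
and turning left at each crossing. The Gauss diagram comes from a classical link diagram iff each
connected component of this surface is a sphere. -/

/-- Crossing `e.1` is approached along the orientation on the strand of the endpoint `e`. `true` iff
the other strand passes from right to left, so that its outgoing end is on the left. -/
def otherGoesLeft (G : GaussDiagram m) (e : Fin G.n × Bool) : Bool :=
  if G.sign e.1 = 1 then e.2 else !e.2

/-- Leave the point `e` on its circle, forward (`true`) or backward (`false`). The pair `(p, true)`
is the arc `p`, walked along its orientation; `(p, false)` is the same arc, walked backward. -/
def leave (G : GaussDiagram m) (p : Pt m G.n) : Bool → Pt m G.n × Bool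
  | true => (p, true)
  | false => (G.toArrow.succ.symm p, false)

/-- The point reached at the end of a walked arc. -/
def target (G : GaussDiagram m) : Pt m G.n × Bool → Pt m G.n
  | (p, true) => G.toArrow.succ p
  | (p, false) => p

/-- One step along the boundary of the face on the left: walk the arc to its end; go straight on
at a marker, and turn left into the other strand at a crossing. -/
def faceStep (G : GaussDiagram m) (d : Pt m G.n × Bool) : Pt m G.n × Bool :=
  match G.target d with
  | Sum.inl i => G.leave (Sum.inl i) d.2
  | Sum.inr e => G.leave (Sum.inr (opp e)) (d.2 == G.otherGoesLeft e)

/-- The number of faces: the orbits of `faceStep`. -/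
def numFaces (G : GaussDiagram m) : ℕ :=
  Nat.card (Quot fun d d' : Pt m G.n × Bool => G.faceStep d = d')

/-- The number of connected components of the link diagram. -/
def numPieces (G : GaussDiagram m) : ℕ :=
  Nat.card (G.toArrow.graph Set.univ).ConnectedComponent

/-- `G` is a Gauss diagram of a classical link. The surface has `n + m` vertices, `2 * n + m` edges
and `numFaces` faces, and it consists of `numPieces` connected closed surfaces; all of them are
spheres iff the Euler characteristic `(n + m) - (2 * n + m) + numFaces` is `2 * numPieces`. -/
def IsClassical (G : GaussDiagram m) : Prop := G.numFaces = G.n + 2 * G.numPieces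

/-! ### Isotopy of links -/

/-- The same Gauss diagram up to orientation preserving diffeomorphisms of the circles, names of
circles and arrows, and the position of the base point (which may be on another circle). -/
def SameUnbased (G H : GaussDiagram m) : Prop :=
  ∃ (σ : Fin m ≃ Fin m) (τ : Fin G.n ≃ Fin H.n),
    (∀ i, H.word (σ i) ~r (G.word i).map (mapEnd τ)) ∧ ∀ a, H.sign (τ a) = G.sign a

/-- `G` is obtained from `H` by erasing the arrows in `S`. -/
def IsErasure (G H : GaussDiagram m) (S : Set (Fin H.n)) : Prop :=
  ∃ τ : Fin G.n ↪ Fin H.n, Set.range τ = Sᶜ ∧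
    (∀ i, keep Sᶜ (H.word i) = (G.word i).map (mapEnd τ)) ∧ ∀ a, H.sign (τ a) = G.sign a

/-- The points of the list `l` are consecutive on some circle of `G`. -/
def Consecutive (G : GaussDiagram m) (l : List (Fin G.n × Bool)) : Prop :=
  ∃ i, l <:+: G.word i

/-- First Reidemeister move, from `H` to `G`: an arrow with adjacent endpoints is erased. -/
def Omega1 (G H : GaussDiagram m) : Prop :=
  ∃ (a : Fin H.n) (b : Bool), H.Consecutive [(a, b), (a, !b)] ∧ IsErasure G H {a}

/-- Second Reidemeister move, from `H` to `G`: two arrows with opposite signs, with adjacent tails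
and adjacent heads, are erased. The two strands may run in the same or in opposite directions. -/
def Omega2 (G H : GaussDiagram m) : Prop :=
  ∃ a b : Fin H.n, a ≠ b ∧ H.sign a = - H.sign b ∧
    H.Consecutive [(a, true), (b, true)] ∧
    (H.Consecutive [(a, false), (b, false)] ∨ H.Consecutive [(b, false), (a, false)]) ∧
    IsErasure G H {a, b}

/-- The points `x` and `y` are adjacent on a circle of `G`, in this order if `s = 1` and in the
opposite order if `s = -1`. -/
def Adjacent (G : GaussDiagram m) (s : ℤˣ) (x y : Fin G.n × Bool) : Prop :=
  G.Consecutive (if s = 1 then [x, y] else [y, x])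

/-- Third Reidemeister move, in all its oriented versions: the top strand crosses over the middle
strand (arrow `a`) and over the bottom strand (arrow `b`), the middle strand crosses over the
bottom strand (arrow `c`), and on each of the three strands the two points change places. The signs
of the crossings and the side `s` of the triangle determine in which order they are met. -/
def Omega3 (G H : GaussDiagram m) : Prop :=
  ∃ (a b c : Fin G.n) (s : ℤˣ) (τ : Fin G.n ≃ Fin H.n), a ≠ b ∧ b ≠ c ∧ a ≠ c ∧
    G.Adjacent (s * (G.sign a * G.sign b * G.sign c)) (a, true) (b, true) ∧
    G.Adjacent (s * G.sign a) (a, false) (c, true) ∧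
    G.Adjacent (s * G.sign b) (b, false) (c, false) ∧
    (∀ i, H.word i = (G.word i).map fun e => mapEnd τ
      (Equiv.swap (a, true) (b, true) (Equiv.swap (a, false) (c, true)
        (Equiv.swap (b, false) (c, false) e)))) ∧
    ∀ d, H.sign (τ d) = G.sign d

/-- The diagrams of classical links represent isotopic links: they are related by Reidemeister
moves through diagrams of classical links. -/
def Isotopic : GaussDiagram m → GaussDiagram m → Prop :=
  Relation.EqvGen fun G H => G.IsClassical ∧ H.IsClassical ∧
    (SameUnbased G H ∨ Omega1 G H ∨ Omega2 G H ∨ Omega3 G H)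

/-! ### Linking number, components and the Conway polynomial -/

open Classical in
/-- The linking number of the link components `i ≠ j`: half the sum of the signs of the crossings
between them. -/
def lk (G : GaussDiagram m) (i j : Fin m) : ℚ :=
  (∑ a : Fin G.n with G.toArrow.Joins a i j, ((G.sign a : ℤ) : ℚ)) / 2

open Classical in
/-- The arrows with both endpoints on the circle `i`. -/
def ownArrows (G : GaussDiagram m) (i : Fin m) : Finset (Fin G.n) :=
  {a | (a, true) ∈ G.word i ∧ (a, false) ∈ G.word i}

open Classical in
/-- The new name of an endpoint of an arrow in `S`, when the arrows in `S` are numbered in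
increasing order. -/
def rename {n : ℕ} (S : Finset (Fin n)) (e : Fin n × Bool) : Option (Fin S.card × Bool) :=
  if h : e.1 ∈ S then some ((S.orderIsoOfFin rfl).symm ⟨e.1, h⟩, e.2) else none

theorem rename_eq_some {n : ℕ} (S : Finset (Fin n)) (e : Fin n × Bool) (x : Fin S.card × Bool) :
    rename S e = some x ↔ e = mapEnd (S.orderEmbOfFin rfl) x := by
  unfold rename mapEnd
  obtain ⟨e1, e2⟩ := e
  obtain ⟨x1, x2⟩ := x
  have hx : S.orderEmbOfFin rfl x1 = (S.orderIsoOfFin rfl x1 : Fin n) := rfl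
  constructor
  · intro h
    split_ifs at h with hS
    simp only [Option.some.injEq, Prod.mk.injEq] at h
    rw [hx, ← h.1]
    simp [h.2]
  · intro h
    simp only [Prod.mk.injEq] at h
    obtain ⟨rfl, rfl⟩ := h
    rw [dif_pos (Finset.orderEmbOfFin_mem S rfl x1)]
    simp only [Option.some.injEq, Prod.mk.injEq, and_true]
    rw [OrderIso.symm_apply_eq]
    exact Subtype.ext hx

/-- The Gauss diagram of the `i`-th component of the link: erase all other circles, and all arrows
with an endpoint on them. -/
def component (G : GaussDiagram m) (i : Fin m) : GaussDiagram 1 where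
  n := (G.ownArrows i).card
  toArrow :=
    { word := fun _ => (G.word i).filterMap (rename (G.ownArrows i))
      base := 0
      complete := by
        intro x
        rw [Fin.sum_univ_one, List.count_filterMap]
        have h1 : List.countP (fun e => rename (G.ownArrows i) e == some x) (G.word i)
            = (G.word i).count (mapEnd ((G.ownArrows i).orderEmbOfFin rfl) x) := by
          refine List.countP_congr fun e _ => ?_
          rw [beq_iff_eq, beq_iff_eq, rename_eq_some]
        rw [h1]
        refine List.count_eq_one_of_mem (G.toArrow.word_nodup i) ?_
        have h2 := Finset.orderEmbOfFin_mem (G.ownArrows i) rfl x.1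
        simp only [ownArrows, Finset.mem_filter, Finset.mem_univ, true_and] at h2
        obtain ⟨y, b⟩ := x
        cases b
        · exact h2.2
        · exact h2.1 }
  sign := fun a => G.sign ((G.ownArrows i).orderEmbOfFin rfl a)

open Classical in
/-- `H` is obtained from `G` by changing the crossing `a`: the arrow is reversed, and so is its
sign. -/
def IsCrossingChange (G H : GaussDiagram m) (a : Fin G.n) : Prop :=
  ∃ τ : Fin G.n ≃ Fin H.n,
    (∀ i, H.word i = (G.word i).map fun e => mapEnd τ (if e.1 = a then opp e else e)) ∧
    ∀ b, H.sign (τ b) = if b = a then - G.sign b else G.sign b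

/-- `H` is obtained from `G` by smoothing the crossing `a` along the orientation: whoever arrives
at one endpoint of `a` goes on from the other endpoint. If both endpoints are on one circle `i`,
with the arc words `u` and `v` between them, this circle becomes two circles `u` and `v`. If they
are on different circles `i` and `j`, these are merged to one circle. -/
def IsSmoothing (G : GaussDiagram m) (H : GaussDiagram m₀) (a : Fin G.n) : Prop :=
  ∃ τ : Fin H.n ↪ Fin G.n, Set.range τ = {a}ᶜ ∧ (∀ b, H.sign b = G.sign (τ b)) ∧
    ((∃ (i : Fin m) (u v : List (Fin G.n × Bool)) (σ : Option (Fin m) ≃ Fin m₀),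
        G.word i ~r (a, true) :: u ++ (a, false) :: v ∧
        (H.word (σ none)).map (mapEnd τ) ~r u ∧
        (H.word (σ (some i))).map (mapEnd τ) ~r v ∧
        ∀ k, k ≠ i → (H.word (σ (some k))).map (mapEnd τ) ~r G.word k) ∨
     (∃ (i j : Fin m) (hij : i ≠ j) (u v : List (Fin G.n × Bool)) (σ : {k // k ≠ j} ≃ Fin m₀),
        G.word i ~r (a, true) :: u ∧ G.word j ~r (a, false) :: v ∧
        (H.word (σ ⟨i, hij⟩)).map (mapEnd τ) ~r u ++ v ∧
        ∀ k, k.1 ≠ i → (H.word (σ k)).map (mapEnd τ) ~r G.word k.1))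

/-- `f` is the Conway polynomial of oriented classical links (its values on Gauss diagrams that are
not classical are immaterial), given by its characteristic properties: it is an isotopy invariant, it is `1` on the unknot, and
`∇(L₊) - ∇(L₋) = z ∇(L₀)` for all links with diagrams that differ only in a positive, a negative
and a smoothed crossing. -/
structure IsConwayPolynomial (f : (m : ℕ) → GaussDiagram m → ℤ[X]) : Prop where
  invariant : ∀ (m : ℕ) (G H : GaussDiagram m), G.IsClassical → H.IsClassical →
    Isotopic G H → f m G = f m H
  unknot : ∀ G : GaussDiagram 1, G.n = 0 → f 1 G = 1
  skein : ∀ (m m₀ : ℕ) (Gp Gm : GaussDiagram m) (G₀ : GaussDiagram m₀) (a : Fin Gp.n),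
    Gp.IsClassical → Gm.IsClassical → G₀.IsClassical →
    Gp.sign a = 1 → IsCrossingChange Gp Gm a → IsSmoothing Gp G₀ a →
    f m Gp - f m Gm = X * f m₀ G₀

end GaussDiagram

end

/-! A link diagram is treated as a curve: a permutation of its edges together with pairs of points,
the crossings. A set of arrows is a state if smoothing its crossings leaves one closed curve and
each of its arrows is met first at the prescribed end on the tour from the base edge `e`. By
`GaussDiagram.pairingSum_eq` sums of pairings become sums over states, so the sum over all ascending
(or descending) diagrams is a coefficient of the polynomial `Curve.stateSum`.

Invariance of the state sum. Walk along the diagram against its orientation; on a lower strand jump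
to the upper one with weight 1 - s^(±2). Take the determinant of 1 minus the matrix of this walk,
cut at `e`, times a power of s given by the writhe. It satisfies a skein relation with coefficient
s⁻¹ - s (`normDet_skein`). An explicit sum over states satisfies the same relation, and both sides
agree when the upper strands are chosen by order of passage, so they agree always
(`normDet_eq_expansion`). A state T enters with the factor s^(-index T). In the plane this index is
the same for all states, because the intersection form vanishes on cycles (`Planar.index_eq`). So
the determinant is a power of s times the state sum at z = s⁻¹ - s. The determinant does not know
whether states ascend or descend, and moving `e` multiplies it by a power of s. The symmetry s ↦
-s⁻¹ shows that powers of s do not matter (`Polynomial.eq_of_aeval_inv_sub`). Hence a planar diagram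
has one state sum. It is the Conway polynomial: the skein relation is visible on states
(`stateSum_sub_stateSum_change`).

Irreducible diagrams. Everything applies to the sublink of any set I of circles. An arrow of a state
whose removal disconnects the circles is a bridge. Let F_I(y) be the state sum of I in which y
counts bridges; F_I(1) is the full state sum, and F_I(0) is the sum over irreducible states.
Differentiation marks a bridge, and a bridge cuts a state into states of a set J that contains the
base circle and of its complement in I. The base edge of the second state is dictated by the bridge
but does not matter, so summing over the possible bridges gives a linking number: F_I' = z Σ_J lk(J,
I∖J) F_J F_{I∖J}. The summand is symmetric in J and I∖J, hence the sum is half the sum over all J ⊆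
I and forgets the base circle. By induction on I, F_I is determined by the state sums and linking
numbers of sublinks (`IsLinkSum.bridgePoly_eq`). This gives the first two claims. For two circles F
is linear in y with slope z lk ∇(L₁) ∇(L₂), and this slope is F(1) - F(0), the reducible part.

Reidemeister moves preserve the state sums and linking numbers of all sublinks (`Curve.SameSums`).
An arrow with adjacent ends lies in no state. States with exactly one of two parallel arrows of
opposite signs cancel, and no state contains both. For the third move, eliminating the three sides
of the triangle from the determinant leaves the same matrix before and after; if the sublink misses
one of the three strands, at most one of the three arrows can occur in its states and nothing
changes.

Planarity, in the form that every cycle bounds, follows from the Euler characteristic by counting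
dimensions (`GaussDiagram.IsClassical.planar`). Diagrams with different points are compared through
first return maps: a state depends only on the order of the ends of its arrows along the circles. -/

noncomputable section

open Equiv

/-! ### Positions on a cycle of a permutation -/

namespace CyclePos

variable {E : Type} (f : Perm E)

/-- The least positive number of steps from `e` to `u` along `f`. -/
def pos (e u : E) : ℕ := sInf {k | 0 < k ∧ (f ^ k) e = u}

variable {f} {e u v : E}

theorem pos_le {k : ℕ} (hk : 0 < k) (h : (f ^ k) e = u) : pos f e u ≤ k :=
  Nat.sInf_le ⟨hk, h⟩

theorem pow_ne_of_lt_pos {k : ℕ} (hk : 0 < k) (h : k < pos f e u) : (f ^ k) e ≠ u :=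
  fun h' => absurd (pos_le hk h') (not_le.2 h)

theorem sameCycle_of_pow {k : ℕ} (h : (f ^ k) e = u) : f.SameCycle e u := ⟨k, by simpa using h⟩

theorem apply_inv (f : Perm E) (u : E) : f (f⁻¹ u) = u := f.apply_symm_apply u

variable [Finite E]

theorem pos_spec (h : f.SameCycle e u) : 0 < pos f e u ∧ (f ^ pos f e u) e = u := by
  have : {k | 0 < k ∧ (f ^ k) e = u}.Nonempty := by
    obtain ⟨i, h0, -, hi⟩ := h.exists_pow_eq''
    exact ⟨i, h0, hi⟩
  exact Nat.sInf_mem this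

theorem pos_inj (hu : f.SameCycle e u) (hv : f.SameCycle e v) (h : pos f e u = pos f e v) :
    u = v := by
  rw [← (pos_spec hu).2, ← (pos_spec hv).2, h]

theorem pos_lt_of_fwd {K : ℕ} (hK : 0 < K) (hu : (f ^ K) e = u) (hv : f.SameCycle e v)
    (h : ∀ l, 0 < l → l ≤ K → (f ^ l) e ≠ v) : pos f e u < pos f e v := by
  refine (pos_le hK hu).trans_lt ?_
  by_contra hc
  exact h _ (pos_spec hv).1 (not_lt.1 hc) (pos_spec hv).2

/-- The tour from `e` ends at `e`, so what is met sooner on the way back is met later on the way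
forward. -/
theorem pos_lt_of_back {K : ℕ} (hu : (f⁻¹ ^ K) e = u) (hv : f.SameCycle e v)
    (h : ∀ l, l ≤ K → (f⁻¹ ^ l) e ≠ v) : pos f e v < pos f e u := by
  have hsu : f.SameCycle e u := ⟨-K, by simpa [zpow_neg] using hu⟩
  have hKu : (f ^ K) u = e := by
    rw [← hu, inv_pow, apply_inv]
  obtain ⟨hp, hpv⟩ := pos_spec hv
  obtain ⟨hq, hqu⟩ := pos_spec hsu
  set p := pos f e v
  set q := pos f e u
  by_contra hc
  have hqp : q ≤ p := not_lt.1 hc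
  have hper : (f ^ (K + q)) e = e := by rw [pow_add, Perm.mul_apply, hqu, hKu]
  by_cases hlt : K + q ≤ p
  · have h1 : (f ^ (p - (K + q))) e = v := by
      rw [← hpv]
      conv_rhs => rw [← Nat.sub_add_cancel hlt, pow_add, Perm.mul_apply, hper]
    rcases Nat.eq_zero_or_pos (p - (K + q)) with h0 | h0
    · rw [h0] at h1
      exact h 0 (Nat.zero_le _) (by simpa using h1)
    · have := pos_le h0 h1
      change p ≤ _ at this
      omega
  · refine h (K + q - p) (by omega) ?_
    rw [inv_pow, Perm.inv_eq_iff_eq, ← hpv, ← Perm.mul_apply, ← pow_add,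
      Nat.sub_add_cancel (by omega), hper]

/-- Positions count from 1, so the base edge comes last: its own position is the length of its
cycle. -/
theorem pos_lt_self (hu : f.SameCycle e u) (h : u ≠ e) : pos f e u < pos f e e := by
  refine pos_lt_of_back (K := 0) (by simp) hu fun l hl => ?_
  obtain rfl : l = 0 := by omega
  simpa using h.symm

theorem pos_apply (hu : f.SameCycle e u) (h : u ≠ e) : pos f e (f u) = pos f e u + 1 := by
  obtain ⟨h1, h2⟩ := pos_spec hu
  have h3 : (f ^ (pos f e u + 1)) e = f u := by rw [pow_succ', Perm.mul_apply, h2]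
  refine le_antisymm (pos_le (Nat.succ_pos _) h3) ?_
  obtain ⟨h4, h5⟩ := pos_spec (sameCycle_of_pow h3)
  by_contra hc
  obtain ⟨k, hk⟩ : ∃ k, pos f e (f u) = k + 1 := ⟨_, (Nat.succ_pred_eq_of_pos h4).symm⟩
  rw [hk, pow_succ', Perm.mul_apply] at h5
  have h6 := f.injective h5
  rcases Nat.eq_zero_or_pos k with h0 | h0
  · rw [h0] at h6
    exact h (by simpa using h6.symm)
  · have := pos_le h0 h6
    omega

theorem pos_apply_self : pos f e (f e) = 1 :=
  le_antisymm (pos_le one_pos (by simp)) (pos_spec ⟨1, by simp⟩).1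

end CyclePos

/-! ### Curves with crossings -/

/-- A family of oriented closed curves with crossings. The edges `E` are cyclically ordered by
`nxt`; the edge `p` starts at the point `p` and ends at `nxt p`. A crossing `x` consists of the two
points `en (x, true)` (on the upper strand) and `en (x, false)` and of a sign. -/
structure Curve (E X : Type) where
  nxt : Perm E
  en : X × Bool ↪ E
  sgn : X → ℤˣ

namespace Curve

open CyclePos Classical

variable {E X : Type} (C : Curve E X)

/-- Exchange the endpoints of the arrows in `S`. -/
def flip (S : Finset X) : Perm (X × Bool) :=
  Function.Involutive.toPerm (fun y => (y.1, if y.1 ∈ S then !y.2 else y.2)) (by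
    rintro ⟨x, b⟩
    by_cases h : x ∈ S <;> simp [h])

theorem flip_apply (S : Finset X) (y : X × Bool) :
    flip S y = (y.1, if y.1 ∈ S then !y.2 else y.2) := rfl

/-- Exchange the endpoints of the arrows in `S`, as points of the curve. -/
def jumpAt (S : Finset X) : Perm E := (flip S).viaEmbedding C.en

/-- The curve with the crossings in `S` smoothed. -/
def bd (S : Finset X) : Perm E := C.nxt.trans (C.jumpAt S)

theorem jumpAt_mem {S : Finset X} {x : X} (h : x ∈ S) (b : Bool) :
    C.jumpAt S (C.en (x, b)) = C.en (x, !b) := by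
  rw [jumpAt, Perm.viaEmbedding_apply]; exact congrArg C.en (by simp [flip_apply, h])

theorem jumpAt_notMem {S : Finset X} {x : X} (h : x ∉ S) (b : Bool) :
    C.jumpAt S (C.en (x, b)) = C.en (x, b) := by
  rw [jumpAt, Perm.viaEmbedding_apply]; exact congrArg C.en (by simp [flip_apply, h])

theorem jumpAt_of_forall_ne {S : Finset X} {u : E} (h : ∀ x ∈ S, ∀ b, u ≠ C.en (x, b)) :
    C.jumpAt S u = u := by
  by_cases hu : u ∈ Set.range C.en
  · obtain ⟨⟨x, b⟩, rfl⟩ := hu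
    exact C.jumpAt_notMem (fun hx => h x hx b rfl) b
  · exact Perm.viaEmbedding_apply_of_notMem _ _ _ hu

theorem jumpAt_jumpAt (S : Finset X) (u : E) : C.jumpAt S (C.jumpAt S u) = u := by
  by_cases h : ∃ x ∈ S, ∃ b, u = C.en (x, b)
  · obtain ⟨x, hx, b, rfl⟩ := h
    rw [C.jumpAt_mem hx, C.jumpAt_mem hx, Bool.not_not]
  · push Not at h
    rw [C.jumpAt_of_forall_ne h, C.jumpAt_of_forall_ne h]

theorem bd_apply (S : Finset X) (u : E) : C.bd S u = C.jumpAt S (C.nxt u) := rfl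

theorem bd_symm_apply (S : Finset X) (u : E) : (C.bd S)⁻¹ u = C.nxt.symm (C.jumpAt S u) := by
  rw [Perm.inv_eq_iff_eq, bd_apply, apply_symm_apply, jumpAt_jumpAt]

theorem bd_congr {S T : Finset X} {u : E}
    (h : ∀ x b, C.nxt u = C.en (x, b) → (x ∈ S ↔ x ∈ T)) : C.bd S u = C.bd T u := by
  rw [bd_apply, bd_apply]
  by_cases hu : ∃ x ∈ S, ∃ b, C.nxt u = C.en (x, b)
  · obtain ⟨x, hx, b, hb⟩ := hu
    rw [hb, C.jumpAt_mem hx, C.jumpAt_mem ((h x b hb).1 hx)]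
  · push Not at hu
    rw [C.jumpAt_of_forall_ne hu, C.jumpAt_of_forall_ne]
    exact fun x hx b hb => hu x ((h x b hb).2 hx) b hb

/-- Smoothing the crossings in `S` gives one closed curve. -/
def OneB (S : Finset X) : Prop := ∀ u v, (C.bd S).SameCycle u v

/-- The upper point of `x` comes first, when the curve with the crossings in `S` smoothed is
followed from the edge `e`. -/
def fst (S : Finset X) (e : E) (x : X) : Bool :=
  decide (pos (C.bd S) e (C.en (x, true)) < pos (C.bd S) e (C.en (x, false)))

theorem fst_eq [Finite E] {S : Finset X} {e : E} {x : X} {b : Bool}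
    (h : pos (C.bd S) e (C.en (x, b)) < pos (C.bd S) e (C.en (x, !b))) : C.fst S e x = b := by
  cases b
  · simpa [fst] using h.le
  · simpa [fst] using h

/-- One state of the state sum for ascending (`δ = true`) or descending (`δ = false`) states. -/
def IsState (δ : Bool) (e : E) (S : Finset X) : Prop :=
  C.OneB S ∧ ∀ a ∈ S, C.fst S e a = δ

/-- The state sum. -/
def stateSum [Fintype X] (δ : Bool) (e : E) : ℤ[X] :=
  ∑ S : Finset X with C.IsState δ e S, ∏ a ∈ S, ((C.sgn a : ℤ) : ℤ[X]) * Polynomial.X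

end Curve

namespace Curve

open CyclePos Classical Matrix

variable {E X : Type} (C : Curve E X)

/-! ### The random walk matrix -/

/-- The matrix of a walk on a curve whose behaviour at the crossings is given by `B`. The row of
the edge `u` combines the rows `r` of the points from which `u` can be entered. -/
def walk (r : E → E → ℝ) (B : X → Bool → Bool → ℝ) : Matrix E E ℝ := fun u =>
  if h : ∃ y, C.en y = u then
    B h.choose.1 h.choose.2 true • r (C.en (h.choose.1, true)) +
      B h.choose.1 h.choose.2 false • r (C.en (h.choose.1, false))
  else r u

theorem walk_en (r : E → E → ℝ) (B : X → Bool → Bool → ℝ) (x : X) (b : Bool) :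
    C.walk r B (C.en (x, b)) =
      B x b true • r (C.en (x, true)) + B x b false • r (C.en (x, false)) := by
  have h : ∃ y, C.en y = C.en (x, b) := ⟨_, rfl⟩
  have h' : h.choose = (x, b) := C.en.injective h.choose_spec
  unfold walk
  rw [dif_pos h, h']

theorem walk_of_forall_ne (r : E → E → ℝ) (B : X → Bool → Bool → ℝ) {u : E}
    (h : ∀ y, C.en y ≠ u) : C.walk r B u = r u := by
  unfold walk
  rw [dif_neg]
  rintro ⟨y, hy⟩
  exact h y hy

/-- The unit row of the edge that ends at `u`. -/
def inRow (u : E) : E → ℝ := Pi.single (C.nxt.symm u) 1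

/-- The unit row of the edge that ends at `u`, where the edge `e` is cut. -/
def cutRow (e u : E) : E → ℝ := if C.nxt.symm u = e then 0 else C.inRow u

variable [Fintype E]

/-- The determinant of the walk on the curve that is cut at the edge `e`. -/
def cutDet (e : E) (B : X → Bool → Bool → ℝ) : ℝ := (1 - C.walk (C.cutRow e) B).det

/-- Both rows are altered by combinations of the same two vectors. Since the determinant is
alternating, the second order terms combine to one minor `p * q' - q * p'`. -/
theorem det_two_rows (M : Matrix E E ℝ) {i j : E} (hij : i ≠ j) (d d' a a' : E → ℝ)
    (p q p' q' : ℝ) :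
    ((M.updateRow i (d - (p • a + q • a'))).updateRow j (d' - (p' • a + q' • a'))).det =
      ((M.updateRow i d).updateRow j d').det - p' * ((M.updateRow i d).updateRow j a).det
      - q' * ((M.updateRow i d).updateRow j a').det - p * ((M.updateRow i a).updateRow j d').det
      - q * ((M.updateRow i a').updateRow j d').det
      + (p * q' - q * p') * ((M.updateRow i a).updateRow j a').det := by
  have h1 : ∀ (A : Matrix E E ℝ) (k : E) (u v w : E → ℝ) (x y : ℝ),
      (A.updateRow k (u - (x • v + y • w))).det =
        (A.updateRow k u).det - x * (A.updateRow k v).det - y * (A.updateRow k w).det := by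
    intro A k u v w x y
    have : u - (x • v + y • w) = u + ((-x) • v + (-y) • w) := by module
    rw [this, det_updateRow_add, det_updateRow_add, det_updateRow_smul, det_updateRow_smul]
    ring
  have h2 : ∀ u v : E → ℝ, (M.updateRow i u).updateRow j v = (M.updateRow j v).updateRow i u :=
    fun u v => Function.update_comm hij _ _ _
  have h3 : ∀ u : E → ℝ, ((M.updateRow i u).updateRow j u).det = 0 := by
    intro u
    refine det_zero_of_row_eq hij ?_
    rw [updateRow_ne hij, updateRow_self, updateRow_self]
  have h4 : ∀ u v : E → ℝ, ((M.updateRow i u).updateRow j v).det =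
      - ((M.updateRow i v).updateRow j u).det := by
    intro u v
    have h5 := h3 (u + v)
    have h6 : ∀ w : E → ℝ, ((M.updateRow i (u + v)).updateRow j w).det =
        ((M.updateRow i u).updateRow j w).det + ((M.updateRow i v).updateRow j w).det := by
      intro w
      rw [h2, det_updateRow_add, ← h2, ← h2]
    rw [det_updateRow_add, h6, h6, h3, h3] at h5
    linarith
  have h7 : ∀ w : E → ℝ, ((M.updateRow i (d - (p • a + q • a'))).updateRow j w).det =
      ((M.updateRow i d).updateRow j w).det - p * ((M.updateRow i a).updateRow j w).det
      - q * ((M.updateRow i a').updateRow j w).det := by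
    intro w
    rw [h2, h1, ← h2, ← h2, ← h2]
  rw [h1, h7, h7, h7, h3, h3, h4 a' a]
  ring

/-- A linear relation between the behaviours at one crossing gives a linear relation between the
determinants. -/
theorem cutDet_skein (e : E) (x : X) {B B₁ B₂ : X → Bool → Bool → ℝ} {c c₁ c₂ : ℝ}
    (hB₁ : ∀ y ≠ x, B₁ y = B y) (hB₂ : ∀ y ≠ x, B₂ y = B y) (hc : c₁ - c₂ = c)
    (hb : ∀ b b', c₁ * B₁ x b b' - c₂ * B₂ x b b' = c * B x b b')
    (hd : c₁ * (B₁ x true true * B₁ x false false - B₁ x true false * B₁ x false true)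
      - c₂ * (B₂ x true true * B₂ x false false - B₂ x true false * B₂ x false true)
      = c * (B x true true * B x false false - B x true false * B x false true)) :
    c₁ * C.cutDet e B₁ - c₂ * C.cutDet e B₂ = c * C.cutDet e B := by
  have hne : C.en (x, true) ≠ C.en (x, false) := fun h => by simpa using C.en.injective h
  -- Only the rows of the two edges that leave `x` involve `B' x`, so each matrix arises from the
  -- one for `B` by replacing two rows.
  have key : ∀ B' : X → Bool → Bool → ℝ, (∀ y ≠ x, B' y = B y) →
      1 - C.walk (C.cutRow e) B' =
      (((1 - C.walk (C.cutRow e) B).updateRow (C.en (x, true))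
        (Pi.single (C.en (x, true)) 1 - (B' x true true • C.cutRow e (C.en (x, true)) +
          B' x true false • C.cutRow e (C.en (x, false))))).updateRow (C.en (x, false))
        (Pi.single (C.en (x, false)) 1 - (B' x false true • C.cutRow e (C.en (x, true)) +
          B' x false false • C.cutRow e (C.en (x, false))))) := by
    intro B' hB'
    have hone : ∀ u : E, (1 : Matrix E E ℝ) u = Pi.single u 1 := by
      intro u; ext v; rw [one_apply, Pi.single_apply]; simp [eq_comm]
    funext u
    by_cases h1 : u = C.en (x, false)
    · subst h1
      rw [updateRow_self, ← walk_en, ← hone]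
      rfl
    · rw [updateRow_ne h1]
      by_cases h2 : u = C.en (x, true)
      · subst h2
        rw [updateRow_self, ← walk_en, ← hone]
        rfl
      · rw [updateRow_ne h2]
        change (1 : Matrix E E ℝ) u - _ = (1 : Matrix E E ℝ) u - _
        congr 1
        by_cases h3 : ∃ y, C.en y = u
        · obtain ⟨⟨y, b⟩, rfl⟩ := h3
          have hy : y ≠ x := by
            rintro rfl
            cases b
            · exact h1 rfl
            · exact h2 rfl
          rw [walk_en, walk_en, hB' y hy]
        · push Not at h3
          rw [walk_of_forall_ne _ _ _ h3, walk_of_forall_ne _ _ _ h3]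
  unfold cutDet
  rw [key B₁ hB₁, key B₂ hB₂]
  conv_rhs => rw [key B fun _ _ => rfl]
  -- Each determinant is now affine in the entries of the behaviour at `x` and in their 2 × 2
  -- determinant; the hypotheses `hc`, `hb` and `hd` match the coefficients.
  simp only [det_two_rows _ hne]
  have e1 := hb true true
  have e2 := hb true false
  have e3 := hb false true
  have e4 := hb false false
  subst hc
  linear_combination
    (- ((((1 - C.walk (C.cutRow e) B).updateRow (C.en (x, true)) (Pi.single (C.en (x, true)) 1)).updateRow (C.en (x, false)) (C.cutRow e (C.en (x, true)))).det)) * e3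
    - ((((1 - C.walk (C.cutRow e) B).updateRow (C.en (x, true)) (Pi.single (C.en (x, true)) 1)).updateRow (C.en (x, false)) (C.cutRow e (C.en (x, false)))).det) * e4
    - ((((1 - C.walk (C.cutRow e) B).updateRow (C.en (x, true)) (C.cutRow e (C.en (x, true)))).updateRow (C.en (x, false)) (Pi.single (C.en (x, false)) 1)).det) * e1
    - ((((1 - C.walk (C.cutRow e) B).updateRow (C.en (x, true)) (C.cutRow e (C.en (x, false)))).updateRow (C.en (x, false)) (Pi.single (C.en (x, false)) 1)).det) * e2
    + ((((1 - C.walk (C.cutRow e) B).updateRow (C.en (x, true)) (C.cutRow e (C.en (x, true)))).updateRow (C.en (x, false)) (C.cutRow e (C.en (x, false)))).det) * hd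

end Curve

namespace Curve

open CyclePos Classical Matrix

variable {E X : Type} (C : Curve E X)

/-! ### Skein relations -/

/-- The sign of the crossing `x`, after a change of crossing if `o x = false`. -/
def eps (o : X → Bool) (x : X) : ℤˣ := if o x then C.sgn x else - C.sgn x

/-- The behaviour of the random walk at the crossings: those in `S` are smoothed, and the point
`o x` is on the upper strand of the crossing `x`. -/
def behav (s : ℝ) (S : Finset X) (o : X → Bool) (x : X) (b b' : Bool) : ℝ :=
  if x ∈ S then (if b' = b then 0 else 1)
  else if b = o x then (if b' = b then 1 else 0)
  else if b' = b then s ^ (2 * (C.eps o x : ℤ)) else 1 - s ^ (2 * (C.eps o x : ℤ))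

variable [Fintype X]

/-- The writhe. -/
def writhe (S : Finset X) (o : X → Bool) : ℤ := ∑ x ∈ Sᶜ, (C.eps o x : ℤ)

/-- The difference of the numbers of positive and negative self-crossings, where a crossing counts
with the opposite sign if it is passed first on the lower strand. -/
def index (e : E) (S : Finset X) : ℤ :=
  ∑ x ∈ Sᶜ, if C.fst S e x then (C.sgn x : ℤ) else - (C.sgn x : ℤ)

/-- The term of a state in the expansion of the determinant. -/
def term (δ : Bool) (s : ℝ) (e : E) (S : Finset X) (o : X → Bool) (T : Finset X) : ℝ :=
  if S ⊆ T ∧ C.OneB T ∧ ∀ a ∈ T \ S, C.fst T e a = (o a == δ) then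
    (∏ a ∈ T \ S, ((C.eps o a : ℤ) : ℝ) * (s⁻¹ - s)) * s ^ (- C.index e T)
  else 0

/-- The expansion of the determinant by states. -/
def expansion (δ : Bool) (s : ℝ) (e : E) (S : Finset X) (o : X → Bool) : ℝ :=
  ∑ T, C.term δ s e S o T

omit [Fintype X] in
theorem eps_update_ne {o : X → Bool} {x y : X} (h : y ≠ x) (b : Bool) :
    C.eps (Function.update o x b) y = C.eps o y := by
  simp [eps, Function.update_of_ne h]

/-- If `x ∈ T`, the end of `x` that is met first in `T` admits exactly one of the two choices of
upper strand. Either choice contributes `sgn x`, because the second term is subtracted and its sign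
is reversed. If `x ∉ T`, the choice does not enter the term. -/
theorem term_skein (δ : Bool) (s : ℝ) (e : E) {S : Finset X} {x : X} (hx : x ∉ S) (o : X → Bool)
    (T : Finset X) :
    C.term δ s e S (Function.update o x true) T - C.term δ s e S (Function.update o x false) T =
      ((C.sgn x : ℤ) : ℝ) * (s⁻¹ - s) * C.term δ s e (insert x S) o T := by
  by_cases hT : x ∈ T
  · have hdiff : T \ S = insert x (T \ insert x S) := by
      ext y
      by_cases hy : y = x
      · subst hy; simp [hT, hx]
      · simp [hy]
    have hxn : x ∉ T \ insert x S := by simp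
    have hne : ∀ a ∈ T \ insert x S, a ≠ x := fun a ha h => hxn (h ▸ ha)
    have hsub : insert x S ⊆ T ↔ S ⊆ T := by simp [Finset.insert_subset_iff, hT]
    have hcond : ∀ b, (S ⊆ T ∧ C.OneB T ∧
        ∀ a ∈ T \ S, C.fst T e a = (Function.update o x b a == δ)) ↔
        (C.fst T e x = (b == δ)) ∧ (insert x S ⊆ T ∧ C.OneB T ∧
          ∀ a ∈ T \ insert x S, C.fst T e a = (o a == δ)) := by
      intro b
      rw [hdiff, hsub]
      simp only [Finset.forall_mem_insert, Function.update_self]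
      have : (∀ a ∈ T \ insert x S, C.fst T e a = (Function.update o x b a == δ)) ↔
          ∀ a ∈ T \ insert x S, C.fst T e a = (o a == δ) :=
        forall₂_congr fun a ha => by rw [Function.update_of_ne (hne a ha)]
      rw [this]
      tauto
    have hprod : ∀ b, ∏ a ∈ T \ S, ((C.eps (Function.update o x b) a : ℤ) : ℝ) * (s⁻¹ - s) =
        (((if b then C.sgn x else - C.sgn x : ℤˣ) : ℤ) : ℝ) * (s⁻¹ - s) *
          ∏ a ∈ T \ insert x S, ((C.eps o a : ℤ) : ℝ) * (s⁻¹ - s) := by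
      intro b
      rw [hdiff, Finset.prod_insert hxn]
      congr 1
      · simp [eps]
      · exact Finset.prod_congr rfl fun a ha => by rw [eps_update_ne _ (hne a ha)]
    unfold term
    simp only [hcond, hprod]
    generalize ∏ a ∈ T \ insert x S, ((C.eps o a : ℤ) : ℝ) * (s⁻¹ - s) = p
    by_cases hQ : insert x S ⊆ T ∧ C.OneB T ∧ ∀ a ∈ T \ insert x S, C.fst T e a = (o a == δ)
    · simp only [eq_true hQ]
      cases hf : C.fst T e x <;> cases δ <;> simp <;> ring
    · simp only [eq_false hQ]
      simp
  · have h1 : ∀ b, C.term δ s e S (Function.update o x b) T = C.term δ s e S o T := by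
      intro b
      have hne : ∀ a ∈ T \ S, a ≠ x := by
        rintro a ha rfl
        exact hT (Finset.mem_sdiff.1 ha).1
      unfold term
      have e1 : (∀ a ∈ T \ S, C.fst T e a = (Function.update o x b a == δ)) ↔
          ∀ a ∈ T \ S, C.fst T e a = (o a == δ) :=
        forall₂_congr fun a ha => by rw [Function.update_of_ne (hne a ha)]
      have e2 : ∏ a ∈ T \ S, ((C.eps (Function.update o x b) a : ℤ) : ℝ) * (s⁻¹ - s) =
          ∏ a ∈ T \ S, ((C.eps o a : ℤ) : ℝ) * (s⁻¹ - s) :=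
        Finset.prod_congr rfl fun a ha => by rw [eps_update_ne _ (hne a ha)]
      simp only [e1, e2]
    have h2 : C.term δ s e (insert x S) o T = 0 := by
      unfold term
      rw [if_neg]
      rintro ⟨h, -⟩
      exact hT (h (Finset.mem_insert_self x S))
    rw [h1, h1, h2]
    ring

theorem expansion_skein (δ : Bool) (s : ℝ) (e : E) {S : Finset X} {x : X} (hx : x ∉ S)
    (o : X → Bool) :
    C.expansion δ s e S (Function.update o x true) -
      C.expansion δ s e S (Function.update o x false) =
      ((C.sgn x : ℤ) : ℝ) * (s⁻¹ - s) * C.expansion δ s e (insert x S) o := by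
  unfold expansion
  rw [← Finset.sum_sub_distrib, Finset.mul_sum]
  exact Finset.sum_congr rfl fun T _ => C.term_skein δ s e hx o T

theorem writhe_update {S : Finset X} {x : X} (hx : x ∉ S) (o : X → Bool) (b : Bool) :
    C.writhe S (Function.update o x b) =
      (if b then (C.sgn x : ℤ) else - (C.sgn x : ℤ)) + C.writhe (insert x S) o := by
  unfold writhe
  rw [Finset.compl_insert, ← Finset.add_sum_erase _ _ (Finset.mem_compl.2 hx)]
  congr 1
  · cases b <;> simp [eps]
  · exact Finset.sum_congr rfl fun y hy => by rw [eps_update_ne _ (Finset.ne_of_mem_erase hy)]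

variable [Fintype E]

/-- The determinant of the walk, normalized by the writhe. -/
def normDet (s : ℝ) (e : E) (S : Finset X) (o : X → Bool) : ℝ :=
  s ^ (- C.writhe S o) * C.cutDet e (C.behav s S o)

/-- With ε the sign of `x`, the writhe contributes the factors s^(-ε) and s^ε for the two choices.
Their difference is ε(s⁻¹ - s), and with these coefficients the three behaviours satisfy the linear
relation of `cutDet_skein`, also for the 2 × 2 determinants. -/
theorem normDet_skein {s : ℝ} (hs : s ≠ 0) (e : E) {S : Finset X} {x : X} (hx : x ∉ S)
    (o : X → Bool) :
    C.normDet s e S (Function.update o x true) - C.normDet s e S (Function.update o x false) =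
      ((C.sgn x : ℤ) : ℝ) * (s⁻¹ - s) * C.normDet s e (insert x S) o := by
  unfold normDet
  rw [writhe_update C hx, writhe_update C hx, ← mul_assoc]
  have hB : ∀ b, ∀ y ≠ x, C.behav s S (Function.update o x b) y = C.behav s (insert x S) o y := by
    intro b y hy
    funext c c'
    simp [behav, hy, eps_update_ne]
  have hsq : s ^ (2:ℤ) = s * s := by rw [zpow_two]
  have hsq' : s ^ (-2:ℤ) = s⁻¹ * s⁻¹ := by rw [_root_.zpow_neg, hsq, mul_inv]
  refine C.cutDet_skein e x (hB true) (hB false) ?_ ?_ ?_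
  · rcases Int.units_eq_one_or (C.sgn x) with h | h <;> simp [h, zpow_add₀ hs] <;>
      field_simp
  · intro b b'
    rcases Int.units_eq_one_or (C.sgn x) with h | h <;> cases b <;> cases b' <;>
      simp [h, zpow_add₀ hs, behav, hx, eps, hsq, hsq'] <;> field_simp <;> ring
  · rcases Int.units_eq_one_or (C.sgn x) with h | h <;>
      simp [h, zpow_add₀ hs, behav, hx, eps, hsq, hsq'] <;> field_simp <;> ring

end Curve

/-! ### Unitriangular matrices, Alexander numberings and null vectors of the walk -/

/-- A matrix that is unitriangular with respect to a height function has determinant one. -/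
theorem Matrix.det_eq_one_of_height {n : Type} [Fintype n] [DecidableEq n] (M : Matrix n n ℝ)
    (p : n → ℕ) (h1 : ∀ i, M i i = 1) (h : ∀ i j, i ≠ j → M i j ≠ 0 → p j < p i) : M.det = 1 := by
  rw [Matrix.det_apply, Finset.sum_eq_single 1]
  · simp [h1]
  · intro σ _ hσ
    by_contra hne
    have hprod : ∏ i, M (σ i) i ≠ 0 := fun h0 => hne (by rw [h0, smul_zero])
    have hall : ∀ i, M (σ i) i ≠ 0 := fun i => (Finset.prod_ne_zero_iff.1 hprod) i (Finset.mem_univ i)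
    have hle : ∀ i ∈ Finset.univ, p i ≤ p (σ i) := fun i _ => by
      by_cases hi : σ i = i
      · rw [hi]
      · exact (h _ _ hi (hall i)).le
    -- A permutation that never lowers the height preserves it, as the sum of the heights is fixed.
    have heq := (Finset.sum_eq_sum_iff_of_le hle).1 (Equiv.sum_comp σ p).symm
    refine hσ (Equiv.ext fun i => ?_)
    by_contra hi
    exact absurd (heq i (Finset.mem_univ i)) (h _ _ hi (hall i)).ne
  · simp

namespace Curve

open CyclePos Classical Matrix

variable {E X : Type} (C : Curve E X)

/-- An Alexander numbering of the edges: the numbers of the faces on their left. -/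
structure IsNumbering (h : E → ℤ) : Prop where
  of_ne : ∀ u, (∀ y, C.en y ≠ u) → h (C.nxt.symm u) = h u
  cross : ∀ x b, h (C.en (x, b)) = h (C.nxt.symm (C.en (x, !b)))
  diff : ∀ x, h (C.nxt.symm (C.en (x, true))) = h (C.nxt.symm (C.en (x, false))) + C.sgn x

/-- Against the orientation, the walk leaves every edge with total weight one; so it fixes the
constant vector. -/
theorem behav_sum (s : ℝ) (S : Finset X) (o : X → Bool) (x : X) (b : Bool) :
    C.behav s S o x b true + C.behav s S o x b false = 1 := by
  unfold behav
  by_cases h : x ∈ S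
  · cases b <;> simp [h]
  · cases b <;> cases o x <;> simp [h]

/-- The local form of a fixed row vector of the walk: `s ^ (-2 * h)` is reproduced at every
crossing, smoothed or not and whichever strand is above, because the numbers of the incoming strands
differ by the sign of the crossing. -/
theorem behav_numbering {h : E → ℤ} (hh : C.IsNumbering h) {s : ℝ} (hs : s ≠ 0) (S : Finset X)
    (o : X → Bool) (x : X) (b : Bool) :
    s ^ (-2 * h (C.en (x, true))) * C.behav s S o x true b +
      s ^ (-2 * h (C.en (x, false))) * C.behav s S o x false b =
      s ^ (-2 * h (C.nxt.symm (C.en (x, b)))) := by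
  have h1 := hh.cross x true
  have h2 := hh.cross x false
  have h3 := hh.diff x
  simp only [Bool.not_true, Bool.not_false] at h1 h2
  rw [h3] at h2
  rw [h1, h2]
  set k := h (C.nxt.symm (C.en (x, false)))
  have e1 : ∀ a : ℤ, s ^ (-2 * (k + a)) * s ^ (2 * a) = s ^ (-2 * k) := by
    intro a; rw [← zpow_add₀ hs]; congr 1; ring
  have e2 : ∀ a : ℤ, s ^ (-2 * k) * s ^ (2 * -a) = s ^ (-2 * (k + a)) := by
    intro a; rw [← zpow_add₀ hs]; congr 1; ring
  unfold behav eps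
  by_cases hx : x ∈ S
  · cases b <;> simp [hx, h3, k]
  · cases b <;> cases hb : o x <;> simp only [hx, if_true, if_false, h3, Bool.true_eq_false,
      Bool.false_eq_true, Units.val_neg]
    · linear_combination - e2 (C.sgn x : ℤ)
    · linear_combination e1 (C.sgn x : ℤ)
    · linear_combination e2 (C.sgn x : ℤ)
    · linear_combination - e1 (C.sgn x : ℤ)

theorem inRow_apply (u g : E) : C.inRow u g = if C.nxt g = u then 1 else 0 := by
  unfold inRow
  rw [Pi.single_apply]
  exact if_congr (by rw [Equiv.eq_symm_apply]) rfl rfl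

theorem cutRow_apply (e u g : E) : C.cutRow e u g = if g = e then 0 else C.inRow u g := by
  unfold cutRow
  by_cases h : C.nxt.symm u = e
  · subst h
    rw [if_pos rfl, inRow, Pi.single_apply]
    split_ifs <;> simp
  · rw [if_neg h]
    split_ifs with hg
    · subst hg
      rw [inRow, Pi.single_apply, if_neg (Ne.symm h)]
    · rfl

theorem walk_cutRow_apply (e : E) (B : X → Bool → Bool → ℝ) (f g : E) :
    C.walk (C.cutRow e) B f g = if g = e then 0 else C.walk C.inRow B f g := by
  by_cases h : ∃ y, C.en y = f
  · obtain ⟨⟨x, b⟩, rfl⟩ := h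
    rw [walk_en, walk_en]
    simp only [Pi.add_apply, Pi.smul_apply, cutRow_apply]
    split_ifs <;> simp
  · push Not at h
    rw [walk_of_forall_ne _ _ _ h, walk_of_forall_ne _ _ _ h, cutRow_apply]

/-- The edge from which a nonzero entry of the walk comes. -/
theorem walk_inRow_ne_zero {B : X → Bool → Bool → ℝ} {f g : E} (h : C.walk C.inRow B f g ≠ 0) :
    (C.nxt g = f ∧ ∀ y, C.en y ≠ f) ∨
      ∃ x b b', f = C.en (x, b) ∧ C.nxt g = C.en (x, b') ∧ B x b b' ≠ 0 := by
  by_cases hf : ∃ y, C.en y = f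
  · obtain ⟨⟨x, b⟩, rfl⟩ := hf
    right
    rw [walk_en] at h
    simp only [Pi.add_apply, Pi.smul_apply, inRow_apply, smul_eq_mul] at h
    by_cases h1 : C.nxt g = C.en (x, true)
    · have h2 : C.nxt g ≠ C.en (x, false) := by
        rw [h1]; intro h; simpa using C.en.injective h
      exact ⟨x, b, true, rfl, h1, fun h0 => h (by simp [h0, h2])⟩
    · by_cases h2 : C.nxt g = C.en (x, false)
      · exact ⟨x, b, false, rfl, h2, fun h0 => h (by simp [h0, h1])⟩
      · simp [h1, h2] at h
  · push Not at hf
    left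
    rw [walk_of_forall_ne _ _ _ hf, inRow_apply] at h
    exact ⟨by_contra fun hc => h (if_neg hc), hf⟩

/-- A nonzero entry of the walk for a configuration. -/
theorem walk_behav_ne_zero {s : ℝ} {S : Finset X} {o : X → Bool} {f g : E}
    (h : C.walk C.inRow (C.behav s S o) f g ≠ 0) :
    C.bd S g = f ∨
      ∃ x ∉ S, f = C.en (x, !(o x)) ∧ C.bd S g = C.en (x, o x) := by
  rcases C.walk_inRow_ne_zero h with ⟨h1, h2⟩ | ⟨x, b, b', rfl, h2, h3⟩
  · left
    rw [bd_apply, h1, jumpAt_of_forall_ne]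
    exact fun x _ b hb => h2 _ hb.symm
  · unfold behav at h3
    by_cases hx : x ∈ S
    · left
      rw [bd_apply, h2, jumpAt_mem _ hx]
      cases b <;> cases b' <;> simp [hx] at h3 ⊢
    · rw [bd_apply, h2, jumpAt_notMem _ hx]
      by_cases hb : b' = b
      · left; rw [hb]
      · right
        refine ⟨x, hx, ?_⟩
        cases b <;> cases b' <;> cases ho : o x <;> simp_all

variable [Fintype E]

theorem sum_walk {B : X → Bool → Bool → ℝ} (hB : ∀ x b, B x b true + B x b false = 1) (f : E) :
    ∑ g, C.walk C.inRow B f g = 1 := by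
  have h1 : ∀ u, ∑ g, C.inRow u g = 1 := fun u => by simp [inRow]
  by_cases h : ∃ y, C.en y = f
  · obtain ⟨⟨x, b⟩, rfl⟩ := h
    rw [walk_en]
    simp only [Pi.add_apply, Pi.smul_apply, smul_eq_mul, Finset.sum_add_distrib, ← Finset.mul_sum,
      h1, mul_one, hB]
  · push Not at h
    rw [walk_of_forall_ne _ _ _ h, h1]

theorem sum_mul_walk {B : X → Bool → Bool → ℝ} {u : E → ℝ}
    (hu : ∀ v, (∀ y, C.en y ≠ v) → u v = u (C.nxt.symm v))
    (hB : ∀ x b, u (C.en (x, true)) * B x true b + u (C.en (x, false)) * B x false b =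
      u (C.nxt.symm (C.en (x, b)))) (g : E) :
    ∑ f, u f * C.walk C.inRow B f g = u g := by
  by_cases h : ∃ y, C.en y = C.nxt g
  · obtain ⟨⟨x, b⟩, hy⟩ := h
    have hne : C.en (x, true) ≠ C.en (x, false) := fun h => by simpa using C.en.injective h
    rw [Finset.sum_eq_add _ _ hne]
    · have hg := hB x b
      rw [hy, Equiv.symm_apply_apply] at hg
      rw [← hg, walk_en, walk_en]
      simp only [Pi.add_apply, Pi.smul_apply, smul_eq_mul, inRow_apply, ← hy]
      cases b
      · simp [hne.symm]
      · simp [hne]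
    · intro f _ hf
      by_contra h0
      rcases C.walk_inRow_ne_zero (right_ne_zero_of_mul h0) with ⟨h1, h2⟩ | ⟨x', c, c', rfl, h2, -⟩
      · exact h2 _ (hy.trans h1)
      · rw [← hy] at h2
        have := C.en.injective h2
        obtain rfl : x = x' := congrArg Prod.fst this
        cases c
        · exact hf.2 rfl
        · exact hf.1 rfl
    · simp
    · simp
  · push Not at h
    rw [Finset.sum_eq_single (C.nxt g)]
    · rw [walk_of_forall_ne _ _ _ h, inRow_apply, if_pos rfl, mul_one, hu _ h,
        Equiv.symm_apply_apply]
    · intro f _ hf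
      by_contra h0
      rcases C.walk_inRow_ne_zero (right_ne_zero_of_mul h0) with ⟨h1, h2⟩ | ⟨x', c, c', rfl, h2, -⟩
      · exact hf h1.symm
      · exact h _ h2.symm
    · simp

/-- The determinant vanishes if the walk does not leave the orbit of `e`, or does not enter it. -/
theorem cutDet_eq_zero {e : E} {B : X → Bool → Bool → ℝ} (O : E → Prop) (he : O e)
    {r : E} (hr : ¬ O r)
    (h : (∀ f g, O f → ¬ O g → C.walk C.inRow B f g = 0) ∧
        (∃ u : E → ℝ, (∀ v, u v ≠ 0) ∧ ∀ g, ∑ f, u f * C.walk C.inRow B f g = u g) ∨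
      (∀ f g, ¬ O f → O g → C.walk C.inRow B f g = 0) ∧ ∀ f, ∑ g, C.walk C.inRow B f g = 1) :
    C.cutDet e B = 0 := by
  set M := 1 - C.walk (C.cutRow e) B with hM
  have hMR : ∀ f g, ¬ O g → M f g = (if f = g then 1 else 0) - C.walk C.inRow B f g := by
    intro f g hg
    have : g ≠ e := fun h => hg (h ▸ he)
    rw [hM, Matrix.sub_apply, walk_cutRow_apply, if_neg this, one_apply]
  have hne : ∀ f g, O f → ¬ O g → f ≠ g := fun f g h1 h2 h => h2 (h ▸ h1)
  change M.det = 0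
  rcases h with ⟨h1, u, hu0, hu⟩ | ⟨h1, h2⟩
  -- The cut edge lies in `O`, so the block outside `O` does not notice the cut. It is singular,
  -- because the restriction of `u` annihilates it from the left.
  · rw [twoBlockTriangular_det' M O]
    · rw [mul_eq_zero]
      right
      rw [← exists_vecMul_eq_zero_iff]
      refine ⟨fun f => u f, fun h0 => hu0 r (congrFun h0 ⟨r, hr⟩), ?_⟩
      funext ⟨g, hg⟩
      have e1 : ∑ f : {f // ¬ O f}, u f * M f g = ∑ f, u f * M f g - ∑ f : {f // O f}, u f * M f g := by
        rw [eq_sub_iff_add_eq, add_comm]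
        exact Fintype.sum_subtype_add_sum_subtype O (fun f => u f * M f g)
      have e2 : ∑ f, u f * M f g = 0 := by
        simp only [hMR _ g hg, mul_sub, Finset.sum_sub_distrib, hu]
        simp
      have e3 : ∑ f : {f // O f}, u f * M f g = 0 := by
        refine Finset.sum_eq_zero fun f _ => ?_
        rw [hMR _ g hg, h1 f g f.2 hg, if_neg (hne _ _ f.2 hg)]
        simp
      change ∑ f : {f // ¬ O f}, u f * M f g = 0
      rw [e1, e2, e3, sub_zero]
    · intro f hf g hg
      rw [hMR _ _ hg, h1 f g hf hg, if_neg (hne _ _ hf hg), sub_zero]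
  -- Here the constant vector is in the kernel of the block outside `O`.
  · rw [twoBlockTriangular_det M O]
    · rw [mul_eq_zero]
      right
      rw [← exists_mulVec_eq_zero_iff]
      refine ⟨fun f => 1, fun h0 => one_ne_zero (congrFun h0 ⟨r, hr⟩), ?_⟩
      funext ⟨f, hf⟩
      change ∑ g : {g // ¬ O g}, M f g * 1 = 0
      have e1 : ∑ g : {g // ¬ O g}, ((if f = g then 1 else 0) - C.walk C.inRow B f g : ℝ) =
          ∑ g, ((if f = g then 1 else 0) - C.walk C.inRow B f g : ℝ) := by
        rw [← Fintype.sum_subtype_add_sum_subtype O, right_eq_add]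
        refine Finset.sum_eq_zero fun g _ => ?_
        rw [h1 f g hf g.2, if_neg (hne _ _ g.2 hf).symm, sub_zero]
      simp only [mul_one]
      rw [Finset.sum_congr rfl fun g _ => hMR f g.1 g.2, e1, Finset.sum_sub_distrib, h2]
      simp
    · intro f hf g hg
      by_cases hge : g = e
      · rw [hM, Matrix.sub_apply, walk_cutRow_apply, if_pos hge, one_apply,
          if_neg (hne _ _ hg hf).symm, sub_zero]
      · rw [hM, Matrix.sub_apply, walk_cutRow_apply, if_neg hge, one_apply, h1 f g hf hg,
          if_neg (hne _ _ hg hf).symm, sub_zero]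

end Curve

namespace Curve

open CyclePos Classical Matrix

variable {E X : Type} (C : Curve E X)

/-! ### Evaluation at a descending curve -/

/-- A choice of upper strands for which all states but the trivial one are excluded. -/
def leafInfo (δ : Bool) (e : E) (S : Finset X) (x : X) : Bool :=
  -- If both strands are on the cycle of `e`, the one passed first is above. If neither is, the
  -- positions have the default value 0 and the choice is immaterial. If exactly one is, that cycle
  -- lies above the rest for `δ = true` and below it for `δ = false`.
  if (C.bd S).SameCycle e (C.en (x, true)) ↔ (C.bd S).SameCycle e (C.en (x, false)) then
    C.fst S e x
  else if (C.bd S).SameCycle e (C.en (x, true)) then δ else !δ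

theorem leafInfo_true [Finite E] {e : E} {S : Finset X} {x : X} {b : Bool}
    (h1 : (C.bd S).SameCycle e (C.en (x, b)))
    (h2 : (C.bd S).SameCycle e (C.en (x, !b)) →
      pos (C.bd S) e (C.en (x, b)) < pos (C.bd S) e (C.en (x, !b))) :
    C.leafInfo true e S x = b := by
  unfold leafInfo
  by_cases h3 : (C.bd S).SameCycle e (C.en (x, !b))
  · have := C.fst_eq (h2 h3)
    cases b <;> simp_all
  · cases b <;> simp_all

theorem leafInfo_false [Finite E] {e : E} {S : Finset X} {x : X} {b : Bool}
    (h1 : (C.bd S).SameCycle e (C.en (x, b)))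
    (h2 : (C.bd S).SameCycle e (C.en (x, !b)) →
      pos (C.bd S) e (C.en (x, !b)) < pos (C.bd S) e (C.en (x, b))) :
    C.leafInfo false e S x = !b := by
  unfold leafInfo
  by_cases h3 : (C.bd S).SameCycle e (C.en (x, !b))
  · have h4 := h2 h3
    have := C.fst_eq (b := !b) (by rwa [Bool.not_not])
    cases b <;> simp_all
  · cases b <;> simp_all

theorem jumpAt_congr {S T : Finset X} {u : E}
    (h : ∀ x b, u = C.en (x, b) → (x ∈ S ↔ x ∈ T)) : C.jumpAt S u = C.jumpAt T u := by
  have := C.bd_congr (u := C.nxt.symm u) (S := S) (T := T) fun x b hx =>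
    h x b (by rwa [apply_symm_apply] at hx)
  simpa [bd_apply] using this

/-- The endpoints of the arrows in `T` that are not in `S`. -/
def IsNewEnd (S T : Finset X) (u : E) : Prop := ∃ a ∈ T \ S, ∃ b, u = C.en (a, b)

theorem bd_eq_of_not_isNewEnd {S T : Finset X} (hST : S ⊆ T) {u : E}
    (h : ¬ C.IsNewEnd S T (C.nxt u)) : C.bd T u = C.bd S u := by
  refine C.bd_congr fun x b hx => ⟨fun hT => ?_, fun hS => hST hS⟩
  by_contra hS
  exact h ⟨x, Finset.mem_sdiff.2 ⟨hT, hS⟩, b, hx⟩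

theorem isNewEnd_bd {S T : Finset X} {u : E} :
    C.IsNewEnd S T (C.bd S u) ↔ C.IsNewEnd S T (C.nxt u) := by
  constructor
  · rintro ⟨a, ha, b, hb⟩
    refine ⟨a, ha, b, ?_⟩
    rw [← C.jumpAt_jumpAt S (C.nxt u), ← bd_apply, hb,
      C.jumpAt_notMem (Finset.mem_sdiff.1 ha).2]
  · rintro ⟨a, ha, b, hb⟩
    refine ⟨a, ha, b, ?_⟩
    rw [bd_apply, hb, C.jumpAt_notMem (Finset.mem_sdiff.1 ha).2]

/-- The tours of `S` and `T` can part only at an end of an arrow of `T \ S`, where the tour of `T`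
jumps. -/
theorem pow_bd_eq {S T : Finset X} (hST : S ⊆ T) {e : E} {K : ℕ}
    (h : ∀ l, 0 < l → l < K → ¬ C.IsNewEnd S T ((C.bd S ^ l) e)) :
    ∀ l < K, (C.bd T ^ l) e = (C.bd S ^ l) e := by
  intro l
  induction l with
  | zero => simp
  | succ l ih =>
    intro hl
    rw [pow_succ', pow_succ', Perm.mul_apply, Perm.mul_apply, ih (by omega)]
    refine C.bd_eq_of_not_isNewEnd hST ?_
    rw [← isNewEnd_bd, ← Perm.mul_apply, ← pow_succ']
    exact h _ (Nat.succ_pos l) hl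

/-- Backward, a jump comes after its point has been reached, so that the tours still agree at step
`K`. -/
theorem pow_inv_bd_eq {S T : Finset X} (hST : S ⊆ T) {e : E} {K : ℕ}
    (h : ∀ l, l < K → ¬ C.IsNewEnd S T (((C.bd S)⁻¹ ^ l) e)) :
    ∀ l ≤ K, ((C.bd T)⁻¹ ^ l) e = ((C.bd S)⁻¹ ^ l) e := by
  intro l
  induction l with
  | zero => simp
  | succ l ih =>
    intro hl
    rw [pow_succ', pow_succ', Perm.mul_apply, Perm.mul_apply, ih (by omega), bd_symm_apply,
      bd_symm_apply]
    congr 1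
    refine C.jumpAt_congr fun x b hx => ⟨fun hT => ?_, fun hS => hST hS⟩
    by_contra hS
    exact h l (by omega) ⟨x, Finset.mem_sdiff.2 ⟨hT, hS⟩, b, hx⟩

theorem sameCycle_of_inv_pow {f : Perm E} {e u : E} {k : ℕ} (h : (f⁻¹ ^ k) e = u) :
    f.SameCycle e u := ⟨-k, by simpa [_root_.zpow_neg] using h⟩

/-- Let `(a, c)` be the first end of an arrow of `T \ S` on the tour of `S` from `e`. The tour of
`T` agrees until it would get there, but arrives at `(a, !c)` instead. So `T` meets `(a, !c)` first,
whereas `leafInfo` puts `(a, c)` on the upper strand. -/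
theorem not_forall_fst_true [Finite E] {e : E} {S T : Finset X} (hST : S ⊆ T) (hne : T ≠ S)
    (hT : C.OneB T) : ∃ a ∈ T \ S, C.fst T e a ≠ C.leafInfo true e S a := by
  have hex : ∃ k, 0 < k ∧ C.IsNewEnd S T ((C.bd S ^ k) e) := by
    by_contra hc
    push Not at hc
    obtain ⟨a, ha⟩ : (T \ S).Nonempty := Finset.sdiff_nonempty.2 fun h => hne (h.antisymm hST)
    obtain ⟨k, hk0, -, hk⟩ := (hT e (C.en (a, true))).exists_pow_eq''
    refine hc k hk0 ?_
    rw [← C.pow_bd_eq hST (K := k + 1) (fun l hl _ => hc l hl) k (by omega), hk]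
    exact ⟨a, ha, true, rfl⟩
  obtain ⟨hK0, a, ha, c, hac⟩ := Nat.find_spec hex
  have hmin : ∀ l, 0 < l → l < Nat.find hex → ¬ C.IsNewEnd S T ((C.bd S ^ l) e) :=
    fun l hl hlt h => Nat.find_min hex hlt ⟨hl, h⟩
  set K := Nat.find hex
  have hagree := C.pow_bd_eq hST hmin
  have haS := (Finset.mem_sdiff.1 ha).2
  have haT := (Finset.mem_sdiff.1 ha).1
  have hTK : (C.bd T ^ K) e = C.en (a, !c) := by
    obtain ⟨k, hk⟩ : ∃ k, K = k + 1 := ⟨K - 1, by omega⟩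
    rw [hk, pow_succ', Perm.mul_apply] at hac ⊢
    rw [hagree k (by omega), bd_apply]
    have : C.nxt ((C.bd S ^ k) e) = C.en (a, c) := by
      rw [← C.jumpAt_jumpAt S (C.nxt _), ← bd_apply, hac, C.jumpAt_notMem haS]
    rw [this, C.jumpAt_mem haT]
  refine ⟨a, ha, ?_⟩
  have h1 : C.fst T e a = !c := by
    refine C.fst_eq ?_
    rw [Bool.not_not]
    refine pos_lt_of_fwd hK0 hTK (hT _ _) fun l hl hlK h => ?_
    rcases hlK.lt_or_eq with hlt | rfl
    · rw [hagree l hlt] at h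
      exact hmin l hl hlt ⟨a, ha, c, h⟩
    · rw [hTK] at h
      have := C.en.injective h
      cases c <;> simp at this
  have h2 : C.leafInfo true e S a = c := by
    refine C.leafInfo_true (sameCycle_of_pow hac) fun h => ?_
    refine pos_lt_of_fwd hK0 hac h fun l hl hlK h' => ?_
    rcases hlK.lt_or_eq with hlt | rfl
    · exact hmin l hl hlt ⟨a, ha, _, h'⟩
    · rw [hac] at h'
      have := C.en.injective h'
      cases c <;> simp at this
  rw [h1, h2]
  cases c <;> simp

/-- Go backward from `e`. The first end `(a, c)` of an arrow of `T \ S` is the same for both tours,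
hence it comes last in `T`. In `S` it also comes last, or the tour misses the other end; in both
cases `leafInfo` puts `(a, !c)` on the upper strand, which is the choice that the state `T` forbids.
-/
theorem not_forall_fst_false [Finite E] {e : E} {S T : Finset X} (hST : S ⊆ T) (hne : T ≠ S)
    (hT : C.OneB T) : ∃ a ∈ T \ S, C.fst T e a ≠ !C.leafInfo false e S a := by
  have hex : ∃ k, C.IsNewEnd S T (((C.bd S)⁻¹ ^ k) e) := by
    by_contra hc
    push Not at hc
    obtain ⟨a, ha⟩ : (T \ S).Nonempty := Finset.sdiff_nonempty.2 fun h => hne (h.antisymm hST)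
    obtain ⟨k, -, -, hk⟩ := (hT e (C.en (a, true))).inv.exists_pow_eq''
    refine hc k ?_
    rw [← C.pow_inv_bd_eq hST (K := k) (fun l _ => hc l) k le_rfl, hk]
    exact ⟨a, ha, true, rfl⟩
  obtain ⟨a, ha, c, hac⟩ := Nat.find_spec hex
  have hmin : ∀ l, l < Nat.find hex → ¬ C.IsNewEnd S T (((C.bd S)⁻¹ ^ l) e) :=
    fun l hlt h => Nat.find_min hex hlt h
  set K := Nat.find hex
  have hagree := C.pow_inv_bd_eq hST hmin
  have hback : ∀ f : Perm E, (f⁻¹ ^ K) e = C.en (a, c) → (∀ l < K, (f⁻¹ ^ l) e ≠ C.en (a, !c)) →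
      f.SameCycle e (C.en (a, !c)) → pos f e (C.en (a, !c)) < pos f e (C.en (a, c)) := by
    intro f hf h h'
    refine pos_lt_of_back hf h' fun l hl h'' => ?_
    rcases hl.lt_or_eq with hlt | rfl
    · exact h l hlt h''
    · rw [hf] at h''
      have := C.en.injective h''
      cases c <;> simp at this
  refine ⟨a, ha, ?_⟩
  have h1 : C.fst T e a = !c := by
    refine C.fst_eq ?_
    rw [Bool.not_not]
    refine hback _ (by rw [hagree K le_rfl, hac]) (fun l hl h => ?_) (hT _ _)
    rw [hagree l hl.le] at h
    exact hmin l hl ⟨a, ha, _, h⟩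
  have h2 : C.leafInfo false e S a = !c := by
    refine C.leafInfo_false (sameCycle_of_inv_pow hac) (hback _ hac fun l hl h => ?_)
    exact hmin l hl ⟨a, ha, _, h⟩
  rw [h1, h2]
  cases c <;> simp

theorem leafInfo_of_oneB {δ : Bool} {e : E} {S : Finset X} (hS : C.OneB S) (x : X) :
    C.leafInfo δ e S x = C.fst S e x := by
  simp [leafInfo, hS e]

variable [Fintype E] [Fintype X]

/-- For this choice of upper strands all states other than `S` itself are excluded by the preceding
two lemmas. -/
theorem expansion_leaf (δ : Bool) (s : ℝ) (e : E) (S : Finset X) :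
    C.expansion δ s e S (C.leafInfo δ e S) = if C.OneB S then s ^ (- C.index e S) else 0 := by
  unfold expansion
  rw [Finset.sum_eq_single S]
  · simp [term]
  · intro T _ hT
    unfold term
    rw [if_neg]
    rintro ⟨h1, h2, h3⟩
    cases δ
    · obtain ⟨a, ha, h⟩ := C.not_forall_fst_false h1 hT h2 (e := e)
      exact h (by rw [h3 a ha]; cases C.leafInfo false e S a <;> rfl)
    · obtain ⟨a, ha, h⟩ := C.not_forall_fst_true h1 hT h2 (e := e)
      exact h (by rw [h3 a ha]; cases C.leafInfo true e S a <;> rfl)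
  · simp

/-- If there is one curve, upper strands are passed first, so each step of the walk against the
orientation, including jumps to upper strands, leads to an earlier edge, and the matrix is
unitriangular. If there are several curves, the one through `e` is above the others and the walk
cannot leave it (`δ = true`), or below them and the walk cannot enter it (`δ = false`); a diagonal
block is then singular. -/
theorem normDet_leaf (δ : Bool) {s : ℝ} (hs : s ≠ 0) {h : E → ℤ} (hh : C.IsNumbering h) (e : E)
    (S : Finset X) :
    C.normDet s e S (C.leafInfo δ e S) = if C.OneB S then s ^ (- C.index e S) else 0 := by
  unfold normDet
  split_ifs with hS
  · have h1 : C.writhe S (C.leafInfo δ e S) = C.index e S := by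
      refine Finset.sum_congr rfl fun x _ => ?_
      rw [eps, C.leafInfo_of_oneB hS]
      split_ifs <;> simp
    have hlt : ∀ f g, C.walk (C.cutRow e) (C.behav s S (C.leafInfo δ e S)) f g ≠ 0 →
        pos (C.bd S) e g < pos (C.bd S) e f := by
      intro f g h0
      rw [walk_cutRow_apply] at h0
      split_ifs at h0 with hge
      · exact absurd rfl h0
      · have h3 := pos_apply (hS e g) hge
        rcases C.walk_behav_ne_zero h0 with h2 | ⟨x, hx, rfl, h2⟩
        · rw [← h2, h3]
          omega
        · rw [h2] at h3
          rw [C.leafInfo_of_oneB hS] at h3 ⊢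
          have h4 : pos (C.bd S) e (C.en (x, true)) ≠ pos (C.bd S) e (C.en (x, false)) := by
            intro h
            simpa using C.en.injective (pos_inj (hS _ _) (hS _ _) h)
          cases hf : C.fst S e x
          · simp only [fst, decide_eq_false_iff_not] at hf
            rw [fst, decide_eq_false hf] at h3
            simp only [Bool.not_false]
            omega
          · simp only [fst, decide_eq_true_eq] at hf
            rw [fst, decide_eq_true hf] at h3
            simp only [Bool.not_true]
            omega
    have h2 : C.cutDet e (C.behav s S (C.leafInfo δ e S)) = 1 := by
      refine Matrix.det_eq_one_of_height _ (pos (C.bd S) e) (fun f => ?_) fun f g hfg h0 => ?_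
      · rw [Matrix.sub_apply, one_apply_eq, sub_eq_self]
        by_contra h0
        exact lt_irrefl _ (hlt f f h0)
      · rw [Matrix.sub_apply, one_apply_ne hfg, zero_sub, neg_ne_zero] at h0
        exact hlt f g h0
    rw [h1, h2, mul_one]
  · obtain ⟨r, hr⟩ : ∃ r, ¬ (C.bd S).SameCycle e r := by
      by_contra hc
      push Not at hc
      exact hS fun u v => (hc u).symm.trans (hc v)
    rw [mul_eq_zero]
    right
    have hstep : ∀ g, (C.bd S).SameCycle e (C.bd S g) ↔ (C.bd S).SameCycle e g := fun g =>
      Perm.sameCycle_apply_right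
    refine C.cutDet_eq_zero (fun g => (C.bd S).SameCycle e g) (Perm.SameCycle.refl _ _) hr ?_
    cases δ
    · right
      refine ⟨fun f g hf hg => ?_, C.sum_walk (C.behav_sum s S _)⟩
      by_contra h0
      rcases C.walk_behav_ne_zero h0 with h2 | ⟨x, hx, rfl, h2⟩
      · exact hf (by rwa [← h2, hstep])
      · rw [← hstep, h2] at hg
        have := C.leafInfo_false hg (fun h => absurd h hf)
        cases hl : C.leafInfo false e S x <;> simp [hl] at this
    · left
      refine ⟨fun f g hf hg => ?_, fun f => s ^ (-2 * h f), fun f => zpow_ne_zero _ hs, ?_⟩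
      · by_contra h0
        rcases C.walk_behav_ne_zero h0 with h2 | ⟨x, hx, rfl, h2⟩
        · exact hg (by rwa [← hstep, h2])
        · rw [← hstep, h2] at hg
          have := C.leafInfo_true hf (fun h => absurd (by rwa [Bool.not_not] at h) hg)
          cases hl : C.leafInfo true e S x <;> simp [hl] at this
      · exact C.sum_mul_walk (fun v hv => by rw [hh.of_ne v hv])
          (C.behav_numbering hh hs S _)

/-- The determinant of the walk is a sum over states. -/
theorem normDet_eq_expansion (δ : Bool) {s : ℝ} (hs : s ≠ 0) {h : E → ℤ} (hh : C.IsNumbering h)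
    (e : E) (S : Finset X) (o : X → Bool) : C.normDet s e S o = C.expansion δ s e S o := by
  induction hn : Sᶜ.card generalizing S o with
  | zero =>
    have hS : Sᶜ = ∅ := Finset.card_eq_zero.1 hn
    have ho : ∀ o', C.normDet s e S o = C.normDet s e S o' := by
      intro o'
      have : C.behav s S o = C.behav s S o' := by
        funext x b b'
        have : x ∈ S := by
          by_contra hx
          simpa [hS] using Finset.mem_compl.2 hx
        simp [behav, this]
      unfold normDet writhe
      rw [this, hS]
      simp
    have ho' : ∀ o', C.expansion δ s e S o = C.expansion δ s e S o' := by
      intro o'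
      refine Finset.sum_congr rfl fun T _ => ?_
      have : T \ S = ∅ := by
        rw [Finset.sdiff_eq_inter_compl, hS, Finset.inter_empty]
      unfold term
      rw [this]
      simp
    rw [ho (C.leafInfo δ e S), ho' (C.leafInfo δ e S), normDet_leaf C δ hs hh, expansion_leaf]
  | succ n ih =>
    -- Both sides satisfy the same skein relation and agree after one more smoothing, so a change of
    -- crossing does not affect their difference.
    have hstep : ∀ (o : X → Bool) (x : X), x ∉ S → ∀ b,
        C.normDet s e S (Function.update o x b) - C.expansion δ s e S (Function.update o x b) =
        C.normDet s e S (Function.update o x (!b)) -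
          C.expansion δ s e S (Function.update o x (!b)) := by
      intro o x hx b
      have h1 := C.normDet_skein hs e hx o
      have h2 := C.expansion_skein δ s e hx o
      rw [ih (insert x S) o (by
        rw [Finset.compl_insert, Finset.card_erase_of_mem (Finset.mem_compl.2 hx), hn]; rfl)] at h1
      cases b
      · simp only [Bool.not_false]; linarith
      · simp only [Bool.not_true]; linarith
    have hall : ∀ (A : Finset X), A ⊆ Sᶜ → ∀ o o' : X → Bool, (∀ x ∉ A, o x = o' x) →
        C.normDet s e S o - C.expansion δ s e S o =
          C.normDet s e S o' - C.expansion δ s e S o' := by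
      intro A
      induction A using Finset.induction_on with
      | empty =>
        intro _ o o' h
        rw [funext fun x => h x (by simp)]
      | insert x A hx ihA =>
        intro hA o o' h
        have hxS : x ∉ S := Finset.mem_compl.1 (hA (Finset.mem_insert_self x A))
        rw [← ihA (fun y hy => hA (Finset.mem_insert_of_mem hy)) (Function.update o x (o' x)) o'
          fun y hy => ?_]
        · by_cases hox : o x = o' x
          · rw [← hox, Function.update_eq_self]
          · have := hstep o x hxS (o x)
            rw [Function.update_eq_self] at this
            rw [this, show (!o x) = o' x by revert hox; cases o x <;> cases o' x <;> simp]
        · by_cases hy' : y = x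
          · subst hy'; simp
          · rw [Function.update_of_ne hy']
            exact h y (by simp [hy, hy'])
    -- All crossings outside `S` are changed to the choice of `leafInfo`, where both sides are
    -- known; the values in `S` are irrelevant.
    let o' : X → Bool := fun x => if x ∈ S then o x else C.leafInfo δ e S x
    have h1 := hall Sᶜ subset_rfl o o' fun x hx => by
      simp only [Finset.mem_compl, not_not] at hx
      simp [o', hx]
    have h2 : C.normDet s e S o' = C.normDet s e S (C.leafInfo δ e S) := by
      have e1 : C.writhe S o' = C.writhe S (C.leafInfo δ e S) :=
        Finset.sum_congr rfl fun x hx => by simp [eps, o', Finset.mem_compl.1 hx]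
      have e2 : C.behav s S o' = C.behav s S (C.leafInfo δ e S) := by
        funext x b b'
        by_cases hx : x ∈ S
        · simp [behav, hx]
        · simp [behav, hx, o', eps]
      unfold normDet
      rw [e1, e2]
    have h3 : C.expansion δ s e S o' = C.expansion δ s e S (C.leafInfo δ e S) := by
      refine Finset.sum_congr rfl fun T _ => ?_
      have e1 : ∀ a ∈ T \ S, o' a = C.leafInfo δ e S a := fun a ha => by
        simp [o', (Finset.mem_sdiff.1 ha).2]
      unfold term
      rw [Finset.prod_congr rfl fun a ha => by rw [eps, e1 a ha, ← eps]]
      have e2 : (∀ a ∈ T \ S, C.fst T e a = (o' a == δ)) ↔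
          ∀ a ∈ T \ S, C.fst T e a = (C.leafInfo δ e S a == δ) :=
        forall₂_congr fun a ha => by rw [e1 a ha]
      simp only [e2]
    rw [h2, h3, normDet_leaf C δ hs hh, expansion_leaf, sub_self] at h1
    linarith

end Curve

namespace Curve

open CyclePos Classical

variable {E X : Type} (C : Curve E X)

/-! ### Planar curves -/

/-- The point of the strand that passes the crossing `x` from left to right. -/
def lr (x : X) : E := C.en (x, decide (C.sgn x = 1))

/-- The point of the strand that passes the crossing `x` from right to left. -/
def rl (x : X) : E := C.en (x, !decide (C.sgn x = 1))

/-- `L` assigns numbers to the faces on the left of the edges, and `β` is its boundary. -/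
structure Bounds (β L : E → ℚ) : Prop where
  of_ne : ∀ u, (∀ y, C.en y ≠ u) → L (C.nxt.symm u) = L u
  -- The number on the right of an edge is `L - β`. Each of these four fields says that two edges at
  -- a crossing border the same face.
  west : ∀ x, L (C.nxt.symm (C.lr x)) = L (C.rl x)
  south : ∀ x, L (C.nxt.symm (C.lr x)) - β (C.nxt.symm (C.lr x)) = L (C.nxt.symm (C.rl x))
  north : ∀ x, L (C.lr x) = L (C.rl x) - β (C.rl x)
  east : ∀ x, L (C.nxt.symm (C.rl x)) - β (C.nxt.symm (C.rl x)) = L (C.lr x) - β (C.lr x)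

theorem sum_lr_rl {M : Type} [AddCommMonoid M] (φ : E → M) (x : X) :
    φ (C.en (x, true)) + φ (C.en (x, false)) = φ (C.lr x) + φ (C.rl x) := by
  unfold lr rl
  cases decide (C.sgn x = 1)
  · exact add_comm _ _
  · rfl

variable [Fintype E]

/-- The chain `β` is a cycle. -/
def IsCycle (β : E → ℚ) : Prop :=
  ∀ ψ : E → ℚ, (∀ x, ψ (C.en (x, true)) = ψ (C.en (x, false))) →
    ∑ u, β u * (ψ (C.nxt u) - ψ u) = 0

/-- Every cycle is a boundary. -/
def Planar : Prop := ∀ β, C.IsCycle β → ∃ L, C.Bounds β L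

variable {C}

theorem IsCycle.sum_symm {β : E → ℚ} (h : C.IsCycle β) {ψ : E → ℚ}
    (hψ : ∀ x, ψ (C.en (x, true)) = ψ (C.en (x, false))) :
    ∑ u, (β (C.nxt.symm u) - β u) * ψ u = 0 := by
  rw [← h ψ hψ]
  simp only [sub_mul, mul_sub, Finset.sum_sub_distrib]
  congr 1
  rw [← Equiv.sum_comp C.nxt]
  simp

theorem IsCycle.of_ne {β : E → ℚ} (h : C.IsCycle β) {u : E} (hu : ∀ y, C.en y ≠ u) :
    β (C.nxt.symm u) = β u := by
  have := h.sum_symm (ψ := Pi.single u 1) fun x => by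
    rw [Pi.single_eq_of_ne (hu _), Pi.single_eq_of_ne (hu _)]
  simp only [Pi.single_apply, mul_ite, mul_one, mul_zero, Finset.sum_ite_eq', Finset.mem_univ,
    if_true] at this
  linarith

/-- Kirchhoff's law, from the test function that is supported at the crossing. -/
theorem IsCycle.cross {β : E → ℚ} (h : C.IsCycle β) (x : X) :
    β (C.nxt.symm (C.lr x)) + β (C.nxt.symm (C.rl x)) = β (C.lr x) + β (C.rl x) := by
  have := h.sum_symm (ψ := Pi.single (C.en (x, true)) 1 + Pi.single (C.en (x, false)) 1)
    fun y => by
      by_cases hy : y = x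
      · subst hy; simp
      · simp [hy]
  simp only [Pi.add_apply, Pi.single_apply, mul_add, mul_ite, mul_one, mul_zero,
    Finset.sum_add_distrib, Finset.sum_ite_eq', Finset.mem_univ, if_true] at this
  have e1 := C.sum_lr_rl β x
  have e2 := C.sum_lr_rl (fun u => β (C.nxt.symm u)) x
  linarith

theorem isCycle_one : C.IsCycle fun _ => 1 := by
  intro ψ _
  simp only [one_mul, Finset.sum_sub_distrib]
  rw [Equiv.sum_comp C.nxt ψ, sub_self]

/-- A planar curve has an Alexander numbering. -/
theorem Planar.exists_isNumbering (hC : C.Planar) : ∃ h, C.IsNumbering h := by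
  obtain ⟨L, hL⟩ := hC _ isCycle_one
  have h1 := hL.west
  have h2 := hL.south
  have h3 := hL.north
  have key : ∀ x, L (C.lr x) = L (C.nxt.symm (C.rl x)) := fun x => by
    linarith [h1 x, h2 x, h3 x]
  have fl : ∀ {a b : ℚ}, a - 1 = b → ⌊a⌋ = ⌊b⌋ + 1 := fun {a b} h => by
    rw [← h, Int.floor_sub_one]; ring
  -- `L` is only rational, but adjacent faces differ by one, so rounding down preserves all
  -- relations.
  refine ⟨fun u => ⌊L u⌋, fun u hu => by simp only [hL.of_ne u hu], ?_, ?_⟩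
  · intro x b
    rcases Int.units_eq_one_or (C.sgn x) with hs | hs <;> cases b <;>
      simp only [lr, rl] at h1 h2 key
    all_goals
      have a1 := h1 x
      have a2 := key x
      simp [hs] at a1 a2
      simp [a1, a2]
  · intro x
    rcases Int.units_eq_one_or (C.sgn x) with hs | hs
    · have a := h2 x
      simp [lr, rl, hs] at a
      simp [hs, fl a]
    · have a := h2 x
      simp [lr, rl, hs] at a
      simp [hs, fl a]

/-! ### The intersection form -/

variable [Fintype X]

variable (C) in
/-- The contribution of a crossing to the intersection number, times four. -/
def interAt (x : X) (α β : E → ℚ) : ℚ :=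
  α (C.lr x) * (β (C.rl x) + β (C.nxt.symm (C.rl x))) -
  α (C.rl x) * (β (C.nxt.symm (C.lr x)) + β (C.lr x)) +
  α (C.nxt.symm (C.lr x)) * (β (C.nxt.symm (C.rl x)) + β (C.rl x)) -
  α (C.nxt.symm (C.rl x)) * (β (C.lr x) + β (C.nxt.symm (C.lr x)))

variable (C) in
/-- Four times the intersection number of chains. -/
def inter : (E → ℚ) →ₗ[ℚ] (E → ℚ) →ₗ[ℚ] ℚ :=
  LinearMap.mk₂ ℚ (fun α β => ∑ x, C.interAt x α β)
    (fun α α' β => by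
      rw [← Finset.sum_add_distrib]
      exact Finset.sum_congr rfl fun x _ => by simp only [interAt, Pi.add_apply]; ring)
    (fun c α β => by
      rw [smul_eq_mul, Finset.mul_sum]
      exact Finset.sum_congr rfl fun x _ => by
        simp only [interAt, Pi.smul_apply, smul_eq_mul]; ring)
    (fun α β β' => by
      rw [← Finset.sum_add_distrib]
      exact Finset.sum_congr rfl fun x _ => by simp only [interAt, Pi.add_apply]; ring)
    (fun c α β => by
      rw [smul_eq_mul, Finset.mul_sum]
      exact Finset.sum_congr rfl fun x _ => by
        simp only [interAt, Pi.smul_apply, smul_eq_mul]; ring)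

omit [Fintype E] in
theorem inter_apply (α β : E → ℚ) : C.inter α β = ∑ x, C.interAt x α β := rfl

omit [Fintype E] in
theorem inter_self (α : E → ℚ) : C.inter α α = 0 := by
  rw [inter_apply]
  exact Finset.sum_eq_zero fun x _ => by unfold interAt; ring

theorem sum_eq_sum_ends {φ : E → ℚ} (h : ∀ u, (∀ y, C.en y ≠ u) → φ u = 0) :
    ∑ u, φ u = ∑ x, (φ (C.lr x) + φ (C.rl x)) := by
  have h1 : ∑ u ∈ Finset.univ.map C.en, φ u = ∑ u, φ u :=
    Finset.sum_subset (Finset.subset_univ _) fun u _ hu => h u fun y hy => hu (by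
      rw [← hy]; exact Finset.mem_map_of_mem _ (Finset.mem_univ y))
  rw [← h1, Finset.sum_map, Fintype.sum_prod_type]
  refine Finset.sum_congr rfl fun x _ => ?_
  rw [Fintype.sum_bool, sum_lr_rl]

/-- Let `β` bound `L`; then `2 * L - β` adds the numbers of the faces on both sides of an edge.
Crossing by crossing, the intersection number is -2 times the difference of `α * (2 * L - β)` on
outgoing and incoming edges, and these differences cancel along the curve. -/
theorem Planar.inter_eq_zero (hC : C.Planar) {α β : E → ℚ} (hα : C.IsCycle α)
    (hβ : C.IsCycle β) : C.inter α β = 0 := by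
  obtain ⟨L, hL⟩ := hC β hβ
  let g : E → ℚ := fun u => α u * (2 * L u - β u)
  have h1 : ∑ u, (g u - g (C.nxt.symm u)) = 0 := by
    rw [Finset.sum_sub_distrib, Equiv.sum_comp C.nxt.symm g, sub_self]
  rw [C.sum_eq_sum_ends fun u hu => by
    simp only [g, hL.of_ne u hu, hα.of_ne hu, hβ.of_ne hu, sub_self]] at h1
  rw [inter_apply, ← mul_zero (-2), ← h1, Finset.mul_sum]
  refine Finset.sum_congr rfl fun x _ => ?_
  have a1 := hL.west x
  have a2 := hL.south x
  have a3 := hL.north x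
  have a4 := hL.east x
  have a5 := hα.cross x
  simp only [g, interAt]
  generalize α (C.lr x) = α0 at *
  generalize α (C.rl x) = α1 at *
  generalize α (C.nxt.symm (C.lr x)) = α2 at *
  generalize α (C.nxt.symm (C.rl x)) = α3 at *
  generalize L (C.lr x) = L0 at *
  generalize L (C.rl x) = L1 at *
  generalize L (C.nxt.symm (C.lr x)) = L2 at *
  generalize L (C.nxt.symm (C.rl x)) = L3 at *
  obtain rfl : α3 = α0 + α1 - α2 := by linarith
  obtain rfl : L2 = L1 := a1
  subst a3
  subst a2
  have hb : β (C.lr x) = β (C.nxt.symm (C.rl x)) + β (C.nxt.symm (C.lr x)) - β (C.rl x) := by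
    linarith
  rw [hb]
  ring

end Curve

/-! ### The self-intersection of a cut curve, and why all states have the same index -/

namespace CyclePos

variable {E : Type} {f : Perm E} {e : E}

open Classical in
variable (f e) in
/-- The chain of the first `j` edges after `e`. -/
def initial (j : ℕ) : E → ℚ := fun v => if pos f e v < j + 1 then 1 else 0

variable [Finite E]

theorem pos_pow_succ (e : E) {k : ℕ} (hk : k < pos f e e) : pos f e ((f ^ (k + 1)) e) = k + 1 := by
  induction k with
  | zero => simpa using pos_apply_self
  | succ k ih =>
    rw [pow_succ', Perm.mul_apply, pos_apply (sameCycle_of_pow rfl), ih (by omega)]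
    exact pow_ne_of_lt_pos k.succ_pos hk

theorem pos_le_self (e : E) {u : E} (h : f.SameCycle e u) : pos f e u ≤ pos f e e := by
  rcases eq_or_ne u e with rfl | hu
  · exact le_rfl
  · exact (pos_lt_self h hu).le

theorem sum_eq_sum_range [Fintype E] {M : Type} [AddCommMonoid M] (h : ∀ u, f.SameCycle e u)
    (φ : E → M) : ∑ u, φ u = ∑ j ∈ Finset.range (pos f e e), φ ((f ^ (j + 1)) e) := by
  refine Finset.sum_bij' (fun u _ => pos f e u - 1) (fun j _ => (f ^ (j + 1)) e) ?_ ?_ ?_ ?_ ?_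
  · intro u _
    have := pos_le_self e (h u)
    have := (pos_spec (h u)).1
    simp only [Finset.mem_range]; omega
  · simp
  · intro u _
    have := (pos_spec (h u)).1
    rw [Nat.sub_add_cancel this, (pos_spec (h u)).2]
  · intro j hj
    rw [pos_pow_succ e (Finset.mem_range.1 hj), Nat.add_sub_cancel]
  · intro u _
    rw [Nat.sub_add_cancel (pos_spec (h u)).1, (pos_spec (h u)).2]

open Classical in
theorem initial_zero (h : ∀ u, f.SameCycle e u) : initial f e 0 = 0 := by
  funext v
  have := (pos_spec (h v)).1
  simp only [initial, Pi.zero_apply]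
  rw [if_neg (by omega)]

open Classical in
theorem initial_succ (h : ∀ u, f.SameCycle e u) {j : ℕ} (hj : j < pos f e e) :
    initial f e (j + 1) = initial f e j + Pi.single ((f ^ (j + 1)) e) 1 := by
  funext v
  have h1 := pos_pow_succ (f := f) e hj
  by_cases hv : v = (f ^ (j + 1)) e
  · subst hv
    simp [initial, h1]
  · have h2 : pos f e v ≠ j + 1 := fun h3 => hv (pos_inj (h v) (h _) (h3.trans h1.symm))
    simp only [initial, Pi.add_apply, Pi.single_eq_of_ne hv, add_zero]
    exact if_congr (by omega) rfl rfl

open Classical in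
theorem initial_eq_sum (h : ∀ u, f.SameCycle e u) {j : ℕ} (hj : j ≤ pos f e e) :
    initial f e j = ∑ i ∈ Finset.range j, Pi.single ((f ^ (i + 1)) e) 1 := by
  induction j with
  | zero => rw [initial_zero h, Finset.sum_range_zero]
  | succ j ih => rw [initial_succ h (by omega), ih (by omega), Finset.sum_range_succ]

end CyclePos

/-- Summation by parts. The vectors `c i + g (i + 1) - g i` stand for edges, written as cycles plus
differences of paths. As `B` is alternating and vanishes on the cycles, the double sum over ordered
pairs collapses to terms that involve only consecutive indices and total sums. -/
theorem LinearMap.sum_apply_sum_range {V : Type} [AddCommGroup V] [Module ℚ V]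
    (B : V →ₗ[ℚ] V →ₗ[ℚ] ℚ) (hB : ∀ v, B v v = 0) (c g : ℕ → V) (hc : ∀ i j, B (c i) (c j) = 0)
    (n : ℕ) :
    ∑ j ∈ Finset.range n, B (∑ i ∈ Finset.range j, (c i + g (i + 1) - g i))
        (c j + g (j + 1) - g j) =
      B (∑ i ∈ Finset.range n, c i) (g n) +
        ∑ j ∈ Finset.range n, (B (g j) (c j) + B (g j) (g (j + 1)) - B (c j) (g (j + 1))) -
        B (g 0) (∑ i ∈ Finset.range n, (c i + g (i + 1) - g i)) := by
  induction n with
  | zero => simp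
  | succ n ih =>
    have h1 : ∑ i ∈ Finset.range n, (c i + g (i + 1) - g i) =
        ∑ i ∈ Finset.range n, c i + g n - g 0 := by
      rw [add_sub_assoc, ← Finset.sum_range_sub g n, ← Finset.sum_add_distrib]
      exact Finset.sum_congr rfl fun i _ => by abel
    have h2 : B (∑ i ∈ Finset.range n, c i) (c n) = 0 := by
      rw [map_sum, LinearMap.sum_apply]
      exact Finset.sum_eq_zero fun i _ => hc i n
    rw [Finset.sum_range_succ, ih, Finset.sum_range_succ c, Finset.sum_range_succ _ n,
      Finset.sum_range_succ _ n, h1]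
    simp only [map_add, map_sub, LinearMap.add_apply, LinearMap.sub_apply, h2, hB]
    ring

namespace Curve

open CyclePos Classical

variable {E X : Type} {C : Curve E X}

theorem apply_bd {M : Type} {ψ : E → M} (hψ : ∀ x, ψ (C.en (x, true)) = ψ (C.en (x, false)))
    (S : Finset X) (u : E) : ψ (C.bd S u) = ψ (C.nxt u) := by
  rw [bd_apply]
  by_cases hu : ∃ x ∈ S, ∃ b, C.nxt u = C.en (x, b)
  · obtain ⟨x, hx, b, hb⟩ := hu
    rw [hb, C.jumpAt_mem hx]
    cases b
    · exact hψ x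
    · exact (hψ x).symm
  · push Not at hu
    rw [C.jumpAt_of_forall_ne hu]

variable (C) in
/-- Chains that connect a fixed vertex with all other vertices. -/
def pathTo (S : Finset X) (e u : E) : E → ℚ :=
  initial (C.bd S) e
    -- Both points of a crossing get the path to its upper point, so the chain depends on the vertex
    -- only. The edge in position `pos` starts at the vertex, hence the path stops one edge before.
    (pos (C.bd S) e (if h : ∃ x, C.en (x, false) = u then C.en (h.choose, true) else u) - 1)

theorem pathTo_en (S : Finset X) (e : E) (x : X) :
    C.pathTo S e (C.en (x, true)) = C.pathTo S e (C.en (x, false)) := by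
  have h1 : ∃ y, C.en (y, false) = C.en (x, false) := ⟨x, rfl⟩
  have h2 : ¬ ∃ y, C.en (y, false) = C.en (x, true) := by simp
  have h3 : h1.choose = x := by simp
  rw [pathTo, pathTo, dif_pos h1, dif_neg h2, h3]

variable [Fintype E]

theorem sum_pathTo {S : Finset X} (hS : C.OneB S) (e u : E) {ψ : E → ℚ}
    (hψ : ∀ x, ψ (C.en (x, true)) = ψ (C.en (x, false))) :
    ∑ v, C.pathTo S e u v * (ψ (C.nxt v) - ψ v) = ψ u - ψ (C.nxt e) := by
  have h1 : ∀ w, ∑ v, initial (C.bd S) e (pos (C.bd S) e w - 1) v * (ψ (C.nxt v) - ψ v) =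
      ψ w - ψ (C.nxt e) := by
    intro w
    have hp := (pos_spec (hS e w)).1
    have hle := pos_le_self e (hS e w)
    rw [initial_eq_sum (hS e) (by omega)]
    simp only [Finset.sum_apply, Finset.sum_mul]
    rw [Finset.sum_comm]
    have h2 : ∀ i ∈ Finset.range (pos (C.bd S) e w - 1),
        ∑ v, (Pi.single ((C.bd S ^ (i + 1)) e) 1 : E → ℚ) v * (ψ (C.nxt v) - ψ v) =
          ψ ((C.bd S ^ (i + 1 + 1)) e) - ψ ((C.bd S ^ (i + 1)) e) := by
      intro i _
      rw [Finset.sum_eq_single ((C.bd S ^ (i + 1)) e) (fun v _ hv => by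
        rw [Pi.single_eq_of_ne hv, zero_mul]) (by simp), Pi.single_eq_same, one_mul,
        ← apply_bd hψ S, ← Perm.mul_apply, ← pow_succ' (C.bd S) (i + 1)]
    rw [Finset.sum_congr rfl h2, Finset.sum_range_sub (fun i => ψ ((C.bd S ^ (i + 1)) e)),
      Nat.sub_add_cancel hp, (pos_spec (hS e w)).2, zero_add, pow_one, apply_bd hψ S]
  rw [pathTo, h1]
  split_ifs with h
  · rw [hψ, h.choose_spec]
  · rfl

theorem isCycle_pathTo {S : Finset X} (hS : C.OneB S) (e u : E) :
    C.IsCycle (C.pathTo S e u + Pi.single u 1 - C.pathTo S e (C.nxt u)) := by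
  intro ψ hψ
  simp only [Pi.add_apply, Pi.sub_apply, add_mul, sub_mul, Finset.sum_add_distrib,
    Finset.sum_sub_distrib, sum_pathTo hS e _ hψ]
  have h1 : ∑ v, (Pi.single u 1 : E → ℚ) v * (ψ (C.nxt v) - ψ v) = ψ (C.nxt u) - ψ u := by
    rw [Finset.sum_eq_single u (fun v _ hv => by rw [Pi.single_eq_of_ne hv, zero_mul]) (by simp),
      Pi.single_eq_same, one_mul]
  rw [h1]
  ring

variable [Fintype X]

/-- The self-intersection number of the curve with smoothed crossings, cut at an edge. -/
theorem Planar.sum_inter_initial (hC : C.Planar) (e : E) :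
    ∃ κ : ℚ, ∀ S, C.OneB S →
      ∑ v, C.inter (initial (C.bd S) e (pos (C.bd S) e v - 1)) (Pi.single v 1) = κ := by
  by_cases h : ∃ S, C.OneB S
  swap
  · exact ⟨0, fun S hS => absurd ⟨S, hS⟩ h⟩
  obtain ⟨S₀, hS₀⟩ := h
  let γ := C.pathTo S₀ e
  -- Every edge is closed up to a cycle by paths of the fixed state `S₀`. The value given next
  -- involves edges `u` and their successors `C.nxt u`, but not the order in which `S` visits them.
  let c : E → E → ℚ := fun u => γ u + Pi.single u 1 - γ (C.nxt u)
  refine ⟨C.inter (∑ u, c u) (γ (C.nxt e)) + ∑ u, (C.inter (γ u) (c u) +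
    C.inter (γ u) (γ (C.nxt u)) - C.inter (c u) (γ (C.nxt u))) -
    C.inter (γ (C.nxt e)) (∑ u, Pi.single u 1), fun S hS => ?_⟩
  -- A jump stays at the same vertex, and the paths know only the vertex.
  have hγ : ∀ u, γ (C.bd S u) = γ (C.nxt u) := apply_bd (pathTo_en S₀ e) S
  let f : ℕ → E := fun j => (C.bd S ^ (j + 1)) e
  have hf : ∀ j, γ (f (j + 1)) = γ (C.nxt (f j)) := fun j => by
    rw [← hγ, ← Perm.mul_apply, ← pow_succ' (C.bd S) (j + 1)]
  have hN : f (pos (C.bd S) e e) = f 0 := by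
    change (C.bd S ^ (pos (C.bd S) e e + 1)) e = (C.bd S ^ 1) e
    rw [pow_succ', Perm.mul_apply, (pos_spec (hS e e)).2, pow_one]
  have h0 : γ (f 0) = γ (C.nxt e) := by rw [← hγ]; simp [f]
  have he : ∀ j, c (f j) + γ (f (j + 1)) - γ (f j) = Pi.single (f j) 1 := fun j => by
    rw [hf]; simp only [c]; abel
  have key := LinearMap.sum_apply_sum_range C.inter inter_self (fun j => c (f j))
    (fun j => γ (f j)) (fun i j => hC.inter_eq_zero (isCycle_pathTo hS₀ e _)
      (isCycle_pathTo hS₀ e _)) (pos (C.bd S) e e)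
  simp only [he, hN] at key
  simp only [hf] at key
  rw [h0] at key
  rw [sum_eq_sum_range (hS e), sum_eq_sum_range (hS e) c, sum_eq_sum_range (hS e),
    sum_eq_sum_range (hS e) fun u => (Pi.single u 1 : E → ℚ), ← key]
  refine Finset.sum_congr rfl fun j hj => ?_
  have hj := Finset.mem_range.1 hj
  rw [pos_pow_succ e hj, Nat.add_sub_cancel, initial_eq_sum (hS e) hj.le]

/-- `p'`, `q'` and `p`, `q` are the positions of the incoming and outgoing edges of a crossing that
is not smoothed, on a tour of length `N`. An outgoing edge directly follows its incoming edge unless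
the tour closes up there, which leaves few orders. -/
theorem count_pairs_notMem {p q p' q' N : ℕ}
    (h1 : p' = N ∧ p = 1 ∨ p' ≠ N ∧ p = p' + 1) (h2 : q' = N ∧ q = 1 ∨ q' ≠ N ∧ q = q' + 1)
    (hpq : p ≠ q) (hpq' : p' ≠ q') (hp : 0 < p') (hq : 0 < q') (lp : p' ≤ N) (lq : q' ≤ N) :
    (if p < q then (1 : ℚ) else 0) + (if p < q' then 1 else 0) - ((if q < p' then 1 else 0) +
      (if q < p then 1 else 0)) + ((if p' < q' then 1 else 0) + (if p' < q then 1 else 0)) -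
      ((if q' < p then 1 else 0) + (if q' < p' then 1 else 0)) =
    (if p < q then 4 else -4) + ((if p' = q then 1 else 0) - (if q' = p then 1 else 0) -
        (if p' = N then 4 else 0) + (if q' = N then 4 else 0)) := by
  have e1 : p' = N ↔ N ≤ p' := by omega
  have e2 : q' = N ↔ N ≤ q' := by omega
  have e3 : p' = q ↔ ¬ p' < q ∧ ¬ q < p' := by omega
  have e4 : q' = p ↔ ¬ q' < p ∧ ¬ p < q' := by omega
  have e5 : q < p ↔ ¬ p < q := by omega
  have e6 : q' < p' ↔ ¬ p' < q' := by omega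
  simp only [e1, e2, e3, e4, e5, e6]
  by_cases a1 : N ≤ p' <;> by_cases a2 : N ≤ q' <;> by_cases a3 : p < q <;>
    by_cases a4 : p' < q <;> by_cases a5 : p < q' <;> by_cases a6 : q < p' <;>
    by_cases a7 : q' < p <;> by_cases a8 : p' < q' <;> (try (exfalso; omega)) <;>
  · simp only [a1, a2, a3, a4, a5, a6, a7, a8, if_true, if_false, not_true, not_false_iff, and_true, and_false]
    norm_num

/-- At a smoothed crossing the outgoing edges are exchanged, and the main term disappears. -/
theorem count_pairs_mem {p q p' q' N : ℕ}
    (h1 : p' = N ∧ q = 1 ∨ p' ≠ N ∧ q = p' + 1) (h2 : q' = N ∧ p = 1 ∨ q' ≠ N ∧ p = q' + 1)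
    (hpq : p ≠ q) (hpq' : p' ≠ q') (hp : 0 < p') (hq : 0 < q') (lp : p' ≤ N) (lq : q' ≤ N) :
    (if p < q then (1 : ℚ) else 0) + (if p < q' then 1 else 0) - ((if q < p' then 1 else 0) +
      (if q < p then 1 else 0)) + ((if p' < q' then 1 else 0) + (if p' < q then 1 else 0)) -
      ((if q' < p then 1 else 0) + (if q' < p' then 1 else 0)) =
    (if p' = q then 1 else 0) - (if q' = p then 1 else 0) -
        (if p' = N then 4 else 0) + (if q' = N then 4 else 0) := by
  have e1 : p' = N ↔ N ≤ p' := by omega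
  have e2 : q' = N ↔ N ≤ q' := by omega
  have e3 : p' = q ↔ ¬ p' < q ∧ ¬ q < p' := by omega
  have e4 : q' = p ↔ ¬ q' < p ∧ ¬ p < q' := by omega
  have e5 : q < p ↔ ¬ p < q := by omega
  have e6 : q' < p' ↔ ¬ p' < q' := by omega
  simp only [e1, e2, e3, e4, e5, e6]
  by_cases a1 : N ≤ p' <;> by_cases a2 : N ≤ q' <;> by_cases a3 : p < q <;>
    by_cases a4 : p' < q <;> by_cases a5 : p < q' <;> by_cases a6 : q < p' <;>
    by_cases a7 : q' < p <;> by_cases a8 : p' < q' <;> (try (exfalso; omega)) <;>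
  · simp only [a1, a2, a3, a4, a5, a6, a7, a8, if_true, if_false, not_true, not_false_iff, and_true, and_false]
    norm_num

-- The last bracket does not involve `S`; this is what makes different states comparable.
omit [Fintype X] in
theorem sum_interAt_initial {S : Finset X} (hS : C.OneB S) (e : E) (x : X) :
    ∑ v, C.interAt x (initial (C.bd S) e (pos (C.bd S) e v - 1)) (Pi.single v 1) =
      (if x ∈ S then 0 else
        if pos (C.bd S) e (C.lr x) < pos (C.bd S) e (C.rl x) then 4 else -4) +
      ((if C.nxt.symm (C.lr x) = C.rl x then 1 else 0) -
        (if C.nxt.symm (C.rl x) = C.lr x then 1 else 0) -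
        (if C.nxt.symm (C.lr x) = e then 4 else 0) +
        (if C.nxt.symm (C.rl x) = e then 4 else 0)) := by
  set P := pos (C.bd S) e with hP
  have w : ∀ a b, ∑ v, initial (C.bd S) e (P v - 1) a * (Pi.single v 1 : E → ℚ) b =
      if P a < P b then 1 else 0 := by
    intro a b
    have hp := (pos_spec (hS e b)).1
    rw [Finset.sum_eq_single b (fun v _ hv => by rw [Pi.single_eq_of_ne hv.symm, mul_zero])
      (by simp), Pi.single_eq_same, mul_one, initial]
    exact if_congr (by rw [← hP] at hp ⊢; omega) rfl rfl
  simp only [interAt, mul_add, Finset.sum_add_distrib, Finset.sum_sub_distrib, w]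
  have inj : ∀ {a b}, P a = P b ↔ a = b := fun {a b} =>
    ⟨fun h => pos_inj (hS e a) (hS e b) h, fun h => h ▸ rfl⟩
  have hpos : ∀ a, 0 < P a := fun a => (pos_spec (hS e a)).1
  have hle : ∀ a, P a ≤ P e := fun a => pos_le_self e (hS e a)
  have step : ∀ u, (u = e ∧ P (C.bd S u) = 1) ∨ (u ≠ e ∧ P (C.bd S u) = P u + 1) := fun u => by
    by_cases h : u = e
    · subst h; exact Or.inl ⟨rfl, pos_apply_self⟩
    · exact Or.inr ⟨h, pos_apply (hS e u) h⟩
  have hlr : C.lr x ≠ C.rl x := by unfold lr rl; simp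
  have hb : ∀ b, C.bd S (C.nxt.symm (C.en (x, b))) = C.en (x, if x ∈ S then !b else b) := by
    intro b
    rw [bd_apply, apply_symm_apply]
    split_ifs with h
    · rw [C.jumpAt_mem h]
    · rw [C.jumpAt_notMem h]
  have s1 := step (C.nxt.symm (C.lr x))
  have s2 := step (C.nxt.symm (C.rl x))
  have n1 : P (C.lr x) ≠ P (C.rl x) := fun h => hlr (inj.1 h)
  have n2 : P (C.nxt.symm (C.lr x)) ≠ P (C.nxt.symm (C.rl x)) := fun h =>
    hlr (C.nxt.symm.injective (inj.1 h))
  have b1 : C.bd S (C.nxt.symm (C.lr x)) = if x ∈ S then C.rl x else C.lr x := by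
    unfold lr rl; rw [hb]; split_ifs <;> rfl
  have b2 : C.bd S (C.nxt.symm (C.rl x)) = if x ∈ S then C.lr x else C.rl x := by
    unfold lr rl; rw [hb]; split_ifs <;> simp
  rw [b1] at s1
  rw [b2] at s2
  simp only [← inj, ne_eq] at s1 s2 ⊢
  have p3 := hpos (C.nxt.symm (C.lr x))
  have p4 := hpos (C.nxt.symm (C.rl x))
  have l3 := hle (C.nxt.symm (C.lr x))
  have l4 := hle (C.nxt.symm (C.rl x))
  by_cases hx : x ∈ S
  · simp only [hx, if_true, zero_add] at s1 s2 ⊢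
    exact count_pairs_mem s1 s2 n1 n2 p3 p4 l3 l4
  · simp only [hx, if_false] at s1 s2 ⊢
    exact count_pairs_notMem s1 s2 n1 n2 p3 p4 l3 l4

theorem four_mul_index {S : Finset X} (hS : C.OneB S) (e : E) :
    4 * (C.index e S : ℚ) = ∑ x, if x ∈ S then 0 else
        if pos (C.bd S) e (C.lr x) < pos (C.bd S) e (C.rl x) then (4 : ℚ) else -4 := by
  rw [index, ← Finset.sum_subset (Finset.subset_univ Sᶜ)]
  · push_cast
    rw [Finset.mul_sum]
    refine Finset.sum_congr rfl fun x hx => ?_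
    rw [if_neg (Finset.mem_compl.1 hx)]
    have inj : pos (C.bd S) e (C.en (x, true)) ≠ pos (C.bd S) e (C.en (x, false)) := fun h =>
      absurd (pos_inj (hS e _) (hS e _) h) (by simp)
    rcases Int.units_eq_one_or (C.sgn x) with hs | hs
    · simp only [lr, rl, hs, fst]
      simp
    · have : ¬ (-1 : ℤˣ) = 1 := by decide
      simp only [lr, rl, hs, fst, this]
      rcases lt_or_gt_of_ne inj with h | h
      · simp [h, h.le]
      · simp [h, h.le]
  · intro x _ hx
    rw [if_pos (by simpa using hx)]

/-- Four times the index is the self-intersection number of the cut curve, which is the same for all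
states, up to local corrections that do not involve the state. -/
theorem Planar.index_eq (hC : C.Planar) (e : E) {S S' : Finset X} (hS : C.OneB S)
    (hS' : C.OneB S') : C.index e S = C.index e S' := by
  obtain ⟨κ, hκ⟩ := hC.sum_inter_initial e
  have h1 := hκ S hS
  rw [← hκ S' hS'] at h1
  simp only [inter_apply] at h1
  rw [Finset.sum_comm, Finset.sum_comm (s := Finset.univ (α := E))] at h1
  simp only [sum_interAt_initial hS, sum_interAt_initial hS', Finset.sum_add_distrib (s := Finset.univ (α := X)),
    ← four_mul_index hS, ← four_mul_index hS'] at h1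
  have h2 : (C.index e S : ℚ) = C.index e S' := by linarith
  exact_mod_cast h2

end Curve

/-! ### The state sum as a determinant, and its independence of the base edge -/

/-- The substitution `s ↦ -s⁻¹` fixes `s⁻¹ - s` but, for `s > 1` and `k ≠ 0`, changes the absolute
value of `s ^ k`. So for `k ≠ 0` both values vanish for every `s > 1`, and `s⁻¹ - s` takes
infinitely many values there. -/
theorem Polynomial.eq_of_aeval_inv_sub {P Q : ℤ[X]} (k : ℤ)
    (h : ∀ s : ℝ, s ≠ 0 → aeval (s⁻¹ - s) P = s ^ k * aeval (s⁻¹ - s) Q) : P = Q := by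
  have h1 : ∀ s : ℝ, 1 < s → aeval (s⁻¹ - s) P = aeval (s⁻¹ - s) Q := by
    intro s hs
    have hs0 : s ≠ 0 := by linarith
    have a1 := h s hs0
    have a2 := h (-s⁻¹) (neg_ne_zero.2 (inv_ne_zero hs0))
    have e : (-s⁻¹)⁻¹ - -s⁻¹ = s⁻¹ - s := by rw [inv_neg, inv_inv]; ring
    rw [e] at a2
    rcases eq_or_ne k 0 with rfl | hk
    · simpa using a1
    have a3 : (s ^ k - (-s⁻¹) ^ k) * aeval (s⁻¹ - s) Q = 0 := by
      rw [sub_mul, ← a1, ← a2, sub_self]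
    rcases mul_eq_zero.1 a3 with h0 | h0
    · exfalso
      have h2 : |s ^ k| = |(-s⁻¹) ^ k| := by rw [sub_eq_zero.1 h0]
      rw [abs_zpow, abs_zpow, abs_neg, abs_inv, abs_of_pos (by linarith), inv_zpow, ← zpow_neg] at h2
      have := zpow_right_injective₀ (by linarith) hs.ne' h2
      omega
    · rw [a1, h0, mul_zero]
  have h2 : P.map (Int.castRingHom ℝ) = Q.map (Int.castRingHom ℝ) := by
    refine Polynomial.eq_of_infinite_eval_eq _ _ (Set.Infinite.mono (s := (fun s : ℝ => s⁻¹ - s) '' Set.Ioi 1) ?_ ?_)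
    · rintro _ ⟨s, hs, rfl⟩
      have := h1 s hs
      simpa [aeval_def, eval_map] using this
    · refine Set.Infinite.image ?_ (Set.Ioi_infinite 1)
      intro s hs t ht hst
      simp only [Set.mem_Ioi] at hs ht hst
      rcases lt_trichotomy s t with hlt | rfl | hlt
      · have := inv_strictAnti₀ (show (0:ℝ) < s by linarith) hlt
        linarith
      · rfl
      · have := inv_strictAnti₀ (show (0:ℝ) < t by linarith) hlt
        linarith
  exact Polynomial.map_injective _ Int.cast_injective h2

namespace Matrix

variable {n : Type} [Fintype n] [DecidableEq n]

theorem det_updateCol_single_self (A : Matrix n n ℝ) (i : n) :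
    (A.updateCol i (Pi.single i 1)).det = A.adjugate i i := by
  rw [← transpose_apply A.adjugate, adjugate_transpose, adjugate_apply, updateRow_transpose,
    det_transpose]

/-- The difference of the two entries is the determinant of a matrix all of whose row sums vanish.
-/
theorem adjugate_eq_of_row_sum {A : Matrix n n ℝ} (h : A *ᵥ (fun _ => 1) = 0) (i i' j : n) :
    A.adjugate i j = A.adjugate i' j := by
  rw [adjugate_apply, adjugate_apply, ← sub_eq_zero]
  have : (A.updateRow j (Pi.single i 1 - Pi.single i' 1)).det = 0 := by
    refine exists_mulVec_eq_zero_iff.1 ⟨fun _ => 1, fun h => one_ne_zero (congrFun h i), ?_⟩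
    funext k
    rcases eq_or_ne k j with rfl | hk
    · simp [mulVec, dotProduct, Finset.sum_sub_distrib]
    · have := congrFun h k
      simpa [mulVec, dotProduct, updateRow_ne hk] using this
  rw [sub_eq_add_neg, ← neg_one_smul ℝ (Pi.single i' 1 : n → ℝ), det_updateRow_add, det_updateRow_smul] at this
  linarith

/-- The difference of the two sides is the determinant of a matrix that `u` annihilates from the
left. -/
theorem mul_adjugate_eq_of_left {A : Matrix n n ℝ} {u : n → ℝ} (h : u ᵥ* A = 0) (hu : ∀ i, u i ≠ 0)
    (i j j' : n) : u j' * A.adjugate i j = u j * A.adjugate i j' := by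
  have e : ∀ j, A.adjugate i j = (A.updateCol i (Pi.single j 1)).det := fun j => by
    rw [← transpose_transpose A.adjugate, transpose_apply, adjugate_transpose, adjugate_apply, updateRow_transpose,
      det_transpose]
  rw [e, e, ← sub_eq_zero]
  have : (A.updateCol i (u j' • Pi.single j 1 + (-u j) • Pi.single j' 1)).det = 0 := by
    refine exists_vecMul_eq_zero_iff.1 ⟨u, fun h => hu i (congrFun h i), ?_⟩
    funext k
    rcases eq_or_ne k i with rfl | hk
    · simp [vecMul, dotProduct, mul_add, Finset.sum_add_distrib, Pi.single_apply]
      ring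
    · have := congrFun h k
      simpa [vecMul, dotProduct, updateCol_ne hk] using this
  rw [det_updateCol_add, det_updateCol_smul, det_updateCol_smul] at this
  linarith

end Matrix

namespace Curve

open CyclePos Classical Matrix

variable {E X : Type} {C : Curve E X} [Fintype E]

-- Cutting at `e` replaces the column `e` of `1 - walk` by a unit vector, which turns the
-- determinant into a principal cofactor.
variable (C) in
theorem cutDet_eq_adjugate (e : E) (B : X → Bool → Bool → ℝ) :
    C.cutDet e B = (1 - C.walk C.inRow B).adjugate e e := by
  rw [← det_updateCol_single_self, cutDet]
  congr 1
  ext f g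
  rw [updateCol_apply, Matrix.sub_apply, walk_cutRow_apply]
  split_ifs with h
  · subst h; rw [sub_zero, Matrix.one_apply, Pi.single_apply]
  · rfl

/-- The constant vector and `u` are annihilated by `1 - walk` from the right and from the left; this
makes its principal cofactors proportional to `u`. -/
theorem cutDet_base {B : X → Bool → Bool → ℝ} {u : E → ℝ} (hu0 : ∀ v, u v ≠ 0)
    (hu : ∀ v, (∀ y, C.en y ≠ v) → u v = u (C.nxt.symm v))
    (hB : ∀ x b, u (C.en (x, true)) * B x true b + u (C.en (x, false)) * B x false b =
      u (C.nxt.symm (C.en (x, b))))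
    (hB1 : ∀ x b, B x b true + B x b false = 1) (e e' : E) :
    u e' * C.cutDet e B = u e * C.cutDet e' B := by
  rw [cutDet_eq_adjugate, cutDet_eq_adjugate]
  have h1 : (1 - C.walk C.inRow B) *ᵥ (fun _ => 1) = 0 := by
    funext f
    have := C.sum_walk hB1 f
    rw [sub_mulVec, one_mulVec]
    simp [mulVec, dotProduct, this]
  have h2 : u ᵥ* (1 - C.walk C.inRow B) = 0 := by
    funext g
    have := C.sum_mul_walk hu hB g
    rw [vecMul_sub, vecMul_one]
    simp [vecMul, dotProduct, this]
  rw [adjugate_eq_of_row_sum h1 e e' e, mul_adjugate_eq_of_left h2 hu0]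

variable [Fintype X]

theorem IsNumbering.normDet_base {h : E → ℤ} (hh : C.IsNumbering h) {s : ℝ} (hs : s ≠ 0)
    (S : Finset X) (o : X → Bool) (e e' : E) :
    C.normDet s e S o = s ^ (2 * (h e' - h e)) * C.normDet s e' S o := by
  have h1 := cutDet_base (C := C) (B := C.behav s S o) (u := fun v => s ^ (-2 * h v))
    (fun v => zpow_ne_zero _ hs) (fun v hv => by simp only [hh.of_ne v hv])
    (fun x b => C.behav_numbering hh hs S o x b) (fun x b => C.behav_sum s S o x b) e e'
  have h2 : C.cutDet e (C.behav s S o) = s ^ (2 * (h e' - h e)) * C.cutDet e' (C.behav s S o) := by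
    have h3 : s ^ (2 * (h e' - h e)) = s ^ (2 * h e') * s ^ (-2 * h e) := by
      rw [← zpow_add₀ hs]; ring_nf
    rw [h3, mul_assoc, ← h1, ← mul_assoc, ← zpow_add₀ hs]
    simp
  rw [normDet, normDet, h2]
  ring

/-- As all states have the same index, one power of `s` comes out of the expansion, and it serves
both values of `δ`. -/
theorem Planar.normDet_eq (hC : C.Planar) (e : E) :
    ∃ w : ℤ, ∀ s : ℝ, s ≠ 0 → ∀ δ, C.normDet s e ∅ (fun _ => true) =
      s ^ w * aeval (s⁻¹ - s) (C.stateSum δ e) := by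
  obtain ⟨h, hh⟩ := hC.exists_isNumbering
  obtain ⟨w, hw⟩ : ∃ w : ℤ, ∀ S, C.OneB S → - C.index e S = w := by
    by_cases hS : ∃ S, C.OneB S
    · obtain ⟨S, hS⟩ := hS
      exact ⟨- C.index e S, fun S' hS' => by rw [hC.index_eq e hS hS']⟩
    · exact ⟨0, fun S h => absurd ⟨S, h⟩ hS⟩
  refine ⟨w, fun s hs δ => ?_⟩
  rw [C.normDet_eq_expansion δ hs hh, expansion, stateSum, map_sum, Finset.mul_sum,
    Finset.sum_filter]
  refine Finset.sum_congr rfl fun T _ => ?_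
  rw [term]
  refine if_ctx_congr ?_ (fun hT => ?_) (fun _ => rfl)
  · cases δ <;> simp [IsState]
  · rw [hw T hT.1, mul_comm, map_prod]
    simp [eps]

theorem stateSum_eq_of_normDet {E' X' : Type} [Fintype E'] [Fintype X'] {C' : Curve E' X'}
    (hC : C.Planar) (hC' : C'.Planar) {e : E} {e' : E'} (k : ℤ)
    (h : ∀ s : ℝ, s ≠ 0 → C.normDet s e ∅ (fun _ => true) =
      s ^ k * C'.normDet s e' ∅ (fun _ => true)) (δ δ' : Bool) :
    C.stateSum δ e = C'.stateSum δ' e' := by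
  obtain ⟨w, hw⟩ := hC.normDet_eq e
  obtain ⟨w', hw'⟩ := hC'.normDet_eq e'
  refine Polynomial.eq_of_aeval_inv_sub (k + w' - w) fun s hs => ?_
  have h1 := h s hs
  rw [hw s hs δ, hw' s hs δ', ← mul_assoc, ← zpow_add₀ hs] at h1
  have h2 : s ^ (k + w') = s ^ w * s ^ (k + w' - w) := by
    rw [← zpow_add₀ hs]; ring_nf
  rw [h2, mul_assoc] at h1
  exact mul_left_cancel₀ (zpow_ne_zero _ hs) h1

/-- The state sum of a planar curve does not depend on the base edge, and it is the same for
ascending and descending states. -/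
theorem Planar.stateSum_eq (hC : C.Planar) (δ δ' : Bool) (e e' : E) :
    C.stateSum δ e = C.stateSum δ' e' := by
  obtain ⟨h, hh⟩ := hC.exists_isNumbering
  exact stateSum_eq_of_normDet hC hC (2 * (h e' - h e))
    (fun s hs => hh.normDet_base hs ∅ _ e e') δ δ'

end Curve

/-! ### Elimination of a triangle from the determinant -/

namespace Matrix

variable {n : Type} [Fintype n] [DecidableEq n]

theorem det_updateRow_single_of_col {A : Matrix n n ℝ} {i : n} (h : ∀ k, A k i = if k = i then 1 else 0) :
    (A.updateRow i (Pi.single i 1)).det = A.det := by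
  rw [← adjugate_apply, ← det_updateCol_single_self]
  congr 1
  ext k l
  rw [updateCol_apply]
  split_ifs with hl
  · subst hl; rw [h, Pi.single_apply]
  · rfl

/-- Eliminate the column `i` and forget the row `i`. -/
def elim (i : n) (A : Matrix n n ℝ) : Matrix n n ℝ :=
  fun k => if k = i then Pi.single i 1 else A k - A k i • A i

theorem det_elim {A : Matrix n n ℝ} {i : n} (h : A i i = 1) : (A.elim i).det = A.det := by
  let A' : Matrix n n ℝ := fun k => if k = i then A i else A k - A k i • A i
  have h1 : A.det = A'.det := by
    refine det_eq_of_forall_row_eq_smul_add_const (fun k => if k = i then 0 else A k i) i (by simp) ?_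
    intro k l
    by_cases hk : k = i
    · subst hk; simp [A']
    · simp [A', hk]
  have h2 : A.elim i = A'.updateRow i (Pi.single i 1) := by
    ext k l
    by_cases hk : k = i
    · subst hk; simp [elim]
    · rw [updateRow_ne hk]; simp [elim, A', hk]
  rw [h1, h2, det_updateRow_single_of_col]
  intro k
  by_cases hk : k = i
  · subst hk; simp [A', h]
  · simp [A', hk, h]

/-- A matrix with prescribed rows for the six edges of a triangle. -/
def triangle (A : Matrix n n ℝ) (p₁ p₂ q₁ q₂ r₁ r₂ : n) (u v w : n → ℝ) : Matrix n n ℝ :=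
  fun k => if k = p₁ then Pi.single p₁ 1 else if k = q₁ then Pi.single q₁ 1 else
    if k = r₁ then Pi.single r₁ 1 else if k = p₂ then u else if k = q₂ then v else
    if k = r₂ then w else A k

/-- `p₁`, `q₁`, `r₁` are the sides of the triangle on the top, middle and bottom strand and `p₂`,
`q₂`, `r₂` are the edges after them; `ξ`, `η`, `ζ` stand for the edges that enter the triangle.
Eliminating the sides in this order leaves the passage from the entering to the leaving edges. -/
theorem det_eq_det_triangle {A : Matrix n n ℝ} {p₁ p₂ q₁ q₂ r₁ r₂ : n}
    (hd : [p₁, p₂, q₁, q₂, r₁, r₂].Nodup) {ξ η ζ : n → ℝ} {c₁ c₂ c₃ d₁ d₂ d₃ e₁ e₂ e₃ e₄ e₅ g₁ g₂ g₃ g₄ g₅ : ℝ}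
    (hξ : ξ p₁ = 0 ∧ ξ q₁ = 0 ∧ ξ r₁ = 0) (hη : η p₁ = 0 ∧ η q₁ = 0 ∧ η r₁ = 0)
    (hζ : ζ p₁ = 0 ∧ ζ q₁ = 0 ∧ ζ r₁ = 0)
    (hp₁ : A p₁ = Pi.single p₁ 1 - ξ) (hp₂ : A p₂ = Pi.single p₂ 1 - Pi.single p₁ 1)
    (hq₁ : A q₁ = Pi.single q₁ 1 - (c₁ • η + c₂ • ξ + c₃ • Pi.single p₁ 1))
    (hq₂ : A q₂ = Pi.single q₂ 1 - (d₁ • Pi.single q₁ 1 + d₂ • ξ + d₃ • Pi.single p₁ 1))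
    (hr₁ : A r₁ = Pi.single r₁ 1 - (e₁ • ζ + e₂ • ξ + e₃ • Pi.single p₁ 1 + e₄ • η +
      e₅ • Pi.single q₁ 1))
    (hr₂ : A r₂ = Pi.single r₂ 1 - (g₁ • Pi.single r₁ 1 + g₂ • ξ + g₃ • Pi.single p₁ 1 + g₄ • η +
      g₅ • Pi.single q₁ 1))
    (hA : ∀ k, k ∉ [p₁, p₂, q₁, q₂, r₁, r₂] → A k p₁ = 0 ∧ A k q₁ = 0 ∧ A k r₁ = 0) :
    A.det = (A.triangle p₁ p₂ q₁ q₂ r₁ r₂ (Pi.single p₂ 1 - ξ)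
      (Pi.single q₂ 1 - ((d₁ * c₁) • η + (d₁ * (c₂ + c₃) + d₂ + d₃) • ξ))
      (Pi.single r₂ 1 - ((g₁ * e₁) • ζ + (g₁ * (e₄ + e₅ * c₁) + g₄ + g₅ * c₁) • η +
        (g₁ * (e₂ + e₃ + e₅ * (c₂ + c₃)) + g₂ + g₃ + g₅ * (c₂ + c₃)) • ξ))).det := by
  simp only [List.nodup_cons, List.mem_cons, List.not_mem_nil, or_false, not_or, not_false_eq_true,
    List.nodup_nil, and_true] at hd
  obtain ⟨⟨n1, n2, n3, n4, n5⟩, ⟨n6, n7, n8, n9⟩, ⟨n10, n11, n12⟩, ⟨n13, n14⟩, n15⟩ := hd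
  obtain ⟨x1, x2, x3⟩ := hξ
  obtain ⟨y1, y2, y3⟩ := hη
  obtain ⟨z1, z2, z3⟩ := hζ
  have m : ∀ {i j : n}, ¬ i = j → (Pi.single i 1 : n → ℝ) j = 0 ∧ (Pi.single j 1 : n → ℝ) i = 0 :=
    fun h => ⟨Pi.single_eq_of_ne (Ne.symm h) _, Pi.single_eq_of_ne h _⟩
  have E1 : ∀ k, A.elim p₁ k = if k = p₁ then Pi.single p₁ 1 else A k - A k p₁ • A p₁ := fun k => rfl
  have E2 : ∀ k, (A.elim p₁).elim q₁ k =
    if k = q₁ then Pi.single q₁ 1 else A.elim p₁ k - A.elim p₁ k q₁ • A.elim p₁ q₁ := fun k => rfl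
  have E3 : ∀ k, ((A.elim p₁).elim q₁).elim r₁ k =
    if k = r₁ then Pi.single r₁ 1 else (A.elim p₁).elim q₁ k -
      (A.elim p₁).elim q₁ k r₁ • (A.elim p₁).elim q₁ r₁ := fun k => rfl
  have a1 : A.elim p₁ q₁ = Pi.single q₁ 1 - (c₁ • η + (c₂ + c₃) • ξ) := by
    rw [E1, if_neg (Ne.symm n2), hq₁, hp₁]
    ext k
    simp [m n2, x1, y1]
    ring
  have a2 : A.elim p₁ r₁ = Pi.single r₁ 1 - (e₁ • ζ + (e₂ + e₃) • ξ + e₄ • η + e₅ • Pi.single q₁ 1) := by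
    rw [E1, if_neg (Ne.symm n4), hr₁, hp₁]
    ext k
    simp [m n2, m n4, x1, y1, z1]
    ring
  have b1 : (A.elim p₁).elim q₁ r₁ = Pi.single r₁ 1 - (e₁ • ζ + (e₂ + e₃ + e₅ * (c₂ + c₃)) • ξ +
      (e₄ + e₅ * c₁) • η) := by
    rw [E2, if_neg (Ne.symm n11), a2, a1]
    ext k
    simp [m n11, x2, y2, z2]
    ring
  rw [← det_elim (i := p₁) (A := A) (by rw [hp₁]; simp [x1]),
    ← det_elim (i := q₁) (by rw [a1]; simp [x2, y2]),
    ← det_elim (i := r₁) (by rw [b1]; simp [x3, y3, z3])]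
  congr 1
  funext k
  rw [triangle]
  by_cases k1 : k = p₁
  · subst k1
    rw [if_pos rfl, E3, if_neg n4, E2, if_neg n2, E1, if_pos rfl]
    ext k
    simp [m n2, m n4]
  rw [if_neg k1]
  by_cases k2 : k = q₁
  · subst k2
    rw [if_pos rfl, E3, if_neg n11, E2, if_pos rfl]
    ext k
    simp [m n11]
  rw [if_neg k2]
  by_cases k3 : k = r₁
  · rw [if_pos k3, E3, if_pos k3]
  rw [if_neg k3, E3, if_neg k3, b1, E2, if_neg k2, a1, E1, if_neg k1, hp₁]
  by_cases k4 : k = p₂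
  · subst k4
    rw [if_pos rfl, hp₂]
    ext k
    simp [x2, x3, m n1, m n2, m n6, m n8]
  rw [if_neg k4]
  by_cases k5 : k = q₂
  · subst k5
    rw [if_pos rfl, hq₂]
    ext k
    simp [x1, x2, x3, y3, m n2, m n3, m n4, m n10, m n13, m n11]
    ring
  rw [if_neg k5]
  by_cases k6 : k = r₂
  · subst k6
    rw [if_pos rfl, hr₂]
    ext k
    simp [x1, x2, x3, y1, y2, y3, m n2, m n4, m n5, m n11, m n12, m n15]
    ring
  rw [if_neg k6]
  obtain ⟨h1, h2, h3⟩ := hA k (by simp [k1, k2, k3, k4, k5, k6])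
  simp [h1, h2, h3]

end Matrix

namespace Curve

open CyclePos Classical Matrix

variable {E X : Type} (C : Curve E X) [Fintype E]

/-- The crossings `a`, `b` and `c` are the vertices of a triangle: on the top, middle and bottom
strand there are `a` and `b`, `a` and `c`, `b` and `c`, in this or the opposite order. -/
structure IsTriangle (a b c : X) (δ₁ δ₂ δ₃ : Bool) : Prop where
  ab : a ≠ b
  bc : b ≠ c
  ac : a ≠ c
  top : C.nxt (C.en (if δ₁ then (a, true) else (b, true))) =
    C.en (if δ₁ then (b, true) else (a, true))
  middle : C.nxt (C.en (if δ₂ then (a, false) else (c, true))) =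
    C.en (if δ₂ then (c, true) else (a, false))
  bottom : C.nxt (C.en (if δ₃ then (b, false) else (c, false))) =
    C.en (if δ₃ then (c, false) else (b, false))

omit [Fintype E] in
theorem cutRow_of_ne {e u v : E} (h : C.nxt v ≠ u) : C.cutRow e u v = 0 := by
  unfold cutRow inRow
  split_ifs
  · rfl
  · exact Pi.single_eq_of_ne (fun h' => h (by rw [h', apply_symm_apply])) _

omit [Fintype E] in
theorem cutRow_nxt {e u : E} (h : u ≠ e) : C.cutRow e (C.nxt u) = Pi.single u 1 := by
  unfold cutRow inRow
  rw [symm_apply_apply, if_neg h]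

omit [Fintype E] in
theorem behav_apply (s : ℝ) (x : X) (b b' : Bool) : C.behav s ∅ (fun _ => true) x b b' =
    if b then (if b' then 1 else 0)
    else if b' then 1 - s ^ (2 * (C.sgn x : ℤ)) else s ^ (2 * (C.sgn x : ℤ)) := by
  cases b <;> cases b' <;> simp [behav, eps]

omit [Fintype E] in
theorem en_mem_triangle (a b c : X) (δ₁ δ₂ δ₃ : Bool) {x : X} (hx : x = a ∨ x = b ∨ x = c)
    (b' : Bool) : C.en (x, b') ∈ [C.en (if δ₁ then (a, true) else (b, true)),
      C.en (if δ₁ then (b, true) else (a, true)), C.en (if δ₂ then (a, false) else (c, true)),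
      C.en (if δ₂ then (c, true) else (a, false)), C.en (if δ₃ then (b, false) else (c, false)),
      C.en (if δ₃ then (c, false) else (b, false))] := by
  rcases hx with rfl | rfl | rfl <;> cases b' <;> cases δ₁ <;> cases δ₂ <;> cases δ₃ <;> simp

variable {C}

/-- The sides of the triangle are eliminated. In the remaining coefficients the order `δ₁` on the
top strand has dropped out, and the orders on the other two strands occur in a form that can be
compared across the move. -/
theorem IsTriangle.cutDet_eq {a b c : X} {δ₁ δ₂ δ₃ : Bool} (hC : C.IsTriangle a b c δ₁ δ₂ δ₃)
    {e : E} (he₁ : C.en (if δ₁ then (a, true) else (b, true)) ≠ e)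
    (he₂ : C.en (if δ₂ then (a, false) else (c, true)) ≠ e)
    (he₃ : C.en (if δ₃ then (b, false) else (c, false)) ≠ e) (s : ℝ) {α β γ : ℝ}
    (hα : α = s ^ (2 * (C.sgn a : ℤ))) (hβ : β = s ^ (2 * (C.sgn b : ℤ)))
    (hγ : γ = s ^ (2 * (C.sgn c : ℤ))) {p₁ p₂ q₁ q₂ r₁ r₂ : E}
    (hp₁ : p₁ = C.en (if δ₁ then (a, true) else (b, true)))
    (hp₂ : p₂ = C.en (if δ₁ then (b, true) else (a, true)))
    (hq₁ : q₁ = C.en (if δ₂ then (a, false) else (c, true)))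
    (hq₂ : q₂ = C.en (if δ₂ then (c, true) else (a, false)))
    (hr₁ : r₁ = C.en (if δ₃ then (b, false) else (c, false)))
    (hr₂ : r₂ = C.en (if δ₃ then (c, false) else (b, false))) :
    C.cutDet e (C.behav s ∅ fun _ => true) =
      ((1 - C.walk (C.cutRow e) (C.behav s ∅ fun _ => true)).triangle p₁ p₂ q₁ q₂ r₁ r₂
        (Pi.single p₂ 1 - C.cutRow e p₁)
        (Pi.single q₂ 1 - (α • C.cutRow e q₁ + (1 - α) • C.cutRow e p₁))
        (Pi.single r₂ 1 - ((β * γ) • C.cutRow e r₁ +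
          (if δ₃ then (1 - γ) * (if δ₂ then α else 1) else β * (1 - γ) * (if δ₂ then α else 1)) •
            C.cutRow e q₁ +
          (if δ₃ then γ * (1 - β) + (1 - γ) * (if δ₂ then 1 - α else 0) else
            β * (1 - γ) * (if δ₂ then 1 - α else 0) + (1 - β)) • C.cutRow e p₁))).det := by
  obtain ⟨hab, hbc, hac, top, middle, bottom⟩ := hC
  have hd : [p₁, p₂, q₁, q₂, r₁, r₂].Nodup := by
    subst hp₁ hp₂ hq₁ hq₂ hr₁ hr₂
    cases δ₁ <;> cases δ₂ <;> cases δ₃ <;> simp [hab, hbc, hac, Ne.symm hab, Ne.symm hbc, Ne.symm hac]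
  rw [← hp₁, ← hp₂] at top
  rw [← hq₁, ← hq₂] at middle
  rw [← hr₁, ← hr₂] at bottom
  rw [← hp₁] at he₁
  rw [← hq₁] at he₂
  rw [← hr₁] at he₃
  have t1 : C.cutRow e p₂ = Pi.single p₁ 1 := by rw [← top, C.cutRow_nxt he₁]
  have t2 : C.cutRow e q₂ = Pi.single q₁ 1 := by rw [← middle, C.cutRow_nxt he₂]
  have t3 : C.cutRow e r₂ = Pi.single r₁ 1 := by rw [← bottom, C.cutRow_nxt he₃]
  have row : ∀ x b', (1 - C.walk (C.cutRow e) (C.behav s ∅ fun _ => true) : Matrix E E ℝ) (C.en (x, b')) =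
      Pi.single (C.en (x, b')) 1 - ((if b' then 1 else 1 - s ^ (2 * (C.sgn x : ℤ))) •
        C.cutRow e (C.en (x, true)) + (if b' then 0 else s ^ (2 * (C.sgn x : ℤ))) •
          C.cutRow e (C.en (x, false))) := by
    intro x b'
    ext l
    rw [Matrix.sub_apply, walk_en, Matrix.one_apply, behav_apply, behav_apply]
    cases b' <;> simp [Pi.single_apply, eq_comm]
  have van : ∀ {u}, u ∉ [p₂, q₂, r₂] → C.cutRow e u p₁ = 0 ∧ C.cutRow e u q₁ = 0 ∧
      C.cutRow e u r₁ = 0 := by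
    intro u hu
    simp only [List.mem_cons, List.not_mem_nil, or_false, not_or] at hu
    exact ⟨C.cutRow_of_ne fun h => hu.1 (by rw [← h, top]),
      C.cutRow_of_ne fun h => hu.2.1 (by rw [← h, middle]),
      C.cutRow_of_ne fun h => hu.2.2 (by rw [← h, bottom])⟩
  -- For each order of the crossings on a strand, the coefficients say whether the walk jumps to an
  -- entering edge or to a side of the triangle, and with which weight.
  have key := det_eq_det_triangle (A := 1 - C.walk (C.cutRow e) (C.behav s ∅ fun _ => true))
    hd (ξ := C.cutRow e p₁) (η := C.cutRow e q₁) (ζ := C.cutRow e r₁)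
    (c₁ := if δ₂ then α else 1) (c₂ := if δ₂ then (if δ₁ then 1 - α else 0) else 0)
    (c₃ := if δ₂ then (if δ₁ then 0 else 1 - α) else 0)
    (d₁ := if δ₂ then 1 else α) (d₂ := if δ₂ then 0 else (if δ₁ then 1 - α else 0))
    (d₃ := if δ₂ then 0 else (if δ₁ then 0 else 1 - α))
    (e₁ := if δ₃ then β else γ) (e₂ := if δ₃ then (if δ₁ then 0 else 1 - β) else 0)
    (e₃ := if δ₃ then (if δ₁ then 1 - β else 0) else 0)
    (e₄ := if δ₃ then 0 else (if δ₂ then 0 else 1 - γ))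
    (e₅ := if δ₃ then 0 else (if δ₂ then 1 - γ else 0))
    (g₁ := if δ₃ then γ else β) (g₂ := if δ₃ then 0 else (if δ₁ then 0 else 1 - β))
    (g₃ := if δ₃ then 0 else (if δ₁ then 1 - β else 0))
    (g₄ := if δ₃ then (if δ₂ then 0 else 1 - γ) else 0)
    (g₅ := if δ₃ then (if δ₂ then 1 - γ else 0) else 0)
    ?_ ?_ ?_ ?_ ?_ ?_ ?_ ?_ ?_ ?_
  · rw [cutDet, key]
    congr 2
    · cases δ₁ <;> cases δ₂ <;> simp
    · cases δ₁ <;> cases δ₂ <;> cases δ₃ <;> simp <;> module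
  · apply van
    simp only [List.nodup_cons, List.mem_cons, not_or] at hd ⊢
    tauto
  · apply van
    simp only [List.nodup_cons, List.mem_cons, not_or] at hd ⊢
    tauto
  · apply van
    simp only [List.nodup_cons, List.mem_cons, not_or] at hd ⊢
    tauto
  · clear van hd
    cases δ₁ <;> simp at hp₁ <;> rw [hp₁, row] <;> simp
  · clear van hd
    cases δ₁ <;> simp at hp₁ hp₂ <;> rw [hp₂, row, ← hp₂] <;> simp [t1]
  · cases δ₁ <;> cases δ₂ <;> simp at hp₁ hp₂ hq₁ hq₂ <;>
      rw [hq₁, row, ← hq₁] <;> simp [← hp₁, ← hp₂, t1, ← hα] <;> try module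
  · cases δ₁ <;> cases δ₂ <;> simp at hp₁ hp₂ hq₁ hq₂ <;>
      rw [hq₂, row, ← hq₂] <;> simp [← hp₁, ← hp₂, t1, t2, ← hα] <;> try module
  · cases δ₁ <;> cases δ₂ <;> cases δ₃ <;> simp at hp₁ hp₂ hq₁ hq₂ hr₁ hr₂ <;>
      rw [hr₁, row, ← hr₁] <;> simp [← hq₁, ← hq₂, ← hp₁, ← hp₂, t1, t2, ← hβ, ← hγ] <;> try module
  · cases δ₁ <;> cases δ₂ <;> cases δ₃ <;> simp at hp₁ hp₂ hq₁ hq₂ hr₁ hr₂ <;>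
      rw [hr₂, row, ← hr₂] <;> simp [← hq₁, ← hq₂, ← hp₁, ← hp₂, t1, t2, t3, ← hβ, ← hγ] <;> try module
  · intro k hk
    have hmem : ∀ x b', x = a ∨ x = b ∨ x = c → C.en (x, b') ∈ [p₁, p₂, q₁, q₂, r₁, r₂] := by
      intro x b' hx
      rw [hp₁, hp₂, hq₁, hq₂, hr₁, hr₂]
      exact C.en_mem_triangle a b c δ₁ δ₂ δ₃ hx b'
    have hin : ∀ v ∈ [p₁, q₁, r₁], v ∈ [p₁, p₂, q₁, q₂, r₁, r₂] := by
      intro v hv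
      simp only [List.mem_cons, List.not_mem_nil, or_false] at hv
      rcases hv with h | h | h <;> simp [h]
    have hsub : ∀ {u}, u ∉ [p₁, p₂, q₁, q₂, r₁, r₂] → u ∉ [p₂, q₂, r₂] := by
      intro u hu
      simp only [List.mem_cons, not_or] at hu ⊢
      tauto
    have hone : ∀ v ∈ [p₁, q₁, r₁], (Pi.single k 1 : E → ℝ) v = 0 := by
      intro v hv
      exact Pi.single_eq_of_ne (fun h : v = k => hk (h ▸ hin v hv)) _
    by_cases hx : ∃ y, C.en y = k
    · obtain ⟨⟨x, b'⟩, rfl⟩ := hx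
      have hxn : ∀ b'', C.en (x, b'') ∉ [p₁, p₂, q₁, q₂, r₁, r₂] := by
        intro b'' hb
        refine hk (hmem x b' ?_)
        subst hp₁ hp₂ hq₁ hq₂ hr₁ hr₂
        cases δ₁ <;> cases δ₂ <;> cases δ₃ <;> simp at hb <;> tauto
      obtain ⟨u1, u2, u3⟩ := van (hsub (hxn true))
      obtain ⟨v1, v2, v3⟩ := van (hsub (hxn false))
      rw [row]
      cases b' <;> simp [u1, u2, u3, v1, v2, v3, hone]
    · push Not at hx
      obtain ⟨u1, u2, u3⟩ := van (hsub hk)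
      have h1 : ∀ v ∈ [p₁, q₁, r₁], (1 : Matrix E E ℝ) k v = 0 := by
        intro v hv
        exact Matrix.one_apply_ne fun h => hk (h ▸ hin v hv)
      simp only [Matrix.sub_apply, C.walk_of_forall_ne _ _ hx, u1, u2, u3, sub_zero]
      exact ⟨h1 _ (by simp), h1 _ (by simp), h1 _ (by simp)⟩

/-- The determinant does not change when a strand moves across a crossing. -/
theorem IsTriangle.cutDet_eq_cutDet {C' : Curve E X} (hnxt : C'.nxt = C.nxt)
    (hsgn : C'.sgn = C.sgn) {a b c : X} {δ₁ δ₂ δ₃ : Bool} (hC : C.IsTriangle a b c δ₁ δ₂ δ₃)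
    (hC' : ∀ y, C'.en y = C.en (swap (a, true) (b, true) (swap (a, false) (c, true)
      (swap (b, false) (c, false) y)))) (hδ : C.sgn a = C.sgn b ↔ δ₂ = δ₃)
    {e : E} (he₁ : C.en (if δ₁ then (a, true) else (b, true)) ≠ e)
    (he₂ : C.en (if δ₂ then (a, false) else (c, true)) ≠ e)
    (he₃ : C.en (if δ₃ then (b, false) else (c, false)) ≠ e) {s : ℝ} (hs : s ≠ 0) :
    C'.cutDet e (C'.behav s ∅ fun _ => true) = C.cutDet e (C.behav s ∅ fun _ => true) := by
  have hab := hC.ab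
  have hbc := hC.bc
  have hac := hC.ac
  have E1 : C'.en (a, true) = C.en (b, true) := by
    rw [hC']; simp [swap_apply_def, hab, hac]
  have E2 : C'.en (b, true) = C.en (a, true) := by
    rw [hC']; simp [swap_apply_def, hbc, hab.symm]
  have E3 : C'.en (a, false) = C.en (c, true) := by
    rw [hC']; simp [swap_apply_def, hab, hac, hac.symm, hbc.symm]
  have E4 : C'.en (c, true) = C.en (a, false) := by
    rw [hC']; simp [swap_apply_def, hab, hbc.symm]
  have E5 : C'.en (b, false) = C.en (c, false) := by
    rw [hC']; simp [swap_apply_def, hac.symm, hbc.symm]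
  have E6 : C'.en (c, false) = C.en (b, false) := by
    rw [hC']; simp [swap_apply_def, hbc, hab.symm]
  have E7 : ∀ x, x ≠ a → x ≠ b → x ≠ c → ∀ b', C'.en (x, b') = C.en (x, b') := by
    intro x h1 h2 h3 b'
    rw [hC']; simp [swap_apply_def, h1, h2, h3]
  have P1 : C'.en (if !δ₁ then (a, true) else (b, true)) = C.en (if δ₁ then (a, true) else (b, true)) := by
    cases δ₁ <;> simp [E1, E2]
  have P2 : C'.en (if !δ₁ then (b, true) else (a, true)) = C.en (if δ₁ then (b, true) else (a, true)) := by
    cases δ₁ <;> simp [E1, E2]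
  have Q1 : C'.en (if !δ₂ then (a, false) else (c, true)) = C.en (if δ₂ then (a, false) else (c, true)) := by
    cases δ₂ <;> simp [E3, E4]
  have Q2 : C'.en (if !δ₂ then (c, true) else (a, false)) = C.en (if δ₂ then (c, true) else (a, false)) := by
    cases δ₂ <;> simp [E3, E4]
  have R1 : C'.en (if !δ₃ then (b, false) else (c, false)) = C.en (if δ₃ then (b, false) else (c, false)) := by
    cases δ₃ <;> simp [E5, E6]
  have R2 : C'.en (if !δ₃ then (c, false) else (b, false)) = C.en (if δ₃ then (c, false) else (b, false)) := by
    cases δ₃ <;> simp [E5, E6]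
  -- The edges stay in place while the two crossings on each strand are exchanged, which reverses
  -- all three orders.
  have hT : C'.IsTriangle a b c (!δ₁) (!δ₂) (!δ₃) := by
    refine ⟨hab, hbc, hac, ?_, ?_, ?_⟩
    · rw [P1, P2, hnxt, hC.top]
    · rw [Q1, Q2, hnxt, hC.middle]
    · rw [R1, R2, hnxt, hC.bottom]
  have hrow : C'.cutRow e = C.cutRow e := by
    funext u
    simp only [cutRow, inRow, hnxt]
  have hbeh : (C'.behav s ∅ fun _ => true) = C.behav s ∅ fun _ => true := by
    funext x b' b''
    rw [behav_apply, behav_apply, hsgn]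
  rw [hC.cutDet_eq he₁ he₂ he₃ s rfl rfl rfl rfl rfl rfl rfl rfl rfl,
    hT.cutDet_eq (by rw [P1]; exact he₁) (by rw [Q1]; exact he₂) (by rw [R1]; exact he₃) s rfl rfl rfl
      P1.symm P2.symm Q1.symm Q2.symm R1.symm R2.symm, hrow, hsgn]
  congr 1
  funext k
  unfold triangle
  -- The only input from the geometry of the triangle: the orders on the middle and bottom strands
  -- agree exactly when the weights at `a` and `b` are equal by equality of signs; otherwise the
  -- weights are inverse.
  have hab' : s ^ (2 * (C.sgn a : ℤ)) * s ^ (2 * (C.sgn b : ℤ)) = 1 ∧ δ₂ ≠ δ₃ ∨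
      s ^ (2 * (C.sgn a : ℤ)) = s ^ (2 * (C.sgn b : ℤ)) ∧ δ₂ = δ₃ := by
    by_cases h : δ₂ = δ₃
    · exact Or.inr ⟨by rw [hδ.2 h], h⟩
    · refine Or.inl ⟨?_, h⟩
      have h1 : C.sgn a ≠ C.sgn b := fun h' => h (hδ.1 h')
      rw [← zpow_add₀ hs]
      rcases Int.units_eq_one_or (C.sgn a) with ha | ha <;>
        rcases Int.units_eq_one_or (C.sgn b) with hb | hb <;> simp [ha, hb] at h1 ⊢
  refine if_ctx_congr Iff.rfl (fun _ => rfl) fun k4 => (if_ctx_congr Iff.rfl (fun _ => rfl)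
    fun k5 => (if_ctx_congr Iff.rfl (fun _ => rfl) fun k6 => (if_ctx_congr Iff.rfl (fun _ => rfl)
    fun k1 => (if_ctx_congr Iff.rfl (fun _ => rfl) fun k2 => (if_ctx_congr Iff.rfl (fun _ => ?_)
    fun k3 => ?_)))))
  · generalize s ^ (2 * (C.sgn a : ℤ)) = α at *
    generalize s ^ (2 * (C.sgn b : ℤ)) = β at *
    generalize s ^ (2 * (C.sgn c : ℤ)) = γ at *
    congr 2
    · congr 2
      rcases hab' with ⟨h1, h2⟩ | ⟨h1, h2⟩ <;> cases δ₂ <;> cases δ₃ <;> simp at h2 ⊢ <;>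
        first | (subst h1; ring) | linear_combination (1 - γ) * h1 | linear_combination (γ - 1) * h1
    · congr 1
      rcases hab' with ⟨h1, h2⟩ | ⟨h1, h2⟩ <;> cases δ₂ <;> cases δ₃ <;> simp at h2 ⊢ <;>
        first | (subst h1; ring) | linear_combination (1 - γ) * h1 | linear_combination (γ - 1) * h1
  · rw [hbeh]
    have : C.walk (C.cutRow e) (C.behav s ∅ fun _ => true) k =
        C'.walk (C.cutRow e) (C.behav s ∅ fun _ => true) k := by
      by_cases hk : ∃ y, C.en y = k
      · obtain ⟨⟨x, b'⟩, rfl⟩ := hk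
        have hx : ¬ (x = a ∨ x = b ∨ x = c) := fun hx => by
          have := C.en_mem_triangle a b c δ₁ δ₂ δ₃ hx b'
          simp only [List.mem_cons, List.not_mem_nil, or_false, k1, k2, k3, k4, k5, k6] at this
        push Not at hx
        have h := E7 x hx.1 hx.2.1 hx.2.2
        conv_rhs => rw [← h b']
        rw [walk_en, walk_en, h, h]
      · push Not at hk
        rw [C.walk_of_forall_ne _ _ hk, C'.walk_of_forall_ne]
        exact fun y => by rw [hC']; exact hk _
    funext l
    rw [Matrix.sub_apply, Matrix.sub_apply, this]

end Curve

/-! ### First return maps: points that can be forgotten -/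

namespace CyclePos

variable {E R : Type} {f : Perm E} {j : R ↪ E} {ν : Perm R} {e : E} {r r₀ : R}

/-- The first point in the range of `j` that one meets after `e` along `f` is `j r`. -/
def FirstHit (f : Perm E) (j : R ↪ E) (e : E) (r : R) : Prop :=
  ∃ k > 0, (f ^ k) e = j r ∧ ∀ l, 0 < l → l < k → (f ^ l) e ∉ Set.range j

/-- `ν` is the first return map of `f` to the range of `j`. -/
def Thin (f : Perm E) (j : R ↪ E) (ν : Perm R) : Prop := ∀ r, FirstHit f j (j r) (ν r)

theorem FirstHit.unique {r' : R} (h : FirstHit f j e r) (h' : FirstHit f j e r') : r = r' := by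
  obtain ⟨k, hk, e1, e2⟩ := h
  obtain ⟨k', hk', e1', e2'⟩ := h'
  rcases lt_trichotomy k k' with hlt | rfl | hlt
  · exact absurd ⟨r, e1.symm⟩ (e2' k hk hlt)
  · exact j.injective (e1.symm.trans e1')
  · exact absurd ⟨r', e1'.symm⟩ (e2 k' hk' hlt)

theorem FirstHit.sameCycle (h : FirstHit f j e r) : f.SameCycle e (j r) := by
  obtain ⟨k, -, h, -⟩ := h
  exact sameCycle_of_pow h

theorem FirstHit.exists {k : ℕ} (hk : 0 < k) (h : (f ^ k) e = j r) : ∃ r', FirstHit f j e r' := by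
  classical
  have hex : ∃ k, 0 < k ∧ (f ^ k) e ∈ Set.range j := ⟨k, hk, r, h.symm⟩
  obtain ⟨h1, r', h2⟩ := Nat.find_spec hex
  exact ⟨r', _, h1, h2.symm, fun l hl hlt h3 => Nat.find_min hex hlt ⟨hl, h3⟩⟩

theorem FirstHit.of_sameCycle [Finite E] (h : f.SameCycle e (j r)) : ∃ r', FirstHit f j e r' :=
  FirstHit.exists (pos_spec h).1 (pos_spec h).2

/-- Finite permutations have first return maps. -/
theorem exists_thin [Finite E] (f : Perm E) (j : R ↪ E) : ∃ ν, Thin f j ν := by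
  have := Finite.of_injective j j.injective
  choose ν hν using fun r => FirstHit.of_sameCycle (Perm.SameCycle.refl f (j r))
  have hinj : Function.Injective ν := by
    have key : ∀ r r' k k', (f ^ k) (j r) = j (ν r) → (f ^ k') (j r') = j (ν r') → 0 < k → k ≤ k' →
        (∀ l, 0 < l → l < k' → (f ^ l) (j r') ∉ Set.range j) → ν r = ν r' → r = r' := by
      intro r r' k k' h1 h1' hk hle h2 hh
      have h3 : (f ^ k) (j r) = (f ^ k) ((f ^ (k' - k)) (j r')) := by
        rw [h1, hh, ← h1', ← Perm.mul_apply, ← pow_add, Nat.add_sub_cancel' hle]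
      have h4 := (f ^ k).injective h3
      rcases Nat.eq_zero_or_pos (k' - k) with h0 | h0
      · rw [h0] at h4
        exact j.injective (by simpa using h4)
      · exact absurd ⟨r, h4⟩ (h2 _ h0 (by omega))
    intro r r' hh
    obtain ⟨k, hk, h1, h2⟩ := hν r
    obtain ⟨k', hk', h1', h2'⟩ := hν r'
    rcases le_total k k' with hle | hle
    · exact key r r' k k' h1 h1' hk hle h2' hh
    · exact (key r' r k' k h1' h1 hk' hle h2 hh.symm).symm
  exact ⟨Equiv.ofBijective ν (Finite.injective_iff_bijective.1 hinj), hν⟩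

/-- `T n` is the time of the `n`-th visit to the range of `j`: the delay `k₀` before the first
visit, followed by the return times along the orbit of `r₀` under `ν`. -/
theorem Thin.exists_hitTimes (h : Thin f j ν) (h₀ : FirstHit f j e (ν r₀)) :
    ∃ T : ℕ → ℕ, StrictMono T ∧ (∀ n > 0, 0 < T n ∧ (f ^ T n) e = j ((ν ^ n) r₀)) ∧
      ∀ l > 0, (f ^ l) e ∈ Set.range j → ∃ n > 0, l = T n := by
  choose K hK using h
  obtain ⟨k₀, hk₀, a₀, b₀⟩ := h₀
  let g : ℕ → ℕ := fun n => if n = 0 then k₀ else K ((ν ^ n) r₀)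
  let T : ℕ → ℕ := fun n => ∑ i ∈ Finset.range n, g i
  have hg : ∀ n, 0 < g n := fun n => by
    simp only [g]; split_ifs
    · exact hk₀
    · exact (hK _).1
  have hs : ∀ n, T (n + 1) = T n + g n := fun n => Finset.sum_range_succ _ _
  have hT : StrictMono T := strictMono_nat_of_lt_succ fun n => by
    have := hg n
    rw [hs]; omega
  have h1 : ∀ n > 0, (f ^ T n) e = j ((ν ^ n) r₀) := by
    intro n hn
    induction n with
    | zero => omega
    | succ n ih =>
      rcases Nat.eq_zero_or_pos n with rfl | h0
      · simpa [T, g] using a₀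
      · rw [hs, add_comm, pow_add, Perm.mul_apply, ih h0, pow_succ', Perm.mul_apply]
        simp only [g, if_neg h0.ne']
        exact (hK _).2.1
  have h2 : ∀ n, ∀ l, 0 < l → l < g n → (f ^ (T n + l)) e ∉ Set.range j := by
    intro n l hl hlt
    rcases Nat.eq_zero_or_pos n with rfl | h0
    · have : T 0 = 0 := rfl
      rw [this, zero_add]
      exact b₀ l hl (by simpa [g] using hlt)
    · rw [add_comm, pow_add, Perm.mul_apply, h1 n h0]
      refine (hK _).2.2 l hl ?_
      simpa [g, h0.ne'] using hlt
  refine ⟨T, hT, fun n hn => ⟨(Nat.zero_le _).trans_lt (hT hn), h1 n hn⟩, fun l hl hr => ?_⟩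
  have hex : ∃ m, l ≤ T m := ⟨l, hT.le_apply⟩
  obtain ⟨m, hm, hmin⟩ : ∃ m, l ≤ T m ∧ ∀ m' < m, ¬ l ≤ T m' := by
    classical exact ⟨Nat.find hex, Nat.find_spec hex, fun m' => Nat.find_min hex⟩
  cases m with
  | zero =>
    have : T 0 = 0 := rfl
    omega
  | succ m =>
    refine ⟨m + 1, m.succ_pos, le_antisymm hm ?_⟩
    by_contra hc
    have h3 := hmin m (Nat.lt_succ_self m)
    have h4 := hs m
    refine h2 m (l - T m) (by omega) (by omega) ?_
    rwa [Nat.add_sub_cancel' (by omega)]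

theorem Thin.sameCycle_iff [Finite E] (h : Thin f j ν) (h₀ : FirstHit f j e (ν r₀)) :
    f.SameCycle e (j r) ↔ ν.SameCycle r₀ r := by
  have := Finite.of_injective j j.injective
  obtain ⟨T, -, h1, h2⟩ := h.exists_hitTimes h₀
  constructor
  · intro hs
    obtain ⟨n, hn, hl⟩ := h2 _ (pos_spec hs).1 ⟨r, (pos_spec hs).2.symm⟩
    have h3 := (h1 n hn).2
    rw [← hl, (pos_spec hs).2] at h3
    exact sameCycle_of_pow (j.injective h3).symm
  · intro hs
    have h3 := (h1 _ (pos_spec hs).1).2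
    rw [(pos_spec hs).2] at h3
    exact sameCycle_of_pow h3

/-- Visiting times increase strictly, so the first return map sees the order of the visits. -/
theorem Thin.pos_lt_pos_iff [Finite E] (h : Thin f j ν) (h₀ : FirstHit f j e (ν r₀)) {r' : R}
    (hr : ν.SameCycle r₀ r) (hr' : ν.SameCycle r₀ r') :
    pos f e (j r) < pos f e (j r') ↔ pos ν r₀ r < pos ν r₀ r' := by
  have := Finite.of_injective j j.injective
  obtain ⟨T, hT, h1, h2⟩ := h.exists_hitTimes h₀
  have key : ∀ {r}, ν.SameCycle r₀ r → pos f e (j r) = T (pos ν r₀ r) := by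
    intro r hr
    have hp := pos_spec hr
    have h3 := h1 _ hp.1
    rw [hp.2] at h3
    refine le_antisymm (pos_le h3.1 h3.2) ?_
    have hs := pos_spec (sameCycle_of_pow h3.2)
    obtain ⟨n, hn, hl⟩ := h2 _ hs.1 ⟨r, hs.2.symm⟩
    rw [hl]
    refine hT.monotone (pos_le hn (j.injective ?_))
    rw [← (h1 n hn).2, ← hl, hs.2]
  rw [key hr, key hr', hT.lt_iff_lt]

end CyclePos

namespace Curve

open CyclePos Classical

variable {E X R Y V : Type} {C : Curve E X} {D : Curve R Y} {j : R ↪ E} {τ : Y ↪ X}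

theorem jumpAt_map (hen : ∀ y b, C.en (τ y, b) = j (D.en (y, b))) (T : Finset Y) (r : R) :
    C.jumpAt (T.map τ) (j r) = j (D.jumpAt T r) := by
  by_cases h : ∃ y ∈ T, ∃ b, r = D.en (y, b)
  · obtain ⟨y, hy, b, rfl⟩ := h
    rw [← hen, C.jumpAt_mem (Finset.mem_map_of_mem τ hy), D.jumpAt_mem hy, hen]
  · push Not at h
    rw [D.jumpAt_of_forall_ne h, C.jumpAt_of_forall_ne]
    intro x hx b
    obtain ⟨y, hy, rfl⟩ := Finset.mem_map.1 hx
    rw [hen]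
    exact fun hr => h y hy b (j.injective hr)

/-- Smoothing acts only at remembered points: the path to the first of them is unchanged, and a
jump, if any, occurs on arrival. -/
theorem FirstHit.bd (hen : ∀ y b, C.en (τ y, b) = j (D.en (y, b))) (T : Finset Y) {u : E} {r : R}
    (h : FirstHit C.nxt j u r) : FirstHit (C.bd (T.map τ)) j u (D.jumpAt T r) := by
  obtain ⟨k, hk, h1, h2⟩ := h
  have hs : ∀ l, C.nxt ((C.nxt ^ l) u) = (C.nxt ^ (l + 1)) u := fun l => by
    rw [pow_succ', Perm.mul_apply]
  have h3 : ∀ l < k, (C.bd (T.map τ) ^ l) u = (C.nxt ^ l) u := by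
    intro l
    induction l with
    | zero => simp
    | succ l ih =>
      intro hl
      rw [pow_succ', Perm.mul_apply, ih (by omega), bd_apply, hs, C.jumpAt_of_forall_ne]
      intro x hx b hb
      obtain ⟨y, hy, rfl⟩ := Finset.mem_map.1 hx
      rw [hen] at hb
      exact h2 _ l.succ_pos hl ⟨_, hb.symm⟩
  refine ⟨k, hk, ?_, fun l hl hlk => ?_⟩
  · obtain ⟨k, rfl⟩ : ∃ k', k = k' + 1 := ⟨k - 1, by omega⟩
    rw [pow_succ', Perm.mul_apply, h3 k (by omega), bd_apply, hs, h1, jumpAt_map hen]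
  · rw [h3 l hlk]
    exact h2 l hl hlk

theorem Thin.bd (hen : ∀ y b, C.en (τ y, b) = j (D.en (y, b))) (h : Thin C.nxt j D.nxt)
    (T : Finset Y) : Thin (C.bd (T.map τ)) j (D.bd T) := fun r => FirstHit.bd hen T (h r)

/-- The state `S` of the sublink of the circles in `I`. -/
def IsStateOn (C : Curve E X) (κ : E → V) (δ : Bool) (I : Set V) (e : E) (S : Finset X) : Prop :=
  (∀ a ∈ S, ∀ b, κ (C.en (a, b)) ∈ I) ∧ (∀ u, (C.bd S).SameCycle e u ↔ κ u ∈ I) ∧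
    ∀ a ∈ S, C.fst S e a = δ

theorem mem_bd_iff {κ : E → V} (hκ : ∀ u, κ (C.nxt u) = κ u) {I : Set V} {S : Finset X}
    (hS : ∀ a ∈ S, κ (C.en (a, true)) ∈ I ↔ κ (C.en (a, false)) ∈ I) (u : E) :
    κ (C.bd S u) ∈ I ↔ κ u ∈ I := by
  rw [bd_apply]
  by_cases h : ∃ x ∈ S, ∃ b, C.nxt u = C.en (x, b)
  · obtain ⟨x, hx, b, hb⟩ := h
    rw [hb, C.jumpAt_mem hx, ← hκ u, hb]
    cases b
    · exact hS x hx
    · exact (hS x hx).symm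
  · push Not at h
    rw [C.jumpAt_of_forall_ne h, hκ]

theorem mem_iff_of_sameCycle {κ : E → V} {f : Perm E} {I : Set V}
    (h : ∀ u, κ (f u) ∈ I ↔ κ u ∈ I) {u v : E} (huv : f.SameCycle u v) : κ u ∈ I ↔ κ v ∈ I := by
  obtain ⟨k, rfl⟩ := huv
  have hn : ∀ n : ℕ, ∀ u, κ ((f ^ n) u) ∈ I ↔ κ u ∈ I := by
    intro n
    induction n with
    | zero => simp
    | succ n ih => intro u; rw [pow_succ', Perm.mul_apply, h, ih]
  rcases k with n | n
  · simpa using (hn n u).symm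
  · have := hn (n + 1) ((f ^ Int.negSucc n) u)
    rw [← Perm.mul_apply, ← zpow_natCast, ← zpow_add] at this
    simpa [Int.negSucc_eq] using this

/-- Points that are not endpoints of arrows of a state can be forgotten. -/
theorem isStateOn_iff_of_thin [Finite E] {κ : E → V} (hκ : ∀ u, κ (C.nxt u) = κ u)
    (hen : ∀ y b, C.en (τ y, b) = j (D.en (y, b))) (h : Thin C.nxt j D.nxt) {I : Set V}
    (hI : ∀ u, κ u ∈ I → ∃ r, FirstHit C.nxt j u r) {e : E} {r₀ : R}
    (h₀ : FirstHit C.nxt j e (D.nxt r₀)) (δ : Bool) (T : Finset Y) :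
    C.IsStateOn κ δ I e (T.map τ) ↔ D.IsStateOn (κ ∘ j) δ I r₀ T := by
  have := Finite.of_injective j j.injective
  have hb := Thin.bd hen h T
  have hb₀ : FirstHit (C.bd (T.map τ)) j e (D.bd T r₀) := FirstHit.bd hen T h₀
  have hκ' : ∀ {u v}, C.nxt.SameCycle u v → κ u = κ v := fun {u v} huv => by
    have := mem_iff_of_sameCycle (κ := κ) (I := {κ u}) (fun w => by rw [hκ]) huv
    exact (this.1 rfl).symm
  have hact : (∀ a ∈ T.map τ, ∀ b, κ (C.en (a, b)) ∈ I) ↔ ∀ y ∈ T, ∀ b, (κ ∘ j) (D.en (y, b)) ∈ I := by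
    simp only [Finset.mem_map, forall_exists_index, and_imp, forall_apply_eq_imp_iff₂, hen,
      Function.comp]
  unfold IsStateOn
  rw [hact]
  refine and_congr_right fun hD₁ => ?_
  have hC₁ := hact.2 hD₁
  have hbd := mem_bd_iff (C := C) hκ (S := T.map τ) fun a ha => by
    rw [iff_true_intro (hC₁ a ha true), iff_true_intro (hC₁ a ha false)]
  have horb : (∀ u, (C.bd (T.map τ)).SameCycle e u ↔ κ u ∈ I) ↔
      ∀ r, (D.bd T).SameCycle r₀ r ↔ (κ ∘ j) r ∈ I := by
    refine ⟨fun hC r => ?_, fun hD u => ⟨fun hu => ?_, fun hu => ?_⟩⟩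
    · rw [← hb.sameCycle_iff hb₀, hC]; rfl
    · have h1 : κ (j r₀) ∈ I := (hD r₀).1 (Perm.SameCycle.refl _ _)
      rw [hκ' (h r₀).sameCycle, ← hκ' h₀.sameCycle] at h1
      exact (mem_iff_of_sameCycle hbd hu).1 h1
    -- Every edge in `I` is followed by a remembered point, so no circle of the sublink is lost.
    · obtain ⟨r, hr⟩ := hI u hu
      have h1 := FirstHit.bd hen T hr
      have h2 : κ (j r) ∈ I := by rwa [← hκ' hr.sameCycle]
      have h3 : κ (j (D.jumpAt T r)) ∈ I := by
        have := (hbd (C.nxt.symm (j r))).2 (by rwa [← hκ, apply_symm_apply])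
        rwa [bd_apply, apply_symm_apply, jumpAt_map hen] at this
      exact ((hb.sameCycle_iff hb₀).2 ((hD _).2 h3)).trans h1.sameCycle.symm
  rw [horb]
  refine and_congr_right fun hD₂ => ?_
  have hC₂ := horb.2 hD₂
  simp only [Finset.mem_map, forall_exists_index, and_imp, forall_apply_eq_imp_iff₂]
  refine forall₂_congr fun y hy => ?_
  have hs : ∀ b, (D.bd T).SameCycle r₀ (D.en (y, b)) := fun b => (hD₂ _).2 (hD₁ y hy b)
  unfold fst
  rw [hen, hen, decide_eq_decide.2 (hb.pos_lt_pos_iff hb₀ (hs true) (hs false))]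

end Curve

/-! ### Sublinks: planarity and linking numbers -/

namespace Curve

open CyclePos Classical

variable {E X V : Type} {C : Curve E X} {κ : E → V}

/-- The curve that consists of the circles in `I`. -/
def restrict (C : Curve E X) (hκ : ∀ u, κ (C.nxt u) = κ u) (I : Set V) :
    Curve {u // κ u ∈ I} {x // ∀ b, κ (C.en (x, b)) ∈ I} where
  nxt := C.nxt.subtypePerm fun u => by rw [hκ]
  en := ⟨fun y => ⟨C.en (y.1.1, y.2), y.1.2 y.2⟩, fun y y' h => by
    have := C.en.injective (Subtype.ext_iff.1 h)
    simp only [Prod.mk.injEq] at this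
    exact Prod.ext (Subtype.ext this.1) this.2⟩
  sgn x := C.sgn x.1

variable {hκ : ∀ u, κ (C.nxt u) = κ u} {I : Set V}

theorem apply_nxt_symm (hκ : ∀ u, κ (C.nxt u) = κ u) (u : E) : κ (C.nxt.symm u) = κ u := by
  rw [← hκ, apply_symm_apply]

theorem restrict_symm (u : {u // κ u ∈ I}) :
    ((C.restrict hκ I).nxt.symm u).1 = C.nxt.symm u.1 := by
  rw [Equiv.eq_symm_apply]
  exact congrArg Subtype.val ((C.restrict hκ I).nxt.apply_symm_apply u)

variable [Fintype E]

/-- The cycle is extended by zero. The numbers of faces then do not change across forgotten circles,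
so they satisfy the conditions of the sublink. -/
theorem Planar.restrict (hC : C.Planar) (hκ : ∀ u, κ (C.nxt u) = κ u) (I : Set V) :
    (C.restrict hκ I).Planar := by
  intro β hβ
  let β' : E → ℚ := fun u => if h : κ u ∈ I then β ⟨u, h⟩ else 0
  have hβ' : C.IsCycle β' := by
    intro ψ hψ
    rw [← hβ (fun u => ψ u.1) fun x => hψ x.1,
      ← Finset.sum_filter_add_sum_filter_not Finset.univ (fun u => κ u ∈ I),
      Finset.sum_subtype (p := fun u => κ u ∈ I) _ (by simp), add_eq_left.2]
    · refine Finset.sum_congr rfl fun u _ => ?_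
      simp only [β', dif_pos u.2]
      rfl
    · refine Finset.sum_eq_zero fun u hu => ?_
      simp only [Finset.mem_filter] at hu
      simp only [β', dif_neg hu.2, zero_mul]
  obtain ⟨L, hL⟩ := hC β' hβ'
  have h0 : ∀ u, κ u ∉ I → β' u = 0 := fun u hu => dif_neg hu
  have h1 : ∀ u : {u // κ u ∈ I}, β u = β' u.1 := fun u => by
    simp only [β', dif_pos u.2]
  refine ⟨fun u => L u.1, ?_, ?_, ?_, ?_, ?_⟩
  · rintro ⟨u, hu⟩ h
    rw [restrict_symm]
    by_cases hex : ∃ y, C.en y = u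
    · obtain ⟨⟨x, b⟩, rfl⟩ := hex
      have hb : κ (C.en (x, !b)) ∉ I := fun hb => by
        refine h (⟨x, fun b' => ?_⟩, b) rfl
        rcases Bool.eq_or_eq_not b' b with rfl | rfl
        · exact hu
        · exact hb
      have a1 := hL.west x
      have a2 := hL.south x
      have a3 := hL.north x
      rcases eq_or_ne b (decide (C.sgn x = 1)) with hbs | hbs
      · have e1 : C.en (x, b) = C.lr x := by rw [hbs]; rfl
        have e2 : C.en (x, !b) = C.rl x := by rw [hbs]; rfl
        rw [e2] at hb
        simp only [e1]
        rw [a1, a3, h0 _ hb, sub_zero]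
      · have hbs' : b = !decide (C.sgn x = 1) := by
          rcases Bool.eq_or_eq_not b (decide (C.sgn x = 1)) with h | h
          · exact absurd h hbs
          · exact h
        have e1 : C.en (x, b) = C.rl x := by rw [hbs']; rfl
        have e2 : C.en (x, !b) = C.lr x := by rw [hbs', Bool.not_not]; rfl
        rw [e2] at hb
        simp only [e1]
        rw [← a1, ← a2, h0 _ (by rwa [apply_nxt_symm hκ]), sub_zero]
    · push Not at hex
      exact hL.of_ne u hex
  · intro x
    rw [restrict_symm]
    exact hL.west x.1
  · intro x
    rw [h1, restrict_symm, restrict_symm]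
    exact hL.south x.1
  · intro x
    rw [h1]
    exact hL.north x.1
  · intro x
    rw [h1, h1, restrict_symm]
    exact hL.east x.1

theorem isCycle_indicator (hκ : ∀ u, κ (C.nxt u) = κ u) (K : Set V) :
    C.IsCycle fun u => if κ u ∈ K then 1 else 0 := by
  intro ψ _
  simp only [mul_sub, Finset.sum_sub_distrib]
  rw [sub_eq_zero, ← Equiv.sum_comp C.nxt fun u => (if κ u ∈ K then (1 : ℚ) else 0) * ψ u]
  simp only [hκ]

variable [Fintype X]

/-- The sum of the signs of the crossings where a circle in `K` passes over a circle in `J`. -/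
def lkSum (C : Curve E X) (κ : E → V) (K J : Set V) : ℤ :=
  ∑ a with κ (C.en (a, true)) ∈ K ∧ κ (C.en (a, false)) ∈ J, (C.sgn a : ℤ)

/-- Crossings of `K` over `J` and of `J` over `K`, counted with signs, enter the intersection number
of the two cycles with opposite signs, and this number is zero. -/
theorem Planar.lkSum_comm (hC : C.Planar) (hκ : ∀ u, κ (C.nxt u) = κ u) (K J : Set V) :
    C.lkSum κ K J = C.lkSum κ J K := by
  have h := hC.inter_eq_zero (isCycle_indicator hκ K) (isCycle_indicator hκ J)
  rw [inter_apply] at h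
  have h1 : ∀ x, C.interAt x (fun u => if κ u ∈ K then 1 else 0) (fun u => if κ u ∈ J then 1 else 0) =
      4 * ((if κ (C.en (x, true)) ∈ K ∧ κ (C.en (x, false)) ∈ J then ((C.sgn x : ℤ) : ℚ) else 0) -
        (if κ (C.en (x, true)) ∈ J ∧ κ (C.en (x, false)) ∈ K then ((C.sgn x : ℤ) : ℚ) else 0)) := by
    intro x
    simp only [interAt, apply_nxt_symm hκ]
    rcases Int.units_eq_one_or (C.sgn x) with hs | hs
    · have e1 : C.lr x = C.en (x, true) := by simp [lr, hs]
      have e2 : C.rl x = C.en (x, false) := by simp [rl, hs]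
      rw [e1, e2, hs]
      by_cases a1 : κ (C.en (x, true)) ∈ K <;> by_cases a2 : κ (C.en (x, false)) ∈ K <;>
        by_cases a3 : κ (C.en (x, true)) ∈ J <;> by_cases a4 : κ (C.en (x, false)) ∈ J <;>
        simp only [a1, a2, a3, a4] <;> norm_num
    · have e1 : C.lr x = C.en (x, false) := by simp [lr, hs]
      have e2 : C.rl x = C.en (x, true) := by simp [rl, hs]
      rw [e1, e2, hs]
      by_cases a1 : κ (C.en (x, true)) ∈ K <;> by_cases a2 : κ (C.en (x, false)) ∈ K <;>
        by_cases a3 : κ (C.en (x, true)) ∈ J <;> by_cases a4 : κ (C.en (x, false)) ∈ J <;>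
        simp only [a1, a2, a3, a4] <;> norm_num
  simp only [h1, ← Finset.mul_sum, Finset.sum_sub_distrib, mul_eq_zero, OfNat.ofNat_ne_zero, false_or] at h
  unfold lkSum
  rw [Finset.sum_filter, Finset.sum_filter]
  have h2 := sub_eq_zero.1 h
  exact_mod_cast h2

/-- The state sum of the sublink of the circles in `I`. -/
def stateSumOn (C : Curve E X) (κ : E → V) (δ : Bool) (I : Set V) (e : E) : ℤ[X] :=
  ∑ S : Finset X with C.IsStateOn κ δ I e S, ∏ a ∈ S, ((C.sgn a : ℤ) : ℤ[X]) * Polynomial.X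

omit [Fintype E] [Fintype X] in
theorem isStateOn_univ {δ : Bool} {e : E} {S : Finset X} (h : ∀ u, κ u ∈ I) :
    C.IsStateOn κ δ I e S ↔ C.IsState δ e S := by
  unfold IsStateOn IsState OneB
  simp only [h, implies_true, true_and, iff_true]
  exact and_congr_left fun _ => ⟨fun hs u v => (hs u).symm.trans (hs v), fun hs => hs e⟩

omit [Fintype E] in
theorem stateSumOn_univ (δ : Bool) (e : E) (h : ∀ u, κ u ∈ I) :
    C.stateSumOn κ δ I e = C.stateSum δ e := by
  unfold stateSumOn stateSum
  simp only [isStateOn_univ h]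

theorem stateSumOn_eq_restrict (hκ : ∀ u, κ (C.nxt u) = κ u) (δ : Bool) (I : Set V) {e : E}
    (he : κ e ∈ I) : C.stateSumOn κ δ I e = (C.restrict hκ I).stateSum δ ⟨e, he⟩ := by
  let j : {u // κ u ∈ I} ↪ E := Function.Embedding.subtype _
  let τ : {x // ∀ b, κ (C.en (x, b)) ∈ I} ↪ X := Function.Embedding.subtype _
  have hthin : Thin C.nxt j (C.restrict hκ I).nxt := fun r =>
    ⟨1, one_pos, rfl, fun l _ _ => by omega⟩
  have key : ∀ T : Finset {x // ∀ b, κ (C.en (x, b)) ∈ I},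
      C.IsStateOn κ δ I e (T.map τ) ↔ (C.restrict hκ I).IsState δ ⟨e, he⟩ T := by
    intro T
    have h1 := isStateOn_iff_of_thin (τ := τ) hκ (fun y b => rfl) hthin (I := I)
      (fun u hu => ⟨_, hthin ⟨u, hu⟩⟩) (e := e) (r₀ := ⟨e, he⟩) (hthin ⟨e, he⟩) δ T
    exact h1.trans (isStateOn_univ fun u => u.2)
  rw [stateSum, stateSumOn]
  symm
  refine Finset.sum_bij (fun T _ => T.map τ) ?_ ?_ ?_ ?_
  · intro T hT
    simp only [Finset.mem_filter, Finset.mem_univ, true_and] at hT ⊢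
    exact (key T).2 hT
  · exact fun T _ T' _ h => Finset.map_injective τ h
  · intro S hS
    simp only [Finset.mem_filter, Finset.mem_univ, true_and] at hS
    have h1 : (S.subtype fun x => ∀ b, κ (C.en (x, b)) ∈ I).map τ = S :=
      Finset.subtype_map_of_mem hS.1
    refine ⟨S.subtype _, ?_, h1⟩
    simp only [Finset.mem_filter, Finset.mem_univ, true_and]
    rw [← key, h1]
    exact hS
  · intro T _
    rw [Finset.prod_map]
    rfl

theorem Planar.stateSumOn_eq (hC : C.Planar) (hκ : ∀ u, κ (C.nxt u) = κ u) (δ δ' : Bool)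
    {I : Set V} {e e' : E} (he : κ e ∈ I) (he' : κ e' ∈ I) :
    C.stateSumOn κ δ I e = C.stateSumOn κ δ' I e' := by
  rw [stateSumOn_eq_restrict hκ δ I he, stateSumOn_eq_restrict hκ δ' I he']
  exact (hC.restrict hκ I).stateSum_eq δ δ' _ _

end Curve

/-! ### Gluing states of two sublinks along an arrow -/

namespace Curve

open CyclePos Classical

variable {E X V : Type} {C : Curve E X} {κ : E → V}

/-- The arrow `a` connects sublinks `I₁` and `I₂` with states `S₁` and `S₂`. -/
structure IsGlue (C : Curve E X) (κ : E → V) (I₁ I₂ : Set V) (S₁ S₂ : Finset X) (a : X) (p : Bool) :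
    Prop where
  disj : ∀ v ∈ I₁, v ∉ I₂
  left : ∀ b ∈ S₁, ∀ q, κ (C.en (b, q)) ∈ I₁
  right : ∀ b ∈ S₂, ∀ q, κ (C.en (b, q)) ∈ I₂
  mem_left : κ (C.en (a, !p)) ∈ I₁
  mem_right : κ (C.en (a, p)) ∈ I₂

namespace IsGlue

variable {I₁ I₂ : Set V} {S₁ S₂ : Finset X} {a : X} {p : Bool}

theorem symm (g : C.IsGlue κ I₁ I₂ S₁ S₂ a p) : C.IsGlue κ I₂ I₁ S₂ S₁ a !p where
  disj v h h' := g.disj v h' h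
  left := g.right
  right := g.left
  mem_left := by rw [Bool.not_not]; exact g.mem_right
  mem_right := g.mem_left

theorem notMem_right (g : C.IsGlue κ I₁ I₂ S₁ S₂ a p) : a ∉ S₂ := fun h =>
  g.disj _ g.mem_left (g.right a h _)

theorem notMem_left (g : C.IsGlue κ I₁ I₂ S₁ S₂ a p) : a ∉ S₁ := g.symm.notMem_right

variable (hκ : ∀ u, κ (C.nxt u) = κ u)
include hκ

theorem bd_mem_right (g : C.IsGlue κ I₁ I₂ S₁ S₂ a p) (u : E) : κ (C.bd S₂ u) ∈ I₂ ↔ κ u ∈ I₂ :=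
  mem_bd_iff hκ (fun b hb => by
    rw [iff_true_intro (g.right b hb true), iff_true_intro (g.right b hb false)]) u

theorem bd_mem_left (g : C.IsGlue κ I₁ I₂ S₁ S₂ a p) (u : E) : κ (C.bd S₁ u) ∈ I₁ ↔ κ u ∈ I₁ :=
  g.symm.bd_mem_right hκ u

theorem bd_eq (g : C.IsGlue κ I₁ I₂ S₁ S₂ a p) {u : E} (hu : κ u ∈ I₂)
    (h : C.bd S₂ u ≠ C.en (a, p)) : C.bd (insert a (S₁ ∪ S₂)) u = C.bd S₂ u := by
  refine C.bd_congr fun x b hx => ?_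
  have hb : κ (C.en (x, b)) ∈ I₂ := by rwa [← hx, hκ]
  have h1 : x ∉ S₁ := fun h1 => g.disj _ (g.left x h1 b) hb
  have h2 : x ≠ a := by
    rintro rfl
    rcases Bool.eq_or_eq_not b p with rfl | rfl
    · exact h (by rw [bd_apply, hx, C.jumpAt_notMem g.notMem_right])
    · exact g.disj _ g.mem_left hb
  simp [h1, h2]

omit hκ in
theorem bd_eq_swap (g : C.IsGlue κ I₁ I₂ S₁ S₂ a p) {u : E} (h : C.bd S₂ u = C.en (a, p)) :
    C.bd (insert a (S₁ ∪ S₂)) u = C.en (a, !p) := by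
  have h1 : C.nxt u = C.en (a, p) := by
    rw [← C.jumpAt_notMem g.notMem_right p, ← h, bd_apply, jumpAt_jumpAt]
  rw [bd_apply, h1, C.jumpAt_mem (Finset.mem_insert_self _ _)]

theorem pow_mem (g : C.IsGlue κ I₁ I₂ S₁ S₂ a p) {u : E} (hu : κ u ∈ I₂) (l : ℕ) :
    κ ((C.bd S₂ ^ l) u) ∈ I₂ :=
  (mem_iff_of_sameCycle (g.bd_mem_right hκ) ⟨l, rfl⟩).1 hu

/-- The glued tour follows that of `S₂` until the latter arrives at the end of `a` in the right
sublink; there it changes to the left one. -/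
theorem path [Finite E] (g : C.IsGlue κ I₁ I₂ S₁ S₂ a p) {u : E} (hu : κ u ∈ I₂)
    (h : (C.bd S₂).SameCycle u (C.en (a, p))) :
    (∀ l < pos (C.bd S₂) u (C.en (a, p)),
      (C.bd (insert a (S₁ ∪ S₂)) ^ l) u = (C.bd S₂ ^ l) u) ∧
    (C.bd (insert a (S₁ ∪ S₂)) ^ pos (C.bd S₂) u (C.en (a, p))) u = C.en (a, !p) := by
  have h1 : ∀ l < pos (C.bd S₂) u (C.en (a, p)),
      (C.bd (insert a (S₁ ∪ S₂)) ^ l) u = (C.bd S₂ ^ l) u := by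
    intro l
    induction l with
    | zero => simp
    | succ l ih =>
      intro hl
      have h2 := pow_ne_of_lt_pos l.succ_pos hl
      rw [pow_succ', Perm.mul_apply] at h2
      rw [pow_succ', pow_succ', Perm.mul_apply, Perm.mul_apply, ih (by omega),
        g.bd_eq hκ (g.pow_mem hκ hu l) h2]
  refine ⟨h1, ?_⟩
  obtain ⟨k, hk⟩ : ∃ k, pos (C.bd S₂) u (C.en (a, p)) = k + 1 :=
    ⟨_, (Nat.succ_pred_eq_of_pos (pos_spec h).1).symm⟩
  have h2 := (pos_spec h).2
  rw [hk] at h1 h2 ⊢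
  rw [pow_succ', Perm.mul_apply] at h2 ⊢
  rw [h1 k (by omega), g.bd_eq_swap h2]

/-- The first return map to the sublink on the left. -/
theorem thin [Finite E] (g : C.IsGlue κ I₁ I₂ S₁ S₂ a p) :
    Thin (C.bd (insert a (S₁ ∪ S₂))) (Function.Embedding.subtype fun u => κ u ∈ I₁)
      ((C.bd S₁).subtypePerm (g.bd_mem_left hκ)) := by
  rintro ⟨u, hu⟩
  by_cases h : C.bd S₁ u = C.en (a, !p)
  · have h1 : C.bd (insert a (S₁ ∪ S₂)) u = C.en (a, p) := by
      have := g.symm.bd_eq_swap h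
      rwa [Bool.not_not, Finset.union_comm] at this
    have hs := Perm.SameCycle.refl (C.bd S₂) (C.en (a, p))
    obtain ⟨h2, h3⟩ := g.path hκ g.mem_right hs
    refine ⟨pos (C.bd S₂) (C.en (a, p)) (C.en (a, p)) + 1, Nat.succ_pos _, ?_, ?_⟩
    · change (C.bd (insert a (S₁ ∪ S₂)) ^ _) u = C.bd S₁ u
      rw [pow_succ, Perm.mul_apply, h1, h3, h]
    · intro l hl hlt
      obtain ⟨l, rfl⟩ : ∃ l', l = l' + 1 := ⟨l - 1, by omega⟩
      change (C.bd (insert a (S₁ ∪ S₂)) ^ _) u ∉ _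
      rw [pow_succ, Perm.mul_apply, h1, h2 l (by omega)]
      rintro ⟨⟨v, hv⟩, rfl⟩
      exact g.disj _ hv (g.pow_mem hκ g.mem_right l)
  · refine ⟨1, one_pos, ?_, fun l _ _ => by omega⟩
    have := g.symm.bd_eq hκ hu h
    rw [Finset.union_comm] at this
    rw [pow_one]
    exact this

omit hκ in
theorem _root_.CyclePos.thin_subtypePerm {f : Perm E} {P : E → Prop} (h : ∀ u, P (f u) ↔ P u) :
    Thin f (Function.Embedding.subtype P) (f.subtypePerm h) := fun _ =>
  ⟨1, one_pos, rfl, fun l _ _ => by omega⟩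

theorem sameCycle_iff [Finite E] (g : C.IsGlue κ I₁ I₂ S₁ S₂ a p) {e u : E} (he : κ e ∈ I₁)
    (hu : κ u ∈ I₁) :
    (C.bd (insert a (S₁ ∪ S₂))).SameCycle e u ↔ (C.bd S₁).SameCycle e u := by
  have h1 := (g.thin hκ).sameCycle_iff (r₀ := ⟨e, he⟩) (r := ⟨u, hu⟩) (g.thin hκ ⟨e, he⟩)
  have h2 := thin_subtypePerm (P := fun u => κ u ∈ I₁) (g.bd_mem_left hκ)
  exact h1.trans (h2.sameCycle_iff (h2 ⟨e, he⟩)).symm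

theorem firstHit [Finite E] (g : C.IsGlue κ I₁ I₂ S₁ S₂ a p) {e : E} (he : κ e ∈ I₁)
    (h : (C.bd S₁).SameCycle e (C.en (a, !p))) :
    FirstHit (C.bd (insert a (S₁ ∪ S₂))) (Function.Embedding.subtype fun u => κ u ∈ I₂) e
      ⟨C.en (a, p), g.mem_right⟩ := by
  obtain ⟨h2, h3⟩ := g.symm.path hκ he h
  rw [Finset.union_comm] at h2 h3
  rw [Bool.not_not] at h3
  refine ⟨_, (pos_spec h).1, h3, fun l hl hlt => ?_⟩
  rw [h2 l hlt]
  rintro ⟨⟨v, hv⟩, rfl⟩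
  exact g.disj _ (g.symm.pow_mem hκ he l) hv

omit hκ in
theorem bd_symm_en (g : C.IsGlue κ I₁ I₂ S₁ S₂ a p) :
    C.bd S₂ (C.nxt.symm (C.en (a, p))) = C.en (a, p) := by
  rw [bd_apply, apply_symm_apply, C.jumpAt_notMem g.notMem_right]

/-- Seen from the right sublink, the tour begins with the jump across `a`, so it is the tour of `S₂`
from the edge that ends at `C.en (a, p)`. -/
theorem sameCycle_right_iff [Finite E] (g : C.IsGlue κ I₁ I₂ S₁ S₂ a p) {e u : E} (he : κ e ∈ I₁)
    (h : (C.bd S₁).SameCycle e (C.en (a, !p))) (hu : κ u ∈ I₂) :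
    (C.bd (insert a (S₁ ∪ S₂))).SameCycle e u ↔
      (C.bd S₂).SameCycle (C.nxt.symm (C.en (a, p))) u := by
  have he₂ : κ (C.nxt.symm (C.en (a, p))) ∈ I₂ := by
    rw [apply_nxt_symm hκ]; exact g.mem_right
  have hthin := g.symm.thin hκ
  rw [Finset.union_comm] at hthin
  have e1 : ((C.bd S₂).subtypePerm (p := fun u => κ u ∈ I₂) (g.bd_mem_right hκ)) ⟨_, he₂⟩ =
      ⟨C.en (a, p), g.mem_right⟩ :=
    Subtype.ext (g.bd_symm_en)
  have h0 := g.firstHit hκ he h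
  rw [← e1] at h0
  have h2 := thin_subtypePerm (P := fun u => κ u ∈ I₂) (g.bd_mem_right hκ)
  exact (hthin.sameCycle_iff (r := ⟨u, hu⟩) h0).trans (h2.sameCycle_iff (h2 ⟨_, he₂⟩)).symm

theorem pos_left [Finite E] (g : C.IsGlue κ I₁ I₂ S₁ S₂ a p) {e u v : E} (he : κ e ∈ I₁)
    (hu : (C.bd S₁).SameCycle e u) (hv : (C.bd S₁).SameCycle e v) :
    pos (C.bd (insert a (S₁ ∪ S₂))) e u < pos (C.bd (insert a (S₁ ∪ S₂))) e v ↔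
      pos (C.bd S₁) e u < pos (C.bd S₁) e v := by
  have h2 := thin_subtypePerm (P := fun u => κ u ∈ I₁) (g.bd_mem_left hκ)
  have hu' := (mem_iff_of_sameCycle (g.bd_mem_left hκ) hu).1 he
  have hv' := (mem_iff_of_sameCycle (g.bd_mem_left hκ) hv).1 he
  have hu2 := (h2.sameCycle_iff (r := (⟨u, hu'⟩ : {u // κ u ∈ I₁})) (h2 ⟨e, he⟩)).1 hu
  have hv2 := (h2.sameCycle_iff (r := (⟨v, hv'⟩ : {u // κ u ∈ I₁})) (h2 ⟨e, he⟩)).1 hv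
  exact ((g.thin hκ).pos_lt_pos_iff (g.thin hκ ⟨e, he⟩) hu2 hv2).trans
    (h2.pos_lt_pos_iff (h2 ⟨e, he⟩) hu2 hv2).symm

theorem pos_right [Finite E] (g : C.IsGlue κ I₁ I₂ S₁ S₂ a p) {e u v : E} (he : κ e ∈ I₁)
    (h : (C.bd S₁).SameCycle e (C.en (a, !p)))
    (hu : (C.bd S₂).SameCycle (C.nxt.symm (C.en (a, p))) u)
    (hv : (C.bd S₂).SameCycle (C.nxt.symm (C.en (a, p))) v) :
    pos (C.bd (insert a (S₁ ∪ S₂))) e u < pos (C.bd (insert a (S₁ ∪ S₂))) e v ↔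
      pos (C.bd S₂) (C.nxt.symm (C.en (a, p))) u < pos (C.bd S₂) (C.nxt.symm (C.en (a, p))) v := by
  have he₂ : κ (C.nxt.symm (C.en (a, p))) ∈ I₂ := by
    rw [apply_nxt_symm hκ]; exact g.mem_right
  have hthin := g.symm.thin hκ
  rw [Finset.union_comm] at hthin
  have e1 : ((C.bd S₂).subtypePerm (p := fun u => κ u ∈ I₂) (g.bd_mem_right hκ)) ⟨_, he₂⟩ =
      ⟨C.en (a, p), g.mem_right⟩ :=
    Subtype.ext (g.bd_symm_en)
  have h0 := g.firstHit hκ he h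
  rw [← e1] at h0
  have h2 := thin_subtypePerm (P := fun u => κ u ∈ I₂) (g.bd_mem_right hκ)
  have hu' := (mem_iff_of_sameCycle (g.bd_mem_right hκ) hu).1 he₂
  have hv' := (mem_iff_of_sameCycle (g.bd_mem_right hκ) hv).1 he₂
  have hu2 := (h2.sameCycle_iff (r := (⟨u, hu'⟩ : {u // κ u ∈ I₂})) (h2 ⟨_, he₂⟩)).1 hu
  have hv2 := (h2.sameCycle_iff (r := (⟨v, hv'⟩ : {u // κ u ∈ I₂})) (h2 ⟨_, he₂⟩)).1 hv
  exact (hthin.pos_lt_pos_iff h0 hu2 hv2).trans (h2.pos_lt_pos_iff (h2 ⟨_, he₂⟩) hu2 hv2).symm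

/-- The glued tour starts on the left. When it would arrive at `C.en (a, !p)`, it jumps to `C.en (a,
p)`, which is therefore met first. -/
theorem fst_eq [Finite E] (g : C.IsGlue κ I₁ I₂ S₁ S₂ a p) {e : E} (he : κ e ∈ I₁)
    (h : (C.bd S₁).SameCycle e (C.en (a, !p))) : C.fst (insert a (S₁ ∪ S₂)) e a = p := by
  refine _root_.Curve.fst_eq (C := C) ?_
  obtain ⟨h2, h3⟩ := g.symm.path hκ he h
  rw [Finset.union_comm] at h2 h3
  rw [Bool.not_not] at h3
  have hr : (C.bd (insert a (S₁ ∪ S₂))).SameCycle e (C.en (a, !p)) :=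
    (g.sameCycle_iff hκ he g.mem_left).2 h
  refine pos_lt_of_fwd (pos_spec h).1 h3 hr fun l hl hle => ?_
  rcases hle.lt_or_eq with hlt | rfl
  · rw [h2 l hlt]
    exact pow_ne_of_lt_pos hl hlt
  · rw [h3]
    simp

/-- Gluing of states. -/
theorem isStateOn_iff [Finite E] {δ : Bool} (g : C.IsGlue κ I₁ I₂ S₁ S₂ a δ) {e : E}
    (he : κ e ∈ I₁) : C.IsStateOn κ δ (I₁ ∪ I₂) e (insert a (S₁ ∪ S₂)) ↔
      C.IsStateOn κ δ I₁ e S₁ ∧ C.IsStateOn κ δ I₂ (C.nxt.symm (C.en (a, δ))) S₂ := by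
  have he₂ : κ (C.nxt.symm (C.en (a, δ))) ∈ I₂ := by
    rw [apply_nxt_symm hκ]; exact g.mem_right
  have a1 : ∀ {u}, (C.bd S₁).SameCycle e u → κ u ∈ I₁ := fun hu =>
    (mem_iff_of_sameCycle (g.bd_mem_left hκ) hu).1 he
  have a2 : ∀ {u}, (C.bd S₂).SameCycle (C.nxt.symm (C.en (a, δ))) u → κ u ∈ I₂ := fun hu =>
    (mem_iff_of_sameCycle (g.bd_mem_right hκ) hu).1 he₂
  constructor
  · rintro ⟨-, h2, h3⟩
    have b1 : ∀ u, (C.bd S₁).SameCycle e u ↔ κ u ∈ I₁ := fun u =>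
      ⟨a1, fun hu => (g.sameCycle_iff hκ he hu).1 ((h2 u).2 (Or.inl hu))⟩
    have ha := (b1 _).2 g.mem_left
    have b2 : ∀ u, (C.bd S₂).SameCycle (C.nxt.symm (C.en (a, δ))) u ↔ κ u ∈ I₂ := fun u =>
      ⟨a2, fun hu => (g.sameCycle_right_iff hκ he ha hu).1 ((h2 u).2 (Or.inr hu))⟩
    refine ⟨⟨g.left, b1, fun b hb => ?_⟩, g.right, b2, fun b hb => ?_⟩
    · refine Eq.trans ?_ (h3 b (by simp [hb]))
      rw [fst, fst, decide_eq_decide]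
      exact (g.pos_left hκ he ((b1 _).2 (g.left b hb _)) ((b1 _).2 (g.left b hb _))).symm
    · refine Eq.trans ?_ (h3 b (by simp [hb]))
      rw [fst, fst, decide_eq_decide]
      exact (g.pos_right hκ he ha ((b2 _).2 (g.right b hb _)) ((b2 _).2 (g.right b hb _))).symm
  · rintro ⟨⟨-, b1, c1⟩, -, b2, c2⟩
    have ha := (b1 _).2 g.mem_left
    refine ⟨fun b hb q => ?_, fun u => ⟨fun hu => ?_, ?_⟩, fun b hb => ?_⟩
    · simp only [Finset.mem_insert, Finset.mem_union] at hb
      rcases hb with rfl | hb | hb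
      · rcases Bool.eq_or_eq_not q δ with rfl | rfl
        · exact Or.inr g.mem_right
        · exact Or.inl g.mem_left
      · exact Or.inl (g.left b hb q)
      · exact Or.inr (g.right b hb q)
    · refine (mem_iff_of_sameCycle (mem_bd_iff hκ fun b hb => ?_) hu).1 (Or.inl he)
      have : ∀ q, κ (C.en (b, q)) ∈ I₁ ∪ I₂ := fun q => by
        simp only [Finset.mem_insert, Finset.mem_union] at hb
        rcases hb with rfl | hb | hb
        · rcases Bool.eq_or_eq_not q δ with rfl | rfl
          · exact Or.inr g.mem_right
          · exact Or.inl g.mem_left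
        · exact Or.inl (g.left b hb q)
        · exact Or.inr (g.right b hb q)
      rw [iff_true_intro (this true), iff_true_intro (this false)]
    · rintro (hu | hu)
      · exact (g.sameCycle_iff hκ he hu).2 ((b1 u).2 hu)
      · exact (g.sameCycle_right_iff hκ he ha hu).2 ((b2 u).2 hu)
    · simp only [Finset.mem_insert, Finset.mem_union] at hb
      rcases hb with rfl | hb | hb
      · exact g.fst_eq hκ he ha
      · refine Eq.trans ?_ (c1 b hb)
        rw [fst, fst, decide_eq_decide]
        exact g.pos_left hκ he ((b1 _).2 (g.left b hb _)) ((b1 _).2 (g.left b hb _))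
      · refine Eq.trans ?_ (c2 b hb)
        rw [fst, fst, decide_eq_decide]
        exact g.pos_right hκ he ha ((b2 _).2 (g.right b hb _)) ((b2 _).2 (g.right b hb _))

end IsGlue

end Curve

/-! ### Bridges of states -/

namespace Curve

open CyclePos Classical

variable {E X V : Type} {C : Curve E X} {κ : E → V}

/-- The arrow `a` of the state `S` is a bridge: there is a set of circles such that `a` is the only
arrow in `S` between these circles and the other ones. -/
def IsBridge (C : Curve E X) (κ : E → V) (S : Finset X) (a : X) : Prop :=
  ∃ K : Set V, (κ (C.en (a, true)) ∈ K ↔ κ (C.en (a, false)) ∉ K) ∧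
    ∀ b ∈ S, b ≠ a → (κ (C.en (b, true)) ∈ K ↔ κ (C.en (b, false)) ∈ K)

/-- The bridges of a state. -/
def bridges (C : Curve E X) (κ : E → V) (S : Finset X) : Finset X := {a ∈ S | C.IsBridge κ S a}

namespace IsGlue

variable {I₁ I₂ : Set V} {S₁ S₂ : Finset X} {a : X} {p : Bool}

theorem isBridge_self (g : C.IsGlue κ I₁ I₂ S₁ S₂ a p) :
    C.IsBridge κ (insert a (S₁ ∪ S₂)) a := by
  refine ⟨I₂, ?_, fun b hb hba => ?_⟩
  · have h1 := g.mem_right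
    have h2 := g.disj _ g.mem_left
    cases p
    · exact ⟨fun h => absurd h h2, fun h => absurd h1 h⟩
    · exact ⟨fun _ => h2, fun _ => h1⟩
  · simp only [Finset.mem_insert, hba, Finset.mem_union, false_or] at hb
    rcases hb with hb | hb
    · exact ⟨fun h => absurd h (g.disj _ (g.left b hb _)), fun h => absurd h (g.disj _ (g.left b hb _))⟩
    · exact ⟨fun _ => g.right b hb _, fun _ => g.right b hb _⟩

theorem isBridge_left (g : C.IsGlue κ I₁ I₂ S₁ S₂ a p) {b : X} (hb : b ∈ S₁) :
    C.IsBridge κ (insert a (S₁ ∪ S₂)) b ↔ C.IsBridge κ S₁ b := by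
  constructor
  · rintro ⟨K, h1, h2⟩
    exact ⟨K, h1, fun c hc => h2 c (by simp [hc])⟩
  · rintro ⟨K, h1, h2⟩
    -- A set that separates `b` in the left sublink is extended by all or nothing of the right
    -- sublink, so that `a` does not cross it.
    have hl : ∀ v ∈ I₁, v ∈ (K ∩ I₁) ∪ {v | v ∈ I₂ ∧ κ (C.en (a, !p)) ∈ K} ↔ v ∈ K := fun v hv => by
      have := g.disj v hv
      simp [hv, this]
    have hr : ∀ v ∈ I₂, v ∈ (K ∩ I₁) ∪ {v | v ∈ I₂ ∧ κ (C.en (a, !p)) ∈ K} ↔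
        κ (C.en (a, !p)) ∈ K := fun v hv => by
      have : v ∉ I₁ := fun h => g.disj v h hv
      simp [hv, this]
    refine ⟨(K ∩ I₁) ∪ {v | v ∈ I₂ ∧ κ (C.en (a, !p)) ∈ K}, ?_, fun c hc hcb => ?_⟩
    · rw [hl _ (g.left b hb _), hl _ (g.left b hb _)]
      exact h1
    · simp only [Finset.mem_insert, Finset.mem_union] at hc
      rcases hc with rfl | hc | hc
      · have e1 := hl _ g.mem_left
        have e2 := hr _ g.mem_right
        cases p
        · exact e1.trans e2.symm
        · exact e2.trans e1.symm
      · rw [hl _ (g.left c hc _), hl _ (g.left c hc _)]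
        exact h2 c hc hcb
      · rw [hr _ (g.right c hc _), hr _ (g.right c hc _)]

theorem isBridge_right (g : C.IsGlue κ I₁ I₂ S₁ S₂ a p) {b : X} (hb : b ∈ S₂) :
    C.IsBridge κ (insert a (S₁ ∪ S₂)) b ↔ C.IsBridge κ S₂ b := by
  rw [Finset.union_comm]
  exact g.symm.isBridge_left hb

theorem bridges_eq (g : C.IsGlue κ I₁ I₂ S₁ S₂ a p) :
    C.bridges κ (insert a (S₁ ∪ S₂)) = insert a (C.bridges κ S₁ ∪ C.bridges κ S₂) := by
  ext b
  by_cases hb : b = a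
  · subst hb
    simp [bridges, g.isBridge_self]
  · simp only [bridges, Finset.mem_filter, Finset.mem_insert, hb, Finset.mem_union, false_or]
    constructor
    · rintro ⟨h1 | h1, h2⟩
      · exact Or.inl ⟨h1, (g.isBridge_left h1).1 h2⟩
      · exact Or.inr ⟨h1, (g.isBridge_right h1).1 h2⟩
    · rintro (⟨h1, h2⟩ | ⟨h1, h2⟩)
      · exact ⟨Or.inl h1, (g.isBridge_left h1).2 h2⟩
      · exact ⟨Or.inr h1, (g.isBridge_right h1).2 h2⟩

theorem disjoint (g : C.IsGlue κ I₁ I₂ S₁ S₂ a p) : Disjoint S₁ S₂ :=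
  Finset.disjoint_left.2 fun b h h' => g.disj _ (g.left b h true) (g.right b h' true)

theorem card_bridges (g : C.IsGlue κ I₁ I₂ S₁ S₂ a p) :
    (C.bridges κ (insert a (S₁ ∪ S₂))).card = (C.bridges κ S₁).card + (C.bridges κ S₂).card + 1 := by
  have h1 : Disjoint (C.bridges κ S₁) (C.bridges κ S₂) :=
    g.disjoint.mono (Finset.filter_subset _ _) (Finset.filter_subset _ _)
  rw [g.bridges_eq, Finset.card_insert_of_notMem, Finset.card_union_of_disjoint h1]
  rw [Finset.mem_union, not_or]
  exact ⟨fun h => g.notMem_left (Finset.filter_subset _ _ h),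
    fun h => g.notMem_right (Finset.filter_subset _ _ h)⟩

theorem prod_eq {M : Type} [CommMonoid M] (w : X → M) (g : C.IsGlue κ I₁ I₂ S₁ S₂ a p) :
    ∏ b ∈ insert a (S₁ ∪ S₂), w b = w a * ((∏ b ∈ S₁, w b) * ∏ b ∈ S₂, w b) := by
  rw [Finset.prod_insert, Finset.prod_union g.disjoint]
  rw [Finset.mem_union, not_or]
  exact ⟨g.notMem_left, g.notMem_right⟩

end IsGlue

variable [Finite E]

theorem pos_lt_of_fst {S : Finset X} {e : E} {a : X} {δ : Bool} (h : C.fst S e a = δ)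
    (hs : ∀ b, (C.bd S).SameCycle e (C.en (a, b))) :
    pos (C.bd S) e (C.en (a, δ)) < pos (C.bd S) e (C.en (a, !δ)) := by
  have hne : pos (C.bd S) e (C.en (a, δ)) ≠ pos (C.bd S) e (C.en (a, !δ)) := fun h =>
    absurd (pos_inj (hs _) (hs _) h) (by simp)
  rcases lt_or_gt_of_ne hne with hlt | hlt
  · exact hlt
  · have := C.fst_eq (x := a) (b := !δ) (by rwa [Bool.not_not])
    rw [h] at this
    simp at this

/-- A bridge decomposes a state. -/
theorem IsStateOn.exists_glue (hκ : ∀ u, κ (C.nxt u) = κ u) {δ : Bool} {I : Finset V} {e : E}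
    {S : Finset X} (hS : C.IsStateOn κ δ I e S) {a : X} (ha : a ∈ S) (hb : C.IsBridge κ S a) :
    ∃ J ⊆ I, κ e ∈ J ∧ ∃ S₁ S₂, insert a (S₁ ∪ S₂) = S ∧
      C.IsGlue κ J ((I \ J : Finset V) : Set V) S₁ S₂ a δ := by
  obtain ⟨K, hK1, hK2⟩ := hb
  obtain ⟨h1, h2, h3⟩ := hS
  have he : κ e ∈ I := (h2 e).1 (Perm.SameCycle.refl _ _)
  -- The circles on the same side of the bridge as the base edge.
  let J := I.filter fun v => v ∈ K ↔ κ e ∈ K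
  have hmem : ∀ v ∈ I, v ∈ J ↔ (v ∈ K ↔ κ e ∈ K) := fun v hv => by simp [J, hv]
  have hcross : ∀ b ∈ S, b ≠ a → ∀ q, κ (C.en (b, q)) ∈ J ↔ κ (C.en (b, !q)) ∈ J := by
    intro b hb hba q
    rw [hmem _ (h1 b hb _), hmem _ (h1 b hb _)]
    have := hK2 b hb hba
    cases q
    · rw [Bool.not_false, this]
    · rw [Bool.not_true, this]
  have hcross_a : κ (C.en (a, δ)) ∈ J ↔ κ (C.en (a, !δ)) ∉ J := by
    rw [hmem _ (h1 a ha _), hmem _ (h1 a ha _)]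
    cases δ
    · rw [Bool.not_false]; tauto
    · rw [Bool.not_true]; tauto
  -- Otherwise the tour would stay in `J` until it meets `C.en (a, !δ)`. But `C.en (a, δ)` is met
  -- earlier, and it is reached by a jump from the circle of `C.en (a, !δ)`, which is not in `J`.
  have hright : κ (C.en (a, δ)) ∉ J := by
    intro hJ
    have hJ' := hcross_a.1 hJ
    have hlt := pos_lt_of_fst (h3 a ha) fun b => (h2 _).2 (h1 a ha b)
    have hp := pos_spec ((h2 _).2 (h1 a ha δ))
    have claim : ∀ l < pos (C.bd S) e (C.en (a, !δ)), κ ((C.bd S ^ l) e) ∈ J := by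
      intro l
      induction l with
      | zero => exact fun _ => (hmem _ he).2 Iff.rfl
      | succ l ih =>
        intro hl
        have hJl := ih (by omega)
        have hne := pow_ne_of_lt_pos l.succ_pos hl
        rw [pow_succ', Perm.mul_apply] at hne ⊢
        generalize (C.bd S ^ l) e = u at hJl hne ⊢
        rw [bd_apply] at hne ⊢
        by_cases hx : ∃ x ∈ S, ∃ b, C.nxt u = C.en (x, b)
        · obtain ⟨x, hx, b, hb⟩ := hx
          rw [← hκ, hb] at hJl
          rw [hb, C.jumpAt_mem hx] at hne ⊢
          by_cases hxa : x = a
          · subst hxa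
            rcases Bool.eq_or_eq_not b δ with rfl | rfl
            · exact absurd rfl hne
            · exact absurd hJl hJ'
          · exact (hcross x hx hxa b).1 hJl
        · push Not at hx
          rwa [C.jumpAt_of_forall_ne hx, hκ]
    obtain ⟨k, hk⟩ : ∃ k, pos (C.bd S) e (C.en (a, δ)) = k + 1 :=
      ⟨_, (Nat.succ_pred_eq_of_pos hp.1).symm⟩
    have hk' := claim k (by omega)
    have h4 := hp.2
    rw [hk, pow_succ', Perm.mul_apply, bd_apply] at h4
    have h5 := congrArg (C.jumpAt S) h4
    rw [jumpAt_jumpAt, C.jumpAt_mem ha] at h5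
    rw [← hκ, h5] at hk'
    exact hJ' hk'
  refine ⟨J, Finset.filter_subset _ _, (hmem _ he).2 Iff.rfl,
    (S.erase a).filter fun b => κ (C.en (b, true)) ∈ J,
    (S.erase a).filter fun b => ¬ κ (C.en (b, true)) ∈ J, ?_, ?_, ?_, ?_, ?_, ?_⟩
  · rw [Finset.filter_union_filter_not_eq, Finset.insert_erase ha]
  · intro v hv hv'
    simp only [Finset.coe_sdiff, Set.mem_sdiff] at hv'
    exact hv'.2 hv
  · intro b hb q
    simp only [Finset.mem_filter, Finset.mem_erase] at hb
    cases q
    · exact (hcross b hb.1.2 hb.1.1 true).1 hb.2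
    · exact hb.2
  · intro b hb q
    simp only [Finset.mem_filter, Finset.mem_erase] at hb
    rw [Finset.coe_sdiff]
    refine ⟨h1 b hb.1.2 q, ?_⟩
    cases q
    · exact fun h => hb.2 ((hcross b hb.1.2 hb.1.1 true).2 h)
    · exact hb.2
  · by_contra h
    exact hright (hcross_a.2 h)
  · rw [Finset.coe_sdiff]
    exact ⟨h1 a ha δ, hright⟩

omit [Finite E] in
/-- The decomposition of a state by a bridge is unique. -/
theorem IsGlue.subset (hκ : ∀ u, κ (C.nxt u) = κ u) (hsurj : Function.Surjective κ) {δ : Bool}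
    {I J J' : Finset V} {e : E} {S₁ S₂ S₁' S₂' : Finset X} {a : X} (hJI : J ⊆ I) (heJ' : κ e ∈ J')
    (hS : C.IsStateOn κ δ I e (insert a (S₁ ∪ S₂)))
    (g : C.IsGlue κ J ((I \ J : Finset V) : Set V) S₁ S₂ a δ)
    (g' : C.IsGlue κ J' ((I \ J' : Finset V) : Set V) S₁' S₂' a δ)
    (h : insert a (S₁ ∪ S₂) = insert a (S₁' ∪ S₂')) : J ⊆ J' := by
  intro v hv
  by_contra hv'
  obtain ⟨u, rfl⟩ := hsurj v
  have hu := (hS.2.1 u).2 (hJI hv)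
  have hside : ∀ {J : Finset V} {S₁ S₂}, C.IsGlue κ J ((I \ J : Finset V) : Set V) S₁ S₂ a δ →
      ∀ b ∈ insert a (S₁ ∪ S₂), b ≠ a → (κ (C.en (b, true)) ∈ J ↔ κ (C.en (b, false)) ∈ J) := by
    intro J S₁ S₂ g b hb hba
    simp only [Finset.mem_insert, Finset.mem_union, hba, false_or] at hb
    rcases hb with hb | hb
    · exact ⟨fun _ => g.left b hb false, fun _ => g.left b hb true⟩
    · have := fun q => (Finset.mem_sdiff.1 (g.right b hb q)).2
      exact ⟨fun h => absurd h (this true), fun h => absurd h (this false)⟩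
  -- No arrow of the state, not even `a`, joins `J \ J'` to the other circles. The single tour
  -- starts in `J'`, so it could never reach `J \ J'`.
  have hD : ∀ b ∈ insert a (S₁ ∪ S₂), κ (C.en (b, true)) ∈ (J : Set V) \ J' ↔
      κ (C.en (b, false)) ∈ (J : Set V) \ J' := by
    intro b hb
    by_cases hba : b = a
    · subst hba
      have h1 : κ (C.en (b, δ)) ∉ J := (Finset.mem_sdiff.1 g.mem_right).2
      have h2 : κ (C.en (b, !δ)) ∈ J' := g'.mem_left
      cases δ
      · exact ⟨fun h => absurd h2 h.2, fun h => absurd h.1 h1⟩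
      · exact ⟨fun h => absurd h.1 h1, fun h => absurd h2 h.2⟩
    · have h1 := hside g b hb hba
      have h2 := hside g' b (h ▸ hb) hba
      simp only [Set.mem_sdiff, Finset.mem_coe, h1, h2]
  exact ((mem_iff_of_sameCycle (mem_bd_iff hκ hD) hu).2 ⟨hv, hv'⟩).2 heJ'

end Curve

/-! ### The generating polynomial of bridges and its derivative -/

namespace Curve

open CyclePos Classical

variable {E X V : Type} {C : Curve E X} {κ : E → V} [Fintype X]

/-- The weight of a state. -/
def weight (C : Curve E X) (S : Finset X) : ℤ[X] := ∏ a ∈ S, ((C.sgn a : ℤ) : ℤ[X]) * Polynomial.X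

/-- The state sum of a sublink, where the bridges of states are counted by the outer variable. -/
def bridgePoly (C : Curve E X) (κ : E → V) (δ : Bool) (I : Set V) (e : E) : ℤ[X][X] :=
  ∑ S : Finset X with C.IsStateOn κ δ I e S,
    Polynomial.C (C.weight S) * Polynomial.X ^ (C.bridges κ S).card

theorem eval_one_bridgePoly (δ : Bool) (I : Set V) (e : E) :
    (C.bridgePoly κ δ I e).eval 1 = C.stateSumOn κ δ I e := by
  rw [bridgePoly, stateSumOn, eval_finsetSum]
  refine Finset.sum_congr rfl fun S _ => ?_
  rw [eval_mul, eval_C, eval_pow, eval_X, one_pow, mul_one, weight]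

theorem eval_zero_bridgePoly (δ : Bool) (I : Set V) (e : E) :
    (C.bridgePoly κ δ I e).eval 0 =
      ∑ S : Finset X with C.IsStateOn κ δ I e S ∧ C.bridges κ S = ∅, C.weight S := by
  rw [bridgePoly, eval_finsetSum, ← Finset.filter_filter, Finset.sum_filter _ _ (s := Finset.filter _ _)]
  refine Finset.sum_congr rfl fun S _ => ?_
  simp only [eval_mul, eval_C, eval_pow, eval_X, zero_pow_eq, Finset.card_eq_zero, mul_ite, mul_one,
    mul_zero]

variable [Finite E]

/-- A state with a marked bridge amounts to a set `J` around the base circle, an arrow with its end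
`δ` outside `J` and the other end in `J`, and states of both sublinks, the second one based at that
arrow. -/
theorem sum_bridges (hκ : ∀ u, κ (C.nxt u) = κ u) (hsurj : Function.Surjective κ) {M : Type}
    [AddCommMonoid M] (δ : Bool) (I : Finset V) (e : E) (g : Finset X → X → M) :
    ∑ S : Finset X with C.IsStateOn κ δ I e S, ∑ a ∈ C.bridges κ S, g S a =
      ∑ J ∈ I.powerset with κ e ∈ J,
        ∑ a with κ (C.en (a, !δ)) ∈ J ∧ κ (C.en (a, δ)) ∈ I \ J,
          ∑ S₁ : Finset X with C.IsStateOn κ δ J e S₁,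
            ∑ S₂ : Finset X with
              C.IsStateOn κ δ ((I \ J : Finset V) : Set V) (C.nxt.symm (C.en (a, δ))) S₂,
              g (insert a (S₁ ∪ S₂)) a := by
  simp only [← Finset.sum_product', Finset.sum_sigma']
  symm
  have glue : ∀ {J : Finset V} {a : X} {S₁ S₂ : Finset X},
      (κ (C.en (a, !δ)) ∈ J ∧ κ (C.en (a, δ)) ∈ I \ J) → C.IsStateOn κ δ J e S₁ →
      C.IsStateOn κ δ ((I \ J : Finset V) : Set V) (C.nxt.symm (C.en (a, δ))) S₂ →
      C.IsGlue κ J ((I \ J : Finset V) : Set V) S₁ S₂ a δ := fun {J a S₁ S₂} ha h₁ h₂ =>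
    ⟨fun v hv hv' => (Finset.mem_sdiff.1 hv').2 hv, h₁.1, h₂.1, ha.1, ha.2⟩
  have hunion : ∀ {J : Finset V}, J ⊆ I → (J : Set V) ∪ ((I \ J : Finset V) : Set V) = I := by
    intro J hJ
    rw [← Finset.coe_union, Finset.union_sdiff_of_subset hJ]
  refine Finset.sum_bij (fun y _ => ⟨insert y.2.1 (y.2.2.1 ∪ y.2.2.2), y.2.1⟩) ?_ ?_ ?_ ?_
  · rintro ⟨J, a, S₁, S₂⟩ h
    simp only [Finset.mem_sigma, Finset.mem_filter, Finset.mem_powerset, Finset.mem_univ, true_and,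
      Finset.mem_product] at h ⊢
    obtain ⟨⟨hJ, he⟩, ha, h₁, h₂⟩ := h
    have g := glue ha h₁ h₂
    have h3 := (g.isStateOn_iff hκ he).2 ⟨h₁, h₂⟩
    rw [hunion hJ] at h3
    exact ⟨h3, Finset.mem_filter.2 ⟨Finset.mem_insert_self _ _, g.isBridge_self⟩⟩
  · rintro ⟨J, a, S₁, S₂⟩ h ⟨J', a', S₁', S₂'⟩ h' heq
    simp only [Finset.mem_sigma, Finset.mem_filter, Finset.mem_powerset, Finset.mem_univ, true_and,
      Finset.mem_product] at h h'
    simp only [Sigma.mk.injEq, heq_eq_eq] at heq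
    obtain ⟨heq, rfl⟩ := heq
    obtain ⟨⟨hJ, he⟩, ha, h₁, h₂⟩ := h
    obtain ⟨⟨hJ', he'⟩, ha', h₁', h₂'⟩ := h'
    have g := glue ha h₁ h₂
    have g' := glue ha' h₁' h₂'
    have h3 := (g.isStateOn_iff hκ he).2 ⟨h₁, h₂⟩
    rw [hunion hJ] at h3
    obtain rfl : J = J' := (g.subset hκ hsurj hJ he' h3 g' heq).antisymm
      (g'.subset hκ hsurj hJ' he (heq ▸ h3) g heq.symm)
    have hmem : ∀ {b}, b ∈ S₁ ∪ S₂ ↔ b ∈ S₁' ∪ S₂' := by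
      intro b
      by_cases hb : b = a
      · subst hb
        simp [g.notMem_left, g.notMem_right, g'.notMem_left, g'.notMem_right]
      · have := Finset.ext_iff.1 heq b
        rwa [Finset.mem_insert, Finset.mem_insert, or_iff_right hb, or_iff_right hb] at this
    have hdis : ∀ {T₁ T₁' T₂ T₂' : Finset X}, (∀ {b}, b ∈ T₁ ∪ T₂ ↔ b ∈ T₁' ∪ T₂') →
        C.IsGlue κ J ((I \ J : Finset V) : Set V) T₁ T₂ a δ →
        C.IsGlue κ J ((I \ J : Finset V) : Set V) T₁' T₂' a δ → T₁ ⊆ T₁' ∧ T₂ ⊆ T₂' := by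
      intro T₁ T₁' T₂ T₂' hm g g'
      refine ⟨fun b hb => ?_, fun b hb => ?_⟩
      · rcases Finset.mem_union.1 (hm.1 (Finset.mem_union_left _ hb)) with h | h
        · exact h
        · exact absurd (g'.right b h true) (g.disj _ (g.left b hb true))
      · rcases Finset.mem_union.1 (hm.1 (Finset.mem_union_right _ hb)) with h | h
        · exact absurd (g.right b hb true) (g'.disj _ (g'.left b h true))
        · exact h
    obtain ⟨a1, a2⟩ := hdis hmem g g'
    obtain ⟨b1, b2⟩ := hdis (fun {b} => (hmem (b := b)).symm) g' g
    rw [a1.antisymm b1, a2.antisymm b2]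
  · rintro ⟨S, a⟩ h
    simp only [Finset.mem_sigma, Finset.mem_filter, Finset.mem_univ, true_and, bridges] at h
    obtain ⟨hS, ha, hb⟩ := h
    obtain ⟨J, hJ, he, S₁, S₂, rfl, g⟩ := hS.exists_glue hκ ha hb
    have h3 := hS
    rw [← hunion hJ, g.isStateOn_iff hκ he] at h3
    refine ⟨⟨J, a, S₁, S₂⟩, ?_, rfl⟩
    simp only [Finset.mem_sigma, Finset.mem_filter, Finset.mem_powerset, Finset.mem_univ, true_and,
      Finset.mem_product]
    exact ⟨⟨hJ, he⟩, ⟨g.mem_left, g.mem_right⟩, h3.1, h3.2⟩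
  · intros; rfl

/-- Differentiation in the outer variable marks a bridge. Weights multiply under gluing, and numbers
of bridges add up, with one more for the mark. -/
theorem derivative_bridgePoly (hκ : ∀ u, κ (C.nxt u) = κ u) (hsurj : Function.Surjective κ)
    (δ : Bool) (I : Finset V) (e : E) :
    derivative (C.bridgePoly κ δ I e) = ∑ J ∈ I.powerset with κ e ∈ J,
      ∑ a with κ (C.en (a, !δ)) ∈ J ∧ κ (C.en (a, δ)) ∈ I \ J,
        Polynomial.C (((C.sgn a : ℤ) : ℤ[X]) * Polynomial.X) * (C.bridgePoly κ δ J e *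
          C.bridgePoly κ δ ((I \ J : Finset V) : Set V) (C.nxt.symm (C.en (a, δ)))) := by
  have h1 : derivative (C.bridgePoly κ δ I e) =
      ∑ S : Finset X with C.IsStateOn κ δ I e S, ∑ a ∈ C.bridges κ S,
        Polynomial.C (C.weight S) * Polynomial.X ^ ((C.bridges κ S).card - 1) := by
    rw [bridgePoly, derivative_sum]
    refine Finset.sum_congr rfl fun S _ => ?_
    rw [derivative_C_mul_X_pow, Finset.sum_const, nsmul_eq_mul, Polynomial.C_mul]
    simp only [map_natCast]
    ring
  rw [h1, sum_bridges hκ hsurj δ I e fun S a => Polynomial.C (C.weight S) *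
    Polynomial.X ^ ((C.bridges κ S).card - 1)]
  refine Finset.sum_congr rfl fun J hJ => Finset.sum_congr rfl fun a ha => ?_
  rw [bridgePoly, bridgePoly, Finset.sum_mul_sum, Finset.mul_sum]
  refine Finset.sum_congr rfl fun S₁ h₁ => ?_
  rw [Finset.mul_sum]
  refine Finset.sum_congr rfl fun S₂ h₂ => ?_
  simp only [Finset.mem_filter, Finset.mem_univ, true_and] at h₁ h₂ ha
  have g : C.IsGlue κ J ((I \ J : Finset V) : Set V) S₁ S₂ a δ :=
    ⟨fun v hv hv' => (Finset.mem_sdiff.1 hv').2 hv, h₁.1, h₂.1, ha.1, ha.2⟩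
  rw [g.card_bridges, Nat.add_sub_cancel, weight, g.prod_eq, pow_add]
  simp only [Polynomial.C_mul, weight]
  ring

/-! ### State sums without bridges -/

/-- A planar link: the state sums of its sublinks depend on nothing but the sublink. -/
structure IsLinkSum (C : Curve E X) (κ : E → V) (A : Finset V → ℤ[X]) (l : Finset V → Finset V → ℤ) :
    Prop where
  label : ∀ u, κ (C.nxt u) = κ u
  surj : Function.Surjective κ
  sum : ∀ δ (I : Finset V) e, κ e ∈ I → C.stateSumOn κ δ I e = A I
  lk : ∀ K J : Finset V, Disjoint K J → C.lkSum κ K J = l K J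
  symm : ∀ K J, l K J = l J K

variable {A : Finset V → ℤ[X]} {l : Finset V → Finset V → ℤ}

/-- For smaller sublinks the polynomial does not depend on the base edge, so the sum over the
possible bridges involves their signs only and gives a linking number. -/
theorem IsLinkSum.derivative (h : C.IsLinkSum κ A l) (δ : Bool) (I : Finset V) (e : E)
    {F : Finset V → ℤ[X][X]}
    (hF : ∀ J ⊂ I, ∀ e, κ e ∈ J → C.bridgePoly κ δ J e = F J) :
    derivative (C.bridgePoly κ δ I e) = ∑ J ∈ I.powerset with κ e ∈ J,
      Polynomial.C ((l J (I \ J) : ℤ[X]) * Polynomial.X) * (F J * F (I \ J)) := by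
  rw [derivative_bridgePoly h.label h.surj]
  refine Finset.sum_congr rfl fun J hJ => ?_
  simp only [Finset.mem_filter, Finset.mem_powerset] at hJ
  -- For `δ = true` the arrows point from `I \ J` to `J`, for `δ = false` from `J` to `I \ J`; the
  -- symmetry of linking numbers makes this irrelevant.
  have h1 : l J (I \ J) = ∑ a with κ (C.en (a, !δ)) ∈ J ∧ κ (C.en (a, δ)) ∈ I \ J,
      (C.sgn a : ℤ) := by
    cases δ
    · rw [← h.lk J (I \ J) Finset.disjoint_sdiff]
      unfold lkSum
      simp only [Bool.not_false, Finset.mem_coe]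
    · rw [h.symm, ← h.lk (I \ J) J Finset.disjoint_sdiff.symm]
      unfold lkSum
      simp only [Bool.not_true, Finset.mem_coe]
      exact Finset.sum_congr (Finset.filter_congr fun a _ => and_comm) fun _ _ => rfl
  rw [h1, Int.cast_sum, Finset.sum_mul, map_sum, Finset.sum_mul]
  refine Finset.sum_congr rfl fun a ha => ?_
  simp only [Finset.mem_filter, Finset.mem_univ, true_and] at ha
  obtain ⟨ha1, ha2⟩ := ha
  obtain ⟨ha2, ha3⟩ := Finset.mem_sdiff.1 ha2
  rw [hF J _ e hJ.2, hF (I \ J) _]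
  · rw [apply_nxt_symm h.label]
    exact Finset.mem_sdiff.2 ⟨ha2, ha3⟩
  · exact Finset.ssubset_iff_subset_ne.2 ⟨Finset.sdiff_subset, fun he => by
      have := hJ.1 hJ.2
      rw [← he] at this
      exact (Finset.mem_sdiff.1 this).2 hJ.2⟩
  · exact Finset.ssubset_iff_subset_ne.2 ⟨hJ.1, fun he => ha3 (he ▸ ha2)⟩

/-- Complements exchange the sets that contain `v` with those that do not. This is what frees the
derivative from the base circle. -/
theorem sum_powerset_symm {M : Type} [AddCommGroup M] [IsAddTorsionFree M] (I : Finset V)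
    {T : Finset V → M} (hT : ∀ J ⊆ I, T (I \ J) = T J) {v : V} (hv : v ∈ I) :
    2 • ∑ J ∈ I.powerset with v ∈ J, T J = ∑ J ∈ I.powerset, T J := by
  rw [two_nsmul, ← Finset.sum_filter_add_sum_filter_not I.powerset (fun J => v ∈ J)]
  congr 1
  refine Finset.sum_bij' (fun J _ => I \ J) (fun J _ => I \ J) ?_ ?_ ?_ ?_ ?_
  · intro J hJ
    simp only [Finset.mem_filter, Finset.mem_powerset] at hJ ⊢
    exact ⟨Finset.sdiff_subset, fun h => (Finset.mem_sdiff.1 h).2 hJ.2⟩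
  · intro J hJ
    simp only [Finset.mem_filter, Finset.mem_powerset] at hJ ⊢
    exact ⟨Finset.sdiff_subset, Finset.mem_sdiff.2 ⟨hv, hJ.2⟩⟩
  · intro J hJ
    simp only [Finset.mem_filter, Finset.mem_powerset] at hJ
    exact Finset.sdiff_sdiff_eq_self hJ.1
  · intro J hJ
    simp only [Finset.mem_filter, Finset.mem_powerset] at hJ
    exact Finset.sdiff_sdiff_eq_self hJ.1
  · intro J hJ
    simp only [Finset.mem_filter, Finset.mem_powerset] at hJ
    exact (hT J hJ.1).symm

theorem _root_.Polynomial.eq_of_derivative_eq {R : Type} [CommRing R] [IsDomain R] [CharZero R]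
    {P Q : R[X]} (h : derivative P = derivative Q) (x : R) (hx : P.eval x = Q.eval x) : P = Q := by
  have h1 : derivative (P - Q) = 0 := by rw [derivative_sub, h, sub_self]
  have h2 := eq_C_of_derivative_eq_zero h1
  have h3 : (P - Q).eval x = 0 := by rw [eval_sub, hx, sub_self]
  rw [h2, eval_C] at h3
  rw [h3, map_zero] at h2
  exact sub_eq_zero.1 h2

/-- The numbers of states with given numbers of bridges are determined by the state sums and the
linking numbers of sublinks. -/
theorem IsLinkSum.bridgePoly_eq {E' X' : Type} [Fintype X'] [Finite E'] {C' : Curve E' X'}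
    {κ' : E' → V} (h : C.IsLinkSum κ A l) (h' : C'.IsLinkSum κ' A l) (δ δ' : Bool) (I : Finset V)
    {e : E} {e' : E'} (he : κ e ∈ I) (he' : κ' e' ∈ I) :
    C.bridgePoly κ δ I e = C'.bridgePoly κ' δ' I e' := by
  let F : Finset V → ℤ[X][X] := fun J =>
    if hJ : ∃ e, κ e ∈ J then C.bridgePoly κ δ J hJ.choose else 0
  suffices H : ∀ I : Finset V, (∀ e, κ e ∈ I → C.bridgePoly κ δ I e = F I) ∧
      ∀ e', κ' e' ∈ I → C'.bridgePoly κ' δ' I e' = F I by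
    rw [(H I).1 e he, (H I).2 e' he']
  intro I
  induction I using Finset.strongInduction with
  | H I ih =>
    let T : Finset V → ℤ[X][X] := fun J =>
      Polynomial.C ((l J (I \ J) : ℤ[X]) * Polynomial.X) * (F J * F (I \ J))
    have hT : ∀ J ⊆ I, T (I \ J) = T J := fun J hJ => by
      simp only [T]
      rw [Finset.sdiff_sdiff_eq_self hJ, h.symm, mul_comm (F J)]
    have key : ∀ v ∈ I, 2 • ∑ J ∈ I.powerset with v ∈ J, T J = ∑ J ∈ I.powerset, T J :=
      fun v hv => sum_powerset_symm I hT hv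
    -- Twice the derivative is a sum over all subsets of `I`, in which base edge, direction and
    -- diagram no longer occur.
    have d1 : ∀ e, κ e ∈ I → 2 • Polynomial.derivative (C.bridgePoly κ δ I e) =
        ∑ J ∈ I.powerset, T J := fun e he => by
      rw [h.derivative δ I e fun J hJ => (ih J hJ).1, key _ he]
    have d2 : ∀ e', κ' e' ∈ I → 2 • Polynomial.derivative (C'.bridgePoly κ' δ' I e') =
        ∑ J ∈ I.powerset, T J := fun e' he' => by
      rw [h'.derivative δ' I e' fun J hJ => (ih J hJ).2, key _ he']
    have cancel : ∀ {P Q : ℤ[X][X]}, 2 • P = 2 • Q → P = Q := fun {P Q} hPQ => by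
      have : (2 : ℤ[X][X]) * P = 2 * Q := by simpa [two_nsmul, two_mul] using hPQ
      exact mul_left_cancel₀ two_ne_zero this
    have c1 : ∀ e, κ e ∈ I → C.bridgePoly κ δ I e = F I := fun e he => by
      have hex : ∃ e, κ e ∈ I := ⟨e, he⟩
      simp only [F, dif_pos hex]
      refine Polynomial.eq_of_derivative_eq (cancel ((d1 e he).trans (d1 _ hex.choose_spec).symm)) 1 ?_
      rw [eval_one_bridgePoly, eval_one_bridgePoly, h.sum _ _ _ he, h.sum _ _ _ hex.choose_spec]
    refine ⟨c1, fun e' he' => ?_⟩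
    obtain ⟨e, hee⟩ := h.surj (κ' e')
    have he : κ e ∈ I := hee ▸ he'
    rw [← c1 e he]
    refine Polynomial.eq_of_derivative_eq (cancel ((d2 e' he').trans (d1 e he).symm)) 1 ?_
    rw [eval_one_bridgePoly, eval_one_bridgePoly, h.sum _ _ _ he, h'.sum _ _ _ he']

end Curve

/-! ### Cyclic words -/

namespace CyclePos

theorem isRotated_iff_append {α : Type} {l l' : List α} :
    l ~r l' ↔ ∃ a b, l = a ++ b ∧ l' = b ++ a := by
  constructor
  · intro h
    obtain ⟨n, hn, rfl⟩ := List.mem_map.1 (List.isRotated_iff_mem_map_range.1 h)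
    have hn' : n ≤ l.length := by
      have := List.mem_range.1 hn
      omega
    exact ⟨l.take n, l.drop n, (List.take_append_drop n l).symm,
      List.rotate_eq_drop_append_take hn'⟩
  · rintro ⟨a, b, rfl, rfl⟩
    exact List.isRotated_append

theorem IsRotated.filterMap {α β : Type} {l l' : List α} (h : l ~r l') (g : α → Option β) :
    l.filterMap g ~r l'.filterMap g := by
  obtain ⟨a, b, rfl, rfl⟩ := isRotated_iff_append.1 h
  rw [List.filterMap_append, List.filterMap_append]
  exact List.isRotated_append

theorem exists_filterMap_eq {α β : Type} {g : α → Option β} {w : List α} {l : List β}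
    (h : l ~r w.filterMap g) : ∃ w', w ~r w' ∧ w'.filterMap g = l := by
  obtain ⟨a, b, h1, h2⟩ := isRotated_iff_append.1 h.symm
  obtain ⟨w₁, w₂, rfl, h3, h4⟩ := List.filterMap_eq_append_iff.1 h1
  exact ⟨w₂ ++ w₁, List.isRotated_append, by rw [List.filterMap_append, h3, h4, h2]⟩

theorem eq_of_cons_isRotated {α : Type} {r : α} {a b : List α} (h : r :: a ~r r :: b)
    (hn : (r :: a).Nodup) : a = b := by
  obtain ⟨c, d, h1, h2⟩ := isRotated_iff_append.1 h
  rw [h1] at hn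
  cases c with
  | nil => simp only [List.nil_append, List.append_nil] at h1 h2; simpa using h1.trans h2.symm
  | cons x c =>
    cases d with
    | nil => simp only [List.nil_append, List.append_nil] at h1 h2; simpa using h1.trans h2.symm
    | cons y d =>
      simp only [List.cons_append, List.cons.injEq] at h1 h2
      simp [← h1.1, ← h2.1] at hn

theorem exists_isRotated_cons {α : Type} {l : List α} {u : α} (h : u ∈ l) : ∃ t, l ~r u :: t := by
  obtain ⟨a, b, rfl⟩ := List.append_of_mem h
  exact ⟨b ++ a, List.isRotated_append⟩

variable {E E' R V : Type}

/-- The cyclic word `l` is a walk along `f`. -/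
def Circuit (f : Perm E) (l : List E) : Prop :=
  ∀ u t, l ~r u :: t → List.IsChain (fun a b => f a = b) (u :: (t ++ [u]))

theorem Circuit.of_isChain {f : Perm E} {l : List E} {u : E} {t : List E} (h : l ~r u :: t)
    (hc : List.IsChain (fun a b => f a = b) (u :: (t ++ [u]))) : Circuit f l := by
  intro v s hs
  obtain ⟨a, b, h1, h2⟩ := isRotated_iff_append.1 (h.symm.trans hs)
  cases a with
  | nil => simp only [List.nil_append, List.append_nil] at h1 h2; rw [← h1] at h2; cases h2; exact hc
  | cons x a =>
    cases b with
    | nil => simp only [List.nil_append, List.append_nil] at h1 h2; rw [← h1] at h2; cases h2; exact hc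
    | cons y b =>
      simp only [List.cons_append, List.cons.injEq] at h1 h2
      obtain ⟨rfl, rfl⟩ := h1
      obtain ⟨rfl, rfl⟩ := h2
      have h3 : List.IsChain (fun a b => f a = b) ((u :: a) ++ v :: (b ++ [u])) := by simpa using hc
      rw [List.isChain_split] at h3
      have : List.IsChain (fun a b => f a = b) ((v :: b) ++ u :: (a ++ [v])) := by
        rw [List.isChain_split]
        exact ⟨h3.2, h3.1⟩
      simpa using this

theorem Circuit.of_formPerm [DecidableEq E] {f : Perm E} {l : List E} (hn : l.Nodup)
    (h : ∀ u ∈ l, f u = l.formPerm u) : Circuit f l := by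
  intro u t hu
  have hn' := hu.nodup_iff.1 hn
  rw [List.isChain_iff_getElem]
  intro i hi
  simp only [List.length_cons, List.length_append, List.length_nil] at hi
  have h1 : (u :: (t ++ [u]))[i] = (u :: t)[i]'(by simp; omega) := by
    exact List.getElem_append_left (as := u :: t) (bs := [u]) _
  rw [h1, h _ (hu.mem_iff.2 (List.getElem_mem _)), List.formPerm_eq_of_isRotated hn hu,
    List.formPerm_apply_getElem _ hn']
  rcases Nat.lt_or_ge (i + 1) (u :: t).length with hlt | hge
  · simp only [Nat.mod_eq_of_lt hlt]
    symm
    exact List.getElem_append_left (as := u :: t) (bs := [u]) hlt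
  · have hi' : i + 1 = (u :: t).length := by simp at hge ⊢; omega
    have h2 : (u :: (t ++ [u]))[i + 1]'(by simp; omega) = u := by
      have := List.getElem_append_right (as := u :: t) (bs := [u]) (i := i + 1) (by omega) (h₂ := by simp; omega)
      refine this.trans ?_
      simp
    rw [h2]
    simp [hi']

theorem firstHit_of_isChain {f : Perm E} {j : R ↪ E} {rd : E → Option R}
    (hrd : ∀ u r, rd u = some r ↔ u = j r) {r : R} {s : List R} : ∀ {t : List E} {e : E},
    List.IsChain (fun a b => f a = b) (e :: t) → t.filterMap rd = r :: s → FirstHit f j e r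
  | [], e, _, h => by simp at h
  | u :: t, e, hc, h => by
    obtain ⟨h1, h2⟩ := List.isChain_cons_cons.1 hc
    cases hu : rd u with
    | some q =>
      rw [List.filterMap_cons_some hu] at h
      obtain ⟨rfl, -⟩ := List.cons.inj h
      exact ⟨1, one_pos, by rw [pow_one, h1]; exact (hrd u q).1 hu, fun l hl hl' => by omega⟩
    | none =>
      rw [List.filterMap_cons_none hu] at h
      obtain ⟨k, hk, h3, h4⟩ := firstHit_of_isChain hrd h2 h
      subst h1
      refine ⟨k + 1, k.succ_pos, by rw [pow_succ, Perm.mul_apply, h3], fun l hl hl' => ?_⟩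
      obtain ⟨l, rfl⟩ : ∃ l', l = l' + 1 := ⟨l - 1, by omega⟩
      rw [pow_succ, Perm.mul_apply]
      rcases Nat.eq_zero_or_pos l with rfl | h0
      · rintro ⟨q, hq⟩
        have h5 := (hrd _ q).2 hq.symm
        rw [pow_zero, Perm.one_apply, hu] at h5
        simp at h5
      · exact h4 l h0 (by omega)

/-- The cyclic words `W v` list the cycles of `f` with labels in `I`. -/
structure Words (f : Perm E) (κ : E → V) (I : Set V) (W : V → List E) : Prop where
  label : ∀ u, κ (f u) = κ u
  circuit : ∀ v ∈ I, Circuit f (W v)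
  nodup : ∀ v ∈ I, (W v).Nodup
  mem : ∀ v ∈ I, ∀ u, u ∈ W v ↔ κ u = v
  ne : ∀ v ∈ I, W v ≠ []

theorem Words.firstHit {f : Perm E} {κ : E → V} {I : Set V} {W : V → List E} (h : Words f κ I W)
    {j : R ↪ E} {rd : E → Option R} (hrd : ∀ u r, rd u = some r ↔ u = j r)
    {v : V} (hv : v ∈ I) {e : E} {t : List E} (hr : W v ~r e :: t) {r : R} {s : List R}
    (hs : (t ++ [e]).filterMap rd = r :: s) : FirstHit f j e r :=
  firstHit_of_isChain hrd (h.circuit v hv e t hr) hs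

theorem Words.exists_firstHit {f : Perm E} {κ : E → V} {I : Set V} {W : V → List E}
    (h : Words f κ I W) {j : R ↪ E} {rd : E → Option R} (hrd : ∀ u r, rd u = some r ↔ u = j r)
    (hne : ∀ v ∈ I, (W v).filterMap rd ≠ []) {u : E} (hu : κ u ∈ I) : ∃ r, FirstHit f j u r := by
  obtain ⟨t, ht⟩ := exists_isRotated_cons ((h.mem _ hu u).2 rfl)
  obtain ⟨r, s, hs⟩ : ∃ r s, (t ++ [u]).filterMap rd = r :: s := by
    refine List.exists_cons_of_ne_nil fun h0 => hne _ hu ?_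
    have : W (κ u) ~r t ++ [u] := ht.trans (List.isRotated_append (l := [u]))
    have h1 := IsRotated.filterMap this rd
    rw [h0] at h1
    exact List.isRotated_nil_iff.1 h1
  exact ⟨r, h.firstHit hrd hu ht hs⟩

/-- Permutations with the same cyclic words have the same first return map. -/
theorem Words.thin {f : Perm E} {κ : E → V} {I : Set V} {W : V → List E} {f' : Perm E'}
    {κ' : E' → V} {W' : V → List E'} (h : Words f κ I W) (h' : Words f' κ' I W') {j : R ↪ E}
    {j' : R ↪ E'} {rd : E → Option R} {rd' : E' → Option R} (hrd : ∀ u r, rd u = some r ↔ u = j r)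
    (hrd' : ∀ u r, rd' u = some r ↔ u = j' r) (hj : ∀ r, κ (j r) ∈ I)
    (hr : ∀ v ∈ I, (W v).filterMap rd ~r (W' v).filterMap rd') {ν : Perm R} (hν : Thin f j ν) :
    Thin f' j' ν ∧ ∀ r, κ (j r) = κ' (j' r) := by
  have hmem : ∀ r, j' r ∈ W' (κ (j r)) := by
    intro r
    have h1 : r ∈ (W (κ (j r))).filterMap rd :=
      List.mem_filterMap.2 ⟨j r, (h.mem _ (hj r) _).2 rfl, (hrd _ _).2 rfl⟩
    obtain ⟨u, hu, hu'⟩ := List.mem_filterMap.1 ((hr _ (hj r)).mem_iff.1 h1)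
    rwa [(hrd' _ _).1 hu'] at hu
  refine ⟨fun r => ?_, fun r => ((h'.mem _ (hj r) _).1 (hmem r)).symm⟩
  obtain ⟨t, ht⟩ := exists_isRotated_cons ((h.mem _ (hj r) _).2 rfl)
  obtain ⟨t', ht'⟩ := exists_isRotated_cons (hmem r)
  have h1 : ((j r) :: t).filterMap rd ~r ((j' r) :: t').filterMap rd' :=
    ((IsRotated.filterMap ht rd).symm.trans (hr _ (hj r))).trans (IsRotated.filterMap ht' rd')
  have h2 : (((j r) :: t).filterMap rd).Nodup := by
    refine List.Nodup.filterMap (fun a a' b hb hb' => ?_) (ht.nodup_iff.1 (h.nodup _ (hj r)))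
    rw [(hrd _ _).1 hb, (hrd _ _).1 hb']
  rw [List.filterMap_cons_some ((hrd _ r).2 rfl)] at h1 h2
  rw [List.filterMap_cons_some ((hrd' _ r).2 rfl)] at h1
  have h3 := eq_of_cons_isRotated h1 h2
  obtain ⟨q, s, hs⟩ : ∃ q s, (t ++ [j r]).filterMap rd = q :: s := by
    refine List.exists_cons_of_ne_nil ?_
    rw [List.filterMap_append, List.filterMap_cons_some ((hrd _ r).2 rfl)]
    simp
  have hs' : (t' ++ [j' r]).filterMap rd' = q :: s := by
    rw [← hs, List.filterMap_append, List.filterMap_append, h3,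
      List.filterMap_cons_some ((hrd _ r).2 rfl), List.filterMap_cons_some ((hrd' _ r).2 rfl)]
    rfl
  rw [(hν r).unique (h.firstHit hrd (hj r) ht hs)]
  exact h'.firstHit hrd' (hj r) ht' hs'

end CyclePos

namespace Curve

open CyclePos Classical

variable {E X E' X' R Y V : Type} {C : Curve E X} {C' : Curve E' X'} {τ : Y ↪ X} {τ' : Y ↪ X'}
  {κ : E → V} {κ' : E' → V} {I : Set V} {W : V → List E} {W' : V → List E'}

theorem isStateOn_iff_of_points [Finite E] [Finite E'] (h : Words C.nxt κ I W)
    (h' : Words C'.nxt κ' I W') {j : R ↪ E} {j' : R ↪ E'} {rd : E → Option R}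
    {rd' : E' → Option R} (hrd : ∀ u r, rd u = some r ↔ u = j r)
    (hrd' : ∀ u r, rd' u = some r ↔ u = j' r) (hj : ∀ r, κ (j r) ∈ I)
    (hr : ∀ v ∈ I, (W v).filterMap rd ~r (W' v).filterMap rd')
    (hne : ∀ v ∈ I, (W v).filterMap rd ≠ []) {en : Y × Bool ↪ R}
    (hen : ∀ y b, C.en (τ y, b) = j (en (y, b))) (hen' : ∀ y b, C'.en (τ' y, b) = j' (en (y, b)))
    {v₀ : V} (hv₀ : v₀ ∈ I) {e : E} {e' : E'} {t : List E} {t' : List E'} (he : W v₀ ~r e :: t)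
    (he' : W' v₀ ~r e' :: t') (ht : (t ++ [e]).filterMap rd = (t' ++ [e']).filterMap rd')
    (δ : Bool) (T : Finset Y) :
    C.IsStateOn κ δ I e (T.map τ) ↔ C'.IsStateOn κ' δ I e' (T.map τ') := by
  obtain ⟨ν, hν⟩ := exists_thin C.nxt j
  obtain ⟨hν', hκ⟩ := h.thin h' hrd hrd' hj hr hν
  have hne' : ∀ v ∈ I, (W' v).filterMap rd' ≠ [] := fun v hv h0 => by
    have := hr v hv
    rw [h0, List.isRotated_nil_iff] at this
    exact hne v hv this
  obtain ⟨r, s, hs⟩ : ∃ r s, (t ++ [e]).filterMap rd = r :: s := by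
    refine List.exists_cons_of_ne_nil fun h0 => hne _ hv₀ ?_
    have := IsRotated.filterMap (he.trans (List.isRotated_append (l := [e]))) rd
    rw [h0] at this
    exact List.isRotated_nil_iff.1 this
  have h1 : FirstHit C.nxt j e (ν (ν.symm r)) := by
    rw [Equiv.apply_symm_apply]; exact h.firstHit hrd hv₀ he hs
  have h1' : FirstHit C'.nxt j' e' (ν (ν.symm r)) := by
    rw [Equiv.apply_symm_apply]; exact h'.firstHit hrd' hv₀ he' (ht.symm.trans hs)
  let D : Curve R Y := ⟨ν, en, fun _ => 1⟩
  rw [isStateOn_iff_of_thin (D := D) h.label hen hν (fun u hu => h.exists_firstHit hrd hne hu) h1,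
    isStateOn_iff_of_thin (D := D) h'.label hen' hν' (fun u hu => h'.exists_firstHit hrd' hne' hu)
      h1']
  have : κ ∘ j = κ' ∘ j' := funext hκ
  rw [this]

/-- States are determined by the cyclic words of the endpoints of their arrows, and the linear
word of these that is read from the base edge. -/
theorem isStateOn_iff_of_words [Finite E] [Finite E'] (h : Words C.nxt κ I W)
    (h' : Words C'.nxt κ' I W') {rd : E → Option (Y × Bool)} {rd' : E' → Option (Y × Bool)}
    (hrd : ∀ u z, rd u = some z ↔ u = C.en (τ z.1, z.2))
    (hrd' : ∀ u z, rd' u = some z ↔ u = C'.en (τ' z.1, z.2)) (hκ : ∀ y b, κ (C.en (τ y, b)) ∈ I)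
    (hr : ∀ v ∈ I, (W v).filterMap rd ~r (W' v).filterMap rd')
    {v₀ : V} (hv₀ : v₀ ∈ I) {e : E} {e' : E'} {t : List E} {t' : List E'} (he : W v₀ ~r e :: t)
    (he' : W' v₀ ~r e' :: t') (ht : (t ++ [e]).filterMap rd = (t' ++ [e']).filterMap rd')
    (δ : Bool) (T : Finset Y) :
    C.IsStateOn κ δ I e (T.map τ) ↔ C'.IsStateOn κ' δ I e' (T.map τ') := by
  have hk' : ∀ y b, κ' (C'.en (τ' y, b)) ∈ I := by
    intro y b
    have h1 : (y, b) ∈ (W (κ (C.en (τ y, b)))).filterMap rd :=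
      List.mem_filterMap.2 ⟨_, (h.mem _ (hκ y b) _).2 rfl, (hrd _ _).2 rfl⟩
    obtain ⟨u, hu, hu'⟩ := List.mem_filterMap.1 ((hr _ (hκ y b)).mem_iff.1 h1)
    rw [(hrd' _ _).1 hu'] at hu
    rw [(h'.mem _ (hκ y b) _).1 hu]
    exact hκ y b
  -- Circles without ends of the given arrows would disappear from the first return map, so on each
  -- of them one point is kept as a marker.
  let V₀ : Type := {v : V // v ∈ I ∧ (W v).filterMap rd = []}
  have key : ∀ {E X : Type} {C : Curve E X} {τ : Y ↪ X} {κ : E → V} {W : V → List E}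
      {rd : E → Option (Y × Bool)} (h : Words C.nxt κ I W)
      (hrd : ∀ u z, rd u = some z ↔ u = C.en (τ z.1, z.2)) (hκ : ∀ y b, κ (C.en (τ y, b)) ∈ I)
      (hV : ∀ v ∈ I, (∃ q : V₀, q.1 = v) ↔ (W v).filterMap rd = []),
      ∃ (j : (Y × Bool) ⊕ V₀ ↪ E) (rd₁ : E → Option ((Y × Bool) ⊕ V₀)),
        (∀ u r, rd₁ u = some r ↔ u = j r) ∧ (∀ z, j (Sum.inl z) = C.en (τ z.1, z.2)) ∧
        (∀ r, κ (j r) ∈ I) ∧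
        (∀ q : V₀, (W q.1).filterMap rd₁ = [Sum.inr q]) ∧
        (∀ v ∈ I, (¬ ∃ q : V₀, q.1 = v) → (W v).filterMap rd₁ = ((W v).filterMap rd).map Sum.inl) ∧
        ∀ v ∈ I, (¬ ∃ q : V₀, q.1 = v) → ∀ l : List E, (∀ u ∈ l, u ∈ W v) →
          l.filterMap rd₁ = (l.filterMap rd).map Sum.inl := by
    intro E X C τ κ W rd h hrd hκ hV
    let mark : V₀ → E := fun q => (W q.1).head (h.ne _ q.2.1)
    have hm : ∀ q : V₀, mark q ∈ W q.1 := fun q => List.head_mem _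
    have hmκ : ∀ q : V₀, κ (mark q) = q.1 := fun q => (h.mem _ q.2.1 _).1 (hm q)
    have hminj : Function.Injective mark := fun q q' hq => Subtype.ext (by rw [← hmκ, hq, hmκ])
    have hmn : ∀ (q : V₀) (z : Y × Bool), mark q ≠ C.en (τ z.1, z.2) := fun q z hz => by
      have h1 := List.filterMap_eq_nil_iff.1 ((hV _ q.2.1).1 ⟨q, rfl⟩) _ (hm q)
      rw [(hrd _ z).2 hz] at h1
      simp at h1
    let j : (Y × Bool) ⊕ V₀ ↪ E :=
      ⟨Sum.elim (fun z => C.en (τ z.1, z.2)) mark, by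
        rintro (z | q) (z' | q') hh
        · have h1 := C.en.injective hh
          simp only [Prod.mk.injEq, EmbeddingLike.apply_eq_iff_eq] at h1
          rw [Prod.ext h1.1 h1.2]
        · exact absurd hh.symm (hmn q' z)
        · exact absurd hh (hmn q z')
        · rw [hminj hh]⟩
    let rd₁ : E → Option ((Y × Bool) ⊕ V₀) := fun u =>
      if hu : ∃ r, u = j r then some hu.choose else none
    have hrd₁ : ∀ u r, rd₁ u = some r ↔ u = j r := by
      intro u r
      by_cases hu : ∃ r, u = j r
      · simp only [rd₁, dif_pos hu, Option.some.injEq]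
        refine ⟨fun hh => hh ▸ hu.choose_spec, fun hh => j.injective (hu.choose_spec.symm.trans hh)⟩
      · simp only [rd₁, dif_neg hu, reduceCtorEq, false_iff]
        exact fun hh => hu ⟨r, hh⟩
    have hl : ∀ v ∈ I, (¬ ∃ q : V₀, q.1 = v) → ∀ l : List E, (∀ u ∈ l, u ∈ W v) →
          l.filterMap rd₁ = (l.filterMap rd).map Sum.inl := by
      intro v hv hq l hl
      rw [List.map_filterMap]
      refine List.filterMap_congr fun u hu => ?_
      refine Option.ext fun r => ?_
      rw [hrd₁, Option.map_eq_some_iff]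
      rcases r with z | q
      · constructor
        · exact fun hh => ⟨z, (hrd _ _).2 hh, rfl⟩
        · rintro ⟨z', hz', hh⟩
          cases hh
          exact (hrd _ _).1 hz'
      · refine ⟨fun hh => absurd ⟨q, ?_⟩ hq, by simp⟩
        have h1 := (h.mem v hv u).1 (hl u hu)
        rw [hh] at h1
        exact (hmκ q).symm.trans h1
    refine ⟨j, rd₁, hrd₁, fun z => rfl, ?_, fun q => ?_, fun v hv hq => hl v hv hq _ fun _ => id, hl⟩
    · rintro (z | q)
      · exact hκ z.1 z.2
      · change κ (mark q) ∈ I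
        rw [hmκ]
        exact q.2.1
    · have h1 : ∃ t, W q.1 = mark q :: t := ⟨_, (List.cons_head_tail (h.ne _ q.2.1)).symm⟩
      obtain ⟨t, ht⟩ := h1
      have hn := h.nodup _ q.2.1
      have hk := List.filterMap_eq_nil_iff.1 ((hV _ q.2.1).1 ⟨q, rfl⟩)
      rw [ht] at hn ⊢
      rw [List.filterMap_cons_some ((hrd₁ (mark q) (Sum.inr q)).2 rfl), List.filterMap_eq_nil_iff.2]
      intro u hu
      rw [Option.eq_none_iff_forall_ne_some]
      rintro (z | q') hh
      · have h2 := hk u (by rw [ht]; exact List.mem_cons_of_mem _ hu)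
        rw [(hrd u z).2 ((hrd₁ _ _).1 hh)] at h2
        simp at h2
      · have h2 := (h.mem _ q.2.1 u).1 (by rw [ht]; exact List.mem_cons_of_mem _ hu)
        rw [(hrd₁ _ _).1 hh] at h2
        have h3 : q' = q := Subtype.ext ((hmκ q').symm.trans h2)
        rw [(hrd₁ _ _).1 hh, h3] at hu
        exact (List.nodup_cons.1 hn).1 hu
  have hV : ∀ v ∈ I, (∃ q : V₀, q.1 = v) ↔ (W v).filterMap rd = [] := fun v hv =>
    ⟨fun ⟨q, hq⟩ => hq ▸ q.2.2, fun h0 => ⟨⟨v, hv, h0⟩, rfl⟩⟩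
  have hV' : ∀ v ∈ I, (∃ q : V₀, q.1 = v) ↔ (W' v).filterMap rd' = [] := fun v hv => by
    rw [hV v hv]
    refine ⟨fun h0 => ?_, fun h0 => ?_⟩
    · have := (hr v hv).symm
      rwa [h0, List.isRotated_nil_iff] at this
    · have := hr v hv
      rwa [h0, List.isRotated_nil_iff] at this
  obtain ⟨j, rd₁, a1, a2, a3, a4, a5, a6⟩ := key h hrd hκ hV
  obtain ⟨j', rd₁', b1, b2, b3, b4, b5, b6⟩ := key h' hrd' hk' hV'
  refine isStateOn_iff_of_points h h' a1 b1 a3 (fun v hv => ?_) (fun v hv => ?_)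
    (en := Function.Embedding.inl) (fun y b => (a2 (y, b)).symm) (fun y b => (b2 (y, b)).symm)
    hv₀ he he' ?_ δ T
  · by_cases hq : ∃ q : V₀, q.1 = v
    · obtain ⟨q, rfl⟩ := hq
      rw [a4, b4]
    · rw [a5 v hv hq, b5 v hv hq]
      exact (hr v hv).map _
  · by_cases hq : ∃ q : V₀, q.1 = v
    · obtain ⟨q, rfl⟩ := hq
      rw [a4]; simp
    · rw [a5 v hv hq]
      simpa using fun h0 => hq ((hV v hv).2 (List.filterMap_eq_nil_iff.2 h0))
  · have m1 := he.trans (List.isRotated_append (l := [e]))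
    have m1' := he'.trans (List.isRotated_append (l := [e']))
    by_cases hq : ∃ q : V₀, q.1 = v₀
    · obtain ⟨q, rfl⟩ := hq
      have h1 := IsRotated.filterMap m1 rd₁
      have h1' := IsRotated.filterMap m1' rd₁'
      rw [a4] at h1
      rw [b4] at h1'
      rw [List.isRotated_singleton_iff.1 h1.symm, List.isRotated_singleton_iff.1 h1'.symm]
    · rw [a6 v₀ hv₀ hq _ fun u hu => m1.mem_iff.2 hu, b6 v₀ hv₀ hq _ fun u hu => m1'.mem_iff.2 hu,
        ht]

end Curve

namespace ArrowDiagram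

open CyclePos

variable {m n : ℕ} (A : ArrowDiagram m n)

/-! ### The circles of an arrow diagram -/

theorem exists_mem_word (x : Fin n × Bool) : ∃ i, x ∈ A.word i := by
  by_contra! h
  have h1 := A.complete x
  simp [List.count_eq_zero_of_not_mem (h _)] at h1

theorem eq_of_mem_word {x : Fin n × Bool} {i j : Fin m} (hi : x ∈ A.word i) (hj : x ∈ A.word j) :
    i = j := by
  by_contra hij
  have h1 := Finset.add_le_sum (f := fun i => (A.word i).count x) (s := Finset.univ)
    (fun _ _ => Nat.zero_le _) (Finset.mem_univ i) (Finset.mem_univ j) hij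
  rw [A.complete x] at h1
  have h2 := List.count_pos_iff.2 hi
  have h3 := List.count_pos_iff.2 hj
  omega

/-- The circle on which a point lies. -/
def circle : Pt m n → Fin m
  | Sum.inl i => i
  | Sum.inr x => (A.exists_mem_word x).choose

theorem circle_eq_iff {x : Fin n × Bool} {i : Fin m} : A.circle (Sum.inr x) = i ↔ x ∈ A.word i := by
  have h := (A.exists_mem_word x).choose_spec
  exact ⟨fun hi => hi ▸ h, fun hi => A.eq_of_mem_word h hi⟩

/-- The points on a circle. -/
def pts (i : Fin m) : List (Pt m n) := Sum.inl i :: (A.word i).map Sum.inr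

theorem mem_pts {i : Fin m} {u : Pt m n} : u ∈ A.pts i ↔ A.circle u = i := by
  rcases u with j | x
  · simp [pts, circle]
  · rw [circle_eq_iff]
    simp [pts]

theorem nodup_pts (i : Fin m) : (A.pts i).Nodup := by
  refine List.nodup_cons.2 ⟨by simp, ?_⟩
  exact (A.word_nodup i).map Sum.inr_injective

/-- The cycles of different circles are disjoint, so a single factor of the product moves `u`. -/
theorem succ_apply [DecidableEq (Pt m n)] {u : Pt m n} {i : Fin m} (h : u ∈ A.pts i) :
    A.succ u = (A.pts i).formPerm u := by
  have key : ∀ l : List (Fin m), l.Nodup →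
      (i ∉ l → (l.map fun j => (A.pts j).formPerm).prod u = u) ∧
      (i ∈ l → (l.map fun j => (A.pts j).formPerm).prod u = (A.pts i).formPerm u) := by
    have hfix : ∀ {j}, j ≠ i → ∀ {w}, w ∈ A.pts i → (A.pts j).formPerm w = w := fun hj w hw =>
      List.formPerm_apply_of_notMem fun hw' => hj (by rw [← A.mem_pts.1 hw, A.mem_pts.1 hw'])
    intro l
    induction l with
    | nil => simp
    | cons j l ih =>
      intro hl
      obtain ⟨hj, hl'⟩ := List.nodup_cons.1 hl
      obtain ⟨ih1, ih2⟩ := ih hl'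
      rw [List.map_cons, List.prod_cons]
      simp only [Perm.mul_apply]
      refine ⟨fun hi => ?_, fun hi => ?_⟩
      · simp only [List.mem_cons, not_or] at hi
        rw [ih1 hi.2, hfix (Ne.symm hi.1) h]
      · by_cases hij : i = j
        · subst hij
          rw [ih1 hj]
        · rw [ih2 ((List.mem_cons.1 hi).resolve_left hij),
            hfix (Ne.symm hij) (List.formPerm_apply_mem_of_mem h)]
  have h1 := (key (List.finRange m) (List.nodup_finRange m)).2 (List.mem_finRange i)
  rw [← h1, succ, List.ofFn_eq_map]
  congr!

theorem words : Words A.succ A.circle Set.univ A.pts where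
  label u := by
    classical
    have h := A.mem_pts.2 (rfl : A.circle u = _)
    rw [A.succ_apply h]
    exact A.mem_pts.1 (List.formPerm_apply_mem_of_mem h)
  circuit i _ := by
    classical
    exact Circuit.of_formPerm (A.nodup_pts i) fun u hu => A.succ_apply hu
  nodup i _ := A.nodup_pts i
  mem _ _ _ := A.mem_pts
  ne _ _ := List.cons_ne_nil _ _

theorem _root_.CyclePos.Words.mono {E V : Type} {f : Perm E} {κ : E → V} {I J : Set V}
    {W : V → List E} (h : Words f κ I W) (hJ : J ⊆ I) : Words f κ J W :=
  ⟨h.label, fun v hv => h.circuit v (hJ hv), fun v hv => h.nodup v (hJ hv),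
    fun v hv => h.mem v (hJ hv), fun v hv => h.ne v (hJ hv)⟩

theorem words_comp (σ : Fin m ≃ Fin m) :
    Words A.succ (fun u => σ (A.circle u)) Set.univ fun v => A.pts (σ.symm v) :=
  ⟨fun u => congrArg σ (A.words.label u), fun v _ => A.words.circuit _ trivial,
    fun v _ => A.words.nodup _ trivial,
    fun v _ u => by rw [A.mem_pts, Equiv.eq_symm_apply], fun v _ => A.words.ne _ trivial⟩

theorem circle_succ (u : Pt m n) : A.circle (A.succ u) = A.circle u := A.words.label u

theorem circle_surjective : Function.Surjective A.circle := fun i => ⟨Sum.inl i, rfl⟩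

/-- The arrow diagram as a curve with signs. -/
def curve (s : Fin n → ℤˣ) : Curve (Pt m n) (Fin n) := ⟨A.succ, Function.Embedding.inr, s⟩

/-- A function that is constant along the circles and the arrows. -/
theorem eq_of_invariant {χ : Pt m n → ℚ} (h : ∀ u, χ (A.succ u) = χ u)
    (h' : ∀ a, χ (Sum.inr (a, true)) = χ (Sum.inr (a, false))) (u : Pt m n) :
    χ u = χ (Sum.inl ((A.graph Set.univ).connectedComponentMk (A.circle u)).out) := by
  have h1 : ∀ (i : Fin m) (u : Pt m n), A.circle u = i → χ u = χ (Sum.inl i) := by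
    intro i u hu
    have hc := A.words.circuit i trivial (Sum.inl i) _ (List.IsRotated.refl _)
    have h2 : ∀ (l : List (Pt m n)) (w : Pt m n),
        List.IsChain (fun a b => A.succ a = b) (w :: l) → ∀ v ∈ l, χ v = χ w := by
      intro l
      induction l with
      | nil => simp
      | cons a l ih =>
        intro w hw v hv
        obtain ⟨e1, e2⟩ := List.isChain_cons_cons.1 hw
        have h3 : χ a = χ w := by rw [← e1, h]
        rcases List.mem_cons.1 hv with rfl | hv
        · exact h3
        · rw [ih a e2 v hv, h3]
    refine h2 _ _ hc u ?_
    have := A.mem_pts.2 hu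
    simp only [pts, List.mem_cons] at this
    rcases this with h | h
    · simp [h]
    · exact List.mem_append_left _ h
  have h2 : ∀ i j, (A.graph Set.univ).Adj i j → χ (Sum.inl i) = χ (Sum.inl j) := by
    intro i j hij
    have h3 : ∀ {i j}, (∃ a ∈ Set.univ, A.Joins a i j) → χ (Sum.inl i) = χ (Sum.inl j) := by
      rintro i j ⟨a, -, ⟨ha, hb⟩ | ⟨ha, hb⟩⟩
      · rw [← h1 _ _ (A.circle_eq_iff.2 ha), ← h1 _ _ (A.circle_eq_iff.2 hb), h']
      · rw [← h1 _ _ (A.circle_eq_iff.2 ha), ← h1 _ _ (A.circle_eq_iff.2 hb), h']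
    rcases (SimpleGraph.fromRel_adj _ _ _).1 hij with ⟨-, h4 | h4⟩
    · exact h3 h4
    · exact (h3 h4).symm
  rw [h1 _ u rfl]
  have h3 : (A.graph Set.univ).Reachable
      ((A.graph Set.univ).connectedComponentMk (A.circle u)).out (A.circle u) :=
    SimpleGraph.ConnectedComponent.exact (Quot.out_eq _)
  rw [SimpleGraph.reachable_iff_reflTransGen] at h3
  generalize A.circle u = i at h3 ⊢
  generalize ((A.graph Set.univ).connectedComponentMk i).out = j at h3 ⊢
  induction h3 with
  | refl => rfl
  | tail _ h5 ih => rw [← h2 _ _ h5, ih]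

end ArrowDiagram

/-! ### Planarity of the diagrams of classical links -/

namespace GaussDiagram

open ArrowDiagram Classical

variable {m : ℕ} (G : GaussDiagram m)

/-- The link diagram as a curve. -/
def curve : Curve (Pt m G.n) (Fin G.n) := G.toArrow.curve G.sign

theorem curve_nxt : G.curve.nxt = G.toArrow.succ := rfl

theorem curve_en (x : Fin G.n × Bool) : G.curve.en x = Sum.inr x := rfl

theorem curve_sgn : G.curve.sgn = G.sign := rfl

theorem otherGoesLeft_lr (x : Fin G.n) : G.otherGoesLeft (x, decide (G.sign x = 1)) = true := by
  unfold otherGoesLeft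
  by_cases h : G.sign x = 1 <;> simp [h]

theorem otherGoesLeft_rl (x : Fin G.n) : G.otherGoesLeft (x, !decide (G.sign x = 1)) = false := by
  unfold otherGoesLeft
  by_cases h : G.sign x = 1 <;> simp [h]

variable {G}

/-- Numbers on the faces give a chain on the edges. -/
theorem bounds_of_faceStep {φ : Pt m G.n × Bool → ℚ} (h : ∀ d, φ (G.faceStep d) = φ d) :
    G.curve.Bounds (fun u => φ (u, true) - φ (u, false)) fun u => φ (u, true) := by
  have hl : ∀ x, G.curve.lr x = Sum.inr (x, decide (G.sign x = 1)) := fun x => rfl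
  have hr : ∀ x, G.curve.rl x = Sum.inr (x, !decide (G.sign x = 1)) := fun x => rfl
  have hs : ∀ u, G.curve.nxt (G.curve.nxt.symm u) = u := fun u => Equiv.apply_symm_apply _ _
  refine ⟨fun u hu => ?_, fun x => ?_, fun x => ?_, fun x => ?_, fun x => ?_⟩
  · rcases u with i | x
    · rw [← h (_, true)]
      simp [faceStep, target, ← curve_nxt, leave, apply_symm_apply]
    · exact absurd rfl (hu x)
  · rw [← h (_, true), hl, hr]
    simp [faceStep, target, ← curve_nxt, leave, apply_symm_apply, otherGoesLeft_lr, opp]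
  · rw [sub_sub_cancel, ← h (G.curve.nxt.symm (G.curve.rl x), true), hl, hr]
    simp [faceStep, target, ← curve_nxt, leave, apply_symm_apply, otherGoesLeft_rl, opp]
  · rw [sub_sub_cancel, ← h (_, false), hl, hr]
    simp [faceStep, target, leave, otherGoesLeft_rl, opp]
  · rw [sub_sub_cancel, sub_sub_cancel, ← h (G.curve.lr x, false), hl, hr]
    simp [faceStep, target, ← curve_nxt, leave, otherGoesLeft_lr, opp]

theorem faceStep_marker {φ : Pt m G.n × Bool → ℚ} (h : ∀ d, φ (G.faceStep d) = φ d) (i : Fin m) :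
    φ (G.curve.nxt.symm (Sum.inl i), true) = φ (Sum.inl i, true) ∧
      φ (G.curve.nxt.symm (Sum.inl i), false) = φ (Sum.inl i, false) := by
  constructor
  · rw [← h (_, true)]
    simp [faceStep, target, ← curve_nxt, leave, apply_symm_apply]
  · exact h (Sum.inl i, false)

/-- The vertex of a point: the two ends of an arrow are one crossing. -/
def vertex : Pt m G.n → Fin m ⊕ Fin G.n := Sum.map id Prod.fst

/-- These functions are constant on each connected piece of the diagram, so one value per piece
determines them. -/
theorem finrank_le_numPieces {F : Type} [AddCommGroup F] [Module ℚ F] (f : F →ₗ[ℚ] Pt m G.n → ℚ)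
    (hf : Function.Injective f) (h : ∀ x u, f x (G.curve.nxt u) = f x u)
    (h' : ∀ x a, f x (Sum.inr (a, true)) = f x (Sum.inr (a, false))) :
    Module.finrank ℚ F ≤ G.numPieces := by
  have key : Function.Injective ((LinearMap.funLeft ℚ ℚ fun c :
      (G.toArrow.graph Set.univ).ConnectedComponent => (Sum.inl c.out : Pt m G.n)).comp f) := by
    intro x y hxy
    refine hf (funext fun u => ?_)
    rw [G.toArrow.eq_of_invariant (h x) (h' x) u, G.toArrow.eq_of_invariant (h y) (h' y) u]
    exact congrFun hxy _
  have h1 := LinearMap.finrank_le_finrank_of_injective key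
  rwa [Module.finrank_fintype_fun_eq_card, ← Nat.card_eq_fintype_card] at h1

/-- Diagrams of classical links are planar. -/
theorem IsClassical.planar (hG : G.IsClassical) : G.curve.Planar := by
  let Q := Quot fun d d' : Pt m G.n × Bool => G.faceStep d = d'
  have : Finite Q := Quot.finite _
  let _ : Fintype Q := Fintype.ofFinite _
  let q : Pt m G.n × Bool → Q := Quot.mk _
  have hq : ∀ d, q (G.faceStep d) = q d := fun d =>
    (Quot.sound (r := fun d d' : Pt m G.n × Bool => G.faceStep d = d') rfl).symm
  let L : (Q → ℚ) →ₗ[ℚ] (Pt m G.n → ℚ) := LinearMap.funLeft ℚ ℚ fun u => q (u, true)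
  -- The cellular chain complex of the surface with rational coefficients: `bdr` leads from faces to
  -- edges, the matrix `M` below is the coboundary from vertices to edges, and its transpose the
  -- boundary from edges to vertices.
  let bdr : (Q → ℚ) →ₗ[ℚ] (Pt m G.n → ℚ) := L - LinearMap.funLeft ℚ ℚ fun u => q (u, false)
  have hB : ∀ φ : Q → ℚ, G.curve.Bounds (bdr φ) (L φ) := fun φ =>
    bounds_of_faceStep (φ := φ ∘ q) fun d => by simp only [Function.comp, hq]
  have hM : ∀ φ : Q → ℚ, ∀ i, L φ (G.curve.nxt.symm (Sum.inl i)) = L φ (Sum.inl i) ∧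
      bdr φ (G.curve.nxt.symm (Sum.inl i)) = bdr φ (Sum.inl i) := fun φ i => by
    have h1 := faceStep_marker (φ := φ ∘ q) (fun d => by simp only [Function.comp, hq]) i
    refine ⟨h1.1, ?_⟩
    change (φ ∘ q) _ - (φ ∘ q) _ = (φ ∘ q) _ - (φ ∘ q) _
    rw [h1.1, h1.2]
  obtain ⟨M, hM'⟩ : ∃ M : Matrix (Pt m G.n) (Fin m ⊕ Fin G.n) ℚ, ∀ u w, M u w =
    (if vertex (G.curve.nxt u) = w then 1 else 0) - if vertex u = w then 1 else 0 :=
    ⟨fun u w => _, fun u w => rfl⟩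
  have hMψ : ∀ ψ u, M.mulVecLin ψ u = ψ (vertex (G.curve.nxt u)) - ψ (vertex u) := by
    intro ψ u
    simp [hM', Matrix.mulVec, dotProduct, sub_mul, Finset.sum_sub_distrib]
  have hMβ : ∀ β w, M.transpose.mulVecLin β w =
      ∑ u, if vertex u = w then β (G.curve.nxt.symm u) - β u else 0 := by
    intro β w
    simp only [hM', Matrix.mulVecLin_apply, Matrix.mulVec, dotProduct, Matrix.transpose_apply,
      sub_mul, Finset.sum_sub_distrib, ite_mul, one_mul, zero_mul]
    rw [← Equiv.sum_comp G.curve.nxt.symm, ← Finset.sum_sub_distrib]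
    refine Finset.sum_congr rfl fun u _ => ?_
    rw [apply_symm_apply]
    split_ifs <;> simp
  have hker₁ : Module.finrank ℚ (LinearMap.ker M.mulVecLin) ≤ G.numPieces := by
    refine finrank_le_numPieces ((LinearMap.funLeft ℚ ℚ vertex).comp (Submodule.subtype _)) ?_ ?_ ?_
    · refine (LinearMap.funLeft_injective_of_surjective ℚ ℚ vertex ?_).comp Subtype.val_injective
      rintro (i | a)
      · exact ⟨Sum.inl i, rfl⟩
      · exact ⟨Sum.inr (a, true), rfl⟩
    · intro x u
      have h1 := congrFun (LinearMap.mem_ker.1 x.2) u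
      rw [hMψ] at h1
      exact sub_eq_zero.1 h1
    · intro x a
      rfl
  have hcorner : ∀ φ ∈ LinearMap.ker bdr, ∀ x, L φ (G.curve.nxt.symm (G.curve.lr x)) = L φ (G.curve.lr x)
      ∧ L φ (G.curve.nxt.symm (G.curve.rl x)) = L φ (G.curve.rl x)
      ∧ L φ (G.curve.lr x) = L φ (G.curve.rl x) := by
    intro φ hφ x
    have h0 : ∀ u, bdr φ u = 0 := fun u => congrFun (LinearMap.mem_ker.1 hφ) u
    have h1 := (hB φ).west x
    have h2 := (hB φ).south x
    have h3 := (hB φ).north x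
    have h4 := (hB φ).east x
    simp only [h0, sub_zero] at h1 h2 h3 h4
    exact ⟨by rw [h1, h3], by rw [← h2, h1], h3⟩
  have hker₂ : Module.finrank ℚ (LinearMap.ker bdr) ≤ G.numPieces := by
    refine finrank_le_numPieces (L.comp (Submodule.subtype _)) ?_ ?_ ?_
    · intro x y hxy
      refine Subtype.ext (funext fun c => ?_)
      obtain ⟨⟨u, b⟩, rfl⟩ := Quot.exists_rep c
      have h1 : L x.1 u = L y.1 u := congrFun hxy u
      cases b
      · have h2 := congrFun (LinearMap.mem_ker.1 x.2) u
        have h3 := congrFun (LinearMap.mem_ker.1 y.2) u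
        exact (sub_eq_zero.1 h2).symm.trans (h1.trans (sub_eq_zero.1 h3))
      · exact h1
    · intro x u
      obtain ⟨u, rfl⟩ := G.curve.nxt.symm.surjective u
      rw [apply_symm_apply]
      change L x.1 _ = L x.1 _
      rcases u with i | ⟨a, b⟩
      · exact (hM x.1 i).1.symm
      · have h1 := hcorner x.1 x.2 a
        have h2 : (Sum.inr (a, b) : Pt m G.n) = G.curve.lr a ∨
            (Sum.inr (a, b) : Pt m G.n) = G.curve.rl a := by
          unfold Curve.lr Curve.rl
          by_cases hs : b = decide (G.curve.sgn a = 1)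
          · left; rw [hs]; rfl
          · right; rw [Bool.eq_not_of_ne hs]; rfl
        rcases h2 with h2 | h2 <;> rw [h2]
        · exact h1.1.symm
        · exact h1.2.1.symm
    · intro x a
      change L x.1 _ = L x.1 _
      have h1 := (hcorner x.1 x.2 a).2.2
      unfold Curve.lr Curve.rl at h1
      cases hd : decide (G.curve.sgn a = 1)
      · rw [hd] at h1; exact h1.symm
      · rw [hd] at h1; exact h1
  have hle : LinearMap.range bdr ≤ LinearMap.ker M.transpose.mulVecLin := by
    rintro _ ⟨φ, rfl⟩
    refine LinearMap.mem_ker.2 (funext fun w => ?_)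
    rw [hMβ, Fintype.sum_sum_type, Fintype.sum_prod_type]
    simp only [Fintype.sum_bool, vertex, Sum.map_inl, Sum.map_inr, id]
    rcases w with i | a
    · simp [(hM φ i).2]
    · simp only [reduceCtorEq, if_false, Finset.sum_const_zero, zero_add, Sum.inr.injEq]
      rw [Finset.sum_eq_single a (fun b _ hb => by simp [hb]) (by simp)]
      simp only [if_true, Pi.zero_apply]
      have e1 := G.curve.sum_lr_rl (bdr φ) a
      have e2 := G.curve.sum_lr_rl (fun u => bdr φ (G.curve.nxt.symm u)) a
      simp only [curve_en] at e1 e2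
      linarith [(hB φ).west a, (hB φ).south a, (hB φ).north a, (hB φ).east a]
  have d1 := LinearMap.finrank_range_add_finrank_ker bdr
  have d2 := LinearMap.finrank_range_add_finrank_ker M.mulVecLin
  have d3 := LinearMap.finrank_range_add_finrank_ker M.transpose.mulVecLin
  have d4 := M.rank_transpose
  unfold Matrix.rank at d4
  rw [Module.finrank_fintype_fun_eq_card] at d1 d2 d3
  simp only [Fintype.card_sum, Fintype.card_prod, Fintype.card_fin, Fintype.card_bool] at d2 d3
  have d5 : Fintype.card Q = G.n + 2 * G.numPieces := by
    rw [← Nat.card_eq_fintype_card]; exact hG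
  have heq := Submodule.eq_of_le_of_finrank_le hle (by omega)
  intro β hβ
  have hmem : β ∈ LinearMap.ker M.transpose.mulVecLin := by
    refine LinearMap.mem_ker.2 (funext fun w => ?_)
    have h1 := hβ (fun u => if vertex u = w then 1 else 0) fun x => rfl
    refine Eq.trans ?_ h1
    simp only [Matrix.mulVecLin_apply, Matrix.mulVec, dotProduct, Matrix.transpose_apply, hM']
    exact Finset.sum_congr rfl fun u _ => mul_comm _ _
  rw [← heq] at hmem
  obtain ⟨φ, rfl⟩ := hmem
  exact ⟨L φ, hB φ⟩

end GaussDiagram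

/-! ### Reading the words of a set of arrows -/

namespace Curve

open CyclePos Classical

variable {E X E' X' Y V : Type} {C : Curve E X} {C' : Curve E' X'} {τ : Y ↪ X} {τ' : Y ↪ X'}
  {κ : E → V} {κ' : E' → V} {I : Set V} {W : V → List E} {W' : V → List E'}

/-- Read the elements of the range of an embedding. -/
def read {α β : Type} (j : α ↪ β) (u : β) : Option α := if h : ∃ a, j a = u then some h.choose else none

theorem read_eq_some {α β : Type} {j : α ↪ β} {u : β} {a : α} : read j u = some a ↔ u = j a := by
  unfold read
  split_ifs with h
  · rw [Option.some.injEq]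
    exact ⟨fun hh => by rw [← hh, h.choose_spec], fun hh => j.injective (h.choose_spec.trans hh)⟩
  · simp only [false_iff]
    exact fun hh => h ⟨a, hh.symm⟩

theorem filterMap_read_map {α β : Type} (j : α ↪ β) (l : List α) :
    (l.map j).filterMap (read j) = l := by
  rw [List.filterMap_map]
  have : read j ∘ j = some := funext fun a => read_eq_some.2 rfl
  rw [this, List.filterMap_some]

theorem map_filterMap_read {α β : Type} (j : α ↪ β) (l : List β) :
    (l.filterMap (read j)).map j = l.filter (fun u => u ∈ Set.range j) := by
  induction l with
  | nil => rfl
  | cons u l ih =>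
    by_cases h : u ∈ Set.range j
    · obtain ⟨a, rfl⟩ := h
      rw [List.filterMap_cons_some (read_eq_some.2 rfl), List.filter_cons_of_pos (by simp),
        List.map_cons, ih]
    · have h1 : read j u = none := by
        rw [Option.eq_none_iff_forall_ne_some]
        exact fun a ha => h ⟨a, (read_eq_some.1 ha).symm⟩
      rw [List.filterMap_cons_none h1, List.filter_cons_of_neg (by simpa using h), ih]

theorem read_trans {α β γ : Type} (i : α ↪ β) (j : β ↪ γ) (u : γ) :
    read (i.trans j) u = (read j u).bind (read i) := by
  refine Option.ext fun a => ?_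
  rw [read_eq_some, Option.bind_eq_some_iff]
  constructor
  · rintro rfl
    exact ⟨i a, read_eq_some.2 rfl, read_eq_some.2 rfl⟩
  · rintro ⟨b, h1, h2⟩
    rw [read_eq_some.1 h1, read_eq_some.1 h2]
    rfl

theorem filterMap_read_trans {α β γ : Type} (i : α ↪ β) (j : β ↪ γ) (l : List γ) :
    l.filterMap (read (i.trans j)) = (l.filterMap (read j)).filterMap (read i) := by
  rw [List.filterMap_filterMap]
  exact List.filterMap_congr fun u _ => read_trans i j u

/-- An embedding of arrows, on their endpoints. -/
def ends (τ : Y ↪ X) : Y × Bool ↪ X × Bool := τ.prodMap (Function.Embedding.refl _)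

/-- States are determined by the cyclic words of the endpoints of their arrows. -/
theorem isStateOn_iff_of_isRotated [Finite E] [Finite E'] (h : Words C.nxt κ I W)
    (h' : Words C'.nxt κ' I W')
    (hr : ∀ v ∈ I, (W v).filterMap (read ((ends τ).trans C.en)) ~r
      (W' v).filterMap (read ((ends τ').trans C'.en)))
    {v₀ : V} (hv₀ : v₀ ∈ I) {e : E} {e' : E'} {t : List E} {t' : List E'} (he : W v₀ ~r e :: t)
    (he' : W' v₀ ~r e' :: t')
    (ht : (t ++ [e]).filterMap (read ((ends τ).trans C.en)) =
      (t' ++ [e']).filterMap (read ((ends τ').trans C'.en))) (δ : Bool) (T : Finset Y) :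
    C.IsStateOn κ δ I e (T.map τ) ↔ C'.IsStateOn κ' δ I e' (T.map τ') := by
  have hlab : ∀ y b, κ (C.en (τ y, b)) ∈ I ↔ κ' (C'.en (τ' y, b)) ∈ I := by
    have key : ∀ {E X E' X' : Type} {C : Curve E X} {C' : Curve E' X'} {τ : Y ↪ X} {τ' : Y ↪ X'}
        {κ : E → V} {κ' : E' → V} {W : V → List E} {W' : V → List E'} (_ : Words C.nxt κ I W)
        (_ : Words C'.nxt κ' I W') (_ : ∀ v ∈ I, (W v).filterMap (read ((ends τ).trans C.en)) ~r
          (W' v).filterMap (read ((ends τ').trans C'.en))) (y : Y) (b : Bool),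
        κ (C.en (τ y, b)) ∈ I → κ' (C'.en (τ' y, b)) ∈ I := by
      intro E X E' X' C C' τ τ' κ κ' W W' h h' hr y b hy
      have h1 : (y, b) ∈ (W (κ (C.en (τ y, b)))).filterMap (read ((ends τ).trans C.en)) :=
        List.mem_filterMap.2 ⟨_, (h.mem _ hy _).2 rfl, read_eq_some.2 rfl⟩
      obtain ⟨u, hu, hu'⟩ := List.mem_filterMap.1 ((hr _ hy).mem_iff.1 h1)
      rw [read_eq_some.1 hu'] at hu
      have h2 := (h'.mem _ hy _).1 hu
      change κ' (C'.en (τ' y, b)) = _ at h2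
      rwa [h2]
    exact fun y b => ⟨key h h' hr y b, key h' h (fun v hv => (hr v hv).symm) y b⟩
  -- An arrow with an end outside `I` prevents both sides; the remaining arrows have both ends in
  -- `I`.
  by_cases hT : ∀ y ∈ T, ∀ b, κ (C.en (τ y, b)) ∈ I
  · let ι : {y : Y // ∀ b, κ (C.en (τ y, b)) ∈ I} ↪ Y := Function.Embedding.subtype _
    obtain ⟨T', rfl⟩ : ∃ T', T = T'.map ι :=
      ⟨T.subtype _, (Finset.subtype_map_of_mem hT).symm⟩
    have e1 : (ends ι).trans ((ends τ).trans C.en) = (ends (ι.trans τ)).trans C.en := rfl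
    have e2 : (ends ι).trans ((ends τ').trans C'.en) = (ends (ι.trans τ')).trans C'.en := rfl
    rw [Finset.map_map, Finset.map_map]
    refine isStateOn_iff_of_words h h' (rd := read ((ends (ι.trans τ)).trans C.en))
      (rd' := read ((ends (ι.trans τ')).trans C'.en)) (fun u z => read_eq_some)
      (fun u z => read_eq_some) (fun y b => y.2 b) ?_ hv₀ he he' ?_ δ T'
    · intro v hv
      rw [← e1, ← e2, filterMap_read_trans (ends ι) ((ends τ).trans C.en),
        filterMap_read_trans (ends ι) ((ends τ').trans C'.en)]
      exact IsRotated.filterMap (hr v hv) _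
    · rw [← e1, ← e2, filterMap_read_trans (ends ι) ((ends τ).trans C.en),
        filterMap_read_trans (ends ι) ((ends τ').trans C'.en), ht]
  · refine iff_of_false (fun hs => hT fun y hy b => hs.1 _ (Finset.mem_map_of_mem _ hy) b)
      fun hs => hT fun y hy b => (hlab y b).2 (hs.1 _ (Finset.mem_map_of_mem _ hy) b)

/-- Cyclic words fix the tour but not its start; the base edge of the second curve is chosen so that
the linear words read from both base edges agree. -/
theorem exists_isStateOn_iff_of_isRotated [Finite E] [Finite E'] (h : Words C.nxt κ I W)
    (h' : Words C'.nxt κ' I W')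
    (hr : ∀ v ∈ I, (W v).filterMap (read ((ends τ).trans C.en)) ~r
      (W' v).filterMap (read ((ends τ').trans C'.en))) {e : E} (he : κ e ∈ I) :
    ∃ e', κ' e' = κ e ∧ ∀ (δ : Bool) (T : Finset Y),
      (C.IsStateOn κ δ I e (T.map τ) ↔ C'.IsStateOn κ' δ I e' (T.map τ')) := by
  obtain ⟨t, ht⟩ := exists_isRotated_cons ((h.mem _ he _).2 rfl)
  have h1 := (IsRotated.filterMap (ht.trans (List.isRotated_append (l := [e])))
    (read ((ends τ).trans C.en))).symm.trans (hr _ he)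
  obtain ⟨w, hw, hw'⟩ := exists_filterMap_eq h1
  have hne : w ≠ [] := by
    rintro rfl
    exact h'.ne _ he (List.isRotated_nil_iff.1 hw)
  obtain ⟨t', e', rfl⟩ : ∃ t' e', w = t' ++ [e'] :=
    ⟨w.dropLast, w.getLast hne, (List.dropLast_append_getLast hne).symm⟩
  refine ⟨e', (h'.mem _ he _).1 (hw.mem_iff.2 (by simp)), fun δ T => ?_⟩
  exact isStateOn_iff_of_isRotated h h' hr he ht (hw.trans List.isRotated_append) hw'.symm δ T

theorem isBridge_map_iff {σ : V ≃ V} {T : Finset Y} {D : Curve E' Y} {κ' : E' → V}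
    (h : ∀ y b, κ (C.en (τ y, b)) = σ (κ' (D.en (y, b)))) (a : Y) :
    IsBridge C κ (T.map τ) (τ a) ↔ IsBridge D κ' T a := by
  unfold IsBridge
  simp only [Finset.mem_map, forall_exists_index, and_imp, forall_apply_eq_imp_iff₂, h, ne_eq,
    EmbeddingLike.apply_eq_iff_eq]
  constructor
  · rintro ⟨K, h1, h2⟩
    exact ⟨σ ⁻¹' K, h1, h2⟩
  · rintro ⟨K, h1, h2⟩
    refine ⟨σ.symm ⁻¹' K, ?_, ?_⟩ <;> simpa

theorem bridges_map_eq_empty_iff {σ : V ≃ V} {T : Finset Y} {D : Curve E' Y} {κ' : E' → V}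
    (h : ∀ y b, κ (C.en (τ y, b)) = σ (κ' (D.en (y, b)))) :
    bridges C κ (T.map τ) = ∅ ↔ bridges D κ' T = ∅ := by
  simp only [Finset.eq_empty_iff_forall_notMem, bridges, Finset.mem_filter, not_and]
  constructor
  · exact fun hh y hy hb => hh _ (Finset.mem_map_of_mem _ hy) ((isBridge_map_iff h y).2 hb)
  · intro hh x hx hb
    obtain ⟨y, hy, rfl⟩ := Finset.mem_map.1 hx
    exact hh y hy ((isBridge_map_iff h y).1 hb)

end Curve

namespace ArrowDiagram

open CyclePos Classical Curve

variable {m n N : ℕ} {A : ArrowDiagram m n} {B : ArrowDiagram m N} {s : Fin n → ℤˣ}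

/-! ### States of arrow diagrams -/

theorem filterMap_pts {Y : Type} (τ : Y ↪ Fin n) (i : Fin m) :
    (A.pts i).filterMap (read ((ends τ).trans (A.curve s).en)) =
      (A.word i).filterMap (read (ends τ)) := by
  have h : ∀ (j : Fin n × Bool ↪ Pt m n), j = Function.Embedding.inr →
      (A.pts i).filterMap (read j) = A.word i := by
    rintro j rfl
    unfold pts
    rw [List.filterMap_cons_none]
    · exact filterMap_read_map Function.Embedding.inr (A.word i)
    · rw [Option.eq_none_iff_forall_ne_some]
      intro x hx
      simpa using read_eq_some.1 hx
  rw [filterMap_read_trans (ends τ) (A.curve s).en, h (A.curve s).en rfl]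

/-- The word that is read from a marker. -/
theorem filterMap_base {Y : Type} (τ : Y ↪ Fin n) (i : Fin m) :
    ((A.word i).map Sum.inr ++ [Sum.inl i]).filterMap (read ((ends τ).trans (A.curve s).en)) =
      (A.word i).filterMap (read (ends τ)) := by
  have h0 : read ((ends τ).trans (A.curve s).en) (Sum.inl i) = none := by
    rw [Option.eq_none_iff_forall_ne_some]
    intro x hx
    have := read_eq_some.1 hx
    simp [curve] at this
  rw [← filterMap_pts (s := s), pts, List.filterMap_append, List.filterMap_cons_none h0,
    List.filterMap_cons_none h0, List.filterMap_nil, List.append_nil]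

theorem keep_range (τ : Fin n ↪ Fin N) (l : List (Fin N × Bool)) :
    keep (Set.range τ) l = (l.filterMap (read (ends τ))).map (mapEnd τ) := by
  have h : (mapEnd τ : Fin n × Bool → Fin N × Bool) = ends τ := rfl
  rw [h, map_filterMap_read, keep]
  refine List.filter_congr fun x _ => ?_
  rw [decide_eq_decide]
  constructor
  · rintro ⟨a, ha⟩
    exact ⟨(a, x.2), Prod.ext ha rfl⟩
  · rintro ⟨y, rfl⟩
    exact ⟨y.1, rfl⟩

theorem filterMap_map_mapEnd (τ : Fin n ↪ Fin N) (l : List (Fin n × Bool)) :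
    (l.map (mapEnd τ)).filterMap (read (ends τ)) = l := filterMap_read_map (ends τ) l

theorem filterMap_read_refl (l : List (Fin n × Bool)) :
    l.filterMap (read (ends (Function.Embedding.refl (Fin n)))) = l := by
  have := filterMap_map_mapEnd (Function.Embedding.refl (Fin n)) l
  rwa [show (mapEnd (Function.Embedding.refl (Fin n)) : _ → Fin n × Bool) = id from rfl,
    List.map_id] at this

theorem isHom_iff {σ : Fin m ≃ Fin m} {τ : Fin n ↪ Fin N} :
    IsHom A B σ τ ↔ σ A.base = B.base ∧
      (B.word B.base).filterMap (read (ends τ)) = A.word A.base ∧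
      ∀ i, (B.word (σ i)).filterMap (read (ends τ)) ~r A.word i := by
  constructor
  · rintro ⟨h1, h2, h3⟩
    simp only [keep_range] at h2 h3
    refine ⟨h1, (List.map_injective_iff.2 (ends τ).injective) h2, fun i => ?_⟩
    have h4 := IsRotated.filterMap (h3 i) (read (ends τ))
    rwa [filterMap_map_mapEnd, filterMap_map_mapEnd] at h4
  · rintro ⟨h1, h2, h3⟩
    refine ⟨h1, by rw [keep_range, h2], fun i => ?_⟩
    rw [keep_range]
    exact (h3 i).map _

theorem IsHom.isStateOn_iff {σ : Fin m ≃ Fin m} {τ : Fin n ↪ Fin N} (h : IsHom A B σ τ)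
    (s' : Fin N → ℤˣ) (δ : Bool) (T : Finset (Fin n)) :
    (B.curve s').IsStateOn B.circle δ Set.univ (Sum.inl B.base) (T.map τ) ↔
      (A.curve s).IsStateOn A.circle δ Set.univ (Sum.inl A.base) T := by
  obtain ⟨h1, h2, h3⟩ := isHom_iff.1 h
  have key := isStateOn_iff_of_isRotated (C := B.curve s') (C' := A.curve s) (τ := τ)
    (τ' := Function.Embedding.refl _) B.words (A.words_comp σ) (fun v _ => by
      rw [filterMap_pts, filterMap_pts, filterMap_read_refl]
      have := h3 (σ.symm v)
      rwa [Equiv.apply_symm_apply] at this) (v₀ := B.base) trivial (List.IsRotated.refl _)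
    (by rw [← h1, Equiv.symm_apply_apply]; exact List.IsRotated.refl _)
    (by rw [filterMap_base, filterMap_base, filterMap_read_refl, h2]) δ T
  rw [key, Finset.map_refl]
  unfold IsStateOn
  simp

variable (A) in
theorem bd_univ : (A.curve s).bd Finset.univ = A.boundary := by
  ext u
  rw [bd_apply]
  change (A.curve s).jumpAt Finset.univ (A.succ u) = jump (A.succ u)
  rcases A.succ u with i | ⟨a, b⟩
  · exact (A.curve s).jumpAt_of_forall_ne fun x _ b => by simp [curve]
  · exact (A.curve s).jumpAt_mem (Finset.mem_univ a) b

theorem numBoundary_eq_one_iff : A.numBoundary = 1 ↔ (A.curve s).OneB Finset.univ := by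
  unfold numBoundary OneB
  rw [Nat.card_eq_one_iff_unique, A.bd_univ]
  constructor
  · rintro ⟨h, -⟩ u v
    exact Quotient.exact (Subsingleton.elim (α := Quotient (Perm.SameCycle.setoid A.boundary))
      (Quotient.mk _ u) (Quotient.mk _ v))
  · intro h
    refine ⟨⟨fun a b => ?_⟩, ⟨Quotient.mk _ (Sum.inl A.base)⟩⟩
    induction a using Quotient.inductionOn
    induction b using Quotient.inductionOn
    exact Quotient.sound (h _ _)

/-- The condition on all times reduces to one on the least times, which are positions on the
boundary. The tour starts at a marker, so time 0, which positions ignore, plays no role. -/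
theorem forall_tour_iff (h : (A.curve s).OneB Finset.univ) (δ : Bool) :
    (∀ a k, A.tour k = Sum.inr (a, !δ) → ∃ j < k, A.tour j = Sum.inr (a, δ)) ↔
      ∀ a, (A.curve s).fst Finset.univ (Sum.inl A.base) a = δ := by
  have hb := A.bd_univ (s := s)
  have hs : ∀ u v, A.boundary.SameCycle u v := by rw [← hb]; exact h
  refine forall_congr' fun a => ?_
  have h0 : ∀ {j x}, A.tour j = Sum.inr x → 0 < j := by
    intro j x hj
    rcases Nat.eq_zero_or_pos j with rfl | h0
    · simp [tour] at hj
    · exact h0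
  have hlt : (A.curve s).fst Finset.univ (Sum.inl A.base) a = δ ↔
      pos A.boundary (Sum.inl A.base) (Sum.inr (a, δ)) <
        pos A.boundary (Sum.inl A.base) (Sum.inr (a, !δ)) := by
    constructor
    · intro hf
      refine lt_of_le_of_ne ?_ fun he => ?_
      · rw [Curve.fst, hb] at hf
        cases δ
        · simpa [curve] using hf
        · exact (of_decide_eq_true hf).le
      · have := pos_inj (hs _ _) (hs _ _) he
        cases δ <;> simp at this
    · intro hf
      exact (A.curve s).fst_eq (by rw [hb]; exact hf)
  rw [hlt]
  constructor
  · intro hk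
    obtain ⟨j, hj, hj'⟩ := hk _ (pos_spec (hs _ _)).2
    exact (pos_le (h0 hj') hj').trans_lt hj
  · intro hp k hk
    exact ⟨_, hp.trans_le (pos_le (h0 hk) hk), (pos_spec (hs _ _)).2⟩

/-- The boundary of the surface never leaves a connected component of the graph. -/
theorem connected_of_oneB {S : Finset (Fin n)} (h : (A.curve s).OneB S) :
    (A.graph (S : Set (Fin n))).Connected := by
  have : Nonempty (Fin m) := ⟨A.base⟩
  refine ⟨fun i j => ?_⟩
  let κ : Pt m n → (A.graph (S : Set (Fin n))).ConnectedComponent := fun u =>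
    (A.graph (S : Set (Fin n))).connectedComponentMk (A.circle u)
  have hκ : ∀ u, κ ((A.curve s).nxt u) = κ u := fun u =>
    congrArg (A.graph (S : Set (Fin n))).connectedComponentMk (A.circle_succ u)
  have hS : ∀ a ∈ S, κ (Sum.inr (a, true)) = κ (Sum.inr (a, false)) := by
    intro a ha
    refine SimpleGraph.ConnectedComponent.sound ?_
    by_cases hc : A.circle (Sum.inr (a, true)) = A.circle (Sum.inr (a, false))
    · rw [hc]
    · exact ((SimpleGraph.fromRel_adj _ _ _).2 ⟨hc, Or.inl ⟨a, ha, Or.inl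
        ⟨A.circle_eq_iff.1 rfl, A.circle_eq_iff.1 rfl⟩⟩⟩).reachable
  have h1 := mem_iff_of_sameCycle (I := {κ (Sum.inl j)}) (mem_bd_iff hκ fun a ha => by
    change κ (Sum.inr (a, true)) ∈ _ ↔ κ (Sum.inr (a, false)) ∈ _
    rw [hS a ha]) (h (Sum.inl i) (Sum.inl j))
  exact SimpleGraph.ConnectedComponent.exact (h1.2 rfl)

/-- If the graph is disconnected without `a`, the circles that are reachable from the tail of `a`
without using `a` form the separating set of a bridge. -/
theorem isIrreducible_iff (h : A.IsConnected) :
    A.IsIrreducible ↔ (A.curve s).bridges A.circle Finset.univ = ∅ := by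
  have hjoin : ∀ {a i j}, A.Joins a i j →
      (A.circle (Sum.inr (a, true)) = i ∧ A.circle (Sum.inr (a, false)) = j) ∨
        (A.circle (Sum.inr (a, true)) = j ∧ A.circle (Sum.inr (a, false)) = i) := by
    rintro a i j (⟨h1, h2⟩ | ⟨h1, h2⟩)
    · exact Or.inl ⟨A.circle_eq_iff.2 h1, A.circle_eq_iff.2 h2⟩
    · exact Or.inr ⟨A.circle_eq_iff.2 h1, A.circle_eq_iff.2 h2⟩
  have hK : ∀ {S : Set (Fin n)} {K : Set (Fin m)}, (∀ a ∈ S, A.circle (Sum.inr (a, true)) ∈ K ↔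
      A.circle (Sum.inr (a, false)) ∈ K) → ∀ {i j}, (A.graph S).Reachable i j → (i ∈ K ↔ j ∈ K) := by
    intro S K hS i j hij
    rw [SimpleGraph.reachable_iff_reflTransGen] at hij
    induction hij with
    | refl => rfl
    | tail _ h2 ih =>
      rw [ih]
      rcases (SimpleGraph.fromRel_adj _ _ _).1 h2 with ⟨-, ⟨a, ha, h3⟩ | ⟨a, ha, h3⟩⟩ <;>
        rcases hjoin h3 with ⟨rfl, rfl⟩ | ⟨rfl, rfl⟩ <;>
        simp [hS a ha]
  unfold IsIrreducible
  simp only [Finset.eq_empty_iff_forall_notMem, bridges, Finset.mem_filter, Finset.mem_univ,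
    true_and]
  refine forall_congr' fun a => ?_
  constructor
  · rintro hc ⟨K, h1, h2⟩
    have h3 := hK (S := {a}ᶜ) (fun b hb => h2 b (Finset.mem_univ b) hb)
      (hc.preconnected (A.circle (Sum.inr (a, true))) (A.circle (Sum.inr (a, false))))
    exact iff_not_self (h3.symm.trans h1)
  · intro hb
    have : Nonempty (Fin m) := ⟨A.base⟩
    let K : Set (Fin m) := {i | (A.graph {a}ᶜ).Reachable (A.circle (Sum.inr (a, true))) i}
    have h1 : ∀ b, b ≠ a → (A.circle (Sum.inr (b, true)) ∈ K ↔ A.circle (Sum.inr (b, false)) ∈ K) := by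
      intro b hb
      have h2 : (A.graph {a}ᶜ).Reachable (A.circle (Sum.inr (b, true)))
          (A.circle (Sum.inr (b, false))) := by
        by_cases hc : A.circle (Sum.inr (b, true)) = A.circle (Sum.inr (b, false))
        · rw [hc]
        · exact ((SimpleGraph.fromRel_adj _ _ _).2 ⟨hc, Or.inl ⟨b, hb, Or.inl
            ⟨A.circle_eq_iff.1 rfl, A.circle_eq_iff.1 rfl⟩⟩⟩).reachable
      exact ⟨fun h3 => h3.trans h2, fun h3 => h3.trans h2.symm⟩
    have ht : A.circle (Sum.inr (a, true)) ∈ K := SimpleGraph.Reachable.refl _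
    have hh : A.circle (Sum.inr (a, false)) ∈ K := by
      by_contra hh
      exact hb ⟨K, iff_of_true ht hh, fun b _ hb => h1 b hb⟩
    have hall : ∀ i, i ∈ K := fun i => (hK (S := Set.univ) (K := K) (fun b _ => by
      by_cases hba : b = a
      · subst hba; exact iff_of_true ht hh
      · exact h1 b hba) (h.preconnected _ i)).1 ht
    exact ⟨fun i j => (hall i).symm.trans (hall j)⟩

/-- Connectedness comes for free with a single boundary component. -/
theorem inState_iff (δ : Bool) :
    (A.IsConnected ∧ A.numBoundary = 1 ∧
      ∀ a k, A.tour k = Sum.inr (a, !δ) → ∃ j < k, A.tour j = Sum.inr (a, δ)) ↔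
      (A.curve s).IsStateOn A.circle δ Set.univ (Sum.inl A.base) Finset.univ := by
  rw [isStateOn_univ (I := Set.univ) (fun _ => trivial), numBoundary_eq_one_iff (s := s)]
  unfold IsState
  constructor
  · rintro ⟨-, h1, h2⟩
    exact ⟨h1, fun a _ => (forall_tour_iff h1 δ).1 h2 a⟩
  · rintro ⟨h1, h2⟩
    refine ⟨?_, h1, (forall_tour_iff h1 δ).2 fun a => h2 a (Finset.mem_univ a)⟩
    have := connected_of_oneB h1
    rwa [Finset.coe_univ] at this

theorem inA_iff : A.InA ↔
    (A.curve s).IsStateOn A.circle true Set.univ (Sum.inl A.base) Finset.univ :=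
  inState_iff true

theorem inD_iff : A.InD ↔
    (A.curve s).IsStateOn A.circle false Set.univ (Sum.inl A.base) Finset.univ :=
  inState_iff false

end ArrowDiagram

namespace ArrowDiagram

open CyclePos Classical Curve

variable {m n N : ℕ} {A A' : ArrowDiagram m n} {B : ArrowDiagram m N}

/-! ### Homomorphisms and states -/

/-- Homomorphisms from a connected diagram are determined by their images. -/
theorem IsHom.eq_of_map_eq (hA : A.IsConnected) {σ σ' : Fin m ≃ Fin m} {τ τ' : Fin n ↪ Fin N}
    (h : IsHom A B σ τ) (h' : IsHom A B σ' τ') (hr : Set.range τ = Set.range τ') :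
    σ = σ' ∧ τ = τ' := by
  have hb : ∀ i, σ i = σ' i ∧ ∀ x ∈ A.word i, τ x.1 = τ' x.1 := by
    intro i
    have hi := hA.preconnected A.base i
    rw [SimpleGraph.reachable_iff_reflTransGen] at hi
    induction hi with
    | refl =>
      refine ⟨h.base.trans h'.base.symm, fun x hx => ?_⟩
      have h1 := h.word_base.symm.trans (hr ▸ h'.word_base)
      have h2 := List.map_inj_left.1 h1 x hx
      exact congrArg Prod.fst h2
    | @tail i j _ hij ih =>
      obtain ⟨a, b, hi, hj⟩ : ∃ a b, (a, b) ∈ A.word i ∧ (a, !b) ∈ A.word j := by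
        rcases (SimpleGraph.fromRel_adj _ _ _).1 hij with
          ⟨-, ⟨a, -, ⟨h1, h2⟩ | ⟨h1, h2⟩⟩ | ⟨a, -, ⟨h1, h2⟩ | ⟨h1, h2⟩⟩⟩
        · exact ⟨a, true, h1, h2⟩
        · exact ⟨a, false, h2, h1⟩
        · exact ⟨a, false, h2, h1⟩
        · exact ⟨a, true, h1, h2⟩
      -- The maps agree on the circle `i`, hence on the arrow `a` from there to `j`. One common
      -- letter fixes the rotation of the cyclic word of `j`, and with it all arrows on `j`.
      have ha : τ a = τ' a := ih.2 _ hi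
      have hw := h.word j
      have hw' := h'.word j
      rw [← hr] at hw'
      have hmem : ∀ {σ : Fin m ≃ Fin m} {τ₁ : Fin n ↪ Fin N},
          keep (Set.range τ) (B.word (σ j)) ~r (A.word j).map (mapEnd τ₁) →
          (τ₁ a, !b) ∈ B.word (σ j) := fun {σ τ₁} hw => by
        have : (τ₁ a, !b) ∈ keep (Set.range τ) (B.word (σ j)) :=
          hw.mem_iff.2 (List.mem_map.2 ⟨_, hj, rfl⟩)
        exact (List.mem_filter.1 this).1
      have hσ : σ j = σ' j := B.eq_of_mem_word (hmem hw) (by rw [ha]; exact hmem hw')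
      refine ⟨hσ, ?_⟩
      rw [← hσ] at hw'
      obtain ⟨t, ht⟩ := exists_isRotated_cons hj
      have h1 := ((ht.map (mapEnd τ)).symm.trans hw.symm).trans (hw'.trans (ht.map (mapEnd τ')))
      rw [List.map_cons, List.map_cons] at h1
      have h2 : mapEnd τ (a, !b) = mapEnd τ' (a, !b) := Prod.ext ha rfl
      rw [h2] at h1
      have h3 := eq_of_cons_isRotated h1 (by
        rw [← h2, ← List.map_cons]
        exact (ht.nodup_iff.1 (A.word_nodup j)).map (ends τ).injective)
      intro x hx
      rcases List.mem_cons.1 (ht.mem_iff.1 hx) with rfl | hx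
      · exact ha
      · exact congrArg Prod.fst (List.map_inj_left.1 h3 x hx)
  refine ⟨Equiv.ext fun i => (hb i).1, DFunLike.ext _ _ fun a => ?_⟩
  obtain ⟨i, hi⟩ := A.exists_mem_word (a, true)
  exact (hb i).2 _ hi

theorem IsHom.trans {A B : ArrowDiagram m n} {C : ArrowDiagram m N} {σ σ' : Fin m ≃ Fin m}
    {τ : Fin n ↪ Fin n} {τ' : Fin n ↪ Fin N} (h : IsHom A B σ τ) (h' : IsHom B C σ' τ') :
    IsHom A C (σ.trans σ') (τ.trans τ') := by
  rw [isHom_iff] at *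
  obtain ⟨h1, h2, h3⟩ := h
  obtain ⟨h1', h2', h3'⟩ := h'
  have he : ends (τ.trans τ') = (ends τ).trans (ends τ') := rfl
  refine ⟨by simp [h1, h1'], ?_, fun i => ?_⟩
  · rw [he, filterMap_read_trans, h2', h2]
  · rw [he, filterMap_read_trans]
    exact (IsRotated.filterMap (h3' (σ i)) _).trans (h3 i)

theorem IsHom.iso_of_range_eq {σ σ' : Fin m ≃ Fin m} {τ τ' : Fin n ↪ Fin N} (h : IsHom A B σ τ)
    (h' : IsHom A' B σ' τ') (hr : Set.range τ = Set.range τ') : Iso A A' := by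
  choose ρ hρ using fun a => (hr ▸ Set.mem_range_self a : τ a ∈ Set.range τ')
  have hρi : Function.Injective ρ := fun a b hab => τ.injective (by rw [← hρ, hab, hρ])
  let r : Fin n ↪ Fin n := ⟨ρ, hρi⟩
  have hτ : τ = r.trans τ' := DFunLike.ext _ _ fun a => (hρ a).symm
  rw [isHom_iff] at h h'
  obtain ⟨h1, h2, h3⟩ := h
  obtain ⟨h1', h2', h3'⟩ := h'
  have he : ends τ = (ends r).trans (ends τ') := by rw [hτ]; rfl
  refine ⟨σ.trans σ'.symm, r, isHom_iff.2 ⟨?_, ?_, fun i => ?_⟩⟩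
  · simp [h1, ← h1']
  · rw [← h2', ← filterMap_read_trans, ← he, h2]
  · have h4 := h3' (σ'.symm (σ i))
    rw [Equiv.apply_symm_apply] at h4
    have h5 := IsRotated.filterMap h4 (read (ends r))
    rw [← filterMap_read_trans, ← he] at h5
    exact h5.symm.trans (h3 i)

/-- The subdiagram with the given arrows. -/
def sub (B : ArrowDiagram m N) (τ : Fin n ↪ Fin N) : ArrowDiagram m n where
  word i := (B.word i).filterMap (read (ends τ))
  base := B.base
  complete x := by
    rw [← B.complete (ends τ x)]
    refine Finset.sum_congr rfl fun i _ => ?_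
    rw [List.count_filterMap, List.count]
    refine List.countP_congr fun y _ => ?_
    rw [beq_iff_eq, beq_iff_eq, read_eq_some]

theorem isHom_sub (B : ArrowDiagram m N) (τ : Fin n ↪ Fin N) : IsHom (B.sub τ) B (Equiv.refl _) τ :=
  isHom_iff.2 ⟨rfl, rfl, fun _ => List.IsRotated.refl _⟩

end ArrowDiagram

/-! ### Pairings as sums over sets of arrows -/

namespace GaussDiagram

open ArrowDiagram CyclePos Classical Curve

variable {m n : ℕ} {G : GaussDiagram m}

/-- Sums of pairings are sums over sets of arrows. -/
theorem pairingSum_eq {P : ArrowDiagram m n → Prop} {Q : Finset (Fin G.n) → Prop} [DecidablePred Q]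
    (hP : ∀ A, P A → A.IsConnected)
    (hQ : ∀ A σ τ, IsHom A G.toArrow σ τ → (P A ↔ Q (Finset.univ.map τ))) :
    pairingSum P G = ∑ S : Finset (Fin G.n) with S.card = n ∧ Q S, ∏ a ∈ S, (G.sign a : ℤ) := by
  unfold pairingSum pairing
  rw [Finset.sum_sigma']
  have hrange : ∀ {τ τ' : Fin n ↪ Fin G.n}, Finset.univ.map τ = Finset.univ.map τ' →
      Set.range τ = Set.range τ' := fun {τ τ'} h => by
    have := congrArg (fun s : Finset (Fin G.n) => (s : Set (Fin G.n))) h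
    simpa using this
  refine Finset.sum_bij (fun x _ => Finset.univ.map x.2.2) ?_ ?_ ?_ ?_
  · rintro ⟨q, σ, τ⟩ hx
    simp only [Finset.mem_sigma, Finset.mem_filter, Finset.mem_univ, true_and] at hx ⊢
    exact ⟨by simp, (hQ _ _ _ hx.2).1 hx.1⟩
  · rintro ⟨q, σ, τ⟩ hx ⟨q', σ', τ'⟩ hx' hh
    simp only [Finset.mem_sigma, Finset.mem_filter, Finset.mem_univ, true_and] at hx hx'
    have h1 := hrange hh
    have h2 : q = q' := by
      rw [← q.out_eq, ← q'.out_eq]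
      exact Quotient.sound (hx.2.iso_of_range_eq hx'.2 h1)
    subst h2
    obtain ⟨rfl, rfl⟩ := hx.2.eq_of_map_eq (hP _ hx.1) hx'.2 h1
    rfl
  · intro S hS
    simp only [Finset.mem_filter, Finset.mem_univ, true_and] at hS
    obtain ⟨hc, hS⟩ := hS
    -- The set `S` is the image of the subdiagram formed by its arrows, transported to the chosen
    -- representative of the isomorphism class.
    let τ : Fin n ↪ Fin G.n := (S.orderEmbOfFin hc).toEmbedding
    have hτ : Finset.univ.map τ = S := by
      ext a
      have := S.range_orderEmbOfFin hc
      simp only [Finset.mem_map, Finset.mem_univ, true_and]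
      rw [← Finset.mem_coe, ← this]
      rfl
    obtain ⟨σ, ρ, hρ⟩ := Quotient.mk_out (s := isoSetoid m n) (G.toArrow.sub τ)
    have h1 := hρ.trans (G.toArrow.isHom_sub τ)
    have h2 : Finset.univ.map (ρ.trans τ) = S := by
      rw [← Finset.map_map, ← hτ]
      congr 1
      exact Finset.eq_univ_of_card _ (by simp)
    refine ⟨⟨Quotient.mk _ (G.toArrow.sub τ), σ.trans (Equiv.refl _), ρ.trans τ⟩, ?_, h2⟩
    simp only [Finset.mem_sigma, Finset.mem_filter, Finset.mem_univ, true_and]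
    exact ⟨(hQ _ _ _ h1).2 (by rwa [h2]), h1⟩
  · rintro ⟨q, σ, τ⟩ hx
    rw [Finset.prod_map]

/-- The state sum of a Gauss diagram, with bridges counted by the outer variable. -/
def bridgePoly (G : GaussDiagram m) (δ : Bool) : ℤ[X][X] :=
  G.curve.bridgePoly G.toArrow.circle δ Set.univ (Sum.inl G.toArrow.base)

theorem coeff_sum_weight (Q : Finset (Fin G.n) → Prop) [DecidablePred Q] (n : ℕ) :
    (∑ S : Finset (Fin G.n) with Q S, G.curve.weight S).coeff n =
      ∑ S : Finset (Fin G.n) with S.card = n ∧ Q S, ∏ a ∈ S, (G.sign a : ℤ) := by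
  rw [finsetSum_coeff]
  simp only [and_comm (b := Q _)]
  rw [← Finset.filter_filter, Finset.sum_filter _ _ (s := Finset.filter _ _)]
  refine Finset.sum_congr rfl fun S _ => ?_
  have : G.curve.weight S = Polynomial.C (∏ a ∈ S, (G.sign a : ℤ)) * Polynomial.X ^ S.card := by
    rw [Curve.weight, Finset.prod_mul_distrib, Finset.prod_const, map_prod]
    rfl
  rw [this, coeff_C_mul_X_pow]
  simp only [eq_comm]

/-- Homomorphisms carry irreducible diagrams to states without bridges. These are selected by the
value 0 of the outer variable, while the value 1 counts all states. -/
theorem pairingSum_irreducible {δ : Bool} {P : ArrowDiagram m n → Prop}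
    (hP : ∀ A, P A ↔ (A.curve 1).IsStateOn A.circle δ Set.univ (Sum.inl A.base) Finset.univ)
    (hc : ∀ A, P A → A.IsConnected) :
    pairingSum (fun A => P A ∧ A.IsIrreducible) G = ((G.bridgePoly δ).eval 0).coeff n ∧
    pairingSum (fun A => P A ∧ ¬ A.IsIrreducible) G =
      ((G.bridgePoly δ).eval 1).coeff n - ((G.bridgePoly δ).eval 0).coeff n := by
  have h1 : ∀ A σ τ, IsHom A G.toArrow σ τ → (P A ↔ G.curve.IsStateOn G.toArrow.circle δ Set.univ
      (Sum.inl G.toArrow.base) (Finset.univ.map τ)) := fun A σ τ h =>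
    (hP A).trans (h.isStateOn_iff G.sign δ Finset.univ).symm
  have h2 : ∀ A σ τ, IsHom A G.toArrow σ τ → P A → (A.IsIrreducible ↔
      G.curve.bridges G.toArrow.circle (Finset.univ.map τ) = ∅) := fun A σ τ h hA => by
    rw [isIrreducible_iff (s := 1) (hc A hA), bridges_map_eq_empty_iff (σ := σ) fun a b => ?_]
    refine G.toArrow.circle_eq_iff.2 ?_
    have h3 : (τ a, b) ∈ keep (Set.range τ) (G.toArrow.word (σ (A.circle (Sum.inr (a, b))))) :=
      (h.word _).mem_iff.2 (List.mem_map.2 ⟨(a, b), A.circle_eq_iff.1 rfl, rfl⟩)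
    exact (List.mem_filter.1 h3).1
  have e0 : pairingSum (fun A => P A ∧ A.IsIrreducible) G = ((G.bridgePoly δ).eval 0).coeff n := by
    rw [bridgePoly, eval_zero_bridgePoly]
    have hs := pairingSum_eq (G := G) (n := n) (P := fun A => P A ∧ A.IsIrreducible)
      (Q := fun S => G.curve.IsStateOn G.toArrow.circle δ Set.univ (Sum.inl G.toArrow.base) S ∧
        G.curve.bridges G.toArrow.circle S = ∅) (fun A hA => hc A hA.1) fun A σ τ h =>
      (and_congr_right (h2 A σ τ h)).trans (and_congr_left fun _ => h1 A σ τ h)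
    convert hs.trans (coeff_sum_weight _ n).symm
  have e1 : pairingSum P G = ((G.bridgePoly δ).eval 1).coeff n := by
    rw [bridgePoly, eval_one_bridgePoly, stateSumOn]
    refine Eq.trans ?_ (coeff_sum_weight (G := G) _ n).symm
    exact pairingSum_eq hc h1
  refine ⟨e0, ?_⟩
  rw [← e0, ← e1, eq_sub_iff_add_eq, add_comm]
  unfold pairingSum
  rw [Finset.sum_filter, Finset.sum_filter, Finset.sum_filter, ← Finset.sum_add_distrib]
  refine Finset.sum_congr rfl fun q _ => ?_
  by_cases h3 : P q.out <;> by_cases h4 : q.out.IsIrreducible <;> simp [h3, h4]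

theorem AIr_eq : G.AIr n = ((G.bridgePoly true).eval 0).coeff n :=
  (pairingSum_irreducible (fun _ => inA_iff) fun _ h => h.1).1

theorem DIr_eq : G.DIr n = ((G.bridgePoly false).eval 0).coeff n :=
  (pairingSum_irreducible (fun _ => inD_iff) fun _ h => h.1).1

theorem ARed_eq : G.ARed n =
    ((G.bridgePoly true).eval 1).coeff n - ((G.bridgePoly true).eval 0).coeff n :=
  (pairingSum_irreducible (fun _ => inA_iff) fun _ h => h.1).2

theorem DRed_eq : G.DRed n =
    ((G.bridgePoly false).eval 1).coeff n - ((G.bridgePoly false).eval 0).coeff n :=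
  (pairingSum_irreducible (fun _ => inD_iff) fun _ h => h.1).2

end GaussDiagram

namespace CyclePos

/-- An exchange of two neighbours is invisible if at most one of them is read. -/
theorem filterMap_swap {α β : Type} [DecidableEq α] {g : α → Option β} {p q : α} {w : List α}
    (hn : w.Nodup) (hw : [p, q] <:+: w ∨ [q, p] <:+: w ∨ (p ∉ w ∧ q ∉ w))
    (h : g p = none ∨ g q = none) : w.filterMap (fun x => g (swap p q x)) = w.filterMap g := by
  have hfix : ∀ {p q : α} (l : List α), p ∉ l → q ∉ l →
      l.filterMap (fun x => g (swap p q x)) = l.filterMap g := fun l hp hq =>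
    List.filterMap_congr fun x hx => by
      rw [swap_apply_of_ne_of_ne (fun h => hp (by rwa [← h])) fun h => hq (by rwa [← h])]
  have key : ∀ {p q : α}, [p, q] <:+: w → (g p = none ∨ g q = none) →
      w.filterMap (fun x => g (swap p q x)) = w.filterMap g := by
    rintro p q ⟨a, b, rfl⟩ h
    have hn' : (p ∉ a ∧ q ∉ a) ∧ p ∉ b ∧ q ∉ b := by
      simp only [List.append_assoc, List.cons_append, List.nil_append, List.nodup_append,
        List.nodup_cons, List.mem_cons] at hn
      grind
    simp only [List.filterMap_append, hfix a hn'.1.1 hn'.1.2, hfix b hn'.2.1 hn'.2.2]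
    have h1 : [p, q].filterMap (fun x => g (swap p q x)) = [p, q].filterMap g := by
      rcases h with h | h <;> cases hp : g p <;> cases hq : g q <;> simp_all
    rw [h1]
  rcases hw with hw | hw | hw
  · exact key hw h
  · rw [swap_comm]
    exact key hw h.symm
  · exact hfix w hw.1 hw.2

end CyclePos

namespace Curve

open CyclePos Classical

variable {E X E' X' Y V : Type} {C : Curve E X} {C' : Curve E' X'} {κ : E → V} {κ' : E' → V}

/-! ### Sublinks with the same state sums and linking numbers -/

/-- The sum over the states with the property `q`. -/
def stateSumWith [Fintype X] (C : Curve E X) (κ : E → V) (δ : Bool) (I : Set V) (e : E)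
    (q : Finset X → Prop) : ℤ[X] :=
  ∑ S : Finset X with C.IsStateOn κ δ I e S ∧ q S, C.weight S

theorem stateSumWith_congr [Fintype X] {δ : Bool} {I : Set V} {e : E} {q q' : Finset X → Prop}
    (h : ∀ S, C.IsStateOn κ δ I e S → (q S ↔ q' S)) :
    C.stateSumWith κ δ I e q = C.stateSumWith κ δ I e q' := by
  refine Finset.sum_congr ?_ fun _ _ => rfl
  ext S
  simp only [Finset.mem_filter, Finset.mem_univ, true_and]
  exact and_congr_right (h S)

theorem stateSumOn_eq_stateSumWith [Fintype X] {δ : Bool} {I : Set V} {e : E}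
    {q : Finset X → Prop} (h : ∀ S, C.IsStateOn κ δ I e S → q S) :
    C.stateSumOn κ δ I e = C.stateSumWith κ δ I e q := by
  rw [stateSumWith_congr (q' := fun _ => True) fun S hS => iff_true_intro (h S hS)]
  unfold stateSumOn stateSumWith weight
  simp only [and_true]

theorem stateSumWith_add [Fintype X] {δ : Bool} {I : Set V} {e : E} (q : Finset X → Prop) :
    C.stateSumOn κ δ I e = C.stateSumWith κ δ I e q + C.stateSumWith κ δ I e fun S => ¬ q S := by
  unfold stateSumOn stateSumWith weight
  rw [Finset.sum_filter, Finset.sum_filter, Finset.sum_filter, ← Finset.sum_add_distrib]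
  refine Finset.sum_congr rfl fun S _ => ?_
  by_cases h1 : C.IsStateOn κ δ I e S <;> by_cases h2 : q S <;> simp [h1, h2]

theorem stateSumWith_eq_sum [Fintype X] [Fintype Y] (τ : Y ↪ X) {δ : Bool} {I : Set V} {e : E}
    {q : Finset X → Prop} (hq : ∀ S, q S ↔ ∀ a ∈ S, a ∈ Set.range τ) :
    C.stateSumWith κ δ I e q =
      ∑ T : Finset Y with C.IsStateOn κ δ I e (T.map τ),
        ∏ y ∈ T, ((C.sgn (τ y) : ℤ) : ℤ[X]) * Polynomial.X := by
  symm
  refine Finset.sum_bij (fun T _ => T.map τ) ?_ ?_ ?_ ?_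
  · intro T hT
    simp only [Finset.mem_filter, Finset.mem_univ, true_and] at hT ⊢
    refine ⟨hT, (hq _).2 fun a ha => ?_⟩
    obtain ⟨y, -, rfl⟩ := Finset.mem_map.1 ha
    exact ⟨y, rfl⟩
  · exact fun T _ T' _ h => Finset.map_injective τ h
  · intro S hS
    simp only [Finset.mem_filter, Finset.mem_univ, true_and] at hS
    have h1 := (hq S).1 hS.2
    have h2 : (Finset.univ.filter fun y => τ y ∈ S).map τ = S := by
      ext a
      simp only [Finset.mem_map, Finset.mem_filter, Finset.mem_univ, true_and]
      constructor
      · rintro ⟨y, hy, rfl⟩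
        exact hy
      · intro ha
        obtain ⟨y, rfl⟩ := h1 a ha
        exact ⟨y, ha, rfl⟩
    refine ⟨_, ?_, h2⟩
    simp only [Finset.mem_filter, Finset.mem_univ, true_and]
    rw [h2]
    exact hS.1
  · intro T _
    rw [weight, Finset.prod_map]

theorem stateSumWith_eq [Fintype X] [Fintype X'] [Fintype Y] (τ : Y ↪ X) (τ' : Y ↪ X') {δ : Bool}
    {I : Set V} {e : E} {e' : E'} {q : Finset X → Prop} {q' : Finset X' → Prop}
    (hq : ∀ S, q S ↔ ∀ a ∈ S, a ∈ Set.range τ) (hq' : ∀ S, q' S ↔ ∀ a ∈ S, a ∈ Set.range τ')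
    (hs : ∀ y, C.sgn (τ y) = C'.sgn (τ' y))
    (h : ∀ T : Finset Y, C.IsStateOn κ δ I e (T.map τ) ↔ C'.IsStateOn κ' δ I e' (T.map τ')) :
    C.stateSumWith κ δ I e q = C'.stateSumWith κ' δ I e' q' := by
  rw [stateSumWith_eq_sum τ hq, stateSumWith_eq_sum τ' hq']
  simp only [h, hs]

/-- The contribution of a crossing to the linking numbers. -/
def lkTerm (C : Curve E X) (κ : E → V) (K J : Set V) (a : X) : ℤ :=
  if κ (C.en (a, true)) ∈ K ∧ κ (C.en (a, false)) ∈ J then (C.sgn a : ℤ) else 0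

theorem lkSum_eq_sum [Fintype X] (K J : Set V) : C.lkSum κ K J = ∑ a, C.lkTerm κ K J a := by
  rw [lkSum, Finset.sum_filter]
  rfl

/-- Corresponding sublinks have the same state sums and linking numbers. -/
structure SameSums [Fintype X] [Fintype X'] (C : Curve E X) (κ : E → V) (C' : Curve E' X')
    (κ' : E' → V) : Prop where
  sum : ∀ I : Set V, I.Nonempty → ∃ e e' δ, κ e ∈ I ∧ κ' e' ∈ I ∧
    C.stateSumOn κ δ I e = C'.stateSumOn κ' δ I e'
  lk : ∀ K J : Set V, Disjoint K J → C.lkSum κ K J = C'.lkSum κ' K J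

variable [Fintype E] [Fintype X] [Fintype E'] [Fintype X']

theorem SameSums.stateSumOn_eq (h : SameSums C κ C' κ') (hC : C.Planar) (hC' : C'.Planar)
    (hκ : ∀ u, κ (C.nxt u) = κ u) (hκ' : ∀ u, κ' (C'.nxt u) = κ' u) (δ δ' : Bool) {I : Set V}
    {e : E} {e' : E'} (he : κ e ∈ I) (he' : κ' e' ∈ I) :
    C.stateSumOn κ δ I e = C'.stateSumOn κ' δ' I e' := by
  obtain ⟨e₁, e₁', δ₁, h1, h1', h2⟩ := h.sum I ⟨_, he⟩
  rw [hC.stateSumOn_eq hκ δ δ₁ he h1, h2, hC'.stateSumOn_eq hκ' δ₁ δ' h1' he']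

theorem Planar.exists_isLinkSum (hC : C.Planar) (hκ : ∀ u, κ (C.nxt u) = κ u)
    (hs : Function.Surjective κ) : ∃ A, C.IsLinkSum κ A fun K J => C.lkSum κ K J := by
  refine ⟨fun I => if hI : ∃ e, κ e ∈ I then C.stateSumOn κ true I hI.choose else 0, hκ, hs,
    fun δ I e he => ?_, fun _ _ _ => rfl, fun K J => hC.lkSum_comm hκ K J⟩
  have hI : ∃ e, κ e ∈ I := ⟨e, he⟩
  rw [dif_pos hI]
  exact hC.stateSumOn_eq hκ δ true (Finset.mem_coe.2 he) (Finset.mem_coe.2 hI.choose_spec)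

/-- Both curves satisfy `IsLinkSum` with the same data, and these determine the polynomial for every
base edge and direction. -/
theorem SameSums.bridgePoly_eq [Fintype V] (h : SameSums C κ C' κ') (hC : C.Planar)
    (hC' : C'.Planar) (hκ : ∀ u, κ (C.nxt u) = κ u) (hκ' : ∀ u, κ' (C'.nxt u) = κ' u)
    (hs : Function.Surjective κ) (hs' : Function.Surjective κ') (δ δ' : Bool) (e : E) (e' : E') :
    C.bridgePoly κ δ Set.univ e = C'.bridgePoly κ' δ' Set.univ e' := by
  obtain ⟨A, a⟩ := hC.exists_isLinkSum hκ hs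
  have b : C'.IsLinkSum κ' A fun K J => C.lkSum κ K J := by
    refine ⟨hκ', hs', fun δ₁ I e' he' => ?_, fun K J hKJ => ?_, fun K J => hC.lkSum_comm hκ K J⟩
    · obtain ⟨e, he⟩ := hs (κ' e')
      have he : κ e ∈ I := he ▸ he'
      rw [← a.sum δ₁ I e he]
      exact (h.stateSumOn_eq hC hC' hκ hκ' δ₁ δ₁ (Finset.mem_coe.2 he) (Finset.mem_coe.2 he')).symm
    · exact (h.lk K J (Finset.disjoint_coe.2 hKJ)).symm
  have := a.bridgePoly_eq b δ δ' Finset.univ (Finset.mem_univ (κ e)) (Finset.mem_univ (κ' e'))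
  rwa [Finset.coe_univ] at this

/-! ### Isomorphic curves -/

/-- The curves differ in the names of edges and crossings. -/
structure IsIso (C : Curve E X) (C' : Curve E' X') (ψ : E ≃ E') (τ : X ≃ X') : Prop where
  nxt : ∀ u, C'.nxt (ψ u) = ψ (C.nxt u)
  en : ∀ x b, C'.en (τ x, b) = ψ (C.en (x, b))
  sgn : ∀ x, C'.sgn (τ x) = C.sgn x

variable {ψ : E ≃ E'} {τ : X ≃ X'}

omit [Fintype E] [Fintype X] [Fintype E'] [Fintype X'] in
theorem IsIso.symm_nxt (h : IsIso C C' ψ τ) (u : E) : C'.nxt.symm (ψ u) = ψ (C.nxt.symm u) := by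
  rw [Equiv.symm_apply_eq, h.nxt, Equiv.apply_symm_apply]

omit [Fintype X] [Fintype X'] in
theorem IsIso.planar (h : IsIso C C' ψ τ) (hC : C'.Planar) : C.Planar := by
  intro β hβ
  have h1 : C'.IsCycle (fun u => β (ψ.symm u)) := by
    intro φ hφ
    rw [← Equiv.sum_comp ψ]
    simp only [h.nxt, Equiv.symm_apply_apply]
    refine hβ (fun u => φ (ψ u)) fun x => ?_
    rw [← h.en, ← h.en]
    exact hφ _
  obtain ⟨L, hL⟩ := hC _ h1
  have hl : ∀ x, C'.lr (τ x) = ψ (C.lr x) := fun x => by unfold lr; rw [h.sgn, h.en]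
  have hr : ∀ x, C'.rl (τ x) = ψ (C.rl x) := fun x => by unfold rl; rw [h.sgn, h.en]
  refine ⟨fun u => L (ψ u), fun u hu => ?_, fun x => ?_, fun x => ?_, fun x => ?_, fun x => ?_⟩
  · rw [← h.symm_nxt]
    refine hL.of_ne (ψ u) fun y hy => ?_
    obtain ⟨x, b⟩ := y
    obtain ⟨x, rfl⟩ := τ.surjective x
    rw [h.en] at hy
    exact hu _ (ψ.injective hy)
  · simpa only [hl, hr, h.symm_nxt, Equiv.symm_apply_apply] using hL.west (τ x)
  · simpa only [hl, hr, h.symm_nxt, Equiv.symm_apply_apply] using hL.south (τ x)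
  · simpa only [hl, hr, h.symm_nxt, Equiv.symm_apply_apply] using hL.north (τ x)
  · simpa only [hl, hr, h.symm_nxt, Equiv.symm_apply_apply] using hL.east (τ x)

omit [Fintype E] [Fintype E'] in
theorem IsIso.stateSumOn_eq [Finite E] [Finite E'] (h : IsIso C C' ψ τ) (κ : E' → V)
    (hκ : ∀ u, κ (C'.nxt u) = κ u) (δ : Bool) (I : Set V) (e : E) :
    C'.stateSumOn κ δ I (ψ e) = C.stateSumOn (κ ∘ ψ) δ I e := by
  have hthin : Thin C'.nxt ψ.toEmbedding C.nxt := fun r =>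
    ⟨1, one_pos, h.nxt r, fun l _ _ => by omega⟩
  have key : ∀ T : Finset X, C'.IsStateOn κ δ I (ψ e) (T.map τ.toEmbedding) ↔
      C.IsStateOn (κ ∘ ψ) δ I e T := fun T =>
    isStateOn_iff_of_thin (j := ψ.toEmbedding) hκ (fun y b => h.en y b) hthin
      (fun u _ => ⟨C.nxt (ψ.symm u), by
        have := hthin (ψ.symm u)
        rwa [Equiv.coe_toEmbedding, Equiv.apply_symm_apply] at this⟩) (hthin e) δ T
  rw [stateSumOn_eq_stateSumWith (q := fun _ => True) fun _ _ => trivial,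
    stateSumOn_eq_stateSumWith (q := fun _ => True) fun _ _ => trivial]
  refine stateSumWith_eq τ.toEmbedding (Function.Embedding.refl X) (fun S => ?_) (fun S => ?_)
    (fun y => h.sgn y) fun T => ?_
  · simp
  · simp
  · rw [Finset.map_refl]
    exact key T

omit [Fintype E] [Fintype E'] in
theorem IsIso.stateSum_eq [Finite E] [Finite E'] (h : IsIso C C' ψ τ) (δ : Bool) (e : E) :
    C'.stateSum δ (ψ e) = C.stateSum δ e := by
  have h1 := h.stateSumOn_eq (fun _ => ()) (fun _ => rfl) δ Set.univ e
  rwa [stateSumOn_univ _ _ fun _ => Set.mem_univ _, stateSumOn_univ _ _ fun _ => Set.mem_univ _]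
    at h1

end Curve

namespace ArrowDiagram

open CyclePos Classical Curve

variable {m n N : ℕ} {A : ArrowDiagram m n} {B : ArrowDiagram m N} {Y : Type}

theorem exists_isStateOn_iff {s : Fin n → ℤˣ} {s' : Fin N → ℤˣ} (σ : Fin m ≃ Fin m)
    (τ : Y ↪ Fin n) (τ' : Y ↪ Fin N) {I : Set (Fin m)}
    (hr : ∀ i, σ i ∈ I → (B.word (σ i)).filterMap (read (ends τ')) ~r
      (A.word i).filterMap (read (ends τ))) {e : Pt m N} (he : B.circle e ∈ I) :
    ∃ e', σ (A.circle e') = B.circle e ∧ ∀ (δ : Bool) (T : Finset Y),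
      ((B.curve s').IsStateOn B.circle δ I e (T.map τ') ↔
        (A.curve s).IsStateOn (fun u => σ (A.circle u)) δ I e' (T.map τ)) := by
  refine exists_isStateOn_iff_of_isRotated (C := B.curve s') (C' := A.curve s)
    (B.words.mono (Set.subset_univ I)) ((A.words_comp σ).mono (Set.subset_univ I))
    (fun v hv => ?_) he
  rw [filterMap_pts, filterMap_pts]
  have := hr (σ.symm v) (by rwa [Equiv.apply_symm_apply])
  rwa [Equiv.apply_symm_apply] at this

theorem circle_map {σ : Fin m ≃ Fin m} {τ : Fin n ↪ Fin N}
    (hw : ∀ i, (B.word (σ i)).filterMap (read (ends τ)) ~r A.word i) (x : Fin n × Bool) :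
    B.circle (Sum.inr (τ x.1, x.2)) = σ (A.circle (Sum.inr x)) := by
  rw [circle_eq_iff]
  have h1 := (hw (A.circle (Sum.inr x))).mem_iff.2 (A.circle_eq_iff.1 rfl)
  obtain ⟨y, hy, hy'⟩ := List.mem_filterMap.1 h1
  rwa [read_eq_some.1 hy'] at hy

theorem succ_of_infix {p q : Fin n × Bool} {i : Fin m} (h : [p, q] <:+: A.word i) :
    A.succ (Sum.inr p) = Sum.inr q := by
  obtain ⟨a, b, hab⟩ := h
  have h1 := A.words.circuit i trivial (Sum.inl i) _ (List.IsRotated.refl _)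
  rw [← hab] at h1
  have h2 : List.IsChain (fun a b => A.succ a = b) [(Sum.inr p : Pt m n), Sum.inr q] :=
    h1.infix ⟨Sum.inl i :: a.map Sum.inr, b.map Sum.inr ++ [Sum.inl i], by simp⟩
  exact (List.isChain_cons_cons.1 h2).1

theorem infix_or_notMem {p q : Fin n × Bool} {i : Fin m} (h : [p, q] <:+: A.word i) (k : Fin m) :
    [p, q] <:+: A.word k ∨ [q, p] <:+: A.word k ∨ (p ∉ A.word k ∧ q ∉ A.word k) := by
  by_cases hk : k = i
  · exact Or.inl (hk ▸ h)
  · refine Or.inr (Or.inr ⟨fun hp => hk (A.eq_of_mem_word hp (h.subset (by simp))),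
      fun hq => hk (A.eq_of_mem_word hq (h.subset (by simp)))⟩)

theorem circle_of_infix {p q : Fin n × Bool} {i : Fin m} (h : [p, q] <:+: A.word i) :
    A.circle (Sum.inr p) = A.circle (Sum.inr q) := by
  rw [A.circle_eq_iff.2 (h.subset (by simp) : p ∈ A.word i),
    A.circle_eq_iff.2 (h.subset (by simp) : q ∈ A.word i)]

end ArrowDiagram

namespace GaussDiagram

open ArrowDiagram CyclePos Classical Curve

variable {m : ℕ} {G H : GaussDiagram m} {σ : Fin m ≃ Fin m}

/-! ### Isotopy invariance -/

theorem sum_eq_sum_add {N n : ℕ} {τ : Fin n ↪ Fin N} {S : Finset (Fin N)}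
    (hS : Set.range τ = (S : Set (Fin N))ᶜ) (f : Fin N → ℤ) :
    ∑ a, f a = ∑ a, f (τ a) + ∑ a ∈ S, f a := by
  rw [← Finset.sum_map Finset.univ τ f, ← Finset.sum_add_sum_compl S f, add_comm]
  congr 2
  ext a
  have := Set.ext_iff.1 hS a
  simpa using this.symm

/-- Erasing arrows does not change state sums and linking numbers, if the contributions of these
arrows cancel. -/
theorem sameSums_of_erase {τ : Fin G.n ↪ Fin H.n} {S : Finset (Fin H.n)}
    (hS : Set.range τ = (S : Set (Fin H.n))ᶜ)
    (hw : ∀ i, (H.toArrow.word (σ i)).filterMap (read (ends τ)) ~r G.toArrow.word i)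
    (hs : ∀ a, H.sign (τ a) = G.sign a)
    (hsum : ∀ (I : Set (Fin m)), ∀ i ∈ I, H.curve.stateSumOn H.toArrow.circle true I (Sum.inl i) =
      H.curve.stateSumWith H.toArrow.circle true I (Sum.inl i) fun T => ∀ a ∈ T, a ∉ S)
    (hlk : ∀ K J : Set (Fin m), Disjoint K J →
      ∑ a ∈ S, H.curve.lkTerm H.toArrow.circle K J a = 0) :
    SameSums H.curve H.toArrow.circle G.curve fun u => σ (G.toArrow.circle u) := by
  refine ⟨fun I hI => ?_, fun K J hKJ => ?_⟩
  · obtain ⟨i, hi⟩ := hI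
    obtain ⟨e', he', h1⟩ := exists_isStateOn_iff (A := G.toArrow) (B := H.toArrow) (s := G.sign)
      (s' := H.sign) (I := I) σ (Function.Embedding.refl _) τ (fun k _ => by
        rw [filterMap_read_refl]; exact hw k) (e := Sum.inl i) hi
    have hi' : σ (G.toArrow.circle e') ∈ I := he'.symm ▸ hi
    refine ⟨Sum.inl i, e', true, hi, hi', ?_⟩
    rw [hsum I i hi, stateSumOn_eq_stateSumWith (q := fun _ => True) fun _ _ => trivial]
    refine stateSumWith_eq (C := H.curve) (C' := G.curve) τ (Function.Embedding.refl _)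
      (fun T => ?_) (fun T => by simp) hs fun T => h1 true T
    rw [hS]
    rfl
  · rw [lkSum_eq_sum, lkSum_eq_sum, sum_eq_sum_add hS, hlk K J hKJ, add_zero]
    refine Finset.sum_congr rfl fun a _ => ?_
    unfold lkTerm
    rw [curve_en, curve_en, curve_en, curve_en, circle_map hw (_, true), circle_map hw (_, false),
      curve_sgn, hs]
    rfl

/-- A change of names and base point is treated as an erasure of no arrows. -/
theorem SameUnbased.sameSums (h : SameUnbased G H) :
    ∃ σ : Fin m ≃ Fin m,
      SameSums H.curve H.toArrow.circle G.curve fun u => σ (G.toArrow.circle u) := by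
  obtain ⟨σ, τ, h1, h2⟩ := h
  refine ⟨σ, sameSums_of_erase (τ := τ.toEmbedding) (S := ∅) ?_ (fun i => ?_) h2 (fun I i hi => ?_)
    fun K J _ => Finset.sum_empty⟩
  · simp
  · have h3 := IsRotated.filterMap (h1 i) (read (ends τ.toEmbedding))
    have h4 := filterMap_map_mapEnd τ.toEmbedding (G.word i)
    exact h3.trans (by rw [show mapEnd τ = mapEnd τ.toEmbedding from rfl, h4]; rfl)
  · exact stateSumOn_eq_stateSumWith fun _ _ _ _ => Finset.notMem_empty _

theorem IsErasure.filterMap {S : Set (Fin H.n)} (h : IsErasure G H S) :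
    ∃ τ : Fin G.n ↪ Fin H.n, Set.range τ = Sᶜ ∧
      (∀ i, (H.toArrow.word (Equiv.refl _ i)).filterMap (read (ends τ)) ~r G.toArrow.word i) ∧
      ∀ a, H.sign (τ a) = G.sign a := by
  obtain ⟨τ, h1, h2, h3⟩ := h
  refine ⟨τ, h1, fun i => ?_, h3⟩
  have h4 := h2 i
  rw [← h1, keep_range] at h4
  exact (List.map_injective_iff.2 (ends τ).injective h4) ▸ List.IsRotated.refl _

/-- Smoothing at `a` splits off the edge between its ends as a closed curve, so no state contains
`a`. Both ends are on the same circle, so `a` does not contribute to linking numbers of disjoint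
sublinks. -/
theorem Omega1.sameSums (h : Omega1 G H) :
    SameSums H.curve H.toArrow.circle G.curve G.toArrow.circle := by
  obtain ⟨a, b, ⟨k, hk⟩, he⟩ := h
  obtain ⟨τ, h1, h2, h3⟩ := he.filterMap
  refine sameSums_of_erase (S := {a}) (by rw [h1]; simp) h2 h3 (fun I i hi => ?_) fun K J hKJ => ?_
  · refine stateSumOn_eq_stateSumWith fun S hS x ha hx => ?_
    rw [Finset.mem_singleton.1 hx] at ha
    have h4 : H.curve.bd S (Sum.inr (a, b)) = Sum.inr (a, b) := by
      rw [bd_apply, curve_nxt, succ_of_infix hk]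
      exact (H.curve.jumpAt_mem ha (!b)).trans (by rw [Bool.not_not]; rfl)
    obtain ⟨z, hz⟩ := ((hS.2.1 _).2 (hS.1 a ha b)).symm
    change (H.curve.bd S ^ z) (Sum.inr (a, b)) = _ at hz
    rw [Function.IsFixedPt.perm_zpow h4 z] at hz
    simp at hz
  · rw [Finset.sum_singleton, lkTerm, if_neg]
    rintro ⟨h4, h5⟩
    have h6 := circle_of_infix hk
    refine Set.disjoint_left.1 hKJ h4 ?_
    cases b
    · exact h6 ▸ h5
    · exact h6.symm ▸ h5

theorem read_ends_trans_perm {Y : Type} {n : ℕ} (τ : Y ↪ Fin n) (ρ : Perm (Fin n))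
    (x : Fin n × Bool) :
    read (ends (τ.trans ρ.toEmbedding)) x = read (ends τ) (ρ.symm x.1, x.2) := by
  refine Option.ext fun z => ?_
  rw [read_eq_some, read_eq_some]
  constructor
  · rintro rfl
    exact Prod.ext (ρ.symm_apply_apply _) rfl
  · intro h
    have h1 := congrArg Prod.fst h
    have h2 := congrArg Prod.snd h
    exact Prod.ext ((Equiv.symm_apply_eq ρ).1 h1) h2

theorem swap_ends {n : ℕ} (a b : Fin n) (x : Fin n × Bool) :
    (swap a b x.1, x.2) = swap (a, true) (b, true) (swap (a, false) (b, false) x) := by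
  obtain ⟨x, c⟩ := x
  simp only [swap_apply_def]
  cases c <;> grind

theorem weight_map_swap {n : ℕ} {E : Type} {C : Curve E (Fin n)} {a b : Fin n} {S : Finset (Fin n)}
    (ha : a ∈ S) (hb : b ∉ S) (h : C.sgn a = - C.sgn b) :
    C.weight (S.map (swap a b).toEmbedding) = - C.weight S := by
  unfold weight
  rw [Finset.prod_map, ← Finset.mul_prod_erase S _ ha, ← Finset.mul_prod_erase S _ ha, ← neg_mul]
  congr 1
  · simp [h]
  · refine Finset.prod_congr rfl fun x hx => ?_
    have h1 := Finset.mem_erase.1 hx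
    rw [Equiv.coe_toEmbedding, swap_apply_of_ne_of_ne h1.1 fun h2 => hb (by rw [← h2]; exact h1.2)]

/-- Parallel arrows can be exchanged for each other in states. -/
theorem isStateOn_map_swap {a b : Fin H.n} {i₁ i₀ : Fin m}
    (h₁ : [(a, true), (b, true)] <:+: H.toArrow.word i₁)
    (h₀ : [(a, false), (b, false)] <:+: H.toArrow.word i₀ ∨
      [(b, false), (a, false)] <:+: H.toArrow.word i₀)
    {I : Set (Fin m)} {i : Fin m} (hi : i ∈ I) (δ : Bool) {S : Finset (Fin H.n)} (hb : b ∉ S) :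
    H.curve.IsStateOn H.toArrow.circle δ I (Sum.inl i) (S.map (swap a b).toEmbedding) ↔
      H.curve.IsStateOn H.toArrow.circle δ I (Sum.inl i) S := by
  let τ : {x // x ≠ b} ↪ Fin H.n := Function.Embedding.subtype _
  have hnone : ∀ c, read (ends τ) (b, c) = none := fun c => by
    rw [Option.eq_none_iff_forall_ne_some]
    intro z hz
    exact z.1.2 (congrArg Prod.fst (read_eq_some.1 hz)).symm
  have hword : ∀ k, (H.toArrow.word k).filterMap (read (ends (τ.trans (swap a b).toEmbedding))) =
      (H.toArrow.word k).filterMap (read (ends τ)) := by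
    intro k
    have e1 : (fun x => read (ends (τ.trans (swap a b).toEmbedding)) x) = fun x =>
        read (ends τ) (swap (a, true) (b, true) (swap (a, false) (b, false) x)) := funext fun x => by
      rw [read_ends_trans_perm, symm_swap, swap_ends]
    change List.filterMap (fun x => read (ends (τ.trans (swap a b).toEmbedding)) x) _ = _
    rw [e1]
    have hn := H.toArrow.word_nodup k
    rw [filterMap_swap (g := fun x => read (ends τ) (swap (a, true) (b, true) x)) hn ?_ ?_,
      filterMap_swap (g := read (ends τ)) hn (infix_or_notMem h₁ k) (Or.inr (hnone _))]
    · rcases h₀ with h₀ | h₀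
      · exact infix_or_notMem h₀ k
      · rcases infix_or_notMem h₀ k with h | h | h
        · exact Or.inr (Or.inl h)
        · exact Or.inl h
        · exact Or.inr (Or.inr h.symm)
    · right
      rw [swap_apply_of_ne_of_ne (by simp) (by simp)]
      exact hnone _
  obtain ⟨T, rfl⟩ : ∃ T : Finset {x // x ≠ b}, S = T.map τ :=
    ⟨Finset.univ.filter fun x => x.1 ∈ S, by
      ext x
      simp only [Finset.mem_map, Finset.mem_filter, Finset.mem_univ, true_and]
      exact ⟨fun hx => ⟨⟨x, fun h => hb (by rw [← h]; exact hx)⟩, hx, rfl⟩,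
        fun ⟨y, hy, hyx⟩ => hyx ▸ hy⟩⟩
  rw [Finset.map_map]
  exact isStateOn_iff_of_isRotated (C := H.curve) (C' := H.curve)
    (H.toArrow.words.mono (Set.subset_univ I)) (H.toArrow.words.mono (Set.subset_univ I))
    (fun v _ => by
      rw [curve, filterMap_pts, filterMap_pts, hword]) hi (List.IsRotated.refl _)
    (List.IsRotated.refl _) (by rw [curve, filterMap_base, filterMap_base, hword]) δ T

/-- States do not contain both of two parallel arrows. -/
theorem not_isStateOn_of_mem {a b : Fin H.n} {i₁ i₀ : Fin m}
    (h₁ : [(a, true), (b, true)] <:+: H.toArrow.word i₁)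
    (h₀ : [(a, false), (b, false)] <:+: H.toArrow.word i₀ ∨
      [(b, false), (a, false)] <:+: H.toArrow.word i₀)
    {I : Set (Fin m)} {i : Fin m} {S : Finset (Fin H.n)} (ha : a ∈ S) (hb : b ∈ S) :
    ¬ H.curve.IsStateOn H.toArrow.circle true I (Sum.inl i) S := by
  rintro ⟨s1, s2, s3⟩
  have hbd : ∀ {p : Fin H.n × Bool} {c : Fin H.n} {d : Bool}, c ∈ S →
      H.toArrow.succ (Sum.inr p) = Sum.inr (c, d) →
      H.curve.bd S (Sum.inr p) = Sum.inr (c, !d) := fun hc hp => by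
    rw [bd_apply, curve_nxt, hp]
    exact H.curve.jumpAt_mem hc _
  have hs : ∀ {c d}, c ∈ S → (H.curve.bd S).SameCycle (Sum.inl i) (Sum.inr (c, d)) :=
    fun hc => (s2 _).2 (s1 _ hc _)
  have t1 := hbd hb (succ_of_infix h₁)
  rcases h₀ with h₀ | h₀
  -- Strands in the same direction: each end of `a` is directly followed by the opposite end of `b`,
  -- so the two arrows cannot both be met first at the tail.
  · have t0 := hbd hb (succ_of_infix h₀)
    have p1 := pos_apply (hs (d := true) ha) (by simp)
    have p0 := pos_apply (hs (d := false) ha) (by simp)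
    rw [t1] at p1
    rw [t0] at p0
    have f1 := of_decide_eq_true (s3 a ha)
    have f2 := of_decide_eq_true (s3 b hb)
    simp only [curve_en] at f1 f2
    simp only [Bool.not_true, Bool.not_false] at p0 p1
    omega
  -- Strands in opposite directions: `(a, true)` and `(b, false)` form a closed curve of their own.
  · have t0 := hbd ha (succ_of_infix h₀)
    have h1 := mem_iff_of_sameCycle (κ := id)
      (I := {Sum.inr (a, true), Sum.inr (b, false)}) (f := H.curve.bd S) (fun u => ?_)
      (hs (d := true) ha)
    · simp at h1
    · simp only [id, Set.mem_insert_iff, Set.mem_singleton_iff]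
      constructor
      · rintro (h | h)
        · exact Or.inr ((H.curve.bd S).injective (h.trans t0.symm))
        · exact Or.inl ((H.curve.bd S).injective (h.trans t1.symm))
      · rintro (rfl | rfl)
        · exact Or.inr t1
        · exact Or.inl t0

/-- Exchanging the parallel arrows pairs off the states that contain exactly one of them, and their
weights are opposite. States with both do not exist. In the linking numbers the two signs cancel. -/
theorem Omega2.sameSums (h : Omega2 G H) :
    SameSums H.curve H.toArrow.circle G.curve G.toArrow.circle := by
  obtain ⟨a, b, hab, hs, ⟨i₁, h₁⟩, h₀, he⟩ := h
  obtain ⟨i₀, h₀⟩ : ∃ i₀, [(a, false), (b, false)] <:+: H.toArrow.word i₀ ∨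
      [(b, false), (a, false)] <:+: H.toArrow.word i₀ := by
    rcases h₀ with ⟨i, hi⟩ | ⟨i, hi⟩
    · exact ⟨i, Or.inl hi⟩
    · exact ⟨i, Or.inr hi⟩
  obtain ⟨τ, h1, h2, h3⟩ := he.filterMap
  refine sameSums_of_erase (S := {a, b}) (by rw [h1]; simp) h2 h3 (fun I i hi => ?_)
    fun K J hKJ => ?_
  · obtain ⟨p, hp⟩ : ∃ p : Finset (Fin H.n) → Prop, ∀ S, p S ↔ (a ∈ S ↔ b ∉ S) :=
      ⟨_, fun S => Iff.rfl⟩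
    rw [stateSumWith_add p]
    have hz : H.curve.stateSumWith H.toArrow.circle true I (Sum.inl i) p = 0 := by
      have hmem : ∀ (x : Fin H.n) (S : Finset (Fin H.n)),
          x ∈ S.map (swap a b).toEmbedding ↔ swap a b x ∈ S := fun x S => by
        rw [Finset.mem_map_equiv, symm_swap]
      have hinv : ∀ S : Finset (Fin H.n),
          (S.map (swap a b).toEmbedding).map (swap a b).toEmbedding = S := fun S => by
        ext x
        rw [hmem, hmem, swap_apply_self]
      refine Finset.sum_involution (fun S _ => S.map (swap a b).toEmbedding) ?_ ?_ ?_
        fun S _ => hinv S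
      · intro S hS
        simp only [Finset.mem_filter, Finset.mem_univ, true_and, hp] at hS
        by_cases ha : a ∈ S
        · rw [weight_map_swap ha (hS.2.1 ha) hs, add_neg_cancel]
        · have hb : b ∈ S := by
            by_contra hb
            exact ha (hS.2.2 hb)
          rw [swap_comm, weight_map_swap hb ha (by rw [curve_sgn, hs, neg_neg]), add_neg_cancel]
      · intro S hS _ hh
        simp only [Finset.mem_filter, Finset.mem_univ, true_and, hp] at hS
        have := hmem a S
        rw [hh, swap_apply_left] at this
        exact iff_not_self (this.symm.trans hS.2)
      · intro S hS
        simp only [Finset.mem_filter, Finset.mem_univ, true_and, hp] at hS ⊢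
        rw [hmem, hmem, swap_apply_left, swap_apply_right]
        refine ⟨?_, ?_⟩
        · by_cases hb : b ∈ S
          · have h4 := isStateOn_map_swap h₁ h₀ hi true (S := S.map (swap a b).toEmbedding)
              (by rw [hmem, swap_apply_right]; exact fun ha => hS.2.1 ha hb)
            rw [hinv] at h4
            exact h4.1 hS.1
          · exact (isStateOn_map_swap h₁ h₀ hi true hb).2 hS.1
        · have := hS.2
          tauto
    rw [hz, zero_add]
    refine stateSumWith_congr fun S hS => ?_
    simp only [hp, Finset.mem_insert, Finset.mem_singleton, not_or]
    have hiff : (∀ x ∈ S, ¬x = a ∧ ¬x = b) ↔ a ∉ S ∧ b ∉ S :=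
      ⟨fun h => ⟨fun ha => (h a ha).1 rfl, fun hb => (h b hb).2 rfl⟩,
        fun h x hx => ⟨fun hxa => h.1 (hxa ▸ hx), fun hxb => h.2 (hxb ▸ hx)⟩⟩
    rw [hiff]
    have := fun ha hb => not_isStateOn_of_mem h₁ h₀ (I := I) (i := i) (S := S) ha hb hS
    tauto
  · have h4 := circle_of_infix h₁
    have h5 : H.toArrow.circle (Sum.inr (a, false)) = H.toArrow.circle (Sum.inr (b, false)) := by
      rcases h₀ with h₀ | h₀
      · exact circle_of_infix h₀
      · exact (circle_of_infix h₀).symm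
    have h6 : H.curve.lkTerm H.toArrow.circle K J a = - H.curve.lkTerm H.toArrow.circle K J b := by
      unfold lkTerm
      have h7 : H.toArrow.circle (H.curve.en (a, true)) = H.toArrow.circle (H.curve.en (b, true)) :=
        h4
      have h8 : H.toArrow.circle (H.curve.en (a, false)) =
          H.toArrow.circle (H.curve.en (b, false)) := h5
      by_cases h6 : H.toArrow.circle (H.curve.en (b, true)) ∈ K ∧
          H.toArrow.circle (H.curve.en (b, false)) ∈ J
      · rw [if_pos h6, if_pos (by rw [h7, h8]; exact h6)]
        change ((H.sign a : ℤˣ) : ℤ) = -((H.sign b : ℤˣ) : ℤ)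
        rw [hs, Units.val_neg]
      · rw [if_neg h6, if_neg (by rw [h7, h8]; exact h6), neg_zero]
    rw [Finset.sum_pair hab, h6, neg_add_cancel]

end GaussDiagram

/-! ### The third Reidemeister move for sublinks -/

namespace Curve

open CyclePos Classical

variable {E X V : Type} [Fintype E] [Fintype X] {C C' : Curve E X} {κ : E → V}

/-- The third Reidemeister move does not change the state sum of a sublink that contains the three
strands. -/
theorem IsTriangle.stateSumOn_eq {a b c : X} {δ₁ δ₂ δ₃ : Bool}
    (hT : C.IsTriangle a b c δ₁ δ₂ δ₃) (hP : C.Planar) (hP' : C'.Planar)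
    (hκ : ∀ u, κ (C.nxt u) = κ u) (hnxt : C'.nxt = C.nxt) (hsgn : C'.sgn = C.sgn)
    (hen : ∀ y, C'.en y = C.en (swap (a, true) (b, true) (swap (a, false) (c, true)
      (swap (b, false) (c, false) y)))) (hδ : C.sgn a = C.sgn b ↔ δ₂ = δ₃)
    (hlab : ∀ y, κ (C'.en y) = κ (C.en y)) {I : Set V} (ha : ∀ d, κ (C.en (a, d)) ∈ I)
    (hb : ∀ d, κ (C.en (b, d)) ∈ I) (hc : ∀ d, κ (C.en (c, d)) ∈ I) {e : E} (he : κ e ∈ I)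
    (hne : ∀ y, C.en y ≠ e) (δ : Bool) : C'.stateSumOn κ δ I e = C.stateSumOn κ δ I e := by
  have hκ' : ∀ u, κ (C'.nxt u) = κ u := fun u => by rw [hnxt, hκ]
  -- Both restrictions are realized on the same edges and crossings, which is possible because the
  -- move does not change the circles on which the ends lie.
  let D := C.restrict hκ I
  let D' : Curve {u // κ u ∈ I} {x // ∀ b, κ (C.en (x, b)) ∈ I} :=
    ⟨D.nxt, ⟨fun y => ⟨C'.en (y.1.1, y.2), by rw [hlab]; exact y.1.2 y.2⟩, fun y y' h => by
      have := C'.en.injective (Subtype.ext_iff.1 h)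
      simp only [Prod.mk.injEq] at this
      exact Prod.ext (Subtype.ext this.1) this.2⟩, D.sgn⟩
  have hiso : IsIso D' (C'.restrict hκ' I) (Equiv.refl _)
      (Equiv.subtypeEquivRight fun x => by simp only [hlab]) := by
    refine ⟨fun u => Subtype.ext ?_, fun x b => rfl, fun x => ?_⟩
    · change C'.nxt u.1 = C.nxt u.1
      rw [hnxt]
    · change C'.sgn x.1 = C.sgn x.1
      rw [hsgn]
  have hD' : D'.Planar := hiso.planar (hP'.restrict hκ' I)
  rw [stateSumOn_eq_restrict hκ δ I he, stateSumOn_eq_restrict hκ' δ I he]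
  refine (hiso.stateSum_eq δ ⟨e, he⟩).trans ?_
  have hDT : D.IsTriangle ⟨a, ha⟩ ⟨b, hb⟩ ⟨c, hc⟩ δ₁ δ₂ δ₃ := by
    refine ⟨fun h => hT.ab (Subtype.ext_iff.1 h), fun h => hT.bc (Subtype.ext_iff.1 h),
      fun h => hT.ac (Subtype.ext_iff.1 h), Subtype.ext ?_, Subtype.ext ?_, Subtype.ext ?_⟩
    · have := hT.top
      cases δ₁ <;> exact this
    · have := hT.middle
      cases δ₂ <;> exact this
    · have := hT.bottom
      cases δ₃ <;> exact this
  have hDen : ∀ y, D'.en y = D.en (swap (⟨a, ha⟩, true) (⟨b, hb⟩, true)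
      (swap (⟨a, ha⟩, false) (⟨c, hc⟩, true) (swap (⟨b, hb⟩, false) (⟨c, hc⟩, false) y))) := by
    intro y
    refine Subtype.ext ((hen (y.1.1, y.2)).trans ?_)
    let j : {x // ∀ b, κ (C.en (x, b)) ∈ I} × Bool → X × Bool := fun z => (z.1.1, z.2)
    have hj : Function.Injective j := fun z z' h => by
      simp only [j, Prod.mk.injEq] at h
      exact Prod.ext (Subtype.ext h.1) h.2
    change _ = C.en (j _)
    rw [hj.map_swap, hj.map_swap, hj.map_swap]
  have hDne : ∀ y, D.en y ≠ ⟨e, he⟩ := fun y h => hne _ (Subtype.ext_iff.1 h)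
  refine stateSum_eq_of_normDet hD' (hP.restrict hκ I) 0 (fun s hs => ?_) δ δ
  rw [zpow_zero, one_mul]
  unfold normDet
  rw [IsTriangle.cutDet_eq_cutDet (C := D) (C' := D') rfl rfl hDT (by convert hDen) hδ (hDne _) (hDne _) (hDne _) hs]
  rfl

end Curve

namespace GaussDiagram

open ArrowDiagram CyclePos Classical Curve

variable {m : ℕ} {G H : GaussDiagram m}

theorem pts_map {π : Perm (Fin G.n × Bool)} {τ : Fin G.n ≃ Fin H.n}
    (hw : ∀ i, H.toArrow.word i = (G.toArrow.word i).map fun x => mapEnd τ (π x)) (i : Fin m) :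
    H.toArrow.pts i = (G.toArrow.pts i).map
      (Equiv.sumCongr (Equiv.refl (Fin m)) (π.trans (τ.prodCongr (Equiv.refl Bool)))) := by
  unfold pts
  rw [hw, List.map_cons, List.map_map, List.map_map]
  rfl

theorem circle_map_perm {π : Perm (Fin G.n × Bool)} {τ : Fin G.n ≃ Fin H.n}
    (hw : ∀ i, H.toArrow.word i = (G.toArrow.word i).map fun x => mapEnd τ (π x))
    (u : Pt m G.n) : H.toArrow.circle
      (Equiv.sumCongr (Equiv.refl (Fin m)) (π.trans (τ.prodCongr (Equiv.refl Bool))) u) =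
      G.toArrow.circle u := by
  rw [← H.toArrow.mem_pts, pts_map hw]
  exact List.mem_map_of_mem (G.toArrow.mem_pts.2 rfl)

theorem isIso_of_word_map {π : Perm (Fin G.n × Bool)} {τ : Fin G.n ≃ Fin H.n}
    (hw : ∀ i, H.toArrow.word i = (G.toArrow.word i).map fun x => mapEnd τ (π x))
    {s : Fin G.n → ℤˣ} (hs : ∀ d, H.sign (τ d) = s d) :
    IsIso ⟨G.toArrow.succ, π.symm.toEmbedding.trans G.curve.en, s⟩ H.curve
      (Equiv.sumCongr (Equiv.refl (Fin m)) (π.trans (τ.prodCongr (Equiv.refl Bool)))) τ := by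
  refine ⟨fun u => ?_, fun x b => ?_, hs⟩
  · obtain ⟨t, ht⟩ := exists_isRotated_cons (G.toArrow.mem_pts.2 (rfl : G.toArrow.circle u = _))
    have h1 := G.toArrow.words.circuit _ trivial u t ht
    have h2 := H.toArrow.words.circuit (G.toArrow.circle u) trivial _ _ (by
      rw [pts_map hw]
      exact ht.map _)
    rcases t with _ | ⟨v, t⟩
    · rw [(List.isChain_cons_cons.1 h1).1]
      exact (List.isChain_cons_cons.1 h2).1
    · rw [(List.isChain_cons_cons.1 h1).1]
      exact (List.isChain_cons_cons.1 h2).1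
  · change Sum.inr (τ x, b) = Sum.inr (mapEnd τ (π (π.symm (x, b))))
    rw [apply_symm_apply]
    rfl

theorem Adjacent.infix {s : ℤˣ} {x y : Fin G.n × Bool} (h : G.Adjacent s x y) :
    ∃ i, [x, y] <:+: G.toArrow.word i ∨ [y, x] <:+: G.toArrow.word i := by
  obtain ⟨i, h⟩ := h
  refine ⟨i, ?_⟩
  split_ifs at h
  · exact Or.inl h
  · exact Or.inr h

theorem Adjacent.infix_or_notMem {s : ℤˣ} {x y : Fin G.n × Bool} (h : G.Adjacent s x y)
    (k : Fin m) : [x, y] <:+: G.toArrow.word k ∨ [y, x] <:+: G.toArrow.word k ∨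
      (x ∉ G.toArrow.word k ∧ y ∉ G.toArrow.word k) := by
  obtain ⟨i, h | h⟩ := h.infix
  · exact ArrowDiagram.infix_or_notMem h k
  · rcases ArrowDiagram.infix_or_notMem h k with h | h | h
    · exact Or.inr (Or.inl h)
    · exact Or.inl h
    · exact Or.inr (Or.inr h.symm)

theorem Adjacent.circle_eq {s : ℤˣ} {x y : Fin G.n × Bool} (h : G.Adjacent s x y) :
    G.toArrow.circle (Sum.inr x) = G.toArrow.circle (Sum.inr y) := by
  obtain ⟨i, h | h⟩ := h.infix
  · exact circle_of_infix h
  · exact (circle_of_infix h).symm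

theorem Adjacent.nxt {s : ℤˣ} {x y : Fin G.n × Bool} (h : G.Adjacent s x y) :
    G.curve.nxt (G.curve.en (if decide (s = 1) then x else y)) =
      G.curve.en (if decide (s = 1) then y else x) := by
  obtain ⟨i, h⟩ := h
  by_cases hs : s = 1
  · rw [if_pos hs] at h
    simp only [hs, decide_true, if_true]
    exact succ_of_infix h
  · rw [if_neg hs] at h
    simp only [hs, decide_false, Bool.false_eq_true, if_false]
    exact succ_of_infix h

/-- On each of the three strands at most one of the two exchanged points is read, so the three
exchanges are invisible. -/
theorem filterMap_triangle {a b c : Fin G.n} {s₁ s₂ s₃ : ℤˣ} (hab : a ≠ b) (hbc : b ≠ c)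
    (hac : a ≠ c) (h₁ : G.Adjacent s₁ (a, true) (b, true))
    (h₂ : G.Adjacent s₂ (a, false) (c, true)) (h₃ : G.Adjacent s₃ (b, false) (c, false))
    {Z : Type} {g : Fin G.n × Bool → Option Z} (h₁' : g (a, true) = none ∨ g (b, true) = none)
    (h₂' : g (a, false) = none ∨ g (c, true) = none)
    (h₃' : g (b, false) = none ∨ g (c, false) = none) (k : Fin m) :
    (G.toArrow.word k).filterMap (fun x => g (swap (a, true) (b, true)
      (swap (a, false) (c, true) (swap (b, false) (c, false) x)))) =
      (G.toArrow.word k).filterMap g := by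
  have hn := G.toArrow.word_nodup k
  rw [filterMap_swap (g := fun x => g (swap (a, true) (b, true) (swap (a, false) (c, true) x))) hn
      (h₃.infix_or_notMem k) ?_,
    filterMap_swap (g := fun x => g (swap (a, true) (b, true) x)) hn (h₂.infix_or_notMem k) ?_,
    filterMap_swap hn (h₁.infix_or_notMem k) h₁']
  · rwa [swap_apply_of_ne_of_ne (by simp) (by simp), swap_apply_of_ne_of_ne (a := (a, true))
      (by simp [hac.symm]) (by simp [hbc.symm])]
  · rwa [swap_apply_of_ne_of_ne (a := (a, false)) (by simp [hab.symm]) (by simp [hbc]),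
      swap_apply_of_ne_of_ne (a := (a, true)) (by simp) (by simp),
      swap_apply_of_ne_of_ne (a := (a, false)) (by simp [hac.symm]) (by simp),
      swap_apply_of_ne_of_ne (a := (a, true)) (by simp) (by simp)]

/-- If the sublink contains all three strands, the move is the one across a triangle in the
determinant. Otherwise a missing strand excludes the two arrows that end on it from all states, and
the words of the remaining arrows are unchanged. -/
theorem Omega3.sameSums (hG : G.IsClassical) (hH : H.IsClassical) (h : Omega3 G H) :
    SameSums H.curve H.toArrow.circle G.curve G.toArrow.circle := by
  obtain ⟨a, b, c, s, τ, hab, hbc, hac, h₁, h₂, h₃, hw, hs⟩ := h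
  obtain ⟨π, hπ⟩ : ∃ π : Perm (Fin G.n × Bool), ∀ x, π x = swap (a, true) (b, true)
      (swap (a, false) (c, true) (swap (b, false) (c, false) x)) :=
    ⟨(swap (b, false) (c, false)).trans ((swap (a, false) (c, true)).trans
      (swap (a, true) (b, true))), fun x => rfl⟩
  have hw' : ∀ i, H.toArrow.word i = (G.toArrow.word i).map fun x => mapEnd τ (π x) := by
    simp only [hπ]
    exact hw
  have hπ' : ∀ x, π.symm x = π x := by
    intro x
    rw [symm_apply_eq, hπ, hπ]
    obtain ⟨x, d⟩ := x
    by_cases hxa : x = a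
    · subst hxa
      cases d <;> simp [swap_apply_def, hab, hac, hbc, hab.symm, hac.symm, hbc.symm]
    by_cases hxb : x = b
    · subst hxb
      cases d <;> simp [swap_apply_def, hab, hac, hbc, hab.symm, hac.symm, hbc.symm]
    by_cases hxc : x = c
    · subst hxc
      cases d <;> simp [swap_apply_def, hab, hac, hbc, hab.symm, hac.symm, hbc.symm]
    · simp [swap_apply_def, hxa, hxb, hxc]
  have hlab := circle_map_perm hw'
  have hiso := isIso_of_word_map hw' hs
  have hψ : ∀ i, Equiv.sumCongr (Equiv.refl (Fin m)) (π.trans (τ.prodCongr (Equiv.refl Bool)))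
    (Sum.inl i) = Sum.inl i := fun i => rfl
  generalize Equiv.sumCongr (Equiv.refl (Fin m)) (π.trans (τ.prodCongr (Equiv.refl Bool))) = ψ
    at hlab hiso hψ
  have hlabπ : ∀ y, G.toArrow.circle (Sum.inr (π y)) = G.toArrow.circle (Sum.inr y) := by
    intro y
    have key : ∀ {p q : Fin G.n × Bool}, G.toArrow.circle (Sum.inr p) = G.toArrow.circle (Sum.inr q) →
        ∀ y, G.toArrow.circle (Sum.inr (swap p q y)) = G.toArrow.circle (Sum.inr y) := by
      intro p q hpq y
      rw [swap_apply_def]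
      split_ifs with h1 h2
      · rw [h1, hpq]
      · rw [h2, hpq]
      · rfl
    rw [hπ, key h₁.circle_eq, key h₂.circle_eq, key h₃.circle_eq]
  have hlab' : ∀ y, H.toArrow.circle (Sum.inr (τ y.1, y.2)) = G.toArrow.circle (Sum.inr y) := by
    intro y
    have h1 := hiso.en y.1 y.2
    have h2 := hlab (Sum.inr (π.symm y))
    rw [hπ', hlabπ] at h2
    rw [← h2, ← hπ']
    exact congrArg H.toArrow.circle h1
  refine ⟨fun I hI => ?_, fun K J _ => ?_⟩
  · obtain ⟨i, hi⟩ := hI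
    by_cases hall : ∀ x ∈ [a, b, c], ∀ d, G.toArrow.circle (Sum.inr (x, d)) ∈ I
    · refine ⟨Sum.inl i, Sum.inl i, true, hi, hi, ?_⟩
      rw [← hψ, hiso.stateSumOn_eq H.toArrow.circle H.toArrow.circle_succ true I (Sum.inl i),
        show H.toArrow.circle ∘ ψ = G.toArrow.circle from funext hlab]
      have hT : G.curve.IsTriangle a b c _ _ _ := ⟨hab, hbc, hac, h₁.nxt, h₂.nxt, h₃.nxt⟩
      refine hT.stateSumOn_eq (e := Sum.inl i) hG.planar (hiso.planar hH.planar) G.toArrow.circle_succ rfl rfl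
        (fun y => ?_) ?_ (fun y => ?_) (hall a (by simp)) (hall b (by simp)) (hall c (by simp)) hi
        (fun y => Sum.inr_ne_inl) true
      · change Sum.inr (π.symm y) = Sum.inr _
        rw [hπ', hπ]
        congr!
      -- The orders on the middle and bottom strands are given by `s * G.sign a` and `s * G.sign b`,
      -- so they agree iff the signs of `a` and `b` do.
      · rw [curve_sgn]
        rcases Int.units_eq_one_or s with h5 | h5 <;>
          rcases Int.units_eq_one_or (G.sign a) with h6 | h6 <;>
          rcases Int.units_eq_one_or (G.sign b) with h7 | h7 <;> simp [h5, h6, h7]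
      · change G.toArrow.circle (Sum.inr (π.symm y)) = G.toArrow.circle (Sum.inr y)
        rw [hπ', hlabπ]
    · let ι : {x // ∀ d, G.toArrow.circle (Sum.inr (x, d)) ∈ I} ↪ Fin G.n :=
        Function.Embedding.subtype _
      have hnone : ∀ x, (∃ d, G.toArrow.circle (Sum.inr (x, d)) ∉ I) → ∀ d,
          read (ends ι) (x, d) = none := by
        rintro x ⟨d', hd'⟩ d
        rw [Option.eq_none_iff_forall_ne_some]
        intro z hz
        have := read_eq_some.1 hz
        rw [show x = z.1.1 from congrArg Prod.fst this] at hd'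
        exact hd' (z.1.2 _)
      have h3 : ∃ x ∈ [a, b, c], ∀ y ∈ [a, b, c], y ≠ x → ∀ d, read (ends ι) (y, d) = none := by
        push Not at hall
        obtain ⟨x, hx, d, hd⟩ := hall
        simp only [List.mem_cons, List.not_mem_nil, or_false] at hx
        have c₁ := h₁.circle_eq
        have c₂ := h₂.circle_eq
        have c₃ := h₃.circle_eq
        rcases hx with rfl | rfl | rfl <;> cases d
        · exact ⟨b, by simp, by
            simp only [List.mem_cons, List.not_mem_nil, or_false]
            rintro y (rfl | rfl | rfl) hy
            exacts [hnone _ ⟨_, hd⟩, absurd rfl hy, hnone _ ⟨_, c₂ ▸ hd⟩]⟩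
        · exact ⟨c, by simp, by
            simp only [List.mem_cons, List.not_mem_nil, or_false]
            rintro y (rfl | rfl | rfl) hy
            exacts [hnone _ ⟨_, hd⟩, hnone _ ⟨_, c₁ ▸ hd⟩, absurd rfl hy]⟩
        · exact ⟨a, by simp, by
            simp only [List.mem_cons, List.not_mem_nil, or_false]
            rintro y (rfl | rfl | rfl) hy
            exacts [absurd rfl hy, hnone _ ⟨_, hd⟩, hnone _ ⟨_, c₃ ▸ hd⟩]⟩
        · exact ⟨c, by simp, by
            simp only [List.mem_cons, List.not_mem_nil, or_false]
            rintro y (rfl | rfl | rfl) hy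
            exacts [hnone _ ⟨_, c₁.symm ▸ hd⟩, hnone _ ⟨_, hd⟩, absurd rfl hy]⟩
        · exact ⟨a, by simp, by
            simp only [List.mem_cons, List.not_mem_nil, or_false]
            rintro y (rfl | rfl | rfl) hy
            exacts [absurd rfl hy, hnone _ ⟨_, c₃.symm ▸ hd⟩, hnone _ ⟨_, hd⟩]⟩
        · exact ⟨b, by simp, by
            simp only [List.mem_cons, List.not_mem_nil, or_false]
            rintro y (rfl | rfl | rfl) hy
            exacts [hnone _ ⟨_, c₂.symm ▸ hd⟩, absurd rfl hy, hnone _ ⟨_, hd⟩]⟩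
      obtain ⟨x, -, h3⟩ := h3
      have h4 : ∀ {p q} (d d' : Bool), p ≠ q → p ∈ [a, b, c] → q ∈ [a, b, c] →
          read (ends ι) (p, d) = none ∨ read (ends ι) (q, d') = none := by
        intro p q d d' hpq hp hq
        by_cases hpx : p = x
        · exact Or.inr (h3 q hq (fun hqx => hpq (hpx.trans hqx.symm)) _)
        · exact Or.inl (h3 p hp hpx _)
      have hr : ∀ k, (H.toArrow.word k).filterMap (read (ends (ι.trans τ.toEmbedding))) =
          (G.toArrow.word k).filterMap (read (ends ι)) := by
        intro k
        rw [← filterMap_triangle hab hbc hac h₁ h₂ h₃ (h4 true true hab (by simp) (by simp))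
          (h4 false true hac (by simp) (by simp)) (h4 false false hbc (by simp) (by simp)) k,
          hw', List.filterMap_map]
        refine List.filterMap_congr fun y _ => ?_
        rw [← hπ]
        change read ((ends ι).trans (ends τ.toEmbedding)) (ends τ.toEmbedding (π y)) = _
        rw [read_trans, (read_eq_some (j := ends τ.toEmbedding)).2 rfl]
        rfl
      obtain ⟨e', he', h5⟩ := exists_isStateOn_iff (A := G.toArrow) (B := H.toArrow) (s := G.sign)
        (s' := H.sign) (I := I) (Equiv.refl _) ι (ι.trans τ.toEmbedding) (fun k _ => by
          rw [Equiv.refl_apply, hr]) (e := Sum.inl i) hi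
      refine ⟨Sum.inl i, e', true, hi, by rw [show G.toArrow.circle e' = i from he']; exact hi, ?_⟩
      rw [stateSumOn_eq_stateSumWith (q := fun S => ∀ x ∈ S, x ∈ Set.range (ι.trans τ.toEmbedding)),
        stateSumOn_eq_stateSumWith (q := fun S => ∀ x ∈ S, x ∈ Set.range ι)]
      · exact stateSumWith_eq (C := H.curve) (C' := G.curve) (ι.trans τ.toEmbedding) ι
          (fun S => Iff.rfl) (fun S => Iff.rfl) (fun y => hs _) fun T => h5 true T
      · exact fun S hS x hx => ⟨⟨x, hS.1 x hx⟩, rfl⟩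
      · intro S hS x hx
        obtain ⟨x, rfl⟩ := τ.surjective x
        refine ⟨⟨x, fun d => ?_⟩, rfl⟩
        rw [← hlab']
        exact hS.1 _ hx d
  · rw [lkSum_eq_sum, lkSum_eq_sum, ← Equiv.sum_comp τ]
    refine Finset.sum_congr rfl fun x _ => ?_
    unfold lkTerm
    rw [curve_en, curve_en, curve_en, curve_en, hlab' (x, true), hlab' (x, false), curve_sgn,
      curve_sgn, hs]

end GaussDiagram

/-! ### Isotopy invariants from bridge polynomials -/

namespace Curve

open CyclePos Classical

variable {E X V : Type} [Finite E] [Fintype X] {C : Curve E X} {κ : E → V} {A : Finset V → ℤ[X]}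

/-- A single circle has no decomposition into two sublinks, so the derivative vanishes. -/
theorem IsLinkSum.bridgePoly_singleton (h : C.IsLinkSum κ A fun K J => C.lkSum κ K J) (δ : Bool)
    (e : E) : C.bridgePoly κ δ ({κ e} : Finset V) e = Polynomial.C (A {κ e}) := by
  refine Polynomial.eq_of_derivative_eq ?_ 1 ?_
  · rw [h.derivative δ {κ e} e (F := 0) fun J hJ e' he' => by
      rw [Finset.ssubset_singleton_iff.1 hJ] at he'
      simp at he']
    simp
  · rw [eval_one_bridgePoly, h.sum _ _ _ (Finset.mem_singleton_self _), eval_C]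

end Curve

namespace GaussDiagram

open ArrowDiagram CyclePos Classical Curve

variable {m : ℕ} {G H : GaussDiagram m}

/-- The Conway polynomial, as a state sum. -/
def conway (m : ℕ) (G : GaussDiagram m) : ℤ[X] := G.curve.stateSum true (Sum.inl G.toArrow.base)

theorem stateSumOn_univ_comp (G : GaussDiagram m) {V : Type} (κ : Pt m G.n → V) (δ : Bool)
    (e : Pt m G.n) : G.curve.stateSumOn κ δ Set.univ e = G.curve.stateSum δ e :=
  stateSumOn_univ _ _ fun _ => Set.mem_univ _

theorem bridgePoly_comp (G : GaussDiagram m) (σ : Fin m ≃ Fin m) (δ : Bool) (e : Pt m G.n) :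
    G.curve.bridgePoly (fun u => σ (G.toArrow.circle u)) δ Set.univ e =
      G.curve.bridgePoly G.toArrow.circle δ Set.univ e := by
  unfold Curve.bridgePoly
  have h1 : ∀ S, G.curve.bridges (fun u => σ (G.toArrow.circle u)) S =
      G.curve.bridges G.toArrow.circle S := fun S => by
    refine Finset.filter_congr fun a _ => ?_
    have := isBridge_map_iff (C := G.curve) (κ := fun u => σ (G.toArrow.circle u)) (D := G.curve)
      (κ' := G.toArrow.circle) (σ := σ) (τ := Function.Embedding.refl _) (T := S)
      (fun _ _ => rfl) a
    rwa [Finset.map_refl] at this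
  refine Finset.sum_congr ?_ fun S _ => by rw [h1]
  ext S
  simp [isStateOn_univ]

theorem SameSums.invariants {σ : Fin m ≃ Fin m} (hG : G.IsClassical) (hH : H.IsClassical)
    (h : SameSums H.curve H.toArrow.circle G.curve fun u => σ (G.toArrow.circle u)) :
    (∀ δ δ', H.bridgePoly δ = G.bridgePoly δ') ∧ conway m H = conway m G := by
  have hκ : ∀ u, σ (G.toArrow.circle (G.curve.nxt u)) = σ (G.toArrow.circle u) := fun u =>
    congrArg σ (G.toArrow.circle_succ u)
  constructor
  · intro δ δ'
    unfold GaussDiagram.bridgePoly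
    rw [← bridgePoly_comp G σ]
    exact Curve.SameSums.bridgePoly_eq h hH.planar hG.planar H.toArrow.circle_succ hκ
      H.toArrow.circle_surjective (σ.surjective.comp G.toArrow.circle_surjective) δ δ' _ _
  · have := Curve.SameSums.stateSumOn_eq h hH.planar hG.planar H.toArrow.circle_succ hκ true true
      (I := Set.univ) (e := Sum.inl H.toArrow.base) (e' := Sum.inl G.toArrow.base) trivial trivial
    rwa [stateSumOn_univ_comp, stateSumOn_univ_comp] at this

/-- A diagram has the same sums as itself, and the comparison of two diagrams allows different
directions `δ` and `δ'`. -/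
theorem IsClassical.bridgePoly_eq (hG : G.IsClassical) (δ δ' : Bool) :
    G.bridgePoly δ = G.bridgePoly δ' :=
  (SameSums.invariants (σ := Equiv.refl _) hG hG
    ⟨fun _ ⟨i, hi⟩ => ⟨Sum.inl i, Sum.inl i, true, hi, hi, rfl⟩, fun _ _ _ => rfl⟩).1 δ δ'

theorem IsClassical.stateSum_eq_conway (hG : G.IsClassical) (δ : Bool) (e : Pt m G.n) :
    G.curve.stateSum δ e = conway m G := hG.planar.stateSum_eq _ _ _ _

theorem Isotopic.invariants (h : Isotopic G H) :
    (∀ δ, G.bridgePoly δ = H.bridgePoly δ) ∧ conway m G = conway m H := by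
  induction h with
  | rel G H h =>
    obtain ⟨hG, hH, h⟩ := h
    obtain ⟨σ, h⟩ : ∃ σ : Fin m ≃ Fin m,
        SameSums H.curve H.toArrow.circle G.curve fun u => σ (G.toArrow.circle u) := by
      rcases h with h | h | h | h
      · exact h.sameSums
      · exact ⟨Equiv.refl _, h.sameSums⟩
      · exact ⟨Equiv.refl _, h.sameSums⟩
      · exact ⟨Equiv.refl _, h.sameSums hG hH⟩
    have h1 := SameSums.invariants hG hH h
    exact ⟨fun δ => (h1.1 δ δ).symm, h1.2.symm⟩
  | refl => exact ⟨fun _ => rfl, rfl⟩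
  | symm _ _ _ ih => exact ⟨fun δ => (ih.1 δ).symm, ih.2.symm⟩
  | trans _ _ _ _ _ ih ih' => exact ⟨fun δ => (ih.1 δ).trans (ih'.1 δ), ih.2.trans ih'.2⟩

/-! ### Links with two components -/

theorem words_component (G : GaussDiagram m) (i : Fin m) :
    Words (G.component i).curve.nxt (fun _ => i) {i} fun _ => (G.component i).toArrow.pts 0 where
  label _ := rfl
  circuit _ _ := (G.component i).toArrow.words.circuit 0 trivial
  nodup _ _ := (G.component i).toArrow.nodup_pts 0
  mem v hv u := by
    rw [mem_pts]
    exact iff_of_true (Subsingleton.elim _ _) (Set.mem_singleton_iff.1 hv).symm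
  ne _ _ := List.cons_ne_nil _ _

theorem stateSumOn_component (G : GaussDiagram m) (i : Fin m) (δ : Bool) :
    G.curve.stateSumOn G.toArrow.circle δ {i} (Sum.inl i) =
      (G.component i).curve.stateSum δ (Sum.inl 0) := by
  let τ : Fin (G.component i).n ↪ Fin G.n := ((G.ownArrows i).orderEmbOfFin rfl).toEmbedding
  have hr : (G.toArrow.word i).filterMap (read (ends τ)) = (G.component i).toArrow.word 0 := by
    refine List.filterMap_congr fun x _ => Option.ext fun y => ?_
    exact read_eq_some.trans (rename_eq_some (G.ownArrows i) x y).symm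
  have key : ∀ T : Finset (Fin (G.component i).n), G.curve.IsStateOn G.toArrow.circle δ {i} (Sum.inl i) (T.map τ) ↔
      (G.component i).curve.IsStateOn (fun _ => i) δ {i} (Sum.inl 0)
        (T.map (Function.Embedding.refl _)) := by
    refine isStateOn_iff_of_isRotated (C := G.curve) (C' := (G.component i).curve)
      (G.toArrow.words.mono (Set.subset_univ {i})) (words_component G i) (fun v hv => ?_)
      (Set.mem_singleton i) (List.IsRotated.refl _) (List.IsRotated.refl _) ?_ δ
    · obtain rfl := Set.mem_singleton_iff.1 hv
      rw [curve, curve, filterMap_pts, filterMap_pts, hr]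
      have := filterMap_read_refl ((G.component v).toArrow.word 0)
      rw [this]
    · rw [curve, curve, filterMap_base, filterMap_base, hr]
      have := filterMap_read_refl ((G.component i).toArrow.word 0)
      rw [this]
  rw [← stateSumOn_univ (κ := fun _ => i) (I := {i}) _ _ fun _ => Set.mem_singleton i,
    stateSumOn_eq_stateSumWith (q := fun S => ∀ a ∈ S, a ∈ Set.range τ),
    stateSumOn_eq_stateSumWith (q := fun _ => True) fun _ _ => trivial]
  · exact stateSumWith_eq (C := G.curve) (C' := (G.component i).curve) τ
      (Function.Embedding.refl _) (fun S => Iff.rfl) (fun S => by simp) (fun y => rfl) key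
  · intro S hS a ha
    have h1 : (Set.range τ) = G.ownArrows i := (G.ownArrows i).range_orderEmbOfFin rfl
    rw [h1]
    have h2 := hS.1 a ha
    simp only [ownArrows, Finset.coe_filter, Finset.mem_univ, true_and, Set.mem_ofPred_eq]
    exact ⟨G.toArrow.circle_eq_iff.1 (h2 true), G.toArrow.circle_eq_iff.1 (h2 false)⟩

theorem conway_component (G : GaussDiagram m) (i : Fin m) :
    conway 1 (G.component i) = G.curve.stateSumOn G.toArrow.circle true {i} (Sum.inl i) :=
  (stateSumOn_component G i true).symm

/-- In the plane the signed numbers of crossings of either component over the other are equal, so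
half the total is one of them. -/
theorem lk_eq_lkSum {i j : Fin m} (hG : G.IsClassical) (hij : i ≠ j) :
    G.lk i j = G.curve.lkSum G.toArrow.circle {i} {j} := by
  have h1 := hG.planar.lkSum_comm G.toArrow.circle_succ {j} {i}
  have h2 : (∑ a : Fin G.n with G.toArrow.Joins a i j, ((G.sign a : ℤ) : ℚ)) =
      (G.curve.lkSum G.toArrow.circle {i} {j} : ℚ) + G.curve.lkSum G.toArrow.circle {j} {i} := by
    rw [lkSum_eq_sum, lkSum_eq_sum, Finset.sum_filter, Int.cast_sum, Int.cast_sum,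
      ← Finset.sum_add_distrib]
    refine Finset.sum_congr rfl fun a _ => ?_
    unfold lkTerm Joins
    simp only [curve_en, curve_sgn, ← G.toArrow.circle_eq_iff, Set.mem_singleton_iff]
    by_cases h3 : G.toArrow.circle (Sum.inr (a, true)) = i ∧ G.toArrow.circle (Sum.inr (a, false)) = j
    · have h4 : ¬ (G.toArrow.circle (Sum.inr (a, true)) = j ∧
          G.toArrow.circle (Sum.inr (a, false)) = i) := fun h => hij (h3.1.symm.trans h.1)
      simp [h3, hij, hij.symm]
    · by_cases h4 : G.toArrow.circle (Sum.inr (a, true)) = j ∧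
          G.toArrow.circle (Sum.inr (a, false)) = i
      · simp [h4, hij, hij.symm]
      · simp [h3, h4]
  rw [lk, h2, h1]
  ring

/-- With two circles, only the decomposition into single circles contributes to the derivative, and
its factors are constant in the outer variable. So the polynomial is linear, and the difference of
its values at 1 and 0 is the slope. -/
theorem eval_one_sub_eval_zero_bridgePoly {G : GaussDiagram 2} (hG : G.IsClassical) (δ : Bool) :
    (G.bridgePoly δ).eval 1 - (G.bridgePoly δ).eval 0 =
      Polynomial.C (G.curve.lkSum G.toArrow.circle {0} {1}) * Polynomial.X *
        (conway 1 (G.component 0) * conway 1 (G.component 1)) := by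
  obtain ⟨A, a⟩ := hG.planar.exists_isLinkSum G.toArrow.circle_succ G.toArrow.circle_surjective
  have hA : ∀ i, A {i} = conway 1 (G.component i) := fun i => by
    rw [conway_component, ← a.sum true {i} (Sum.inl i) (Finset.mem_singleton_self i),
      Finset.coe_singleton]
  have h0 : G.bridgePoly δ =
      G.curve.bridgePoly G.toArrow.circle true (Finset.univ : Finset (Fin 2)) (Sum.inl 0) := by
    have := a.bridgePoly_eq a δ true Finset.univ (e := Sum.inl G.toArrow.base) (e' := Sum.inl 0)
      (Finset.mem_univ _) (Finset.mem_univ _)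
    rwa [Finset.coe_univ] at this ⊢
  have h1 : derivative (G.bridgePoly δ) = Polynomial.C (Polynomial.C
      (G.curve.lkSum G.toArrow.circle {0} {1}) * Polynomial.X *
        (conway 1 (G.component 0) * conway 1 (G.component 1))) := by
    rw [h0, a.derivative true Finset.univ (Sum.inl 0) (F := fun J => Polynomial.C (A J))
      fun J hJ e he => ?_]
    · have h2 : ∀ inst : DecidableEq (Fin 2), (Finset.univ : Finset (Fin 2)) \ {0} = {1} := by
        intro inst
        ext i
        fin_cases i <;> simp
      rw [Finset.sum_eq_single_of_mem {0} (by simp [ArrowDiagram.circle]), h2, hA, hA,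
        Finset.coe_singleton, Finset.coe_singleton]
      · simp only [map_mul, eq_intCast]
      · intro J hJ hJ'
        have h3 : ∀ inst : DecidableEq (Fin 2), (Finset.univ : Finset (Fin 2)) \ J = ∅ := by
          intro inst
          rw [Finset.sdiff_eq_empty_iff_subset]
          have h4 : (0 : Fin 2) ∈ J := by
            simp only [Finset.mem_filter] at hJ
            exact hJ.2
          have h5 : (1 : Fin 2) ∈ J := by
            by_contra h5
            refine hJ' (Finset.ext fun i => ?_)
            fin_cases i <;> simp [h4, h5]
          intro i _
          fin_cases i
          exacts [h4, h5]
        rw [h3]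
        simp [lkSum]
    · obtain rfl : J = {G.toArrow.circle e} := by
        generalize G.toArrow.circle e = i at he
        revert J i
        decide
      exact a.bridgePoly_singleton true e
  have h2 : G.bridgePoly δ = Polynomial.C (Polynomial.C
      (G.curve.lkSum G.toArrow.circle {0} {1}) * Polynomial.X *
        (conway 1 (G.component 0) * conway 1 (G.component 1))) * Polynomial.X +
      Polynomial.C ((G.bridgePoly δ).eval 0) := by
    refine Polynomial.eq_of_derivative_eq ?_ 0 (by simp)
    rw [h1, derivative_add, derivative_C_mul, derivative_X, derivative_C, mul_one, add_zero]
  have h3 := congrArg (Polynomial.eval 1) h2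
  rw [h3]
  simp

theorem coeff_eval_bridgePoly {G : GaussDiagram 2} (hG : G.IsClassical) (δ : Bool) (n : ℕ) :
    ((((G.bridgePoly δ).eval 1).coeff n - ((G.bridgePoly δ).eval 0).coeff n : ℤ) : ℚ) =
      G.lk 0 1 * ∑ k ∈ Finset.range n, (((conway 1 (G.component 0)).coeff k *
        (conway 1 (G.component 1)).coeff (n - 1 - k) : ℤ) : ℚ) := by
  rw [← coeff_sub, eval_one_sub_eval_zero_bridgePoly hG, lk_eq_lkSum hG (by decide), mul_assoc,
    coeff_C_mul, Int.cast_mul, ← Int.cast_sum]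
  rcases n with _ | n
  · simp
  · rw [coeff_X_mul, coeff_mul, Finset.Nat.sum_antidiagonal_eq_sum_range_succ_mk]
    rfl

theorem conway_unknot (G : GaussDiagram 1) (h : G.n = 0) : conway 1 G = 1 := by
  have : IsEmpty (Fin G.n) := by rw [h]; infer_instance
  unfold conway stateSum
  have h1 : ∀ S : Finset (Fin G.n), S = ∅ := fun S => Finset.eq_empty_of_isEmpty S
  rw [Finset.sum_eq_single_of_mem ∅]
  · simp
  · simp only [Finset.mem_filter, Finset.mem_univ, true_and]
    refine ⟨fun u v => ?_, fun a => isEmptyElim a⟩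
    have h2 : ∀ w : Pt 1 G.n, w = Sum.inl 0 := by
      rintro (i | a)
      · rw [Subsingleton.elim i 0]
      · exact isEmptyElim a.1
    rw [h2 u, h2 v]
  · exact fun S _ hS => absurd (h1 S) hS

end GaussDiagram

namespace Curve

open CyclePos Classical

variable {E X : Type} (C : Curve E X)

/-! ### The skein relation -/

/-- The crossing `a` is changed. -/
def change (a : X) : Curve E X where
  nxt := C.nxt
  en := (flip {a}).toEmbedding.trans C.en
  sgn x := if x = a then -C.sgn x else C.sgn x

/-- The crossing `a` is smoothed. -/
def smooth (a : X) : Curve E {x // x ≠ a} where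
  nxt := C.bd {a}
  en := (ends (Function.Embedding.subtype _)).trans C.en
  sgn x := C.sgn x.1

theorem change_en_self (a : X) (b : Bool) : (C.change a).en (a, b) = C.en (a, !b) :=
  congrArg C.en (by simp [flip_apply])

theorem change_en_of_ne {a x : X} (h : x ≠ a) (b : Bool) : (C.change a).en (x, b) = C.en (x, b) :=
  congrArg C.en (by simp [flip_apply, h])

/-- Smoothing along the orientation does not see which strand is above. -/
theorem bd_change (a : X) (S : Finset X) : (C.change a).bd S = C.bd S := by
  have h : ∀ u, (C.change a).jumpAt S u = C.jumpAt S u := by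
    intro u
    by_cases hu : ∃ x ∈ S, ∃ b, u = C.en (x, b)
    · obtain ⟨x, hx, b, rfl⟩ := hu
      rw [C.jumpAt_mem hx]
      by_cases hxa : x = a
      · subst hxa
        have h1 := (C.change x).jumpAt_mem hx (!b)
        rwa [change_en_self, change_en_self, Bool.not_not] at h1
      · have h1 := (C.change a).jumpAt_mem hx b
        rwa [change_en_of_ne C hxa, change_en_of_ne C hxa] at h1
    · push Not at hu
      rw [C.jumpAt_of_forall_ne hu]
      refine jumpAt_of_forall_ne _ fun x hx b hb => ?_
      by_cases hxa : x = a
      · subst hxa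
        exact hu x hx _ (hb.trans (C.change_en_self x b))
      · exact hu x hx b (hb.trans (C.change_en_of_ne hxa b))
  exact Equiv.ext fun u => h (C.nxt u)

theorem bd_smooth (a : X) (T : Finset {x // x ≠ a}) :
    (C.smooth a).bd T = C.bd (insert a (T.map (Function.Embedding.subtype _))) := by
  refine Equiv.ext fun u => ?_
  change (C.smooth a).jumpAt T (C.jumpAt {a} (C.nxt u)) = C.jumpAt _ (C.nxt u)
  generalize C.nxt u = v
  have hen : ∀ x b, (C.smooth a).en (x, b) = C.en (x.1, b) := fun x b => rfl
  by_cases hv : ∃ x b, v = C.en (x, b)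
  · obtain ⟨x, b, rfl⟩ := hv
    by_cases hxa : x = a
    · subst hxa
      rw [C.jumpAt_mem (Finset.mem_singleton_self x), C.jumpAt_mem (Finset.mem_insert_self _ _)]
      refine jumpAt_of_forall_ne _ fun y _ b' h => y.2 ?_
      exact (congrArg Prod.fst (C.en.injective ((hen y b').symm.trans h.symm)))
    · rw [C.jumpAt_notMem (by simpa using hxa)]
      by_cases hT : (⟨x, hxa⟩ : {x // x ≠ a}) ∈ T
      · rw [C.jumpAt_mem (x := x) (Finset.mem_insert_of_mem (Finset.mem_map.2 ⟨_, hT, rfl⟩))]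
        exact (C.smooth a).jumpAt_mem hT b
      · rw [C.jumpAt_notMem]
        · exact (C.smooth a).jumpAt_notMem hT b
        · rw [Finset.mem_insert, not_or]
          refine ⟨hxa, fun h => ?_⟩
          obtain ⟨y, hy, hyx⟩ := Finset.mem_map.1 h
          exact hT (by rwa [← Subtype.ext (a1 := y) (a2 := ⟨x, hxa⟩) hyx])
  · push Not at hv
    rw [C.jumpAt_of_forall_ne fun x _ b => hv x b, C.jumpAt_of_forall_ne fun x _ b => hv x b]
    exact jumpAt_of_forall_ne _ fun x _ b h => hv _ _ (h.trans (hen x b))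

theorem fst_change_of_ne {a x : X} (h : x ≠ a) (S : Finset X) (e : E) :
    (C.change a).fst S e x = C.fst S e x := by
  rw [fst, fst, bd_change, change_en_of_ne C h, change_en_of_ne C h]

theorem fst_change_self [Finite E] {S : Finset X} (hS : C.OneB S) (a : X) (e : E) :
    (C.change a).fst S e a = !C.fst S e a := by
  have h1 := (pos_spec (hS e (C.en (a, true)))).2
  have h2 := (pos_spec (hS e (C.en (a, false)))).2
  have h3 : pos (C.bd S) e (C.en (a, true)) ≠ pos (C.bd S) e (C.en (a, false)) := fun h => by
    rw [h, h2] at h1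
    simpa using C.en.injective h1
  rw [fst, fst, bd_change, change_en_self, change_en_self, ← decide_not, decide_eq_decide]
  simp only [Bool.not_true, Bool.not_false]
  omega

/-- The skein relation for state sums. -/
theorem stateSum_sub_stateSum_change [Finite E] [Fintype X] {a : X} (ha : C.sgn a = 1) (e : E) :
    C.stateSum true e - (C.change a).stateSum true e =
      Polynomial.X * (C.smooth a).stateSum true e := by
  have hOneB : ∀ S, (C.change a).OneB S ↔ C.OneB S := fun S => by unfold OneB; rw [bd_change]
  have hw : ∀ S, a ∉ S → (C.change a).weight S = C.weight S := fun S hS =>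
    Finset.prod_congr rfl fun x hx => by
      simp only [change, if_neg fun h : x = a => hS (h ▸ hx)]
  have hw' : ∀ S, a ∈ S → (C.change a).weight S = -C.weight S := fun S hS => by
    unfold weight
    rw [← Finset.mul_prod_erase _ _ hS, ← Finset.mul_prod_erase _ _ hS, ← neg_mul]
    congr 1
    · simp [change, neg_mul]
    · refine Finset.prod_congr rfl fun x hx => ?_
      simp only [change, if_neg (Finset.ne_of_mem_erase hx)]
  -- States without `a` are common to both curves and cancel. If `a ∈ S`, the order in which its
  -- ends are met suits exactly one of the curves, and the reversed sign turns the subtraction into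
  -- an addition; so no condition on the order at `a` remains.
  have key : ∀ S : Finset X, ((if C.IsState true e S then C.weight S else 0) -
      if (C.change a).IsState true e S then (C.change a).weight S else 0) =
      if a ∈ S ∧ C.OneB S ∧ ∀ x ∈ S, x ≠ a → C.fst S e x = true then C.weight S else 0 := by
    intro S
    by_cases hS : C.OneB S
    · by_cases haS : a ∈ S
      · by_cases h3 : ∀ x ∈ S, x ≠ a → C.fst S e x = true
        · have h1 : C.IsState true e S ↔ C.fst S e a = true := by
            refine ⟨fun h => h.2 a haS, fun h => ⟨hS, fun x hx => ?_⟩⟩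
            by_cases hxa : x = a
            · rwa [hxa]
            · exact h3 x hx hxa
          have h2 : (C.change a).IsState true e S ↔ ¬ C.fst S e a = true := by
            constructor
            · intro h h4
              have := h.2 a haS
              rw [fst_change_self C hS, h4] at this
              exact absurd this (by simp)
            · refine fun h => ⟨(hOneB S).2 hS, fun x hx => ?_⟩
              by_cases hxa : x = a
              · rw [hxa, fst_change_self C hS, Bool.eq_false_of_not_eq_true h, Bool.not_false]
              · rw [fst_change_of_ne C hxa]
                exact h3 x hx hxa
          rw [if_pos (⟨haS, hS, h3⟩ : _ ∧ _), hw' S haS]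
          by_cases h4 : C.fst S e a = true
          · rw [if_pos (h1.2 h4), if_neg fun h => h2.1 h h4, sub_zero]
          · rw [if_neg fun h => h4 (h1.1 h), if_pos (h2.2 h4), sub_neg_eq_add, zero_add]
        · rw [if_neg fun h => h3 fun x hx _ => h.2 x hx, if_neg fun h => h3 fun x hx hxa => ?_,
            if_neg fun h => h3 h.2.2, sub_zero]
          rw [← fst_change_of_ne C hxa]
          exact h.2 x hx
      · have h1 : (C.change a).IsState true e S ↔ C.IsState true e S := by
          refine and_congr (hOneB S) (forall₂_congr fun x hx => ?_)
          rw [fst_change_of_ne C fun h => haS (by rwa [← h])]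
        have h3 : ¬ (a ∈ S ∧ C.OneB S ∧ ∀ x ∈ S, x ≠ a → C.fst S e x = true) := fun h => haS h.1
        rw [if_neg h3, hw S haS]
        by_cases h2 : C.IsState true e S
        · rw [if_pos h2, if_pos (h1.2 h2), sub_self]
        · rw [if_neg h2, if_neg fun h => h2 (h1.1 h), sub_self]
    · rw [if_neg fun h => hS h.1, if_neg fun h => hS ((hOneB S).1 h.1), if_neg fun h => hS h.2.1,
        sub_self]
  have h0 : C.stateSum true e - (C.change a).stateSum true e =
      ∑ S : Finset X with a ∈ S ∧ C.OneB S ∧ ∀ x ∈ S, x ≠ a → C.fst S e x = true, C.weight S := by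
    unfold stateSum
    rw [Finset.sum_filter, Finset.sum_filter, Finset.sum_filter, ← Finset.sum_sub_distrib]
    refine Finset.sum_congr rfl fun S _ => ?_
    rw [← key S]
    rfl
  rw [h0, stateSum, Finset.mul_sum]
  let j : {x // x ≠ a} ↪ X := Function.Embedding.subtype _
  have hj : ∀ T : Finset {x // x ≠ a}, a ∉ T.map j := fun T h => by
    obtain ⟨y, -, hy⟩ := Finset.mem_map.1 h
    exact y.2 hy
  have hst : ∀ T : Finset {x // x ≠ a}, (C.smooth a).IsState true e T ↔
      C.OneB (insert a (T.map j)) ∧ ∀ x ∈ insert a (T.map j), x ≠ a →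
        C.fst (insert a (T.map j)) e x = true := by
    intro T
    unfold IsState OneB
    rw [bd_smooth]
    refine and_congr_right fun _ => ?_
    have h1 : ∀ x, (C.smooth a).fst T e x = C.fst (insert a (T.map j)) e x.1 := fun x => by
      rw [fst, fst, bd_smooth]
      rfl
    constructor
    · intro h x hx hxa
      obtain ⟨y, hy, rfl⟩ := Finset.mem_map.1 ((Finset.mem_insert.1 hx).resolve_left hxa)
      exact (h1 y).symm.trans (h y hy)
    · intro h y hy
      rw [h1]
      exact h _ (Finset.mem_insert_of_mem (Finset.mem_map_of_mem j hy)) y.2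
  symm
  refine Finset.sum_bij (fun T _ => insert a (T.map j)) ?_ ?_ ?_ ?_
  · intro T hT
    simp only [Finset.mem_filter, Finset.mem_univ, true_and] at hT ⊢
    exact ⟨Finset.mem_insert_self _ _, (hst T).1 hT⟩
  · intro T _ T' _ h
    refine Finset.map_injective j ?_
    rw [← Finset.erase_insert (hj T), h, Finset.erase_insert (hj T')]
  · intro S hS
    simp only [Finset.mem_filter, Finset.mem_univ, true_and] at hS
    have h1 : insert a ((S.subtype (· ≠ a)).map j) = S := by
      ext x
      by_cases hxa : x = a
      · simp [hxa, hS.1]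
      · simp [j, hxa]
    refine ⟨S.subtype (· ≠ a), ?_, h1⟩
    simp only [Finset.mem_filter, Finset.mem_univ, true_and]
    rw [hst, h1]
    exact hS.2
  · intro T _
    rw [weight, Finset.prod_insert (hj T), Finset.prod_map, ha]
    simp [smooth, j]

/-! ### The circles of a smoothed curve -/

/-- An arc that leads to one end of `a` leads to the other end after the smoothing; this closes up
each of the two halves, or joins two circles. -/
theorem isChain_smooth {a : X} {b b' : Bool} {A : List E} {x : E}
    (h : List.IsChain (fun u v => C.nxt u = v) (x :: (A ++ [C.en (a, b)])))
    (hA : ∀ d, C.en (a, d) ∉ A) (hb : b' = !b) :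
    List.IsChain (fun u v => (C.smooth a).nxt u = v) (x :: (A ++ [C.en (a, b')])) := by
  have hn : ∀ u, (C.smooth a).nxt u = C.jumpAt {a} (C.nxt u) := fun u => rfl
  subst hb
  induction A generalizing x with
  | nil =>
    rw [List.nil_append, List.isChain_cons_cons] at h ⊢
    refine ⟨?_, List.isChain_singleton _⟩
    rw [hn, h.1, C.jumpAt_mem (Finset.mem_singleton_self a)]
  | cons y A ih =>
    rw [List.cons_append, List.isChain_cons_cons] at h ⊢
    refine ⟨?_, ih h.2 fun d hd => hA d (List.mem_cons_of_mem _ hd)⟩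
    rw [hn, h.1]
    refine C.jumpAt_of_forall_ne fun z hz d hd => hA d ?_
    rw [Finset.mem_singleton.1 hz] at hd
    rw [← hd]
    exact List.mem_cons_self

end Curve

namespace CyclePos

theorem exists_cons_filterMap_eq {α β : Type} {j : α ↪ β} {w : List β} {x : α} {l : List α}
    (h : x :: l ~r w.filterMap (Curve.read j)) :
    ∃ A, w ~r j x :: A ∧ A.filterMap (Curve.read j) = l := by
  obtain ⟨w', h1, h2⟩ := exists_filterMap_eq h
  obtain ⟨l₁, y, l₂, rfl, h3, h4, h5⟩ := List.filterMap_eq_cons_iff.1 h2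
  rw [Curve.read_eq_some.1 h4] at h1
  refine ⟨l₂ ++ l₁, h1.trans List.isRotated_append, ?_⟩
  rw [List.filterMap_append, h5, List.filterMap_eq_nil_iff.2 h3, List.append_nil]

theorem exists_append_filterMap_eq {α β : Type} {j : α ↪ β} {w : List β} {x y : α} {u v : List α}
    (h : x :: u ++ y :: v ~r w.filterMap (Curve.read j)) :
    ∃ A B, w ~r j x :: (A ++ j y :: B) ∧ A.filterMap (Curve.read j) = u ∧
      B.filterMap (Curve.read j) = v := by
  obtain ⟨A', h1, h2⟩ := exists_cons_filterMap_eq h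
  obtain ⟨A₁, A₂, rfl, h3, h4⟩ := List.filterMap_eq_append_iff.1 h2
  obtain ⟨l₁, z, B, rfl, h5, h6, h7⟩ := List.filterMap_eq_cons_iff.1 h4
  rw [Curve.read_eq_some.1 h6] at h1
  refine ⟨A₁ ++ l₁, B, by simpa using h1, ?_, h7⟩
  rw [List.filterMap_append, h3, List.filterMap_eq_nil_iff.2 h5, List.append_nil]

variable {E V V' : Type} {f : Perm E} {κ : E → V} {W : V → List E}

theorem Words.of_circuit (hc : ∀ v, Circuit f (W v)) (hn : ∀ v, (W v).Nodup)
    (hm : ∀ v u, u ∈ W v ↔ κ u = v) (hne : ∀ v, W v ≠ []) : Words f κ Set.univ W where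
  label u := by
    obtain ⟨t, ht⟩ := exists_isRotated_cons ((hm (κ u) u).2 rfl)
    have h1 := hc _ u t ht
    rw [← hm, ht.mem_iff]
    rcases t with _ | ⟨v, t⟩
    · rw [(List.isChain_cons_cons.1 h1).1]
      simp
    · rw [(List.isChain_cons_cons.1 h1).1]
      simp
  circuit v _ := hc v
  nodup v _ := hn v
  mem v _ := hm v
  ne v _ := hne v

theorem Words.comp (h : Words f κ Set.univ W) (σ : V ≃ V') :
    Words f (fun u => σ (κ u)) Set.univ fun v => W (σ.symm v) :=
  Words.of_circuit (fun _ => h.circuit _ trivial) (fun _ => h.nodup _ trivial)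
    (fun v u => by rw [h.mem _ trivial, Equiv.eq_symm_apply]) fun _ => h.ne _ trivial

end CyclePos

namespace Curve

open CyclePos Classical

variable {E X V : Type} {C : Curve E X} {κ : E → V} {W : V → List E} {a : X} {A B : List E}

theorem isChain_smooth_of_notMem {x : E} {l : List E}
    (h : List.IsChain (fun u v => C.nxt u = v) (x :: l)) (hl : ∀ d, C.en (a, d) ∉ l) :
    List.IsChain (fun u v => (C.smooth a).nxt u = v) (x :: l) := by
  induction l generalizing x with
  | nil => exact List.isChain_singleton _
  | cons y l ih =>
    rw [List.isChain_cons_cons] at h ⊢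
    refine ⟨?_, ih h.2 fun d hd => hl d (List.mem_cons_of_mem _ hd)⟩
    change C.jumpAt {a} (C.nxt x) = y
    rw [h.1]
    refine C.jumpAt_of_forall_ne fun z hz d hd => hl d ?_
    rw [← Finset.mem_singleton.1 hz, ← hd]
    exact List.mem_cons_self

theorem circuit_smooth {l : List E} (h : Circuit C.nxt l) (hl : ∀ d, C.en (a, d) ∉ l) :
    Circuit (C.smooth a).nxt l := by
  intro u t ht
  refine isChain_smooth_of_notMem (h u t ht) fun d hd => hl d (ht.mem_iff.2 ?_)
  simpa [or_comm] using hd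

/-- A circle on which a crossing is smoothed becomes two circles. -/
theorem exists_words_split (h : Words C.nxt κ Set.univ W) {i : V}
    (hW : W i ~r C.en (a, true) :: (A ++ C.en (a, false) :: B)) :
    ∃ κ' W', Words (C.smooth a).nxt κ' (Set.univ : Set (Option V)) W' ∧
      W' none = C.en (a, true) :: A ∧ W' (some i) = C.en (a, false) :: B ∧
      ∀ k, k ≠ i → W' (some k) = W k := by
  have hn := hW.nodup_iff.1 (h.nodup i trivial)
  simp only [List.nodup_cons, List.nodup_append, List.mem_append, List.mem_cons, not_or] at hn
  obtain ⟨⟨n1, n2, n3⟩, n4, ⟨n5, n6⟩, n7⟩ := hn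
  have nA : ∀ d, C.en (a, d) ∉ A := by
    rintro (_ | _) hd
    · exact n7 _ hd _ (Or.inl rfl) rfl
    · exact n1 hd
  have nB : ∀ d, C.en (a, d) ∉ B := by
    rintro (_ | _) hd
    · exact n5 hd
    · exact n3 hd
  have hc := h.circuit i trivial _ _ hW
  rw [List.append_assoc, List.cons_append, ← List.cons_append, List.isChain_split] at hc
  have hmem : ∀ u, κ u = i ↔ u ∈ C.en (a, true) :: A ∨ u ∈ C.en (a, false) :: B := fun u => by
    rw [← h.mem i trivial, hW.mem_iff]
    simp only [List.mem_cons, List.mem_append, or_assoc]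
  have hdisj : ∀ u, u ∈ C.en (a, true) :: A → u ∉ C.en (a, false) :: B := by
    intro u hu hu'
    rw [List.mem_cons] at hu hu'
    rcases hu with rfl | hu
    · rcases hu' with hu' | hu'
      · exact n2 hu'
      · exact n3 hu'
    · exact n7 u hu u hu' rfl
  -- The half that starts at the upper point of `a` becomes the new circle `none`; the other half
  -- keeps the label `i`.
  refine ⟨fun u => if κ u = i then (if u ∈ C.en (a, true) :: A then none else some i)
    else some (κ u), fun v => v.elim (C.en (a, true) :: A) fun k =>
      if k = i then C.en (a, false) :: B else W k, Words.of_circuit ?_ ?_ ?_ ?_, rfl, if_pos rfl,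
      fun k hk => if_neg hk⟩
  · rintro (_ | k)
    · exact Circuit.of_isChain (List.IsRotated.refl _) (C.isChain_smooth hc.1 nA rfl)
    · by_cases hk : k = i
      · simp only [Option.elim_some, if_pos hk]
        exact Circuit.of_isChain (List.IsRotated.refl _) (C.isChain_smooth hc.2 nB rfl)
      · simp only [Option.elim_some, if_neg hk]
        refine circuit_smooth (h.circuit k trivial) fun d hd => hk ?_
        rw [← (h.mem k trivial _).1 hd, hmem]
        cases d <;> simp
  · rintro (_ | k)
    · exact List.nodup_cons.2 ⟨n1, n4⟩
    · by_cases hk : k = i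
      · simp only [Option.elim_some, if_pos hk]
        exact List.nodup_cons.2 ⟨n5, n6⟩
      · simp only [Option.elim_some, if_neg hk]
        exact h.nodup k trivial
  · rintro (_ | k) u
    · by_cases hu : κ u = i
      · by_cases hu' : u ∈ C.en (a, true) :: A
        · simp only [Option.elim_none, if_pos hu, hu', if_true]
        · simp only [Option.elim_none, if_pos hu, hu', if_false, reduceCtorEq]
      · simp only [Option.elim_none, if_neg hu, reduceCtorEq, iff_false]
        exact fun hu' => hu ((hmem u).2 (Or.inl hu'))
    · by_cases hk : k = i
      · subst hk
        simp only [Option.elim_some, if_true]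
        by_cases hu : κ u = k
        · by_cases hu' : u ∈ C.en (a, true) :: A
          · simp only [if_pos hu, if_pos hu', reduceCtorEq, iff_false]
            exact hdisj u hu'
          · simp only [if_pos hu, if_neg hu', iff_true]
            exact ((hmem u).1 hu).resolve_left hu'
        · simp only [hu, if_false, Option.some.injEq, iff_false]
          exact fun hu' => hu ((hmem u).2 (Or.inr hu'))
      · simp only [Option.elim_some, if_neg hk, h.mem k trivial]
        by_cases hu : κ u = i
        · simp only [if_pos hu]
          refine iff_of_false (fun h1 => hk (h1.symm.trans hu)) fun h1 => ?_
          split_ifs at h1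
          exact hk (Option.some.inj h1).symm
        · simp only [if_neg hu, Option.some.injEq]
  · rintro (_ | k)
    · exact List.cons_ne_nil _ _
    · by_cases hk : k = i
      · simp only [Option.elim_some, if_pos hk]
        exact List.cons_ne_nil _ _
      · simp only [Option.elim_some, if_neg hk]
        exact h.ne k trivial

/-- Two circles between which a crossing is smoothed become one circle. -/
theorem exists_words_merge (h : Words C.nxt κ Set.univ W) {i j : V} (hij : i ≠ j)
    (hi : W i ~r C.en (a, true) :: A) (hj : W j ~r C.en (a, false) :: B) :
    ∃ κ' W', Words (C.smooth a).nxt κ' (Set.univ : Set {k // k ≠ j}) W' ∧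
      W' ⟨i, hij⟩ = C.en (a, true) :: (A ++ C.en (a, false) :: B) ∧
      ∀ k, k.1 ≠ i → W' k = W k.1 := by
  have n1 := List.nodup_cons.1 (hi.nodup_iff.1 (h.nodup i trivial))
  have n2 := List.nodup_cons.1 (hj.nodup_iff.1 (h.nodup j trivial))
  have m1 : ∀ u, u ∈ C.en (a, true) :: A ↔ κ u = i := fun u => by
    rw [← hi.mem_iff, h.mem i trivial]
  have m2 : ∀ u, u ∈ C.en (a, false) :: B ↔ κ u = j := fun u => by
    rw [← hj.mem_iff, h.mem j trivial]
  have hat : κ (C.en (a, true)) = i := (m1 _).1 List.mem_cons_self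
  have haf : κ (C.en (a, false)) = j := (m2 _).1 List.mem_cons_self
  have nA : ∀ d, C.en (a, d) ∉ A := by
    rintro (_ | _) hd
    · exact hij (((m1 _).1 (List.mem_cons_of_mem _ hd)).symm.trans haf)
    · exact n1.1 hd
  have nB : ∀ d, C.en (a, d) ∉ B := by
    rintro (_ | _) hd
    · exact n2.1 hd
    · exact hij (hat.symm.trans ((m2 _).1 (List.mem_cons_of_mem _ hd)))
  have hmem : ∀ u, u ∈ C.en (a, true) :: (A ++ C.en (a, false) :: B) ↔ κ u = i ∨ κ u = j := by
    intro u
    rw [← m1, ← m2, ← List.cons_append, List.mem_append]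
  refine ⟨fun u => if hu : κ u = j then ⟨i, hij⟩ else ⟨κ u, hu⟩, fun k =>
    if k.1 = i then C.en (a, true) :: (A ++ C.en (a, false) :: B) else W k.1,
    Words.of_circuit ?_ ?_ ?_ ?_, if_pos rfl, fun k hk => if_neg hk⟩
  · intro k
    by_cases hk : k.1 = i
    · simp only [if_pos hk]
      refine Circuit.of_isChain (List.IsRotated.refl _) ?_
      rw [List.append_assoc, List.cons_append, ← List.cons_append, List.isChain_split]
      exact ⟨C.isChain_smooth (h.circuit i trivial _ _ hi) nA rfl,
        C.isChain_smooth (h.circuit j trivial _ _ hj) nB rfl⟩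
    · simp only [if_neg hk]
      refine circuit_smooth (h.circuit _ trivial) fun d hd => ?_
      rw [h.mem _ trivial] at hd
      cases d
      · exact k.2 (hd.symm.trans haf)
      · exact hk (hd.symm.trans hat)
  · intro k
    by_cases hk : k.1 = i
    · simp only [if_pos hk]
      rw [← List.cons_append, List.nodup_append]
      refine ⟨List.nodup_cons.2 n1, List.nodup_cons.2 n2, fun u hu v hv huv => hij ?_⟩
      rw [← (m1 u).1 hu, huv, (m2 v).1 hv]
    · simp only [if_neg hk]
      exact h.nodup _ trivial
  · intro k u
    by_cases hk : k.1 = i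
    · simp only [if_pos hk, hmem]
      by_cases hu : κ u = j
      · simp only [hu, or_true, true_iff]
        exact Subtype.ext hk.symm
      · simp only [hu, or_false, dite_false]
        exact ⟨fun h1 => Subtype.ext (h1.trans hk.symm), fun h1 =>
          (congrArg Subtype.val h1).trans hk⟩
    · simp only [if_neg hk, h.mem _ trivial]
      by_cases hu : κ u = j
      · simp only [hu]
        exact iff_of_false (fun h1 => k.2 h1.symm) fun h1 => hk (congrArg Subtype.val h1).symm
      · simp only [dif_neg hu]
        exact ⟨fun h1 => Subtype.ext h1, fun h1 => congrArg Subtype.val h1⟩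
  · intro k
    by_cases hk : k.1 = i
    · simp only [if_pos hk]
      exact List.cons_ne_nil _ _
    · simp only [if_neg hk]
      exact h.ne _ trivial

end Curve

/-! ### Crossing changes and smoothings of Gauss diagrams -/

namespace GaussDiagram

open ArrowDiagram CyclePos Classical Curve

variable {m m₀ : ℕ} {G Gm : GaussDiagram m} {G₀ : GaussDiagram m₀} {a : Fin G.n}

theorem filterMap_read_pts (G : GaussDiagram m) (i : Fin m) :
    (G.toArrow.pts i).filterMap (read G.curve.en) = G.toArrow.word i := by
  have h := filterMap_pts (A := G.toArrow) (s := G.sign) (Function.Embedding.refl _) i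
  rwa [filterMap_read_refl] at h

theorem IsCrossingChange.stateSum_eq (h : IsCrossingChange G Gm a) (i : Fin m) :
    Gm.curve.stateSum true (Sum.inl i) = (G.curve.change a).stateSum true (Sum.inl i) := by
  obtain ⟨τ, h1, h2⟩ := h
  have hw : ∀ i, Gm.toArrow.word i =
      (G.toArrow.word i).map fun x => mapEnd τ (Curve.flip {a} x) := fun i => by
    refine (h1 i).trans (List.map_congr_left fun x _ => ?_)
    rw [flip_apply, opp]
    by_cases hx : x.1 = a
    · simp [hx]
    · simp [hx]
  exact (isIso_of_word_map hw (s := (G.curve.change a).sgn) fun d => by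
    rw [h2]
    unfold change
    by_cases hd : d = a
    · rw [if_pos hd]
      exact (if_pos hd).symm
    · rw [if_neg hd]
      exact (if_neg hd).symm).stateSum_eq true (Sum.inl i)

/-- The smoothed curve keeps the markers of `G` and the two points of `a`, which need not match the
markers of `G₀`. So only the cyclic words of the ends of the remaining arrows are compared. -/
theorem exists_words_smooth (h : IsSmoothing G G₀ a) :
    ∃ τ : Fin G₀.n ↪ Fin G.n, Set.range τ = {a}ᶜ ∧ (∀ b, G₀.sign b = G.sign (τ b)) ∧
      ∃ κ W, Words (G.curve.smooth a).nxt κ (Set.univ : Set (Fin m₀)) W ∧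
        ∀ v, (W v).filterMap (read ((ends τ).trans G.curve.en)) ~r G₀.toArrow.word v := by
  obtain ⟨τ, h1, h2, h⟩ := h
  refine ⟨τ, h1, h2, ?_⟩
  have hnone : ∀ d, read (ends τ) (a, d) = none := fun d => by
    rw [Option.eq_none_iff_forall_ne_some]
    intro y hy
    have h3 : a ∈ Set.range τ := ⟨y.1, (congrArg Prod.fst (read_eq_some.1 hy)).symm⟩
    rw [h1] at h3
    exact h3 rfl
  have hword : ∀ {l v}, (G₀.toArrow.word v).map (mapEnd τ) ~r l →
      l.filterMap (read (ends τ)) ~r G₀.toArrow.word v := fun hl => by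
    have := IsRotated.filterMap hl.symm (read (ends τ))
    rwa [filterMap_map_mapEnd] at this
  have hen : ∀ d, read G.curve.en (G.curve.en (a, d)) = some (a, d) := fun d =>
    read_eq_some.2 rfl
  have hw := G.toArrow.words
  have hread : ∀ k v, (G₀.toArrow.word v).map (mapEnd τ) ~r G.word k →
      (G.toArrow.pts k).filterMap (read ((ends τ).trans G.curve.en)) ~r G₀.toArrow.word v := by
    intro k v hk
    rw [filterMap_read_trans, filterMap_read_pts]
    exact hword hk
  rcases h with ⟨i, u, v, σ, h3, h4, h5, h6⟩ | ⟨i, j, hij, u, v, σ, h3, h4, h5, h6⟩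
  · obtain ⟨A, B, h7, hA, hB⟩ := exists_append_filterMap_eq (j := G.curve.en)
      (w := G.toArrow.pts i) (by rw [filterMap_read_pts]; exact h3.symm)
    obtain ⟨κ, W, hW, e1, e2, e3⟩ := exists_words_split (C := G.curve) hw h7
    refine ⟨_, _, hW.comp σ, fun v' => ?_⟩
    obtain ⟨o, rfl⟩ := σ.surjective v'
    simp only [Equiv.symm_apply_apply]
    rcases o with _ | k
    · rw [e1, filterMap_read_trans, List.filterMap_cons_some (hen true), hA,
        List.filterMap_cons_none (hnone true)]
      exact hword h4
    · by_cases hk : k = i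
      · rw [hk, e2, filterMap_read_trans, List.filterMap_cons_some (hen false), hB,
          List.filterMap_cons_none (hnone false)]
        exact hword h5
      · rw [e3 k hk]
        exact hread k _ (h6 k hk)
  · obtain ⟨A, h7, hA⟩ := exists_cons_filterMap_eq (j := G.curve.en)
      (w := G.toArrow.pts i) (by rw [filterMap_read_pts]; exact h3.symm)
    obtain ⟨B, h8, hB⟩ := exists_cons_filterMap_eq (j := G.curve.en)
      (w := G.toArrow.pts j) (by rw [filterMap_read_pts]; exact h4.symm)
    obtain ⟨κ, W, hW, e1, e2⟩ := exists_words_merge (C := G.curve) hw hij h7 h8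
    refine ⟨_, _, hW.comp σ, fun v' => ?_⟩
    obtain ⟨k, rfl⟩ := σ.surjective v'
    simp only [Equiv.symm_apply_apply]
    by_cases hk : k.1 = i
    · obtain rfl : k = ⟨i, hij⟩ := Subtype.ext hk
      rw [e1, filterMap_read_trans, List.filterMap_cons_some (hen true), List.filterMap_append,
        List.filterMap_cons_some (hen false), hA, hB, List.filterMap_cons_none (hnone true),
        List.filterMap_append, List.filterMap_cons_none (hnone false), ← List.filterMap_append]
      exact hword h5
    · rw [e2 k hk]
      exact hread k.1 _ (h6 k hk)

theorem IsSmoothing.stateSum_eq (h : IsSmoothing G G₀ a) (e : Pt m G.n) :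
    ∃ e', (G.curve.smooth a).stateSum true e = G₀.curve.stateSum true e' := by
  obtain ⟨τ, h1, h2, κ, W, hW, hr⟩ := exists_words_smooth h
  have hτ : ∀ b, τ b ≠ a := fun b hb => by
    have h3 : τ b ∈ Set.range τ := ⟨b, rfl⟩
    rw [h1] at h3
    exact h3 hb
  let τ' : Fin G₀.n ↪ {x // x ≠ a} := τ.codRestrict {x | x ≠ a} hτ
  obtain ⟨e', -, h3⟩ := exists_isStateOn_iff_of_isRotated (C := G.curve.smooth a) (C' := G₀.curve)
    (τ := τ') (τ' := Function.Embedding.refl _) hW G₀.toArrow.words (fun v _ => by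
      have h4 := filterMap_pts (A := G₀.toArrow) (s := G₀.sign) (Function.Embedding.refl _) v
      rw [filterMap_read_refl] at h4
      exact (hr v).trans (by rw [← h4]; rfl)) (e := e) trivial
  refine ⟨e', ?_⟩
  rw [← stateSumOn_univ (κ := κ) (I := Set.univ) true e fun _ => trivial,
    ← stateSumOn_univ (κ := G₀.toArrow.circle) (I := Set.univ) true e' fun _ => trivial,
    stateSumOn_eq_stateSumWith (q := fun _ => True) fun _ _ => trivial,
    stateSumOn_eq_stateSumWith (q := fun _ => True) fun _ _ => trivial]
  refine stateSumWith_eq (C := G.curve.smooth a) (C' := G₀.curve) τ' (Function.Embedding.refl _)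
    (fun S => ?_) (fun S => by simp) (fun b => (h2 b).symm) fun T => h3 true T
  refine iff_of_true trivial fun x _ => ?_
  have h4 : x.1 ∈ Set.range τ := by
    rw [h1]
    exact x.2
  obtain ⟨b, hb⟩ := h4
  exact ⟨b, Subtype.ext hb⟩

theorem isConwayPolynomial_conway : IsConwayPolynomial conway where
  invariant _ _ _ _ _ h := h.invariants.2
  unknot G h := conway_unknot G h
  skein m m₀ Gp Gm G₀ a hp hm h0 ha hc hs := by
    obtain ⟨e', he'⟩ := hs.stateSum_eq (Sum.inl Gp.toArrow.base)
    rw [← hp.stateSum_eq_conway true (Sum.inl Gp.toArrow.base),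
      ← hm.stateSum_eq_conway true (Sum.inl Gp.toArrow.base), hc.stateSum_eq,
      stateSum_sub_stateSum_change Gp.curve ha]
    congr 1
    convert he'.trans (h0.stateSum_eq_conway true e')

end GaussDiagram

end

/-! ### The three claims -/

theorem mainTheorem10 :
    (∀ (n m : ℕ) (G H : GaussDiagram m), G.IsClassical → H.IsClassical → G.Isotopic H →
      G.AIr n = H.AIr n ∧ G.DIr n = H.DIr n) ∧
    (∀ (n m : ℕ) (G : GaussDiagram m), G.IsClassical → G.AIr n = G.DIr n) ∧
    (∃ nabla : (m : ℕ) → GaussDiagram m → Polynomial ℤ, GaussDiagram.IsConwayPolynomial nabla ∧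
      ∀ (n : ℕ) (G : GaussDiagram 2), G.IsClassical →
        (G.ARed n : ℚ) = G.lk 0 1 * ∑ k ∈ Finset.range n,
          (((nabla 1 (G.component 0)).coeff k * (nabla 1 (G.component 1)).coeff (n - 1 - k) : ℤ) : ℚ) ∧
        (G.DRed n : ℚ) = G.lk 0 1 * ∑ k ∈ Finset.range n,
          (((nabla 1 (G.component 0)).coeff k * (nabla 1 (G.component 1)).coeff (n - 1 - k) : ℤ) : ℚ)) := by
  refine ⟨fun n m G H _ _ h => ?_, fun n m G hG => ?_, GaussDiagram.conway,
    GaussDiagram.isConwayPolynomial_conway, fun n G hG => ?_⟩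
  · rw [GaussDiagram.AIr_eq, GaussDiagram.AIr_eq, GaussDiagram.DIr_eq, GaussDiagram.DIr_eq,
      h.invariants.1, h.invariants.1]
    exact ⟨rfl, rfl⟩
  · rw [GaussDiagram.AIr_eq, GaussDiagram.DIr_eq, hG.bridgePoly_eq true false]
  · rw [GaussDiagram.ARed_eq, GaussDiagram.DRed_eq]
    exact ⟨GaussDiagram.coeff_eval_bridgePoly hG true n,
      GaussDiagram.coeff_eval_bridgePoly hG false n⟩
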